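/- Theorem. There is a data structure for Dynamic Interval Scheduling on two machines (DIS2) that supports any sequence of $n$ insert/delete/query operations on intervals in $\tilde{O}(n^{1/2})$ amortized time per operation. Here the data structure maintains, starting from the empty collection, a finite collection of open intervals $(s,f)$, $s<f$, with endpoints in a linearly ordered set; endpoints can only be copied and compared. An insertion adds an interval (equal intervals may occur repeatedly) and returns a handle, a deletion gets the handle of an interval that is currently present and removes that interval, and a query returns the maximum number of intervals of the current collection that can be scheduled on two machines, that is, the maximum of $|A|+|B|$ over disjoint subcollections $A,B$ each consisting of pairwise disjoint intervals. Time is measured on a random access machine on which an arithmetic operation or memory access is charged one plus the bit lengths of the numbers involved (including addresses), and copying or comparing two endpoints is charged one plus the cost of computing their addresses. Precisely: there are one program for each of the three operations and constants $C$, $k$, independent of $n$, of the ordered set and of the sequence, such that for every $n$ and every such sequence of $n$ operations the programs halt, all queries are answered correctly, and the total time is at most $n\cdot C\,n^{1/2}\,(\log(n+2))^{k}$. -/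

import Mathlib

universe u

namespace DIS

/-! ### Interval scheduling on several machines -/

/-- A job: an open interval `(start, finish)` with endpoints in a linear order. -/
structure Job (α : Type u) [LinearOrder α] where
  start : α
  finish : α
  start_lt_finish : start < finish

/-- Two intervals are compatible if they are disjoint (as open intervals): one of them
ends before, or exactly when, the other one starts. -/
def Compatible {α : Type u} [LinearOrder α] (I J : Job α) : Prop :=
  I.finish ≤ J.start ∨ J.finish ≤ I.start

/-- The jobs in `T` (labelled intervals, so that equal intervals may occur repeatedly)
can all be scheduled on `m` machines: there is an assignment to the machines in which
distinct jobs on the same machine are compatible. -/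
def Schedulable {α : Type u} [LinearOrder α] (m : ℕ) (T : Finset (ℕ × Job α)) : Prop :=
  ∃ machine : ℕ × Job α → Fin m,
    ∀ p ∈ T, ∀ q ∈ T, p ≠ q → machine p = machine q → Compatible p.2 q.2

/-- `c` is the largest number of jobs from `S` that can be scheduled on `m` machines. -/
def IsOptimum {α : Type u} [LinearOrder α] (m : ℕ) (S : Set (ℕ × Job α)) (c : ℕ) : Prop :=
  IsGreatest {k : ℕ | ∃ T : Finset (ℕ × Job α), ↑T ⊆ S ∧ Schedulable m T ∧ T.card = k} c

/-! ### Sequences of operations -/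

/-- The operations. `delete i` removes the interval that was inserted by the operation at
position `i` (counted from `0`) of the sequence. -/
inductive Op (α : Type u) [LinearOrder α] where
  | insert (I : Job α)
  | delete (i : ℕ)
  | query

/-- The collection maintained just before the operation at position `k`: the intervals that
were inserted and not deleted by the operations at positions `< k`, each labelled with the
position of its insertion. -/
def contents {α : Type u} [LinearOrder α] (ops : List (Op α)) (k : ℕ) :
    Set (ℕ × Job α) :=
  {p | p.1 < k ∧ ops[p.1]? = some (Op.insert p.2) ∧ ∀ j < k, ops[j]? ≠ some (Op.delete p.1)}

/-- Only intervals that are present at that moment are deleted. -/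
def ValidOps {α : Type u} [LinearOrder α] (ops : List (Op α)) : Prop :=
  ∀ k i, ops[k]? = some (Op.delete i) → ∃ I : Job α, (i, I) ∈ contents ops k

/-! ### The machine: a random access machine with logarithmic cost

The store consists of registers, an indirectly addressable memory of natural numbers, and an
indirectly addressable memory of keys (endpoints of intervals). Keys can only be copied and
compared. Programs are finite structured programs that know nothing about the type of keys. -/

/-- A state of the machine; `⊥` is the content of a key cell that was never written. -/
structure State (α : Type u) where
  reg : ℕ → ℕ
  mem : ℕ → ℕ
  key : ℕ → WithBot α

/-- The initial state: everything is blank. -/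
def State.init (α : Type u) : State α where
  reg := fun _ => 0
  mem := fun _ => 0
  key := fun _ => ⊥

/-- Arithmetic expressions. -/
inductive Expr where
  | const (c : ℕ)
  | reg (x : ℕ)
  | mem (a : Expr)
  | add (a b : Expr)
  | sub (a b : Expr)
  | mul (a b : Expr)
  | div (a b : Expr)

/-- The value of an expression (`sub` is truncated, `div` is integer division, both as
on `ℕ`). -/
def Expr.eval {α : Type u} (σ : State α) : Expr → ℕ
  | .const c => c
  | .reg x => σ.reg x
  | .mem a => σ.mem (a.eval σ)
  | .add a b => a.eval σ + b.eval σ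
  | .sub a b => a.eval σ - b.eval σ
  | .mul a b => a.eval σ * b.eval σ
  | .div a b => a.eval σ / b.eval σ

/-- The cost of evaluating an expression: every constant, register access, memory access and
arithmetic operation is charged one plus the bit length of its result. (The bit lengths of the
operands and of the addresses are charged to the subexpressions that compute them.) -/
def Expr.cost {α : Type u} (σ : State α) : Expr → ℕ
  | .const c => 1 + c.size
  | .reg x => 1 + (σ.reg x).size
  | .mem a => a.cost σ + (1 + (Expr.eval σ (.mem a)).size)
  | .add a b => a.cost σ + b.cost σ + (1 + (Expr.eval σ (.add a b)).size)
  | .sub a b => a.cost σ + b.cost σ + (1 + (Expr.eval σ (.sub a b)).size)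
  | .mul a b => a.cost σ + b.cost σ + (1 + (Expr.eval σ (.mul a b)).size)
  | .div a b => a.cost σ + b.cost σ + (1 + (Expr.eval σ (.div a b)).size)

/-- Tests: comparison of two numbers, comparison of the keys in the key cells with two given
addresses, and Boolean combinations. -/
inductive Test where
  | le (a b : Expr)
  | keyLE (a b : Expr)
  | not (c : Test)
  | and (c d : Test)

def Test.Holds {α : Type u} [LinearOrder α] (σ : State α) : Test → Prop
  | .le a b => a.eval σ ≤ b.eval σ
  | .keyLE a b => σ.key (a.eval σ) ≤ σ.key (b.eval σ)
  | .not c => ¬ c.Holds σ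
  | .and c d => c.Holds σ ∧ d.Holds σ

def Test.cost {α : Type u} (σ : State α) : Test → ℕ
  | .le a b => 1 + a.cost σ + b.cost σ
  | .keyLE a b => 1 + a.cost σ + b.cost σ
  | .not c => 1 + c.cost σ
  | .and c d => 1 + c.cost σ + d.cost σ

/-- Programs. -/
inductive Program where
  | skip
  | assign (x : ℕ) (e : Expr)
  | store (a e : Expr)
  | copyKey (a b : Expr)
  | seq (p q : Program)
  | ite (c : Test) (p q : Program)
  | loop (c : Test) (p : Program)

/-- `Exec p σ τ t`: the program `p`, started in the state `σ`, halts in the state `τ` after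
time `t`. -/
inductive Exec {α : Type u} [LinearOrder α] : Program → State α → State α → ℕ → Prop where
  | skip (σ : State α) : Exec .skip σ σ 1
  | assign (σ : State α) (x : ℕ) (e : Expr) :
      Exec (.assign x e) σ { σ with reg := Function.update σ.reg x (e.eval σ) } (1 + e.cost σ)
  | store (σ : State α) (a e : Expr) :
      Exec (.store a e) σ { σ with mem := Function.update σ.mem (a.eval σ) (e.eval σ) }
        (1 + a.cost σ + e.cost σ)
  | copyKey (σ : State α) (a b : Expr) :
      Exec (.copyKey a b) σ
        { σ with key := Function.update σ.key (a.eval σ) (σ.key (b.eval σ)) }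
        (1 + a.cost σ + b.cost σ)
  | seq {p q : Program} {σ τ ρ : State α} {t s : ℕ} :
      Exec p σ τ t → Exec q τ ρ s → Exec (.seq p q) σ ρ (t + s)
  | ite_true {c : Test} {p q : Program} {σ τ : State α} {t : ℕ} :
      c.Holds σ → Exec p σ τ t → Exec (.ite c p q) σ τ (1 + c.cost σ + t)
  | ite_false {c : Test} {p q : Program} {σ τ : State α} {t : ℕ} :
      ¬ c.Holds σ → Exec q σ τ t → Exec (.ite c p q) σ τ (1 + c.cost σ + t)
  | loop_done {c : Test} {p : Program} {σ : State α} :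
      ¬ c.Holds σ → Exec (.loop c p) σ σ (1 + c.cost σ)
  | loop_step {c : Test} {p : Program} {σ τ ρ : State α} {t s : ℕ} :
      c.Holds σ → Exec p σ τ t → Exec (.loop c p) τ ρ s →
        Exec (.loop c p) σ ρ (1 + c.cost σ + t + s)

/-! ### Data structures -/

/-- A data structure consists of one program for each kind of operation. -/
structure DataStructure where
  insert : Program
  delete : Program
  query : Program

/-- The program that performs a given operation. -/
def DataStructure.code {α : Type u} [LinearOrder α] (D : DataStructure) : Op α → Program
  | .insert _ => D.insert
  | .delete _ => D.delete
  | .query => D.query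

/-- How an operation is handed to the machine, where `outs` lists the outputs of the earlier
operations. An insertion gets the endpoints of its interval in the key cells `0` and `1`. A
deletion gets in register `0` the handle, that is, the number that was output by the insertion
of the interval to be deleted. -/
def feed {α : Type u} [LinearOrder α] (outs : List ℕ) (σ : State α) : Op α → State α
  | .insert I =>
      { σ with key := Function.update (Function.update σ.key 0 (I.start : WithBot α)) 1
                        (I.finish : WithBot α) }
  | .delete i => { σ with reg := Function.update σ.reg 0 (outs.getD i 0) }
  | .query => σ

/-- `Run D ops σ outs t`: performing the operations `ops` one after another, from the initial
state, ends in the state `σ` after total time `t`, and `outs` lists the outputs of the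
operations. The output of an operation is the number left in register `0`: for an insertion the
handle of the new interval, for a query the answer. -/
inductive Run {α : Type u} [LinearOrder α] (D : DataStructure) :
    List (Op α) → State α → List ℕ → ℕ → Prop where
  | nil : Run D [] (State.init α) [] 0
  | snoc {ops : List (Op α)} {op : Op α} {σ τ : State α} {outs : List ℕ} {t s : ℕ} :
      Run D ops σ outs t → Exec (D.code op) (feed outs σ op) τ s →
        Run D (ops ++ [op]) τ (outs ++ [τ.reg 0]) (t + s)

/-- Every query was answered with the maximum number of intervals, among those present at that
moment, that can be scheduled on `m` machines. -/
def CorrectAnswers {α : Type u} [LinearOrder α] (m : ℕ) (ops : List (Op α)) (outs : List ℕ) :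
    Prop :=
  ∀ k, ops[k]? = some Op.query → ∃ c, outs[k]? = some c ∧ IsOptimum m (contents ops k) c

end DIS

/-! Greedy rule. Take the jobs in order of finish. A job goes to the machine, among those on which
it fits, that becomes free last; if it fits on neither, it is dropped. This is optimal by an
exchange bound: blocking a machine until a time not later than any remaining finish loses at most
one job (`opt_le_succ`). So taking a job that fits never hurts, and if it fits on both machines, it
is better to leave free the one that is available earlier (`opt_anti`). `foldl_gstep_eq_opt` and
`isOptimum_opt` make this precise. What remains is to simulate the greedy algorithm quickly while
jobs come and go.

Static jobs. Let `nx v` be the first later position of a job that starts after the job at position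
`v` ends. The state of the greedy algorithm is a pair of last jobs, so there could be quadratically
many states to tabulate. They collapse as follows. As long as no intermediate job fits after the
last job `β` of one machine, the other machine simply follows the chain of `nx` (configurations
`A`). Once an intermediate job is taken, each machine follows its own chain, and the two chains
interlace (configurations `P`) until they arrive at a common job. At that moment the last jobs are
those at `u` and `nx u` for a single position `u`: a node (configuration `Nd`). There are at most
`N` nodes, and the next node with the number of jobs scheduled on the way is a function of the node
(`IsJump`). `cstep_spec` shows that these transitions do what the greedy algorithm does.

All phases are walks in three functional graphs: the successor of a position, `nx`, and the jump
between nodes. Binary lifting tables for them contain, for `2 ^ k` steps, the end of the walk, its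
length in scheduled jobs, and a label. For `nx` the label is the latest starting job strictly
between consecutive elements of the chain; it tells whether `β` finds room somewhere on the walk.
With these tables the greedy algorithm runs from an arbitrary state over an arbitrary stretch of
static positions in a logarithmic number of steps (`ex_gap`). The same machinery computes the jumps
when the tables are built (`ex_buildTables`).

Updates. Insertions and deletions since the last rebuilding are kept in a sorted list of pending
updates (`Layout`). They cut the static sequence into stretches; a query runs `gap` on each stretch
and treats the pending jobs one by one (`ex_answer`). A job inserted later gets a new handle, which
does not occur in the tables, so the tables stay correct (`Tables.extend`).

Amortization. A rebuilding takes place whenever the number of earlier operations is a square.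
Between two rebuildings the pending list then has length of order the square root of the number of
operations, and among `n` operations at most `√n + 1` are accompanied by a rebuilding, each of
near-linear cost. No advance knowledge of `n` is needed. Both contributions are `n √n` up to
logarithms.

Cost. Programs are analysed by counting elementary steps while all stored numbers remain at most `6
n + 20`; `Steps.exec` then turns steps into logarithmic cost, at the price of a constant and one
further logarithm. -/

namespace DIS

/-! ### The greedy algorithm for two machines -/

section Greedy

variable {ι : Type*} {κ : Type*} [LinearOrder κ]

/-- One step of the greedy algorithm. The state consists of the last jobs of the two machines
(the one that finishes first comes first) and of the number of jobs scheduled so far. -/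
def gstep (s f : ι → κ) (st : ι × ι × ℕ) (x : ι) : ι × ι × ℕ :=
  if f st.2.1 ≤ s x then (st.1, x, st.2.2 + 1)
  else if f st.1 ≤ s x then (st.2.1, x, st.2.2 + 1)
  else st

/-- The largest number of jobs of a list, ordered by finish, that can be scheduled on two
machines which are available from `a` and `b` on. -/
def opt (s f : ι → κ) : κ → κ → List ι → ℕ
  | _, _, [] => 0
  | a, b, x :: l => max (opt s f a b l)
      (max (if a ≤ s x then opt s f (f x) b l + 1 else 0)
        (if b ≤ s x then opt s f a (f x) l + 1 else 0))

theorem opt_comm (s f : ι → κ) (l : List ι) : ∀ a b, opt s f a b l = opt s f b a l := by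
  induction l with
  | nil => intros; rfl
  | cons x l ih =>
    intro a b
    simp only [opt]
    rw [ih a b, ih (f x) b, ih a (f x), max_comm (ite (a ≤ s x) _ _)]

theorem opt_anti (s f : ι → κ) (l : List ι) :
    ∀ {a b a' b'}, a' ≤ a → b' ≤ b → opt s f a b l ≤ opt s f a' b' l := by
  induction l with
  | nil => intros; exact le_rfl
  | cons x l ih =>
    intro a b a' b' ha hb
    simp only [opt]
    refine max_le_max (ih ha hb) (max_le_max ?_ ?_)
    · split_ifs with h1 h2
      · exact Nat.succ_le_succ (ih le_rfl hb)
      · exact absurd (ha.trans h1) h2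
      · exact Nat.zero_le _
      · exact le_rfl
    · split_ifs with h1 h2
      · exact Nat.succ_le_succ (ih ha le_rfl)
      · exact absurd (hb.trans h1) h2
      · exact Nat.zero_le _
      · exact le_rfl

/-- Give up the first job of the machine in question. After that job the machine would be free only
from a finish on that is at least `c`, so everything scheduled later on it is still possible when it
is blocked until `c`. -/
theorem opt_le_succ (s f : ι → κ) (l : List ι) :
    ∀ {a b c}, (∀ x ∈ l, c ≤ f x) → opt s f a b l ≤ opt s f c b l + 1 := by
  induction l with
  | nil => intros; simp [opt]
  | cons x l ih =>
    intro a b c hc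
    have hx : c ≤ f x := hc x (by simp)
    have hl : ∀ y ∈ l, c ≤ f y := fun y hy => hc y (by simp [hy])
    have h0 : opt s f c b l ≤ opt s f c b (x :: l) := le_max_left _ _
    refine max_le ((ih hl).trans (Nat.succ_le_succ h0)) (max_le ?_ ?_)
    · split_ifs with h1
      · exact Nat.succ_le_succ ((opt_anti s f l hx le_rfl).trans h0)
      · exact Nat.zero_le _
    · split_ifs with h1
      · refine Nat.succ_le_succ ((ih hl).trans ?_)
        have : opt s f c b (x :: l) ≥ opt s f c (f x) l + 1 := by
          simp only [opt, if_pos h1]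
          exact (le_max_right _ _).trans (le_max_right _ _)
        exact this
      · exact Nat.zero_le _

/-- Skipping a job that fits gains at most one later job (`opt_le_succ`), which the job itself makes
up for. If it fits on both machines, occupying the later one leaves the earlier availability, which
is at least as good by `opt_anti`. -/
theorem foldl_gstep_eq_opt (s f : ι → κ) (l : List ι) :
    ∀ a b n, l.Pairwise (fun x y => f x ≤ f y) → (∀ x ∈ l, f b ≤ f x) → f a ≤ f b →
      (l.foldl (gstep s f) (a, b, n)).2.2 = n + opt s f (f a) (f b) l := by
  induction l with
  | nil => intros; simp [opt]
  | cons x l ih =>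
    intro a b n hl hb hab
    rw [List.pairwise_cons] at hl
    have hbx : f b ≤ f x := hb x (by simp)
    simp only [List.foldl_cons]
    by_cases h1 : f b ≤ s x
    · have h2 : f a ≤ s x := hab.trans h1
      have hs : gstep s f (a, b, n) x = (a, x, n + 1) := by simp [gstep, h1]
      rw [hs, ih _ _ _ hl.2 hl.1 (hab.trans hbx)]
      simp only [opt, if_pos h1, if_pos h2]
      have e1 : opt s f (f x) (f b) l ≤ opt s f (f a) (f x) l := by
        rw [opt_comm]; exact opt_anti s f l hab le_rfl
      have e2 : opt s f (f a) (f b) l ≤ opt s f (f a) (f x) l + 1 := by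
        rw [opt_comm s f l (f a), opt_comm s f l (f a)]; exact opt_le_succ s f l hl.1
      omega
    · by_cases h2 : f a ≤ s x
      · have hs : gstep s f (a, b, n) x = (b, x, n + 1) := by simp [gstep, h1, h2]
        rw [hs, ih _ _ _ hl.2 hl.1 hbx]
        simp only [opt, if_neg h1, if_pos h2]
        have e2 : opt s f (f a) (f b) l ≤ opt s f (f x) (f b) l + 1 := opt_le_succ s f l hl.1
        rw [opt_comm s f l (f b) (f x)]
        omega
      · have hs : gstep s f (a, b, n) x = (a, b, n) := by simp [gstep, h1, h2]
        rw [hs, ih _ _ _ hl.2 (fun y hy => hb y (by simp [hy])) hab]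
        simp [opt, h1, h2]

theorem gstep_le (s f : ι → κ) (st : ι × ι × ℕ) (x : ι) : (gstep s f st x).2.2 ≤ st.2.2 + 1 := by
  unfold gstep; split_ifs <;> simp

theorem foldl_gstep_le (s f : ι → κ) (l : List ι) :
    ∀ st, (l.foldl (gstep s f) st).2.2 ≤ st.2.2 + l.length := by
  induction l with
  | nil => intro st; simp
  | cons x l ih =>
    intro st
    have h1 := ih (gstep s f st x)
    have h2 := gstep_le s f st x
    simp only [List.foldl_cons, List.length_cons]; omega

theorem opt_map {ι' : Type*} (s f : ι → κ) (g : ι' → ι) (l : List ι') :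
    ∀ a b, opt s f a b (l.map g) = opt (s ∘ g) (f ∘ g) a b l := by
  induction l with
  | nil => intros; rfl
  | cons x l ih => intro a b; simp only [List.map_cons, opt, ih, Function.comp]

theorem opt_congr {s f s' f' : ι → κ} (l : List ι) (h : ∀ x ∈ l, s x = s' x ∧ f x = f' x) :
    ∀ a b, opt s f a b l = opt s' f' a b l := by
  induction l with
  | nil => intros; rfl
  | cons x l ih =>
    intro a b
    have hx := h x (by simp)
    have ih' := ih (fun y hy => h y (by simp [hy]))
    simp only [opt, ih', hx.1, hx.2]

end Greedy

/-! ### The recursion `opt` computes the scheduling optimum. -/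

section Optimum

variable {α : Type u} [LinearOrder α]

/-- The start of a labelled job. -/
def jobStart (p : ℕ × Job α) : WithBot α := (p.2.start : WithBot α)

/-- The finish of a labelled job. -/
def jobFinish (p : ℕ × Job α) : WithBot α := (p.2.finish : WithBot α)

theorem jobStart_lt_jobFinish (p : ℕ × Job α) : jobStart p < jobFinish p :=
  WithBot.coe_lt_coe.2 p.2.start_lt_finish

theorem compatible_iff (p q : ℕ × Job α) :
    Compatible p.2 q.2 ↔ jobFinish p ≤ jobStart q ∨ jobFinish q ≤ jobStart p := by
  simp [Compatible, jobStart, jobFinish]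

-- A scheduled job `x` finishes first among the remaining ones. Hence the other jobs of its machine
-- cannot precede it, and they start after `x` finishes; this is the availability that `opt` passes
-- on.
open Classical in
theorem card_le_opt (m : ℕ × Job α → Fin 2) (l : List (ℕ × Job α)) :
    ∀ (T : Finset (ℕ × Job α)) (a b : WithBot α),
      l.Pairwise (fun p q => jobFinish p ≤ jobFinish q) → (∀ p ∈ T, p ∈ l) →
      (∀ p ∈ T, ∀ q ∈ T, p ≠ q → m p = m q → Compatible p.2 q.2) →
      (∀ p ∈ T, m p = 0 → a ≤ jobStart p) → (∀ p ∈ T, m p = 1 → b ≤ jobStart p) →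
      T.card ≤ opt jobStart jobFinish a b l := by
  induction l with
  | nil =>
    intro T a b _ hT _ _ _
    have : T = ∅ := Finset.eq_empty_of_forall_notMem (fun p hp => by simpa using hT p hp)
    simp [this]
  | cons x l ih =>
    intro T a b hl hT hc ha hb
    rw [List.pairwise_cons] at hl
    by_cases hx : x ∈ T
    · have key : ∀ p ∈ T.erase x, m p = m x → jobFinish x ≤ jobStart p := by
        intro p hp hm
        rw [Finset.mem_erase] at hp
        have hpl : p ∈ l := (List.mem_cons.1 (hT p hp.2)).resolve_left hp.1
        rcases (compatible_iff p x).1 (hc p hp.2 x hx hp.1 hm) with h | h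
        · exact absurd ((hl.1 p hpl).trans h) (not_le.2 (jobStart_lt_jobFinish x))
        · exact h
      have hsub : ∀ p ∈ T.erase x, p ∈ l := by
        intro p hp
        rw [Finset.mem_erase] at hp
        exact (List.mem_cons.1 (hT p hp.2)).resolve_left hp.1
      have hc' : ∀ p ∈ T.erase x, ∀ q ∈ T.erase x, p ≠ q → m p = m q → Compatible p.2 q.2 :=
        fun p hp q hq => hc p (Finset.mem_of_mem_erase hp) q (Finset.mem_of_mem_erase hq)
      have hcard := Finset.card_erase_add_one hx
      have hm : m x = 0 ∨ m x = 1 := by omega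
      rcases hm with hm | hm
      · have := ih (T.erase x) (jobFinish x) b hl.2 hsub hc'
          (fun p hp h => key p hp (h.trans hm.symm))
          (fun p hp h => hb p (Finset.mem_of_mem_erase hp) h)
        have h1 := ha x hx hm
        simp only [opt, if_pos h1]
        omega
      · have := ih (T.erase x) a (jobFinish x) hl.2 hsub hc'
          (fun p hp h => ha p (Finset.mem_of_mem_erase hp) h)
          (fun p hp h => key p hp (h.trans hm.symm))
        have h1 := hb x hx hm
        simp only [opt, if_pos h1]
        omega
    · refine (ih T a b hl.2 (fun p hp => ?_) hc ha hb).trans (le_max_left _ _)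
      exact (List.mem_cons.1 (hT p hp)).resolve_left (fun h => hx (h ▸ hp))

-- The choices that attain the maxima in `opt` are traced: each chosen job is added to a schedule of
-- the tail, with its machine set by `Function.update`.
open Classical in
theorem exists_card_eq_opt (l : List (ℕ × Job α)) :
    ∀ (a b : WithBot α), l.Nodup → ∃ (T : Finset (ℕ × Job α)) (m : ℕ × Job α → Fin 2),
      (∀ p ∈ T, p ∈ l) ∧ (∀ p ∈ T, ∀ q ∈ T, p ≠ q → m p = m q → Compatible p.2 q.2) ∧
      (∀ p ∈ T, m p = 0 → a ≤ jobStart p) ∧ (∀ p ∈ T, m p = 1 → b ≤ jobStart p) ∧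
      T.card = opt jobStart jobFinish a b l := by
  induction l with
  | nil => intro a b _; exact ⟨∅, fun _ => 0, by simp [opt]⟩
  | cons x l ih =>
    intro a b hl
    rw [List.nodup_cons] at hl
    -- Both machines are treated at once: `x` is put on machine `i`, and `a'`, `b'` are the
    -- availabilities after that.
    have hadd : ∀ (i : Fin 2) (a' b' : WithBot α), (i = 0 → a' = jobFinish x ∧ b' = b) →
        (i = 1 → a' = a ∧ b' = jobFinish x) → (i = 0 → a ≤ jobStart x) →
        (i = 1 → b ≤ jobStart x) → opt jobStart jobFinish a b (x :: l) =
          opt jobStart jobFinish a' b' l + 1 →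
        ∃ (T : Finset (ℕ × Job α)) (m : ℕ × Job α → Fin 2),
          (∀ p ∈ T, p ∈ x :: l) ∧
          (∀ p ∈ T, ∀ q ∈ T, p ≠ q → m p = m q → Compatible p.2 q.2) ∧
          (∀ p ∈ T, m p = 0 → a ≤ jobStart p) ∧ (∀ p ∈ T, m p = 1 → b ≤ jobStart p) ∧
          T.card = opt jobStart jobFinish a b (x :: l) := by
      intro i a' b' h0 h1 ha hb ho
      obtain ⟨T, m, hT, hc, hta, htb, hcard⟩ := ih a' b' hl.2
      have hxT : x ∉ T := fun h => hl.1 (hT x h)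
      have hm : ∀ p ∈ T, Function.update m x i p = m p :=
        fun p hp => Function.update_of_ne (by rintro rfl; exact hxT hp) _ _
      have hi : i = 0 ∨ i = 1 := by omega
      have hxp : ∀ p ∈ T, m p = i → jobFinish x ≤ jobStart p := by
        intro p hp h
        rcases hi with hi | hi
        · rw [← (h0 hi).1]; exact hta p hp (h.trans hi)
        · rw [← (h1 hi).2]; exact htb p hp (h.trans hi)
      refine ⟨insert x T, Function.update m x i, ?_, ?_, ?_, ?_, ?_⟩
      · intro p hp
        rcases Finset.mem_insert.1 hp with rfl | hp
        · simp
        · simp [hT p hp]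
      · intro p hp q hq hne hpq
        rcases Finset.mem_insert.1 hp with rfl | hp' <;> rcases Finset.mem_insert.1 hq with rfl | hq'
        · exact absurd rfl hne
        · rw [Function.update_self, hm q hq'] at hpq
          exact (compatible_iff _ _).2 (Or.inl (hxp q hq' hpq.symm))
        · rw [Function.update_self, hm p hp'] at hpq
          exact (compatible_iff _ _).2 (Or.inr (hxp p hp' hpq))
        · rw [hm p hp', hm q hq'] at hpq
          exact hc p hp' q hq' hne hpq
      · intro p hp h
        rcases Finset.mem_insert.1 hp with rfl | hp
        · rw [Function.update_self] at h; exact ha h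
        · rw [hm p hp] at h
          rcases hi with hi | hi
          · exact (ha hi).trans ((jobStart_lt_jobFinish x).le.trans (hxp p hp (h.trans hi.symm)))
          · rw [← (h1 hi).1]; exact hta p hp h
      · intro p hp h
        rcases Finset.mem_insert.1 hp with rfl | hp
        · rw [Function.update_self] at h; exact hb h
        · rw [hm p hp] at h
          rcases hi with hi | hi
          · rw [← (h0 hi).2]; exact htb p hp h
          · exact (hb hi).trans ((jobStart_lt_jobFinish x).le.trans (hxp p hp (h.trans hi.symm)))
      · rw [Finset.card_insert_of_notMem hxT, hcard, ho]
    rcases max_choice (opt jobStart jobFinish a b l)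
      (max (if a ≤ jobStart x then opt jobStart jobFinish (jobFinish x) b l + 1 else 0)
        (if b ≤ jobStart x then opt jobStart jobFinish a (jobFinish x) l + 1 else 0)) with h | h
    · obtain ⟨T, m, hT, hc, hta, htb, hcard⟩ := ih a b hl.2
      refine ⟨T, m, fun p hp => by simp [hT p hp], hc, hta, htb, ?_⟩
      rw [hcard, opt, h]
    -- For value `0` the empty schedule will do; otherwise the branches `else 0` cannot attain the
    -- maximum.
    · by_cases hn : opt jobStart jobFinish a b (x :: l) = 0
      · exact ⟨∅, fun _ => 0, by simp, by simp, by simp, by simp, by simp [hn]⟩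
      rcases max_choice
        (if a ≤ jobStart x then opt jobStart jobFinish (jobFinish x) b l + 1 else 0)
        (if b ≤ jobStart x then opt jobStart jobFinish a (jobFinish x) l + 1 else 0) with h' | h'
      · have e : opt jobStart jobFinish a b (x :: l) =
          if a ≤ jobStart x then opt jobStart jobFinish (jobFinish x) b l + 1 else 0 := by
          rw [opt, h, h']
        by_cases hax : a ≤ jobStart x
        · rw [if_pos hax] at e
          exact hadd 0 (jobFinish x) b (by simp) (by simp) (fun _ => hax) (by simp) e
        · rw [if_neg hax] at e; exact absurd e hn
      · have e : opt jobStart jobFinish a b (x :: l) =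
          if b ≤ jobStart x then opt jobStart jobFinish a (jobFinish x) l + 1 else 0 := by
          rw [opt, h, h']
        by_cases hax : b ≤ jobStart x
        · rw [if_pos hax] at e
          exact hadd 1 a (jobFinish x) (by simp) (by simp) (by simp) (fun _ => hax) e
        · rw [if_neg hax] at e; exact absurd e hn

theorem isOptimum_opt (l : List (ℕ × Job α)) (hl : l.Nodup)
    (hs : l.Pairwise (fun p q => jobFinish p ≤ jobFinish q)) :
    IsOptimum 2 {p | p ∈ l} (opt jobStart jobFinish ⊥ ⊥ l) := by
  constructor
  · obtain ⟨T, m, hT, hc, -, -, hcard⟩ := exists_card_eq_opt l ⊥ ⊥ hl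
    exact ⟨T, fun p hp => hT p (by simpa using hp), ⟨m, hc⟩, hcard⟩
  · rintro k ⟨T, hT, ⟨m, hc⟩, rfl⟩
    exact card_le_opt m l T ⊥ ⊥ hs (fun p hp => hT (by simpa using hp)) hc (by simp) (by simp)

end Optimum

end DIS

namespace DIS

/-! ### Counting elementary steps -/

section Steps

variable {α : Type u}

/-- All numbers stored by the machine are at most `B`. -/
def Bounded (B : ℕ) (σ : State α) : Prop := (∀ x, σ.reg x ≤ B) ∧ ∀ a, σ.mem a ≤ B

/-- `Steps B p σ τ s`: the program `p`, started in `σ`, halts in `τ` after `s` elementary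
steps, and only numbers `≤ B` are written. -/
inductive Steps [LinearOrder α] (B : ℕ) : Program → State α → State α → ℕ → Prop where
  | skip (σ : State α) : Steps B .skip σ σ 1
  | assign (σ : State α) (x : ℕ) (e : Expr) : e.eval σ ≤ B →
      Steps B (.assign x e) σ { σ with reg := Function.update σ.reg x (e.eval σ) } 1
  | store (σ : State α) (a e : Expr) : e.eval σ ≤ B →
      Steps B (.store a e) σ { σ with mem := Function.update σ.mem (a.eval σ) (e.eval σ) } 1
  | copyKey (σ : State α) (a b : Expr) :
      Steps B (.copyKey a b) σ
        { σ with key := Function.update σ.key (a.eval σ) (σ.key (b.eval σ)) } 1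
  | seq {p q : Program} {σ τ ρ : State α} {t s : ℕ} :
      Steps B p σ τ t → Steps B q τ ρ s → Steps B (.seq p q) σ ρ (t + s)
  | ite_true {c : Test} {p q : Program} {σ τ : State α} {t : ℕ} :
      c.Holds σ → Steps B p σ τ t → Steps B (.ite c p q) σ τ (1 + t)
  | ite_false {c : Test} {p q : Program} {σ τ : State α} {t : ℕ} :
      ¬ c.Holds σ → Steps B q σ τ t → Steps B (.ite c p q) σ τ (1 + t)
  | loop_done {c : Test} {p : Program} {σ : State α} :
      ¬ c.Holds σ → Steps B (.loop c p) σ σ 1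
  | loop_step {c : Test} {p : Program} {σ τ ρ : State α} {t s : ℕ} :
      c.Holds σ → Steps B p σ τ t → Steps B (.loop c p) τ ρ s →
        Steps B (.loop c p) σ ρ (1 + t + s)

/-- The value of `e` in a bounded state has at most `e.bits` times the bit length of the bound. -/
def Expr.bits : Expr → ℕ
  | .const c => c.size + 1
  | .reg _ => 1
  | .mem _ => 1
  | .add a b => a.bits + b.bits + 1
  | .sub a _ => a.bits
  | .mul a b => a.bits + b.bits
  | .div a _ => a.bits

/-- The cost of `e` in a bounded state is at most `e.weight` times the bit length of the bound. -/
def Expr.weight : Expr → ℕ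
  | .const c => 1 + c.size
  | .reg _ => 2
  | .mem a => a.weight + 2
  | .add a b => a.weight + b.weight + (1 + (Expr.add a b).bits)
  | .sub a b => a.weight + b.weight + (1 + (Expr.sub a b).bits)
  | .mul a b => a.weight + b.weight + (1 + (Expr.mul a b).bits)
  | .div a b => a.weight + b.weight + (1 + (Expr.div a b).bits)

def Test.weight : Test → ℕ
  | .le a b => 1 + a.weight + b.weight
  | .keyLE a b => 1 + a.weight + b.weight
  | .not c => 1 + c.weight
  | .and c d => 1 + c.weight + d.weight

def Program.weight : Program → ℕ
  | .skip => 1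
  | .assign _ e => 1 + e.weight
  | .store a e => 1 + a.weight + e.weight
  | .copyKey a b => 1 + a.weight + b.weight
  | .seq p q => p.weight + q.weight
  | .ite c p q => 1 + c.weight + p.weight + q.weight
  | .loop c p => 1 + c.weight + p.weight

/-- Bit lengths add under multiplication, so a fixed expression enlarges the bit length only by a
constant factor. In particular the quadratic addresses of the arrays need no separate bound. -/
theorem Expr.size_eval_le {B Z : ℕ} (hZ : 1 ≤ Z) (hB : B.size ≤ Z) {σ : State α}
    (h : Bounded B σ) (e : Expr) : (e.eval σ).size ≤ e.bits * Z := by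
  have base : ∀ x, x ≤ B → x < 2 ^ Z := fun x hx =>
    Nat.size_le.1 ((Nat.size_le_size hx).trans hB)
  rw [Nat.size_le]
  induction e with
  | const c =>
    refine Nat.size_le.1 ?_
    simp only [Expr.eval, Expr.bits]
    nlinarith
  | reg x => simpa [Expr.eval, Expr.bits] using base _ (h.1 x)
  | mem a _ => simpa [Expr.eval, Expr.bits] using base _ (h.2 _)
  | add a b iha ihb =>
    simp only [Expr.eval, Expr.bits]
    have h1 : 2 ^ (a.bits * Z) ≤ 2 ^ ((a.bits + b.bits) * Z) :=
      Nat.pow_le_pow_right (by norm_num) (Nat.mul_le_mul_right _ (by omega))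
    have h2 : 2 ^ (b.bits * Z) ≤ 2 ^ ((a.bits + b.bits) * Z) :=
      Nat.pow_le_pow_right (by norm_num) (Nat.mul_le_mul_right _ (by omega))
    -- The summand `1` in `Expr.bits` pays for the carry, because `1 ≤ Z`.
    have h3 : 2 ^ ((a.bits + b.bits) * Z + 1) ≤ 2 ^ ((a.bits + b.bits + 1) * Z) :=
      Nat.pow_le_pow_right (by norm_num) (by rw [Nat.add_mul _ 1]; omega)
    rw [pow_succ] at h3
    omega
  | sub a b iha _ =>
    simp only [Expr.eval, Expr.bits]; omega
  | mul a b iha ihb =>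
    simp only [Expr.eval, Expr.bits]
    rw [Nat.add_mul, pow_add]
    exact Nat.mul_lt_mul'' iha ihb
  | div a b iha _ =>
    simp only [Expr.eval, Expr.bits]
    exact (Nat.div_le_self _ _).trans_lt iha

theorem Expr.cost_le {B Z : ℕ} (hZ : 1 ≤ Z) (hB : B.size ≤ Z) {σ : State α}
    (h : Bounded B σ) (e : Expr) : e.cost σ ≤ e.weight * Z := by
  have hs := fun e => Expr.size_eval_le hZ hB h e
  induction e with
  | const c => simp only [Expr.cost, Expr.weight]; nlinarith
  | reg x =>
    have := hs (.reg x)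
    simp only [Expr.cost, Expr.weight, Expr.eval, Expr.bits] at *; omega
  | mem a ih =>
    have := hs (.mem a)
    simp only [Expr.cost, Expr.weight, Expr.bits, Nat.add_mul] at *; omega
  | add a b iha ihb =>
    have := hs (.add a b)
    simp only [Expr.cost, Expr.weight, Nat.add_mul] at *; omega
  | sub a b iha ihb =>
    have := hs (.sub a b)
    simp only [Expr.cost, Expr.weight, Nat.add_mul] at *; omega
  | mul a b iha ihb =>
    have := hs (.mul a b)
    simp only [Expr.cost, Expr.weight, Nat.add_mul] at *; omega
  | div a b iha ihb =>
    have := hs (.div a b)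
    simp only [Expr.cost, Expr.weight, Nat.add_mul] at *; omega

theorem Test.cost_le {B Z : ℕ} (hZ : 1 ≤ Z) (hB : B.size ≤ Z) {σ : State α}
    (h : Bounded B σ) (c : Test) : c.cost σ ≤ c.weight * Z := by
  induction c with
  | le a b =>
    have := Expr.cost_le hZ hB h a
    have := Expr.cost_le hZ hB h b
    simp only [Test.cost, Test.weight, Nat.add_mul]; omega
  | keyLE a b =>
    have := Expr.cost_le hZ hB h a
    have := Expr.cost_le hZ hB h b
    simp only [Test.cost, Test.weight, Nat.add_mul]; omega
  | not c ih => simp only [Test.cost, Test.weight, Nat.add_mul]; omega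
  | and c d ihc ihd => simp only [Test.cost, Test.weight, Nat.add_mul]; omega

theorem Bounded.update_reg {B : ℕ} {σ : State α} (h : Bounded B σ) {x v : ℕ} (hv : v ≤ B) :
    Bounded B { σ with reg := Function.update σ.reg x v } := by
  refine ⟨fun y => ?_, h.2⟩
  by_cases hy : y = x
  · subst hy; simpa using hv
  · simpa [hy] using h.1 y

theorem Bounded.update_mem {B : ℕ} {σ : State α} (h : Bounded B σ) {x v : ℕ} (hv : v ≤ B) :
    Bounded B { σ with mem := Function.update σ.mem x v } := by
  refine ⟨h.1, fun y => ?_⟩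
  by_cases hy : y = x
  · subst hy; simpa using hv
  · simpa [hy] using h.2 y

variable [LinearOrder α]

theorem Steps.bounded {B s : ℕ} {p : Program} {σ τ : State α} (hp : Steps B p σ τ s) :
    Bounded B σ → Bounded B τ := by
  induction hp with
  | skip => exact id
  | assign σ x e he => exact fun h => h.update_reg he
  | store σ a e he => exact fun h => h.update_mem he
  | copyKey σ a b => exact id
  | seq _ _ ih1 ih2 => exact fun h => ih2 (ih1 h)
  | ite_true _ _ ih => exact ih
  | ite_false _ _ ih => exact ih
  | loop_done => exact id
  | loop_step _ _ _ ih1 ih2 => exact fun h => ih2 (ih1 h)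

/-- One step evaluates some of the expressions of the program once, on numbers of bit length at most
`Z`; the total weight of the program bounds the cost of any of its steps. -/
theorem Steps.exec {B s Z : ℕ} (hZ : 1 ≤ Z) (hB : B.size ≤ Z) {p : Program} {σ τ : State α}
    (hp : Steps B p σ τ s) :
    Bounded B σ → ∃ t, Exec p σ τ t ∧ t ≤ s * (p.weight * Z) := by
  induction hp with
  | skip => exact fun _ => ⟨_, .skip _, by simp [Program.weight]; omega⟩
  | assign σ x e he =>
    intro h
    refine ⟨_, .assign _ _ _, ?_⟩
    have := Expr.cost_le hZ hB h e
    simp only [Program.weight, Nat.add_mul]; omega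
  | store σ a e he =>
    intro h
    refine ⟨_, .store _ _ _, ?_⟩
    have := Expr.cost_le hZ hB h e
    have := Expr.cost_le hZ hB h a
    simp only [Program.weight, Nat.add_mul]; omega
  | copyKey σ a b =>
    intro h
    refine ⟨_, .copyKey _ _ _, ?_⟩
    have := Expr.cost_le hZ hB h a
    have := Expr.cost_le hZ hB h b
    simp only [Program.weight, Nat.add_mul]; omega
  | @seq p q σ τ ρ t s h1 h2 ih1 ih2 =>
    intro h
    obtain ⟨t1, e1, l1⟩ := ih1 h
    obtain ⟨t2, e2, l2⟩ := ih2 (h1.bounded h)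
    refine ⟨_, e1.seq e2, ?_⟩
    simp only [Program.weight]
    have a1 := Nat.mul_le_mul_left t (Nat.mul_le_mul_right Z (Nat.le_add_right p.weight q.weight))
    have a2 := Nat.mul_le_mul_left s (Nat.mul_le_mul_right Z (Nat.le_add_left q.weight p.weight))
    rw [Nat.add_mul]; omega
  | @ite_true c p q σ τ t hc h1 ih =>
    intro h
    obtain ⟨t1, e1, l1⟩ := ih h
    refine ⟨_, .ite_true hc e1, ?_⟩
    have := Test.cost_le hZ hB h c
    have a1 := Nat.mul_le_mul_left t (Nat.mul_le_mul_right Z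
      (show p.weight ≤ 1 + c.weight + p.weight + q.weight by omega))
    simp only [Program.weight]
    rw [Nat.add_mul]
    simp only [Nat.add_mul] at *
    omega
  | @ite_false c p q σ τ t hc h1 ih =>
    intro h
    obtain ⟨t1, e1, l1⟩ := ih h
    refine ⟨_, .ite_false hc e1, ?_⟩
    have := Test.cost_le hZ hB h c
    have a1 := Nat.mul_le_mul_left t (Nat.mul_le_mul_right Z
      (show q.weight ≤ 1 + c.weight + p.weight + q.weight by omega))
    simp only [Program.weight]
    rw [Nat.add_mul]
    simp only [Nat.add_mul] at *
    omega
  | @loop_done c p σ hc =>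
    intro h
    refine ⟨_, .loop_done hc, ?_⟩
    have := Test.cost_le hZ hB h c
    simp only [Program.weight, Nat.add_mul]; omega
  | @loop_step c p σ τ ρ t s hc h1 h2 ih1 ih2 =>
    intro h
    obtain ⟨t1, e1, l1⟩ := ih1 h
    obtain ⟨t2, e2, l2⟩ := ih2 (h1.bounded h)
    refine ⟨_, .loop_step hc e1 e2, ?_⟩
    have := Test.cost_le hZ hB h c
    have a1 := Nat.mul_le_mul_left t (Nat.mul_le_mul_right Z
      (show p.weight ≤ 1 + c.weight + p.weight by omega))
    simp only [Program.weight] at *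
    rw [Nat.add_mul, Nat.add_mul]
    simp only [Nat.add_mul] at *
    omega

end Steps

/-! ### Arrays and keys of jobs -/

section View

variable {α : Type u}

/-- The entry `(k, v)` of the array number `i` of a state. -/
def State.arr (σ : State α) (i k v : ℕ) : ℕ := σ.mem (16 * ((k + v) * (k + v) + v) + i)

def State.setReg (σ : State α) (x v : ℕ) : State α := { σ with reg := Function.update σ.reg x v }

def State.setArr (σ : State α) (i k v x : ℕ) : State α :=
  { σ with mem := Function.update σ.mem (16 * ((k + v) * (k + v) + v) + i) x }

def State.setKey (σ : State α) (i : ℕ) (x : WithBot α) : State α :=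
  { σ with key := Function.update σ.key i x }

/-- The start of the job with handle `h`. -/
def State.sk (σ : State α) (h : ℕ) : WithBot α := σ.key (2 * h + 2)

/-- The finish of the job with handle `h`. -/
def State.fk (σ : State α) (h : ℕ) : WithBot α := σ.key (2 * h + 3)

@[simp] theorem reg_setReg (σ : State α) (x v y : ℕ) :
    (σ.setReg x v).reg y = if y = x then v else σ.reg y := by
  simp [State.setReg, Function.update_apply]

@[simp] theorem arr_setReg (σ : State α) (x v i k w : ℕ) :
    (σ.setReg x v).arr i k w = σ.arr i k w := rfl

@[simp] theorem key_setReg (σ : State α) (x v : ℕ) : (σ.setReg x v).key = σ.key := rfl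
@[simp] theorem sk_setReg (σ : State α) (x v h : ℕ) : (σ.setReg x v).sk h = σ.sk h := rfl
@[simp] theorem fk_setReg (σ : State α) (x v h : ℕ) : (σ.setReg x v).fk h = σ.fk h := rfl

@[simp] theorem reg_setArr (σ : State α) (i k v x y : ℕ) :
    (σ.setArr i k v x).reg y = σ.reg y := rfl
@[simp] theorem sk_setArr (σ : State α) (i k v x h : ℕ) : (σ.setArr i k v x).sk h = σ.sk h := rfl
@[simp] theorem reg_setKey (σ : State α) (i y : ℕ) (x : WithBot α) :
    (σ.setKey i x).reg y = σ.reg y := rfl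
@[simp] theorem key_setKey (σ : State α) (i j : ℕ) (x : WithBot α) :
    (σ.setKey i x).key j = if j = i then x else σ.key j := by
  simp [State.setKey, Function.update_apply]

/-- Since `v ≤ k + v`, the values with `k + v = s` lie between `s * s` and `s * s + s`, and these
ranges are disjoint for different `s`. -/
theorem pair_inj {k v k' v' : ℕ} (h : (k + v) * (k + v) + v = (k' + v') * (k' + v') + v') :
    k = k' ∧ v = v' := by
  have : k + v = k' + v' := by
    by_contra hne
    rcases Nat.lt_or_gt_of_ne hne with h1 | h1
    · nlinarith
    · nlinarith
  rw [this] at h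
  omega

theorem arr_setArr (σ : State α) {i j : ℕ} (k v x k' v' : ℕ) (hi : i < 16) (hj : j < 16) :
    (σ.setArr i k v x).arr j k' v' =
      if j = i ∧ k' = k ∧ v' = v then x else σ.arr j k' v' := by
  simp only [State.setArr, State.arr, Function.update_apply]
  refine if_congr ?_ rfl rfl
  constructor
  · intro h
    have h1 : j = i := by omega
    exact ⟨h1, pair_inj (by omega)⟩
  · rintro ⟨rfl, rfl, rfl⟩; rfl

theorem arr_congr {σ τ : State α} (h : τ.mem = σ.mem) : τ.arr = σ.arr := by
  funext i k v; simp [State.arr, h]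
theorem sk_congr {σ τ : State α} (h : τ.key = σ.key) : τ.sk = σ.sk := by
  funext i; simp [State.sk, h]
theorem fk_congr {σ τ : State α} (h : τ.key = σ.key) : τ.fk = σ.fk := by
  funext i; simp [State.fk, h]

theorem Bounded.arr {B : ℕ} {σ : State α} (h : Bounded B σ) (i k v : ℕ) : σ.arr i k v ≤ B :=
  h.2 _

/-- The address of the entry `(k, v)` of the array number `i`. -/
def addr (i : ℕ) (k v : Expr) : Expr :=
  .add (.mul (.const 16) (.add (.mul (.add k v) (.add k v)) v)) (.const i)

def rd (i : ℕ) (k v : Expr) : Expr := .mem (addr i k v)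

def wr (i : ℕ) (k v e : Expr) : Program := .store (addr i k v) e

/-- The address of the start of the job with handle `h`. -/
def skA (h : Expr) : Expr := .add (.mul (.const 2) h) (.const 2)

/-- The address of the finish of the job with handle `h`. -/
def fkA (h : Expr) : Expr := .add (.mul (.const 2) h) (.const 3)

def lt (a b : Expr) : Test := .not (.le b a)

def eq (a b : Expr) : Test := .and (.le a b) (.le b a)

/-- The job with handle `h` starts after the finish of the job with handle `b`. -/
def fits (b h : Expr) : Test := .keyLE (fkA b) (skA h)

@[simp] theorem eval_const (σ : State α) (c : ℕ) : (Expr.const c).eval σ = c := rfl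
@[simp] theorem eval_reg (σ : State α) (x : ℕ) : (Expr.reg x).eval σ = σ.reg x := rfl
@[simp] theorem eval_add (σ : State α) (a b : Expr) :
    (Expr.add a b).eval σ = a.eval σ + b.eval σ := rfl
@[simp] theorem eval_sub (σ : State α) (a b : Expr) :
    (Expr.sub a b).eval σ = a.eval σ - b.eval σ := rfl
@[simp] theorem eval_mul (σ : State α) (a b : Expr) :
    (Expr.mul a b).eval σ = a.eval σ * b.eval σ := rfl

@[simp] theorem eval_rd (σ : State α) (i : ℕ) (k v : Expr) :
    (rd i k v).eval σ = σ.arr i (k.eval σ) (v.eval σ) := rfl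

variable [LinearOrder α]

@[simp] theorem holds_le (σ : State α) (a b : Expr) :
    (Test.le a b).Holds σ ↔ a.eval σ ≤ b.eval σ := Iff.rfl
@[simp] theorem holds_not (σ : State α) (c : Test) : (Test.not c).Holds σ ↔ ¬ c.Holds σ := Iff.rfl
@[simp] theorem holds_and (σ : State α) (c d : Test) :
    (Test.and c d).Holds σ ↔ c.Holds σ ∧ d.Holds σ := Iff.rfl
@[simp] theorem holds_lt (σ : State α) (a b : Expr) :
    (lt a b).Holds σ ↔ a.eval σ < b.eval σ := not_le
@[simp] theorem holds_eq (σ : State α) (a b : Expr) :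
    (eq a b).Holds σ ↔ a.eval σ = b.eval σ := le_antisymm_iff.symm
@[simp] theorem holds_fits (σ : State α) (b h : Expr) :
    (fits b h).Holds σ ↔ σ.fk (b.eval σ) ≤ σ.sk (h.eval σ) := Iff.rfl
@[simp] theorem holds_sk_le (σ : State α) (b h : Expr) :
    (Test.keyLE (skA b) (skA h)).Holds σ ↔ σ.sk (b.eval σ) ≤ σ.sk (h.eval σ) := Iff.rfl
@[simp] theorem holds_fk_le (σ : State α) (b h : Expr) :
    (Test.keyLE (fkA b) (fkA h)).Holds σ ↔ σ.fk (b.eval σ) ≤ σ.fk (h.eval σ) := Iff.rfl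

end View

/-! ### Rules for total correctness -/

section Rules

variable {α : Type u} [LinearOrder α] {B : ℕ}

/-- The program `p`, started in `σ`, halts, and its final state and number of steps
satisfy `Q`. -/
def Ex (B : ℕ) (p : Program) (σ : State α) (Q : State α → ℕ → Prop) : Prop :=
  ∃ τ s, Steps B p σ τ s ∧ Q τ s

theorem Ex.imp {p : Program} {σ : State α} {Q R : State α → ℕ → Prop} (h : Ex B p σ Q)
    (hQ : ∀ τ s, Q τ s → R τ s) : Ex B p σ R := by
  obtain ⟨τ, s, h1, h2⟩ := h
  exact ⟨τ, s, h1, hQ _ _ h2⟩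

theorem Ex.imp_bounded {p : Program} {σ : State α} {Q R : State α → ℕ → Prop} (h : Ex B p σ Q)
    (hb : Bounded B σ) (hQ : ∀ τ s, Bounded B τ → Q τ s → R τ s) : Ex B p σ R := by
  obtain ⟨τ, s, h1, h2⟩ := h
  exact ⟨τ, s, h1, hQ _ _ (h1.bounded hb) h2⟩

infixr:60 " ;; " => Program.seq

theorem ex_skip {σ : State α} {Q : State α → ℕ → Prop} (h : Q σ 1) : Ex B .skip σ Q :=
  ⟨_, _, .skip σ, h⟩

theorem ex_assign {σ : State α} {x : ℕ} {e : Expr} {Q : State α → ℕ → Prop}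
    (he : e.eval σ ≤ B) (h : Q (σ.setReg x (e.eval σ)) 1) : Ex B (.assign x e) σ Q :=
  ⟨_, _, .assign σ x e he, h⟩

theorem ex_wr {σ : State α} {i : ℕ} {k v e : Expr} {Q : State α → ℕ → Prop}
    (he : e.eval σ ≤ B) (h : Q (σ.setArr i (k.eval σ) (v.eval σ) (e.eval σ)) 1) :
    Ex B (wr i k v e) σ Q :=
  ⟨_, _, .store σ _ e he, h⟩

theorem ex_copyKey {σ : State α} {a b : Expr} {Q : State α → ℕ → Prop}
    (h : Q (σ.setKey (a.eval σ) (σ.key (b.eval σ))) 1) : Ex B (.copyKey a b) σ Q :=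
  ⟨_, _, .copyKey σ a b, h⟩

theorem ex_seq {σ : State α} {p q : Program} {Q : State α → ℕ → Prop}
    (h : Ex B p σ (fun τ s => Ex B q τ (fun ρ t => Q ρ (s + t)))) : Ex B (p ;; q) σ Q := by
  obtain ⟨τ, s, h1, ρ, t, h2, h3⟩ := h
  exact ⟨ρ, _, h1.seq h2, h3⟩

theorem ex_assign_seq {σ : State α} {x : ℕ} {e : Expr} {q : Program} {Q : State α → ℕ → Prop}
    (he : e.eval σ ≤ B) (h : Ex B q (σ.setReg x (e.eval σ)) (fun ρ t => Q ρ (1 + t))) :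
    Ex B (.assign x e ;; q) σ Q :=
  ex_seq (ex_assign he h)

theorem ex_wr_seq {σ : State α} {i : ℕ} {k v e : Expr} {q : Program} {Q : State α → ℕ → Prop}
    (he : e.eval σ ≤ B)
    (h : Ex B q (σ.setArr i (k.eval σ) (v.eval σ) (e.eval σ)) (fun ρ t => Q ρ (1 + t))) :
    Ex B (wr i k v e ;; q) σ Q :=
  ex_seq (ex_wr he h)

theorem ex_ite {σ : State α} {c : Test} {p q : Program} {Q : State α → ℕ → Prop}
    (h1 : c.Holds σ → Ex B p σ (fun τ s => Q τ (1 + s)))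
    (h2 : ¬ c.Holds σ → Ex B q σ (fun τ s => Q τ (1 + s))) : Ex B (.ite c p q) σ Q := by
  by_cases hc : c.Holds σ
  · obtain ⟨τ, s, h, hq⟩ := h1 hc
    exact ⟨τ, _, .ite_true hc h, hq⟩
  · obtain ⟨τ, s, h, hq⟩ := h2 hc
    exact ⟨τ, _, .ite_false hc h, hq⟩

/-- The index of the invariant is a variant: it decreases in every round and therefore bounds the
number of rounds. -/
theorem ex_while {c : Test} {p : Program} {k : ℕ} (I : ℕ → State α → Prop)
    (hstep : ∀ m σ, I m σ → c.Holds σ →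
      Ex B p σ (fun τ s => s ≤ k ∧ ∃ m' < m, I m' τ)) :
    ∀ {m σ}, I m σ → Ex B (.loop c p) σ (fun τ s => s ≤ (k + 1) * m + 1 ∧ ¬ c.Holds τ ∧
      ∃ m', I m' τ) := by
  intro m
  induction m using Nat.strong_induction_on with
  | _ m ih =>
    intro σ hI
    by_cases hc : c.Holds σ
    · obtain ⟨τ, s, h1, hs, m', hm, hI'⟩ := hstep m σ hI hc
      obtain ⟨ρ, t, h2, ht, hd⟩ := ih m' hm hI'
      refine ⟨ρ, _, .loop_step hc h1 h2, ?_, hd⟩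
      have : (k + 1) * (m' + 1) ≤ (k + 1) * m := Nat.mul_le_mul_left _ hm
      rw [Nat.mul_add] at this
      omega
    · exact ⟨σ, 1, .loop_done hc, by omega, hc, m, hI⟩

/-- Binary search from the highest bit to the lowest one: register `35` runs through the
bits, and `R i` describes a state that stands for the number `i`. -/
theorem ex_descend {p : Program} {k K : ℕ} {C : ℕ → Prop} (R : ℕ → State α → Prop)
    (hR : ∀ i σ x, R i σ → R i (σ.setReg 35 x))
    (hbody : ∀ i j σ, R i σ → C i → σ.reg 35 = j → j < K →
      Ex B p σ (fun τ s => s ≤ k ∧ τ.reg 35 = j ∧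
        ((C (i + 2 ^ j) ∧ R (i + 2 ^ j) τ) ∨ (¬ C (i + 2 ^ j) ∧ R i τ)))) :
    ∀ {j i σ}, R i σ → C i → ¬ C (i + 2 ^ j) → σ.reg 35 = j → j ≤ K → j ≤ B →
      Ex B (.loop (.le (.const 1) (.reg 35))
          (.assign 35 (.sub (.reg 35) (.const 1)) ;; p)) σ
        (fun τ s => s ≤ (k + 2) * j + 1 ∧ ∃ i, C i ∧ ¬ C (i + 1) ∧ R i τ) := by
  intro j
  induction j with
  | zero =>
    intro i σ h1 h2 h3 h4 _ _
    exact ⟨σ, 1, .loop_done (by simp [h4]), by omega, i, h2, h3, h1⟩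
  | succ j ih =>
    intro i σ h1 h2 h3 h4 h5 h6
    obtain ⟨τ, s, e1, hs, h7, h8⟩ := hbody i j (σ.setReg 35 j) (hR _ _ _ h1) h2 (by simp) h5
    have e0 : Steps B (.assign 35 (.sub (.reg 35) (.const 1))) σ (σ.setReg 35 j) 1 := by
      have := Steps.assign (B := B) σ 35 (.sub (.reg 35) (.const 1)) (by simp [h4]; omega)
      simpa [State.setReg, h4] using this
    -- `C` need not be monotone: the search keeps `C i` and `¬ C (i + 2 ^ j)` and ends with these
    -- statements for `j = 0`.
    have : ∃ i', R i' τ ∧ C i' ∧ ¬ C (i' + 2 ^ j) := by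
      rcases h8 with ⟨h8, h9⟩ | ⟨h8, h9⟩
      · refine ⟨_, h9, h8, ?_⟩
        rw [pow_succ] at h3
        rwa [show i + 2 ^ j + 2 ^ j = i + 2 ^ j * 2 by ring]
      · exact ⟨_, h9, h2, h8⟩
    obtain ⟨i', g1, g2, g3⟩ := this
    obtain ⟨ρ, t, e2, ht, hq⟩ := ih g1 g2 g3 h7 (by omega) (by omega)
    refine ⟨ρ, _, .loop_step (by simp [h4]) (e0.seq e1) e2, ?_, hq⟩
    rw [Nat.mul_add]; omega

end Rules

end DIS

namespace DIS

/-! ### The greedy algorithm on a static sequence of jobs -/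

/-- A sequence of jobs `sid 0, …, sid (N - 1)` with starts `s` and finishes `f`, and the
function `nx` that finds the next job for one machine. -/
structure Static (κ : Type*) where
  s : ℕ → κ
  f : ℕ → κ
  sid : ℕ → ℕ
  nx : ℕ → ℕ
  N : ℕ

namespace Static

variable {κ : Type*} (D : Static κ)

/-- The jobs at the positions `c, …, L - 1`. -/
def seg (c L : ℕ) : List ℕ := (List.range' c (L - c)).map D.sid

variable {D}

theorem seg_self {c L : ℕ} (h : L ≤ c) : D.seg c L = [] := by
  simp [seg, Nat.sub_eq_zero_of_le h]

theorem seg_cons {c L : ℕ} (h : c < L) : D.seg c L = D.sid c :: D.seg (c + 1) L := by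
  unfold seg
  rw [show L - c = (L - (c + 1)) + 1 by omega, List.range'_succ, List.map_cons]

theorem seg_append {c d L : ℕ} (h1 : c ≤ d) (h2 : d ≤ L) :
    D.seg c L = D.seg c d ++ D.seg d L := by
  induction h1 using Nat.decreasingInduction with
  | self => simp [seg_self le_rfl]
  | of_succ k hk ih =>
    rw [seg_cons (show k < L by omega), seg_cons (show k < d by omega), ih, List.cons_append]

theorem mem_seg {c L h : ℕ} : h ∈ D.seg c L ↔ ∃ j, c ≤ j ∧ j < L ∧ D.sid j = h := by
  simp only [seg, List.mem_map, List.mem_range'_1]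
  exact ⟨fun ⟨j, hj, e⟩ => ⟨j, by omega, by omega, e⟩,
    fun ⟨j, h1, h2, e⟩ => ⟨j, by omega, e⟩⟩

theorem length_seg {c L : ℕ} : (D.seg c L).length = L - c := by simp [seg]

variable [LinearOrder κ] (D)

/-- The greedy algorithm for the jobs at the positions `c, …, L - 1`. -/
def run (c L : ℕ) (st : ℕ × ℕ × ℕ) : ℕ × ℕ × ℕ := (D.seg c L).foldl (gstep D.s D.f) st

/-- The job at position `j` starts after the end of the job with handle `b`. -/
def Fits (b j : ℕ) : Prop := D.f b ≤ D.s (D.sid j)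

/-- The jobs are sorted by finish. -/
def Sorted : Prop := ∀ i j, i ≤ j → j < D.N → D.f (D.sid i) ≤ D.f (D.sid j)

/-- `nx v` is the first position of a job that starts after the end of the job at position `v`;
it is `N` if there is none. -/
structure IsNext : Prop where
  lt : ∀ v, v < D.N → v < D.nx v
  le : ∀ v, v < D.N → D.nx v ≤ D.N
  eq_top : ∀ v, D.N ≤ v → v ≤ D.N + 1 → D.nx v = D.N + 1
  not_fits : ∀ v j, v < D.N → v < j → j < D.nx v → ¬ D.Fits (D.sid v) j
  fits : ∀ v, v < D.N → D.nx v < D.N → D.Fits (D.sid v) (D.nx v)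


variable {D}

theorem run_self {c L : ℕ} (h : L ≤ c) (st : ℕ × ℕ × ℕ) : D.run c L st = st := by
  simp [run, seg_self h]

theorem run_cons {c L : ℕ} (h : c < L) (st : ℕ × ℕ × ℕ) :
    D.run c L st = D.run (c + 1) L (gstep D.s D.f st (D.sid c)) := by
  simp [run, seg_cons h]

theorem run_append {c d L : ℕ} (h1 : c ≤ d) (h2 : d ≤ L) (st : ℕ × ℕ × ℕ) :
    D.run c L st = D.run d L (D.run c d st) := by
  simp [run, seg_append h1 h2]

theorem run_le (c L : ℕ) (st : ℕ × ℕ × ℕ) : (D.run c L st).2.2 ≤ st.2.2 + (L - c) := by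
  have := foldl_gstep_le D.s D.f (D.seg c L) st
  rwa [length_seg] at this

/-- The jobs that do not fit on any machine are skipped. -/
theorem run_skip {c d L : ℕ} {a b n : ℕ} (h1 : c ≤ d) (h2 : d ≤ L)
    (h : ∀ j, c ≤ j → j < d → ¬ D.Fits a j ∧ ¬ D.Fits b j) :
    D.run c L (a, b, n) = D.run d L (a, b, n) := by
  induction h1 using Nat.decreasingInduction with
  | self => rfl
  | of_succ k hk ih =>
    have hf := h k le_rfl hk
    rw [run_cons (show k < L by omega), ← ih (fun j hj => h j (by omega))]
    congr 1
    exact (if_neg hf.2).trans (if_neg hf.1)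

theorem run_last {L : ℕ} {a b n : ℕ} (h : D.Fits b L) :
    D.run L (L + 1) (a, b, n) = (a, D.sid L, n + 1) := by
  rw [run_cons (Nat.lt_succ_self L), run_self le_rfl]
  exact if_pos h

theorem run_last' {L : ℕ} {a b n : ℕ} (h : ¬ D.Fits b L) (h' : D.Fits a L) :
    D.run L (L + 1) (a, b, n) = (b, D.sid L, n + 1) := by
  rw [run_cons (Nat.lt_succ_self L), run_self le_rfl]
  exact (if_neg h).trans (if_pos h')

namespace IsNext

variable (hD : D.IsNext) (hs : D.Sorted)

include hD

theorem le_top {v : ℕ} (h : v ≤ D.N + 1) : D.nx v ≤ D.N + 1 := by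
  by_cases hv : v < D.N
  · have := hD.le v hv; omega
  · exact (hD.eq_top v (by omega) h).le

theorem lt_nx {v : ℕ} (h : v ≤ D.N) : v < D.nx v := by
  by_cases hv : v < D.N
  · exact hD.lt v hv
  · rw [hD.eq_top v (by omega) (by omega)]; omega

theorem lt_of_nx_lt {v : ℕ} (h : D.nx v < D.N) (hv : v ≤ D.N + 1) : v < D.N := by
  by_contra h1
  have := hD.eq_top v (by omega) hv
  omega

include hs

/-- If the successor of `w` came before that of `v`, the job there would start after the finish of
`w`, hence after that of `v`, and would fit after `v` too early. -/
theorem mono {v w : ℕ} (h : v ≤ w) (hw : w ≤ D.N + 1) : D.nx v ≤ D.nx w := by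
  by_cases hwN : w < D.N
  · by_contra hlt
    have h1 := hD.le v (by omega)
    have h2 := hD.lt w hwN
    exact hD.not_fits v (D.nx w) (by omega) (by omega) (by omega)
      ((hs v w h hwN).trans (hD.fits w hwN (by omega)))
  · rw [hD.eq_top w (by omega) hw]; exact hD.le_top (by omega)

theorem not_fits_of_le {v w j : ℕ} (h : v ≤ w) (hw : w < D.N) (h1 : v < j) (h2 : j < D.nx v) :
    ¬ D.Fits (D.sid w) j := fun hf =>
  hD.not_fits v j (by omega) h1 h2 ((hs v w h hw).trans hf)

end IsNext

/-! ### Configurations of the greedy algorithm, their transitions, and the jumps between nodes. -/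

/-- Configurations of the accelerated algorithm, with the number of jobs scheduled so far:
* `A β v n`: the last jobs of the machines are `β` and the job at position `v`;
* `P g w n`: the last jobs of the machines are those at the positions `g < w < nx g`;
* `Nd u n`: the last jobs of the machines are those at the positions `u` and `nx u`. -/
inductive Cfg where
  | A (β v n : ℕ)
  | P (g w n : ℕ)
  | Nd (u n : ℕ)

namespace Cfg

/-- Adds `k` to the number of scheduled jobs. -/
def shift (k : ℕ) : Cfg → Cfg
  | A β v n => A β v (n + k)
  | P g w n => P g w (n + k)
  | Nd u n => Nd u (n + k)

end Cfg

/-- The position of the last job that was considered. -/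
def pos (D : Static κ) : Cfg → ℕ
  | .A _ v _ => v
  | .P _ w _ => w
  | .Nd u _ => D.nx u

/-- The state of the greedy algorithm that belongs to a configuration. -/
def toState (D : Static κ) : Cfg → ℕ × ℕ × ℕ
  | .A β v n => (β, D.sid v, n)
  | .P g w n => (D.sid g, D.sid w, n)
  | .Nd u n => (D.sid u, D.sid (D.nx u), n)

/-- For `P g w`, the inequality `w < nx g` says that the job at `w` came too early for the machine
of `g`. It makes the chains interlace: `g < w < nx g ≤ nx w`. -/
def Valid (D : Static κ) : Cfg → Prop
  | .A _ v _ => v < D.N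
  | .P g w _ => g < w ∧ w < D.nx g ∧ w < D.N
  | .Nd u _ => u < D.N ∧ D.nx u < D.N

open Classical in
/-- The transitions between configurations. -/
noncomputable def cstep (D : Static κ) : Cfg → Option Cfg
  | .A β v n =>
    if D.nx v < D.N then
      if h : ∃ g, v < g ∧ g < D.nx v ∧ D.Fits β g then
        if D.Fits (D.sid (Nat.find h)) (D.nx v) then some (.Nd v (n + 2))
        else some (.P (Nat.find h) (D.nx v) (n + 2))
      else some (.A β (D.nx v) (n + 1))
    else none
  | .P g w n =>
    if D.nx w < D.N then
      if D.nx g = D.nx w then some (.Nd g (n + 1))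
      else if D.nx w = D.nx (D.nx g) then some (.Nd w (n + 2))
      else some (.P (D.nx g) (D.nx w) (n + 2))
    else none
  | .Nd _ _ => none

def Reach (D : Static κ) : Cfg → Cfg → Prop := Relation.ReflTransGen fun x y => D.cstep x = some y

theorem cstep_shift (k : ℕ) (x : Cfg) : D.cstep (x.shift k) = (D.cstep x).map (Cfg.shift k) := by
  cases x with
  | A β v n => simp only [cstep, Cfg.shift]; split_ifs <;> simp [Cfg.shift] <;> omega
  | P g w n => simp only [cstep, Cfg.shift]; split_ifs <;> simp [Cfg.shift] <;> omega
  | Nd u n => rfl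

theorem Reach.shift {x y : Cfg} (h : D.Reach x y) (k : ℕ) : D.Reach (x.shift k) (y.shift k) := by
  induction h with
  | refl => exact .refl
  | tail _ h ih => exact ih.tail (by rw [cstep_shift, h]; rfl)

theorem Reach.eq_of_none {x y z : Cfg} (h : D.Reach x y) (h' : D.Reach x z)
    (hy : D.cstep y = none) (hz : D.cstep z = none) : y = z := by
  have stuck : ∀ {y z : Cfg}, D.cstep y = none → D.Reach y z → y = z := by
    intro y z hy hr
    rcases Relation.ReflTransGen.cases_head hr with h | ⟨w, hw, -⟩
    · exact h
    · rw [hy] at hw; cases hw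
  have hu : Relator.RightUnique fun x y => D.cstep x = some y := fun x y z hy hz =>
    Option.some.inj (hy.symm.trans hz)
  rcases Relation.ReflTransGen.total_of_right_unique hu h h' with h | h
  · exact stuck hy h
  · exact (stuck hz h).symm

-- Every position passed over holds a job that fits on neither machine, by the minimality of `nx`
-- and by `not_fits_of_le`; at the remaining positions the greedy rule decides. From `A β v`, the
-- first job `g` that fits after `β` before `nx v` is taken by the machine of `β`. The job at `nx v`
-- then either fits after `g` too and replaces `g`, which gives the node `v`, or it replaces `v`,
-- which gives a configuration `P`. From `P g w`, if `nx g = nx w`, this job fits on both machines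
-- and replaces `w`, which gives the node `g`. Otherwise the job at `nx g` replaces `g`, and the
-- same comparison is made between `w` and `nx g`.
open Classical in
theorem cstep_spec (hD : D.IsNext) (hs : D.Sorted) {x y : Cfg} (hx : D.Valid x)
    (h : D.cstep x = some y) : D.Valid y ∧ D.pos x < D.pos y ∧ D.pos y < D.N ∧
      D.run (D.pos x + 1) (D.pos y + 1) (D.toState x) = D.toState y := by
  cases x with
  | A β v n =>
    have hv : v < D.N := hx
    have hlt := hD.lt v hv
    simp only [cstep] at h
    split_ifs at h with h1 h2 h3
    · obtain ⟨g1, g2, g3⟩ := Nat.find_spec h2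
      have hmin : ∀ j, v < j → j < Nat.find h2 → ¬ D.Fits β j := fun j hj hj' hf =>
        Nat.find_min h2 hj' ⟨hj, by omega, hf⟩
      generalize Nat.find h2 = g at *
      cases h
      refine ⟨⟨hv, h1⟩, hlt, h1, ?_⟩
      simp only [pos, toState]
      have hw := hD.fits v hv h1
      rw [run_skip (d := g) (by omega) (by omega)
          (fun j hj hj' => ⟨hmin j (by omega) hj', hD.not_fits v j hv (by omega) (by omega)⟩),
        run_append (d := g + 1) (by omega) (by omega),
        run_last' (hD.not_fits v g hv g1 g2) g3,
        run_skip (d := D.nx v) (by omega) (by omega)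
          (fun j hj hj' => ⟨hD.not_fits v j hv (by omega) (by omega),
            hD.not_fits_of_le hs g1.le (by omega) (by omega) hj'⟩),
        run_last h3]
    · obtain ⟨g1, g2, g3⟩ := Nat.find_spec h2
      have hmin : ∀ j, v < j → j < Nat.find h2 → ¬ D.Fits β j := fun j hj hj' hf =>
        Nat.find_min h2 hj' ⟨hj, by omega, hf⟩
      generalize Nat.find h2 = g at *
      cases h
      have hm := hD.mono hs g1.le (by omega)
      -- If the two successors coincided, the job there would fit after `g`, against the present
      -- case. With monotonicity this gives `nx v < nx g`, the validity of `P`.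
      have hne : D.nx v ≠ D.nx g := fun e => h3 (by rw [e]; exact hD.fits g (by omega) (by omega))
      refine ⟨⟨g2, by omega, h1⟩, hlt, h1, ?_⟩
      simp only [pos, toState]
      have hw := hD.fits v hv h1
      rw [run_skip (d := g) (by omega) (by omega)
          (fun j hj hj' => ⟨hmin j (by omega) hj', hD.not_fits v j hv (by omega) (by omega)⟩),
        run_append (d := g + 1) (by omega) (by omega),
        run_last' (hD.not_fits v g hv g1 g2) g3,
        run_skip (d := D.nx v) (by omega) (by omega)
          (fun j hj hj' => ⟨hD.not_fits v j hv (by omega) (by omega),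
            hD.not_fits_of_le hs g1.le (by omega) (by omega) hj'⟩),
        run_last' h3 hw]
    · cases h
      refine ⟨h1, hlt, h1, ?_⟩
      simp only [pos, toState]
      rw [run_skip (d := D.nx v) (by omega) (by omega)
          (fun j hj hj' => ⟨fun hf => h2 ⟨j, by omega, hj', hf⟩,
            hD.not_fits v j hv (by omega) (by omega)⟩),
        run_last (hD.fits v hv h1)]
  | P g w n =>
    obtain ⟨hgw, hwg, hw⟩ := hx
    have hm := hD.mono hs hgw.le (by omega)
    have hg : g < D.N := by omega
    simp only [cstep] at h
    split_ifs at h with h1 h2 h3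
    · cases h
      refine ⟨⟨hg, by omega⟩, hwg, by simp only [pos]; omega, ?_⟩
      simp only [pos, toState]
      rw [run_skip (d := D.nx g) (by omega) (by omega)
          (fun j hj hj' => ⟨hD.not_fits g j hg (by omega) (by omega),
            hD.not_fits w j hw (by omega) (by omega)⟩),
        run_last (by rw [h2]; exact hD.fits w hw (by omega))]
    · have hgN : D.nx g < D.N := by omega
      have h4 := hD.lt _ hgN
      cases h
      refine ⟨⟨hw, h1⟩, hD.lt w hw, h1, ?_⟩
      simp only [pos, toState]
      rw [run_skip (d := D.nx g) (by omega) (by omega)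
          (fun j hj hj' => ⟨hD.not_fits g j hg (by omega) (by omega),
            hD.not_fits w j hw (by omega) (by omega)⟩),
        run_append (d := D.nx g + 1) (by omega) (by omega),
        run_last' (hD.not_fits w _ hw (by omega) (by omega)) (hD.fits g hg hgN),
        run_skip (d := D.nx w) (by omega) (by omega)
          (fun j hj hj' => ⟨hD.not_fits w j hw (by omega) (by omega),
            hD.not_fits _ j hgN (by omega) (by omega)⟩),
        run_last (by
          have := hD.fits _ hgN (by omega)
          rwa [← h3] at this)]
    · have hgN : D.nx g < D.N := by omega
      have h4 := hD.lt _ hgN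
      have h5 := hD.mono hs hwg.le (by omega)
      cases h
      refine ⟨⟨by omega, by omega, h1⟩, hD.lt w hw, h1, ?_⟩
      simp only [pos, toState]
      rw [run_skip (d := D.nx g) (by omega) (by omega)
          (fun j hj hj' => ⟨hD.not_fits g j hg (by omega) (by omega),
            hD.not_fits w j hw (by omega) (by omega)⟩),
        run_append (d := D.nx g + 1) (by omega) (by omega),
        run_last' (hD.not_fits w _ hw (by omega) (by omega)) (hD.fits g hg hgN),
        run_skip (d := D.nx w) (by omega) (by omega)
          (fun j hj hj' => ⟨hD.not_fits w j hw (by omega) (by omega),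
            hD.not_fits _ j hgN (by omega) (by omega)⟩),
        run_last' (hD.not_fits _ _ hgN (by omega) (by omega)) (hD.fits w hw h1)]
  | Nd u n => cases h

theorem Reach.spec (hD : D.IsNext) (hs : D.Sorted) {x y : Cfg} (hx : D.Valid x)
    (h : D.Reach x y) : D.Valid y ∧ D.pos x ≤ D.pos y ∧
      D.run (D.pos x + 1) (D.pos y + 1) (D.toState x) = D.toState y := by
  induction h with
  | refl => exact ⟨hx, le_rfl, run_self le_rfl _⟩
  | tail _ h ih =>
    obtain ⟨h1, h2, h3⟩ := ih
    obtain ⟨g1, g2, g3, g4⟩ := cstep_spec hD hs h1 h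
    exact ⟨g1, by omega, by rw [run_append (Nat.succ_le_succ h2) (Nat.succ_le_succ g2.le), h3, g4]⟩

/-- The job `β` fits somewhere strictly between the position `v` and its successor. -/
def Between (D : Static κ) (v : ℕ) (x : κ) : Prop :=
  ∃ g, v < g ∧ g < D.nx v ∧ g < D.N ∧ x ≤ D.s (D.sid g)

/-- If `β` fits nowhere strictly between consecutive elements of the chain, each transition is one
application of `nx`, so this phase is plain iteration and can be searched by binary lifting. -/
theorem reach_chain (hD : D.IsNext) {β n : ℕ} (i : ℕ) :
    ∀ {v}, v < D.N → (∀ i' < i, ¬ D.Between (D.nx^[i'] v) (D.f β)) → D.nx^[i] v < D.N →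
      D.Reach (.A β v n) (.A β (D.nx^[i] v) (n + i)) := by
  induction i with
  | zero => intros; exact .refl
  | succ i ih =>
    intro v hv hb hlt
    have htop : ∀ i, D.nx^[i] v ≤ D.N + 1 := by
      intro i
      induction i with
      | zero => show v ≤ _; omega
      | succ i ih => rw [Function.iterate_succ_apply']; exact hD.le_top ih
    rw [Function.iterate_succ_apply'] at hlt ⊢
    have h1 := hD.lt_of_nx_lt hlt (htop i)
    refine (ih hv (fun i' h => hb i' (by omega)) h1).tail ?_
    have hn : ¬ ∃ g, D.nx^[i] v < g ∧ g < D.nx (D.nx^[i] v) ∧ D.Fits β g :=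
      fun ⟨g, g1, g2, g3⟩ => hb i (by omega) ⟨g, g1, g2, by omega, g3⟩
    simp only [cstep]
    rw [if_pos hlt, dif_neg hn, add_assoc]

/-- Orbits of `nx` that have met stay together, so being distinct after `i` steps implies being
distinct after fewer steps. Therefore testing the end of a stretch is enough. -/
theorem reach_par (hD : D.IsNext) {n : ℕ} (i : ℕ) :
    ∀ {g w}, w ≤ D.N + 1 → D.nx^[i] g ≠ D.nx^[i] w → D.nx^[i] w ≠ D.nx^[i] (D.nx g) →
      D.nx^[i] w < D.N → D.Reach (.P g w n) (.P (D.nx^[i] g) (D.nx^[i] w) (n + 2 * i)) := by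
  induction i with
  | zero => intros; exact .refl
  | succ i ih =>
    intro g w hw h1 h2 h3
    have htop : ∀ i, D.nx^[i] w ≤ D.N + 1 := by
      intro i
      induction i with
      | zero => exact hw
      | succ i ih => rw [Function.iterate_succ_apply']; exact hD.le_top ih
    rw [Function.iterate_succ_apply', Function.iterate_succ_apply'] at h1 h2
    rw [Function.iterate_succ_apply'] at h3
    rw [Function.iterate_succ_apply', Function.iterate_succ_apply']
    have h4 := hD.lt_of_nx_lt h3 (htop i)
    refine (ih hw (fun e => h1 (by rw [e])) (fun e => h2 (by rw [e])) h4).tail ?_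
    have e : D.nx^[i] (D.nx g) = D.nx (D.nx^[i] g) := by
      rw [← Function.iterate_succ_apply, Function.iterate_succ_apply']
    rw [e] at h2
    simp only [cstep]
    rw [if_pos h3, if_neg h1, if_neg h2]
    rfl

/-- `J` leads from a node configuration to the next one, with `ct` newly scheduled jobs. -/
structure IsJump (D : Static κ) (J ct : ℕ → ℕ) : Prop where
  le : ∀ u, u < D.N → J u ≤ D.N
  eq_top : ∀ v, D.N ≤ v → v ≤ D.N + 1 → J v = D.N + 1
  ct_eq : ∀ u, u ≤ D.N + 1 → (D.N ≤ J u) → ct u = 0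
  nx_lt : ∀ u, u < D.N → J u < D.N → D.nx (J u) < D.N ∧ D.nx u < D.N
  reach : ∀ u, u < D.N → J u < D.N →
    D.Reach (.A (D.sid u) (D.nx u) 0) (.Nd (J u) (ct u))
  not_reach : ∀ u, u < D.N → D.nx u < D.N → J u = D.N →
    ∀ u' n, ¬ D.Reach (.A (D.sid u) (D.nx u) 0) (.Nd u' n)

theorem IsJump.jump_unique {J ct : ℕ → ℕ} (hJ : D.IsJump J ct) {u u' n : ℕ} (hu : u < D.N)
    (hu' : D.nx u < D.N)
    (h : D.Reach (.A (D.sid u) (D.nx u) 0) (.Nd u' n)) : J u = u' := by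
  rcases Nat.lt_or_ge (J u) D.N with h1 | h1
  · have := (hJ.reach u hu h1).eq_of_none h rfl rfl
    injection this
  · exact absurd h (hJ.not_reach u hu hu' (le_antisymm (hJ.le u hu) h1) _ _)

/-- Transitions increase the position, here from `nx u` to `nx (J u)`. As `nx` is monotone, `J u ≤
u` is impossible. -/
theorem IsJump.lt {J ct : ℕ → ℕ} (hJ : D.IsJump J ct) (hD : D.IsNext) (hs : D.Sorted) {u : ℕ}
    (hu : u ≤ D.N) : u < J u := by
  rcases Nat.lt_or_ge (J u) D.N with h1 | h1
  · have hu' : u < D.N := by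
      by_contra h
      have := hJ.eq_top u (by omega) (by omega)
      omega
    obtain ⟨h2, h3⟩ := hJ.nx_lt u hu' h1
    have hR := hJ.reach u hu' h1
    have hne : (Cfg.A (D.sid u) (D.nx u) 0) ≠ .Nd (J u) (ct u) := by intro h; cases h
    rcases Relation.ReflTransGen.cases_head hR with h | ⟨y, hy, hr⟩
    · exact absurd h hne
    · obtain ⟨v1, p1, -, -⟩ := cstep_spec hD hs (x := .A (D.sid u) (D.nx u) 0) h3 hy
      obtain ⟨-, p2, -⟩ := Reach.spec hD hs v1 hr
      simp only [pos] at p1 p2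
      by_contra hle
      have := hD.mono hs (show J u ≤ u by omega) (by omega)
      omega
  · by_cases hu' : u < D.N
    · omega
    · have := hJ.eq_top u (by omega) (by omega); omega

theorem IsJump.run_eq {J ct : ℕ → ℕ} (hJ : D.IsJump J ct) (hD : D.IsNext) (hs : D.Sorted)
    {u n : ℕ} (hu : u < D.N) (h : J u < D.N) :
    D.nx u < D.nx (J u) ∧
    D.run (D.nx u + 1) (D.nx (J u) + 1) (D.sid u, D.sid (D.nx u), n) =
      (D.sid (J u), D.sid (D.nx (J u)), n + ct u) := by
  have hR := (hJ.reach u hu h).shift n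
  have := hR.spec hD hs (show D.Valid (.A _ _ _) from (hJ.nx_lt u hu h).2)
  simp only [Cfg.shift, pos, toState] at this
  rw [Nat.zero_add, Nat.add_comm (ct u)] at this
  refine ⟨?_, this.2.2⟩
  have h1 := hJ.lt hD hs hu.le
  rcases Relation.ReflTransGen.cases_head (hJ.reach u hu h) with h | ⟨y, hy, hr⟩
  · cases h
  · obtain ⟨v1, p1, -, -⟩ := cstep_spec hD hs (x := .A (D.sid u) (D.nx u) 0)
      (hJ.nx_lt u hu h).2 hy
    obtain ⟨-, p2, -⟩ := Reach.spec hD hs v1 hr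
    simp only [pos] at p1 p2
    omega

/-- Each position contributes at most one scheduled job, so the length of a jump is bounded by the
advance of the last considered position, which is `nx u` at the node `u`. -/
theorem IsJump.ct_le {J ct : ℕ → ℕ} (hJ : D.IsJump J ct) (hD : D.IsNext) (hs : D.Sorted)
    {u : ℕ} (hu : u ≤ D.N + 1) : ct u + D.nx u ≤ D.nx (J u) := by
  rcases Nat.lt_or_ge (J u) D.N with h1 | h1
  · have hu' : u < D.N := by
      by_contra h
      have := hJ.eq_top u (by omega) (by omega)
      omega
    obtain ⟨h2, h3⟩ := hJ.run_eq hD hs (n := 0) hu' h1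
    have := D.run_le (D.nx u + 1) (D.nx (J u) + 1) (D.sid u, D.sid (D.nx u), 0)
    rw [h3] at this
    simp only at this
    omega
  · rw [hJ.ct_eq u hu h1]
    have h2 : J u ≤ D.N + 1 := by
      by_cases hu' : u < D.N
      · have := hJ.le u hu'; omega
      · exact (hJ.eq_top u (by omega) hu).le
    rw [hD.eq_top _ h1 h2, Nat.zero_add]
    exact hD.le_top hu

end Static

end DIS

namespace DIS

/-! ### Binary lifting -/

/-- A function on the nodes `0, …, N + 1` that increases up to the sink `N + 1`, with lengths
`ct` of the edges that are dominated by the increase of a potential `X`. -/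
structure IsGraph (N : ℕ) (f ct X : ℕ → ℕ) : Prop where
  lt : ∀ v, v ≤ N → v < f v
  top : f (N + 1) = N + 1
  le : ∀ v, v ≤ N + 1 → f v ≤ N + 1
  X_top : X (N + 1) = N + 1
  X_le : ∀ v, v ≤ N + 1 → X v ≤ N + 1
  ct_le : ∀ v, v ≤ N + 1 → ct v + X v ≤ X (f v)

namespace IsGraph

variable {N : ℕ} {f ct X : ℕ → ℕ} (h : IsGraph N f ct X)

include h

theorem iterate_le {v : ℕ} (hv : v ≤ N + 1) (i : ℕ) : f^[i] v ≤ N + 1 := by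
  induction i with
  | zero => exact hv
  | succ i ih => rw [Function.iterate_succ_apply']; exact h.le _ ih

theorem le_iterate {v : ℕ} (hv : v ≤ N + 1) (i : ℕ) : min (v + i) (N + 1) ≤ f^[i] v := by
  induction i with
  | zero => simp
  | succ i ih =>
    rw [Function.iterate_succ_apply']
    have h1 := h.iterate_le hv i
    by_cases h2 : f^[i] v ≤ N
    · have := h.lt _ h2; omega
    · have h3 : f^[i] v = N + 1 := by omega
      rw [h3, h.top]; omega

theorem iterate_eq_top {v : ℕ} (hv : v ≤ N + 1) {i : ℕ} (hi : N + 1 ≤ i) : f^[i] v = N + 1 := by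
  have h1 := h.iterate_le hv i
  have h2 := h.le_iterate hv i
  omega

theorem sum_add_le {v : ℕ} (hv : v ≤ N + 1) (i : ℕ) :
    ∑ i' ∈ Finset.range i, ct (f^[i'] v) + X v ≤ X (f^[i] v) := by
  induction i with
  | zero => simp
  | succ i ih =>
    rw [Finset.sum_range_succ, Function.iterate_succ_apply']
    have := h.ct_le _ (h.iterate_le hv i)
    omega

end IsGraph

theorem exists_lt_add {P : ℕ → Prop} {i m : ℕ} :
    (∃ j < i + m, P j) ↔ (∃ j < i, P j) ∨ ∃ j < m, P (i + j) := by
  constructor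
  · rintro ⟨j, hj, h⟩
    by_cases hji : j < i
    · exact Or.inl ⟨j, hji, h⟩
    · exact Or.inr ⟨j - i, by omega, by rwa [Nat.add_sub_cancel' (by omega)]⟩
  · rintro (⟨j, hj, h⟩ | ⟨j, hj, h⟩)
    · exact ⟨j, by omega, h⟩
    · exact ⟨i + j, by omega, h⟩

theorem sum_iterate_add (f ct : ℕ → ℕ) (v i m : ℕ) :
    ∑ j ∈ Finset.range (i + m), ct (f^[j] v) =
      ∑ j ∈ Finset.range i, ct (f^[j] v) + ∑ j ∈ Finset.range m, ct (f^[j] (f^[i] v)) := by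
  rw [Finset.sum_range_add]
  congr 1
  refine Finset.sum_congr rfl fun j _ => ?_
  rw [Nat.add_comm i j, Function.iterate_add_apply]

section

variable {α : Type u}

/-- The registers below `n`, the memory and the keys agree. -/
def Frame (n : ℕ) (σ τ : State α) : Prop :=
  τ.mem = σ.mem ∧ τ.key = σ.key ∧ ∀ x < n, τ.reg x = σ.reg x

theorem Frame.refl (n : ℕ) (σ : State α) : Frame n σ σ := ⟨rfl, rfl, fun _ _ => rfl⟩

theorem Frame.trans {n m : ℕ} {σ τ ρ : State α} (h : Frame n σ τ) (h' : Frame m τ ρ)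
    (hn : n ≤ m) : Frame n σ ρ :=
  ⟨h'.1.trans h.1, h'.2.1.trans h.2.1, fun x hx => (h'.2.2 x (by omega)).trans (h.2.2 x hx)⟩

theorem Frame.setReg {n : ℕ} {σ τ : State α} (h : Frame n σ τ) {x v : ℕ} (hx : n ≤ x) :
    Frame n σ (τ.setReg x v) :=
  ⟨h.1, h.2.1, fun y hy => by rw [reg_setReg, if_neg (by omega)]; exact h.2.2 y hy⟩

theorem Frame.arr {n : ℕ} {σ τ : State α} (h : Frame n σ τ) : τ.arr = σ.arr := arr_congr h.1
theorem Frame.sk {n : ℕ} {σ τ : State α} (h : Frame n σ τ) : τ.sk = σ.sk := sk_congr h.2.1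
theorem Frame.fk {n : ℕ} {σ τ : State α} (h : Frame n σ τ) : τ.fk = σ.fk := fk_congr h.2.1

variable [LinearOrder α]

/-- `h` is the handle of a job that starts after `x`. -/
def State.Hit (σ : State α) (h : ℕ) (x : WithBot α) : Prop := 1 ≤ h ∧ x ≤ σ.sk h

/-- Handle `0` means that there is no job. Its start is `⊥`, and so is the finish of an empty
machine, so comparing keys alone would report a hit; this is why `State.Hit` asks for `1 ≤ h`. -/
theorem hit_zero (σ : State α) (x : WithBot α) : ¬ σ.Hit 0 x := fun h => by simpa using h.1

/-- The arrays `3 G`, `3 G + 1`, `3 G + 2` contain, for `k < K`, the results of `2 ^ k` steps of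
the function `f`: the end, a label, and the sum of the lengths `ct`. -/
structure Table (σ : State α) (G N K H : ℕ) (f ct : ℕ → ℕ) (Lb : ℕ → WithBot α → Prop) : Prop where
  up : ∀ k v, k < K → v ≤ N + 1 → σ.arr (3 * G) k v = f^[2 ^ k] v
  hit : ∀ k v x, k < K → v ≤ N + 1 →
    (σ.Hit (σ.arr (3 * G + 1) k v) x ↔ ∃ i < 2 ^ k, Lb (f^[i] v) x)
  ct : ∀ k v, k < K → v ≤ N + 1 →
    σ.arr (3 * G + 2) k v = ∑ i ∈ Finset.range (2 ^ k), ct (f^[i] v)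
  lab_le : ∀ k v, k < K → v ≤ N + 1 → σ.arr (3 * G + 1) k v ≤ H

/-- The handle of the job, among `h` and `h'`, that starts later. -/
theorem hit_max (σ : State α) (h0 : σ.sk 0 = ⊥) {h h' : ℕ} (hr : 1 ≤ h → ⊥ < σ.sk h) (x : WithBot α) :
    σ.Hit (if σ.sk h ≤ σ.sk h' then h' else h) x ↔ σ.Hit h x ∨ σ.Hit h' x := by
  split_ifs with hle
  · refine ⟨Or.inr, ?_⟩
    rintro (⟨h1, h2⟩ | h1)
    · refine ⟨?_, h2.trans hle⟩
      by_contra h3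
      have : h' = 0 := by omega
      subst this
      rw [h0] at hle
      exact absurd (hr h1) (not_lt.2 hle)
    · exact h1
  · refine ⟨Or.inl, ?_⟩
    rintro (h1 | ⟨h1, h2⟩)
    · exact h1
    · refine ⟨?_, h2.trans (not_le.1 hle).le⟩
      by_contra h3
      have : h = 0 := by omega
      subst this
      rw [h0] at hle
      exact hle bot_le

/-- Moves the node in register `30` along the graph `G`, up to the first node whose label is a
job that starts after the end of the job in register `31`, or the last node of potential at most
register `33`. Register `32` is increased by the length of the path, and register `34` gets
the label of the path. -/
def search (G : ℕ) (X : Expr → Expr) : Program :=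
  .assign 34 (.const 0) ;; .assign 35 (.reg 6) ;;
  .loop (.le (.const 1) (.reg 35)) (
    .assign 35 (.sub (.reg 35) (.const 1)) ;;
    .ite (.and (.le (X (rd (3 * G) (.reg 35) (.reg 30))) (.reg 33))
        (.not (.and (.le (.const 1) (rd (3 * G + 1) (.reg 35) (.reg 30)))
          (fits (.reg 31) (rd (3 * G + 1) (.reg 35) (.reg 30))))))
      (.assign 32 (.add (.reg 32) (rd (3 * G + 2) (.reg 35) (.reg 30))) ;;
        .ite (.keyLE (skA (.reg 34)) (skA (rd (3 * G + 1) (.reg 35) (.reg 30))))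
          (.assign 34 (rd (3 * G + 1) (.reg 35) (.reg 30))) .skip ;;
        .assign 30 (rd (3 * G) (.reg 35) (.reg 30)))
      .skip)

theorem ex_search {B G N H : ℕ} {f ct X : ℕ → ℕ} {Lb : ℕ → WithBot α → Prop} {σ : State α}
    (hb : Bounded B σ) (hT : Table σ G N (σ.reg 6) H f ct Lb) (hG : IsGraph N f ct X)
    {Xe : Expr → Expr}
    (hX : ∀ (τ : State α) e, τ.mem = σ.mem → e.eval τ ≤ N + 1 → (Xe e).eval τ = X (e.eval τ))
    (h0 : σ.sk 0 = ⊥) (hH : ∀ h, 1 ≤ h → h ≤ H → ⊥ < σ.sk h)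
    (hv : σ.reg 30 ≤ N + 1) (hL : X (σ.reg 30) ≤ σ.reg 33) (hLN : σ.reg 33 ≤ N)
    (hc : σ.reg 32 + (N + 1) ≤ B) (hK : N + 1 ≤ 2 ^ σ.reg 6) :
    Ex B (search G Xe) σ (fun τ s => s ≤ 12 * σ.reg 6 + 4 ∧ Frame 30 σ τ ∧
      τ.reg 31 = σ.reg 31 ∧ τ.reg 33 = σ.reg 33 ∧ ∃ i, τ.reg 30 = f^[i] (σ.reg 30) ∧
      (∀ i' < i, ¬ Lb (f^[i'] (σ.reg 30)) (σ.fk (σ.reg 31))) ∧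
      X (f^[i] (σ.reg 30)) ≤ σ.reg 33 ∧
      (Lb (f^[i] (σ.reg 30)) (σ.fk (σ.reg 31)) ∨ σ.reg 33 < X (f^[i + 1] (σ.reg 30))) ∧
      τ.reg 32 = σ.reg 32 + ∑ i' ∈ Finset.range i, ct (f^[i'] (σ.reg 30)) ∧
      (∀ x, σ.Hit (τ.reg 34) x ↔ ∃ i' < i, Lb (f^[i'] (σ.reg 30)) x) ∧ τ.reg 34 ≤ H) := by
  set v := σ.reg 30 with hvdef
  set K := σ.reg 6 with hKdef
  have hKB : K ≤ B := hb.1 6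
  -- Only labels of nodes before the `i`-th one count, so that the search stops at the first node
  -- whose own label is hit.
  let C : ℕ → Prop := fun i =>
    (¬ ∃ i' < i, Lb (f^[i'] v) (σ.fk (σ.reg 31))) ∧ X (f^[i] v) ≤ σ.reg 33
  let R : ℕ → State α → Prop := fun i τ => Frame 30 σ τ ∧ τ.reg 31 = σ.reg 31 ∧
    τ.reg 33 = σ.reg 33 ∧ τ.reg 30 = f^[i] v ∧
    τ.reg 32 = σ.reg 32 + ∑ i' ∈ Finset.range i, ct (f^[i'] v) ∧
    (∀ x, σ.Hit (τ.reg 34) x ↔ ∃ i' < i, Lb (f^[i'] v) x) ∧ τ.reg 34 ≤ H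
  have hbody : ∀ i j τ, R i τ → C i → τ.reg 35 = j → j < K → Ex B
      (.ite (.and (.le (Xe (rd (3 * G) (.reg 35) (.reg 30))) (.reg 33))
        (.not (.and (.le (.const 1) (rd (3 * G + 1) (.reg 35) (.reg 30)))
          (fits (.reg 31) (rd (3 * G + 1) (.reg 35) (.reg 30))))))
      (.assign 32 (.add (.reg 32) (rd (3 * G + 2) (.reg 35) (.reg 30))) ;;
        .ite (.keyLE (skA (.reg 34)) (skA (rd (3 * G + 1) (.reg 35) (.reg 30))))
          (.assign 34 (rd (3 * G + 1) (.reg 35) (.reg 30))) .skip ;;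
        .assign 30 (rd (3 * G) (.reg 35) (.reg 30)))
      .skip) τ (fun τ s => s ≤ 10 ∧ τ.reg 35 = j ∧
        ((C (i + 2 ^ j) ∧ R (i + 2 ^ j) τ) ∨ (¬ C (i + 2 ^ j) ∧ R i τ))) := by
    rintro i j τ ⟨hF, h31, h33, h30, h32, h34, h34'⟩ hCi h35 hj
    have hw := hG.iterate_le hv i
    have hup : τ.arr (3 * G) j (f^[i] v) = f^[i + 2 ^ j] v := by
      rw [hF.arr, hT.up j _ hj hw, Nat.add_comm i, Function.iterate_add_apply]
    have hhit : ∀ x, σ.Hit (τ.arr (3 * G + 1) j (f^[i] v)) x ↔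
        ∃ i' < 2 ^ j, Lb (f^[i + i'] v) x := by
      intro x
      rw [hF.arr, hT.hit j _ x hj hw]
      simp only [Nat.add_comm i, Function.iterate_add_apply]
    have hct : τ.arr (3 * G + 2) j (f^[i] v) =
        ∑ i' ∈ Finset.range (2 ^ j), ct (f^[i'] (f^[i] v)) := by
      rw [hF.arr, hT.ct j _ hj hw]
    have hlab : τ.arr (3 * G + 1) j (f^[i] v) ≤ H := by rw [hF.arr]; exact hT.lab_le j _ hj hw
    -- Given `C i`, only the next `2 ^ j` nodes have to be examined, and their common label decides
    -- this with one comparison of keys.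
    have hiff : (Test.and (.le (Xe (rd (3 * G) (.reg 35) (.reg 30))) (.reg 33))
        (.not (.and (.le (.const 1) (rd (3 * G + 1) (.reg 35) (.reg 30)))
          (fits (.reg 31) (rd (3 * G + 1) (.reg 35) (.reg 30)))))).Holds τ ↔ C (i + 2 ^ j) := by
      have e1 := hX τ (rd (3 * G) (.reg 35) (.reg 30)) hF.1
      simp only [eval_rd, eval_reg, h35, h30, hup] at e1
      have e2 := hhit (σ.fk (σ.reg 31))
      simp only [holds_and, holds_le, holds_not, holds_fits, eval_rd, eval_reg, eval_const, h35, h30,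
        h33, e1 (hG.iterate_le hv _), h31, hF.fk, hF.sk]
      rw [and_comm]
      refine and_congr (not_congr ?_) Iff.rfl
      rw [exists_lt_add, ← e2]
      exact ⟨Or.inr, fun h => h.resolve_left hCi.1⟩
    have hsum := hG.sum_add_le hv (i + 2 ^ j)
    have hXle := hG.X_le _ (hG.iterate_le hv (i + 2 ^ j))
    rw [sum_iterate_add] at hsum
    refine ex_ite (fun h => ?_) (fun h => ?_)
    · have hC' := hiff.1 h
      refine ex_assign_seq ?_ ?_
      · simp only [eval_add, eval_reg, eval_rd, h35, h30, hct, h32]; omega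
      refine ex_seq ?_
      simp only [eval_add, eval_reg, eval_rd, h35, h30, hct, h32]
      refine Ex.imp (Q := fun ρ s => s ≤ 2 ∧ Frame 30 σ ρ ∧ ρ.reg 31 = σ.reg 31 ∧
        ρ.reg 33 = σ.reg 33 ∧ ρ.reg 30 = f^[i] v ∧ ρ.reg 35 = j ∧
        ρ.reg 32 = σ.reg 32 + ∑ i' ∈ Finset.range (i + 2 ^ j), ct (f^[i'] v) ∧
        ρ.reg 34 = if σ.sk (τ.reg 34) ≤ σ.sk (τ.arr (3 * G + 1) j (f^[i] v)) then
          τ.arr (3 * G + 1) j (f^[i] v) else τ.reg 34) ?_ ?_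
      · refine ex_ite (fun h1 => ?_) (fun h1 => ?_)
        · simp only [holds_sk_le, sk_setReg, eval_reg, eval_rd, reg_setReg, arr_setReg, h30, h35,
            hF.sk, Nat.reduceEqDiff, if_false] at h1
          refine ex_assign ?_ ?_
          · simp only [eval_reg, eval_rd, reg_setReg, arr_setReg]; rw [hF.arr]; exact hb.arr _ _ _
          · rw [if_pos h1]
            refine ⟨by omega, (hF.setReg (by omega)).setReg (by omega), ?_⟩
            simp [h31, h33, h30, h35, sum_iterate_add, add_assoc]
        · simp only [holds_sk_le, sk_setReg, eval_reg, eval_rd, reg_setReg, arr_setReg, h30, h35,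
            hF.sk, Nat.reduceEqDiff, if_false] at h1
          refine ex_skip ?_
          rw [if_neg h1]
          refine ⟨by omega, hF.setReg (by omega), ?_⟩
          simp [h31, h33, h30, h35, sum_iterate_add, add_assoc]
      · rintro ρ s ⟨hs, hF', g31, g33, g30, g35, g32, g34⟩
        refine ex_assign ?_ ?_
        · simp only [eval_reg, eval_rd]; rw [hF'.arr]; exact hb.arr _ _ _
        · refine ⟨by omega, by simp [g35], Or.inl ⟨hC', hF'.setReg (by omega), by simp [g31],
            by simp [g33], ?_, by simp [g32], ?_⟩⟩
          · simp only [reg_setReg, if_true, eval_rd, eval_reg, g35, g30]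
            rw [hF'.arr, ← hF.arr, hup]
          · simp only [reg_setReg, g34, Nat.reduceEqDiff, if_false]
            refine ⟨fun x => ?_, ?_⟩
            · rw [hit_max σ h0 (fun h1 => hH _ h1 h34'), h34, hhit, exists_lt_add]
            · split_ifs <;> assumption
    · refine ex_skip ⟨by omega, h35, Or.inr ⟨fun h1 => h (hiff.2 h1), hF, h31, h33, h30, h32,
        h34, h34'⟩⟩
  have hR : ∀ i τ x, R i τ → R i (τ.setReg 35 x) := by
    rintro i τ x ⟨hF, h31, h33, h30, h32, h34, h34'⟩
    exact ⟨hF.setReg (by omega), by simpa, by simpa, by simpa, by simpa, by simpa, by simpa⟩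
  refine ex_assign_seq (by simp) (ex_assign_seq (by simp; exact hKB) ?_)
  refine Ex.imp (ex_descend (K := K) (C := C) R hR hbody (j := K) (i := 0) ?_ ?_ ?_ ?_ le_rfl hKB) ?_
  · refine ⟨((Frame.refl 30 σ).setReg (by omega)).setReg (by omega), ?_⟩
    simp [hit_zero, ← hvdef]
  · exact ⟨by simp, hL⟩
  -- After `2 ^ K ≥ N + 1` steps the walk is at the sink, whose potential `N + 1` exceeds every
  -- admissible limit.
  · rintro ⟨-, h⟩
    rw [Nat.zero_add, hG.iterate_eq_top hv hK, hG.X_top] at h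
    omega
  · simp [hKdef]
  · rintro τ s ⟨hs, i, hCi, hCi', hF, h31, h33, h30, h32, h34, h34'⟩
    refine ⟨by omega, hF, h31, h33, i, h30, fun i' h h' => hCi.1 ⟨i', h, h'⟩, hCi.2, ?_, h32, h34,
      h34'⟩
    by_contra hcon
    rw [not_or, not_lt] at hcon
    refine hCi' ⟨?_, hcon.2⟩
    rw [exists_lt_add]
    rintro (h | ⟨i', h, h'⟩)
    · exact hCi.1 h
    · have : i' = 0 := by omega
      subst this
      exact hcon.1 h'

end

end DIS

/-! ### Searches in the first two graphs, and the meeting of two chains. -/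

namespace DIS

namespace Static

variable {κ : Type*} [LinearOrder κ] {D : Static κ}

theorem Reach.eq_of_nd {u n : ℕ} {y : Cfg} (h : D.Reach (.Nd u n) y) : y = .Nd u n := by
  rcases Relation.ReflTransGen.cases_head h with h | ⟨z, hz, -⟩
  · exact h.symm
  · cases hz

/-- Transitions are deterministic and nodes are terminal, so every configuration reached on the way
to a node still leads to it. -/
theorem Reach.reach_nd {x y : Cfg} {u n : ℕ} (h : D.Reach x y) (h' : D.Reach x (.Nd u n)) :
    D.Reach y (.Nd u n) := by
  have hu : Relator.RightUnique fun x y => D.cstep x = some y := fun x y z hy hz =>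
    Option.some.inj (hy.symm.trans hz)
  rcases Relation.ReflTransGen.total_of_right_unique hu h h' with h | h
  · exact h
  · rw [Reach.eq_of_nd h]; exact .refl

end Static

section

variable {α : Type u}

/-- The static sequence of jobs that is stored in a state. -/
def State.stat (σ : State α) : Static (WithBot α) := ⟨σ.sk, σ.fk, σ.arr 9 0, σ.arr 3 0, σ.reg 4⟩

theorem Frame.stat {n : ℕ} {σ τ : State α} (h : Frame n σ τ) (hn : 4 < n) : τ.stat = σ.stat := by
  simp only [State.stat, h.arr, h.sk, h.fk, h.2.2 4 hn]

variable [LinearOrder α]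

/-- The successor function on the nodes `0, …, N + 1`. -/
def succTo (N v : ℕ) : ℕ := min (v + 1) (N + 1)

/-- The lengths of the edges, all equal to one except at the sink. -/
def unitTo (N v : ℕ) : ℕ := if v ≤ N then 1 else 0

theorem isGraph_succTo (N : ℕ) : IsGraph N (succTo N) (unitTo N) id where
  lt v hv := by unfold succTo; omega
  top := by simp [succTo]
  le v _ := min_le_right _ _
  X_top := rfl
  X_le v hv := hv
  ct_le v hv := by unfold succTo unitTo; split_ifs <;> simp only [id] <;> omega

theorem isGraph_nx {D : Static (WithBot α)} (hD : D.IsNext) :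
    IsGraph D.N D.nx (unitTo D.N) id where
  lt v hv := hD.lt_nx hv
  top := hD.eq_top _ (by omega) le_rfl
  le v hv := hD.le_top hv
  X_top := rfl
  X_le v hv := hv
  ct_le v hv := by
    unfold unitTo; split_ifs with h
    · have := hD.lt_nx h; simp only [id]; omega
    · rw [hD.eq_top v (by omega) hv]; simp only [id]; omega

/-- The potential is `nx` instead of the identity because the last position considered at the node
`u` is `nx u`, and limits refer to that position. -/
theorem isGraph_jump {D : Static (WithBot α)} (hD : D.IsNext) (hs : D.Sorted) {J ct : ℕ → ℕ}
    (hJ : D.IsJump J ct) : IsGraph D.N J ct D.nx where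
  lt v hv := hJ.lt hD hs hv
  top := hJ.eq_top _ (by omega) le_rfl
  le v hv := by
    by_cases h : v < D.N
    · have := hJ.le v h; omega
    · exact (hJ.eq_top v (by omega) hv).le
  X_top := hD.eq_top _ (by omega) le_rfl
  X_le v hv := hD.le_top hv
  ct_le v hv := hJ.ct_le hD hs hv

theorem sum_unitTo {N i : ℕ} {p : ℕ → ℕ} (h : ∀ j < i, p j ≤ N) :
    ∑ j ∈ Finset.range i, unitTo N (p j) = i := by
  rw [Finset.sum_congr rfl (g := fun _ => 1)]
  · simp
  · intro j hj; exact if_pos (h j (Finset.mem_range.1 hj))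

/-- The static sequence is sorted, and the lifting tables of its first two graphs are correct. -/
structure Chains (σ : State α) (H : ℕ) : Prop where
  pow : σ.reg 4 + 2 ≤ 2 ^ σ.reg 6
  sk_zero : σ.sk 0 = ⊥
  bot_lt : ∀ h, 1 ≤ h → h ≤ H → ⊥ < σ.sk h
  sid_pos : ∀ v, v < σ.reg 4 → 1 ≤ σ.arr 9 0 v
  sid_le : ∀ v, v < σ.reg 4 → σ.arr 9 0 v ≤ H
  sorted : σ.stat.Sorted
  next : σ.stat.IsNext
  succ : Table σ 0 (σ.reg 4) (σ.reg 6) H (succTo (σ.reg 4)) (unitTo (σ.reg 4))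
    (fun v x => v < σ.reg 4 ∧ x ≤ σ.sk (σ.arr 9 0 v))
  chain : Table σ 1 (σ.reg 4) (σ.reg 6) H σ.stat.nx (unitTo (σ.reg 4)) σ.stat.Between

theorem Chains.of_frame {σ τ : State α} {H n : ℕ} (h : Chains σ H) (hF : Frame n σ τ)
    (hn : 6 < n) : Chains τ H := by
  obtain ⟨h1, h2, h3, h4, h5, h6, h7, h8, h9⟩ := h
  have e4 := hF.2.2 4 (by omega)
  have e6 := hF.2.2 6 (by omega)
  constructor <;> (try rw [hF.stat (by omega)]) <;> (try rw [e4]) <;> (try rw [e6]) <;>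
    (try rw [hF.sk]) <;> (try rw [hF.arr]) <;> (try assumption)
  · obtain ⟨a1, a2, a3, a4⟩ := h8
    constructor <;> (try rw [hF.arr]) <;> (try unfold State.Hit) <;> (try rw [hF.sk]) <;> assumption
  · obtain ⟨a1, a2, a3, a4⟩ := h9
    constructor <;> (try rw [hF.arr]) <;> (try unfold State.Hit) <;> (try rw [hF.sk]) <;> assumption

theorem iterate_succTo {N v i : ℕ} (h : v + i ≤ N + 1) : (succTo N)^[i] v = v + i := by
  induction i with
  | zero => rfl
  | succ i ih =>
    rw [Function.iterate_succ_apply', ih (by omega)]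
    unfold succTo; omega

/-- Searching for the first job, from position `reg 30` on, that starts after the end of the job
in register `31`. -/
theorem ex_search_succ {B H : ℕ} {σ : State α} (hb : Bounded B σ)
    (pow : σ.reg 4 + 2 ≤ 2 ^ σ.reg 6) (sk_zero : σ.sk 0 = ⊥)
    (bot_lt : ∀ h, 1 ≤ h → h ≤ H → ⊥ < σ.sk h)
    (succ : Table σ 0 (σ.reg 4) (σ.reg 6) H (succTo (σ.reg 4)) (unitTo (σ.reg 4))
      (fun v x => v < σ.reg 4 ∧ x ≤ σ.sk (σ.arr 9 0 v)))
    (hv : σ.reg 30 ≤ σ.reg 33) (hL : σ.reg 33 ≤ σ.reg 4) (hc : σ.reg 32 + (σ.reg 4 + 1) ≤ B) :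
    Ex B (search 0 id) σ (fun τ s => s ≤ 12 * σ.reg 6 + 4 ∧ Frame 30 σ τ ∧
      σ.reg 30 ≤ τ.reg 30 ∧ τ.reg 30 ≤ σ.reg 33 ∧
      (∀ j, σ.reg 30 ≤ j → j < τ.reg 30 → ¬ σ.stat.Fits (σ.reg 31) j) ∧
      (τ.reg 30 < σ.reg 33 → σ.stat.Fits (σ.reg 31) (τ.reg 30)) ∧
      (∀ x, σ.Hit (τ.reg 34) x ↔ ∃ j, σ.reg 30 ≤ j ∧ j < τ.reg 30 ∧ x ≤ σ.sk (σ.arr 9 0 j)) ∧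
      τ.reg 34 ≤ H) := by
  refine (ex_search hb succ (isGraph_succTo _) (Xe := id) (fun _ _ _ _ => rfl) sk_zero
    bot_lt (by omega) hv hL hc (by omega)).imp ?_
  rintro τ s ⟨hs, hF, -, -, i, h30, hn, hX, hor, -, hhit, hle⟩
  have hi : σ.reg 30 + i ≤ σ.reg 4 := by
    have := (isGraph_succTo (σ.reg 4)).le_iterate (v := σ.reg 30) (by omega) i
    simp only [id] at hX
    omega
  rw [iterate_succTo (by omega)] at h30 hX
  simp only [id] at hX
  have e : ∀ i' < i, (succTo (σ.reg 4))^[i'] (σ.reg 30) = σ.reg 30 + i' :=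
    fun i' h => iterate_succTo (by omega)
  refine ⟨hs, hF, by omega, by omega, ?_, ?_, fun x => ?_, hle⟩
  · intro j hj hj' hf
    refine hn (j - σ.reg 30) (by omega) ?_
    rw [e _ (by omega), Nat.add_sub_cancel' hj]
    exact ⟨by omega, hf⟩
  · intro h
    rcases hor with h1 | h1
    · rw [h30, ← iterate_succTo (N := σ.reg 4) (by omega)]; exact h1.2
    · rw [iterate_succTo (by omega)] at h1; simp only [id] at h1; omega
  · rw [hhit]
    constructor
    · rintro ⟨i', h1, h2⟩
      rw [e _ h1] at h2
      exact ⟨_, by omega, by omega, h2.2⟩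
    · rintro ⟨j, h1, h2, h3⟩
      refine ⟨j - σ.reg 30, by omega, ?_⟩
      rw [e _ (by omega), Nat.add_sub_cancel' h1]
      exact ⟨by omega, h3⟩

/-- Searching for the first job of the chain after which an additional job is scheduled. -/
theorem ex_search_chain {B H : ℕ} {σ : State α} (hb : Bounded B σ) (hC : Chains σ H)
    (hv : σ.reg 30 ≤ σ.reg 33) (hL : σ.reg 33 < σ.reg 4) (hc : σ.reg 32 + (σ.reg 4 + 1) ≤ B) :
    Ex B (search 1 id) σ (fun τ s => s ≤ 12 * σ.reg 6 + 4 ∧ Frame 30 σ τ ∧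
      τ.reg 31 = σ.reg 31 ∧ τ.reg 30 ≤ σ.reg 33 ∧ σ.reg 30 ≤ τ.reg 30 ∧
      σ.stat.Reach (.A (σ.reg 31) (σ.reg 30) (σ.reg 32)) (.A (σ.reg 31) (τ.reg 30) (τ.reg 32)) ∧
      τ.reg 32 ≤ σ.reg 32 + σ.reg 4 ∧
      (σ.stat.Between (τ.reg 30) (σ.fk (σ.reg 31)) ∨ σ.reg 33 < σ.stat.nx (τ.reg 30))) := by
  have hG : IsGraph (σ.reg 4) σ.stat.nx (unitTo (σ.reg 4)) id := isGraph_nx hC.next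
  refine (ex_search hb hC.chain hG (Xe := id) (fun _ _ _ _ => rfl)
    hC.sk_zero hC.bot_lt (by omega) hv hL.le hc (by have := hC.pow; omega)).imp ?_
  rintro τ s ⟨hs, hF, h31, -, i, h30, hn, hX, hor, h32, -⟩
  simp only [id] at hX
  have hmin := hG.le_iterate (v := σ.reg 30) (by omega) i
  rw [sum_unitTo (fun j hj => ?_)] at h32
  · refine ⟨hs, hF, h31, by omega, by omega, ?_, by omega, ?_⟩
    · rw [h30, h32]
      exact Static.reach_chain hC.next i (show σ.reg 30 < σ.reg 4 by omega) hn
        (show _ < σ.reg 4 by omega)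
    · rw [h30]
      rw [Function.iterate_succ_apply'] at hor
      exact hor
  · have h1 := hG.sum_add_le (hG.iterate_le (v := σ.reg 30) (by omega) j) (i - j)
    rw [← Function.iterate_add_apply, Nat.sub_add_cancel hj.le] at h1
    simp only [id] at h1
    omega

/-- The result of following the configurations from `x` up to the position `L`. -/
def Outcome (D : Static (WithBot α)) (L : ℕ) (x : Static.Cfg) (τ : State α) : Prop :=
  (τ.reg 24 = 1 ∧ D.Reach x (.Nd (τ.reg 25) (τ.reg 22)) ∧ D.nx (τ.reg 25) < L) ∨
  (τ.reg 24 = 0 ∧ (∀ u n, D.Reach x (.Nd u n) → L ≤ D.nx u) ∧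
    D.run (D.pos x + 1) L (D.toState x) = (τ.reg 25, τ.reg 26, τ.reg 22))

theorem Outcome.of_reach {D : Static (WithBot α)} {L : ℕ} {x y : Static.Cfg} {τ : State α}
    (hD : D.IsNext) (hs : D.Sorted) (hx : D.Valid x) (h : D.Reach x y) (hy : D.pos y < L)
    (ho : Outcome D L y τ) : Outcome D L x τ := by
  rcases ho with ⟨h1, h2, h3⟩ | ⟨h1, h2, h3⟩
  · exact Or.inl ⟨h1, h.trans h2, h3⟩
  · refine Or.inr ⟨h1, fun u n hr => h2 u n (h.reach_nd hr), ?_⟩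
    obtain ⟨-, g1, g2⟩ := h.spec hD hs hx
    rw [Static.run_append (Nat.succ_le_succ g1) hy, g2, h3]

/-- Positions only increase along transitions; if the very next configuration is already at or
beyond `L`, so is every node reached later. -/
theorem le_of_cstep {D : Static (WithBot α)} {L : ℕ} {x : Static.Cfg} (hD : D.IsNext)
    (hs : D.Sorted) (hx : D.Valid x) (hn : ∀ u n, x ≠ .Nd u n)
    (h : ∀ y, D.cstep x = some y → L ≤ D.pos y) (u n : ℕ) (hr : D.Reach x (.Nd u n)) :
    L ≤ D.nx u := by
  rcases Relation.ReflTransGen.cases_head hr with h1 | ⟨y, hy, hr'⟩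
  · exact absurd h1 (hn u n)
  · have h1 := h y hy
    obtain ⟨v1, -⟩ := Static.cstep_spec hD hs hx hy
    exact h1.trans (Static.Reach.spec hD hs v1 hr').2.1

/-- Follows a configuration `P` up to the point where its two chains meet. -/
def merge : Program :=
  .assign 35 (.reg 6) ;;
  .loop (.le (.const 1) (.reg 35)) (
    .assign 35 (.sub (.reg 35) (.const 1)) ;;
    .ite (.and (lt (rd 3 (.reg 35) (.reg 28)) (.reg 23))
        (.and (.not (eq (rd 3 (.reg 35) (.reg 27)) (rd 3 (.reg 35) (.reg 28))))
          (.not (eq (rd 3 (.reg 35) (.reg 28)) (rd 3 (.reg 35) (.reg 29))))))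
      (.assign 22 (.add (.reg 22) (.mul (.const 2) (rd 5 (.reg 35) (.reg 28)))) ;;
        .assign 27 (rd 3 (.reg 35) (.reg 27)) ;;
        .assign 28 (rd 3 (.reg 35) (.reg 28)) ;;
        .assign 29 (rd 3 (.reg 35) (.reg 29)))
      .skip)

/-- Three pointers move along `nx` simultaneously, from `g`, from `w` and from `nx g`. The search
ends with a number of steps for which the second pointer is below the limit and different from the
other two, while one more step violates this. So next comes the limit or one of the two coincidences
by which a configuration `P` turns into a node. -/
theorem ex_merge {B H : ℕ} {σ : State α} (hb : Bounded B σ) (hC : Chains σ H)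
    (hL : σ.reg 23 ≤ σ.reg 4) (hgw : σ.reg 27 < σ.reg 28) (hw : σ.reg 28 < σ.stat.nx (σ.reg 27))
    (hwL : σ.reg 28 < σ.reg 23) (h29 : σ.reg 29 = σ.stat.nx (σ.reg 27))
    (hc : σ.reg 22 + 2 * (σ.reg 4 + 1) ≤ B) :
    Ex B merge σ (fun τ s => s ≤ 8 * σ.reg 6 + 4 ∧ Frame 20 σ τ ∧ τ.reg 23 = σ.reg 23 ∧
      τ.reg 24 = σ.reg 24 ∧
      σ.stat.Reach (.P (σ.reg 27) (σ.reg 28) (σ.reg 22)) (.P (τ.reg 27) (τ.reg 28) (τ.reg 22)) ∧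
      τ.reg 28 < σ.reg 23 ∧ τ.reg 29 = σ.stat.nx (τ.reg 27) ∧
      τ.reg 22 ≤ σ.reg 22 + 2 * (σ.reg 4) ∧
      (σ.stat.nx (τ.reg 28) < σ.reg 23 → σ.stat.nx (τ.reg 27) ≠ σ.stat.nx (τ.reg 28) →
        σ.stat.nx (τ.reg 28) = σ.stat.nx (σ.stat.nx (τ.reg 27)))) := by
  set D := σ.stat with hDdef
  have hN : D.N = σ.reg 4 := rfl
  set g := σ.reg 27
  set w := σ.reg 28
  set K := σ.reg 6 with hKdef
  have hKB : K ≤ B := hb.1 6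
  have hG : IsGraph (σ.reg 4) D.nx (unitTo (σ.reg 4)) id := isGraph_nx hC.next
  have hwN : w ≤ σ.reg 4 + 1 := by omega
  let C : ℕ → Prop := fun i => D.nx^[i] w < σ.reg 23 ∧ D.nx^[i] g ≠ D.nx^[i] w ∧
    D.nx^[i] w ≠ D.nx^[i] (D.nx g)
  let R : ℕ → State α → Prop := fun i τ => Frame 20 σ τ ∧ τ.reg 23 = σ.reg 23 ∧
    τ.reg 24 = σ.reg 24 ∧ τ.reg 27 = D.nx^[i] g ∧ τ.reg 28 = D.nx^[i] w ∧
    τ.reg 29 = D.nx^[i] (D.nx g) ∧ τ.reg 22 = σ.reg 22 + 2 * i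
  have hgN : g ≤ σ.reg 4 + 1 := by omega
  have hg'N : D.nx g ≤ σ.reg 4 + 1 := hG.le _ hgN
  have hle : ∀ i, D.nx^[i] w < σ.reg 23 → w + i ≤ D.nx^[i] w := by
    intro i hi
    have := hG.le_iterate hwN i
    omega
  have hbody : ∀ i j τ, R i τ → C i → τ.reg 35 = j → j < K → Ex B
      (.ite (.and (lt (rd 3 (.reg 35) (.reg 28)) (.reg 23))
        (.and (.not (eq (rd 3 (.reg 35) (.reg 27)) (rd 3 (.reg 35) (.reg 28))))
          (.not (eq (rd 3 (.reg 35) (.reg 28)) (rd 3 (.reg 35) (.reg 29))))))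
      (.assign 22 (.add (.reg 22) (.mul (.const 2) (rd 5 (.reg 35) (.reg 28)))) ;;
        .assign 27 (rd 3 (.reg 35) (.reg 27)) ;;
        .assign 28 (rd 3 (.reg 35) (.reg 28)) ;;
        .assign 29 (rd 3 (.reg 35) (.reg 29)))
      .skip) τ (fun τ s => s ≤ 6 ∧ τ.reg 35 = j ∧
        ((C (i + 2 ^ j) ∧ R (i + 2 ^ j) τ) ∨ (¬ C (i + 2 ^ j) ∧ R i τ))) := by
    rintro i j τ ⟨hF, h23, h24, h27, h28, h29', h22⟩ hCi h35 hj
    have hup : ∀ v, v ≤ σ.reg 4 + 1 → τ.arr 3 j (D.nx^[i] v) = D.nx^[i + 2 ^ j] v := by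
      intro v hv
      rw [hF.arr, hC.chain.up j _ hj (hG.iterate_le hv i), Nat.add_comm i,
        Function.iterate_add_apply]
    -- A walk that ends below the limit avoids the sink, so the tabulated sum of unit lengths is the
    -- number of steps; each step schedules two jobs.
    have hct : D.nx^[i + 2 ^ j] w < σ.reg 23 → τ.arr 5 j (D.nx^[i] w) = 2 ^ j := by
      intro h
      rw [hF.arr, hC.chain.ct j _ hj (hG.iterate_le hwN i), sum_unitTo]
      intro k hk
      have h1 := hG.sum_add_le (hG.iterate_le (hG.iterate_le hwN i) k) (2 ^ j - k)
      rw [← Function.iterate_add_apply D.nx k i w, ← Function.iterate_add_apply D.nx _ (k + i) w,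
        show 2 ^ j - k + (k + i) = i + 2 ^ j by omega, Function.iterate_add_apply] at h1
      simp only [id] at h1
      exact (show D.nx^[k] (D.nx^[i] w) ≤ σ.reg 4 by omega)
    have hiff : (Test.and (lt (rd 3 (.reg 35) (.reg 28)) (.reg 23))
        (.and (.not (eq (rd 3 (.reg 35) (.reg 27)) (rd 3 (.reg 35) (.reg 28))))
          (.not (eq (rd 3 (.reg 35) (.reg 28)) (rd 3 (.reg 35) (.reg 29)))))).Holds τ ↔
        C (i + 2 ^ j) := by
      simp only [holds_and, holds_lt, holds_not, holds_eq, eval_rd, eval_reg, h35, h27, h28, h29',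
        h23, hup w hwN, hup g hgN, hup _ hg'N, C, ne_eq]
    refine ex_ite (fun h => ?_) (fun h => ?_)
    · have hC' := hiff.1 h
      have h1 := hct hC'.1
      have h2 := hle _ hC'.1
      refine ex_assign_seq ?_ (ex_assign_seq ?_ (ex_assign_seq ?_ (ex_assign ?_ ?_)))
      · simp only [eval_add, eval_mul, eval_const, eval_reg, eval_rd, h35, h28, h1, h22]; omega
      · simp only [eval_rd, arr_setReg, hF.arr]; exact hb.arr _ _ _
      · simp only [eval_rd, arr_setReg, hF.arr]; exact hb.arr _ _ _
      · simp only [eval_rd, arr_setReg, hF.arr]; exact hb.arr _ _ _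
      · refine ⟨by omega, by simp [h35], Or.inl ⟨hC', (((hF.setReg (by omega)).setReg
          (by omega)).setReg (by omega)).setReg (by omega), ?_⟩⟩
        simp [h23, h24, h27, h28, h29', h35, hup w hwN, hup g hgN, hup _ hg'N, h1, h22, add_assoc,
          mul_add]
    · exact ex_skip ⟨by omega, h35, Or.inr ⟨fun h1 => h (hiff.2 h1), hF, h23, h24, h27, h28,
        h29', h22⟩⟩
  have hR : ∀ i τ x, R i τ → R i (τ.setReg 35 x) := by
    rintro i τ x ⟨hF, h23, h24, h27, h28, h29', h22⟩
    exact ⟨hF.setReg (by omega), by simpa, by simpa, by simpa, by simpa, by simpa, by simpa⟩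
  refine ex_assign_seq (by simp; exact hKB) ?_
  refine Ex.imp (ex_descend (K := K) (C := C) R hR hbody (j := K) (i := 0) ?_ ?_ ?_ ?_ le_rfl hKB) ?_
  · refine ⟨(Frame.refl 20 σ).setReg (by omega), ?_⟩
    simp [g, w, h29]
  · exact ⟨hwL, hgw.ne, hw.ne⟩
  · rintro ⟨h, -⟩
    rw [Nat.zero_add, hG.iterate_eq_top hwN (by have := hC.pow; rw [← hKdef] at this; omega)] at h
    omega
  · simp [hKdef]
  · rintro τ s ⟨hs, i, hCi, hCi', hF, h23, h24, h27, h28, h29', h22⟩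
    have h1 := hle _ hCi.1
    have e : D.nx^[i] (D.nx g) = D.nx (D.nx^[i] g) := by
      rw [← Function.iterate_succ_apply, Function.iterate_succ_apply']
    refine ⟨by omega, hF, h23, h24, ?_, by rw [h28]; exact hCi.1, ?_, by omega, ?_⟩
    · rw [h27, h28, h22]
      exact Static.reach_par hC.next i hwN hCi.2.1 hCi.2.2 (lt_of_lt_of_le hCi.1 hL)
    · rw [h29', h27, e]
    · rw [h27, h28]
      intro a1 a2
      by_contra a3
      refine hCi' ⟨?_, ?_, ?_⟩
      · rw [Function.iterate_succ_apply']; exact a1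
      · rw [Function.iterate_succ_apply', Function.iterate_succ_apply']; exact a2
      · rw [Function.iterate_succ_apply', Function.iterate_succ_apply', e]; exact a3

/-- The steps after the two chains of a configuration `P` have met. -/
def finish : Program :=
  .ite (.le (.reg 23) (.reg 29))
    (.assign 25 (rd 9 (.const 0) (.reg 27)) ;; .assign 26 (rd 9 (.const 0) (.reg 28)))
    (.assign 22 (.add (.reg 22) (.const 1)) ;;
      .ite (eq (.reg 29) (rd 3 (.const 0) (.reg 28)))
        (.assign 24 (.const 1) ;; .assign 25 (.reg 27))
        (.ite (.le (.reg 23) (rd 3 (.const 0) (.reg 28)))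
          (.assign 25 (rd 9 (.const 0) (.reg 28)) ;; .assign 26 (rd 9 (.const 0) (.reg 29)))
          (.assign 22 (.add (.reg 22) (.const 1)) ;; .assign 24 (.const 1) ;;
            .assign 25 (.reg 28))))

/-- At most two jobs remain to be placed: the one at `nx g`, and then the one at `nx w`. By `hm`, if
the chains do not meet at `nx g` and `nx w` is below the limit, they meet at `nx w`. So the result
is the node `g`, the node `w`, or a stop at the limit with the state of the greedy algorithm
explicit. -/
theorem ex_finish {B H : ℕ} {σ : State α} (hb : Bounded B σ) (hC : Chains σ H)
    (hL : σ.reg 23 ≤ σ.reg 4) (hV : σ.stat.Valid (.P (σ.reg 27) (σ.reg 28) (σ.reg 22)))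
    (hwL : σ.reg 28 < σ.reg 23) (h29 : σ.reg 29 = σ.stat.nx (σ.reg 27)) (h24 : σ.reg 24 = 0)
    (hc : σ.reg 22 + 2 ≤ B)
    (hm : σ.stat.nx (σ.reg 28) < σ.reg 23 → σ.stat.nx (σ.reg 27) ≠ σ.stat.nx (σ.reg 28) →
        σ.stat.nx (σ.reg 28) = σ.stat.nx (σ.stat.nx (σ.reg 27))) :
    Ex B finish σ (fun τ s => s ≤ 8 ∧ Frame 20 σ τ ∧ τ.reg 23 = σ.reg 23 ∧
      Outcome σ.stat (σ.reg 23) (.P (σ.reg 27) (σ.reg 28) (σ.reg 22)) τ) := by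
  have hD := hC.next
  have hs := hC.sorted
  have enx : ∀ v, σ.arr 3 0 v = σ.stat.nx v := fun _ => rfl
  have esid : ∀ v, σ.arr 9 0 v = σ.stat.sid v := fun _ => rfl
  have hN : σ.stat.N = σ.reg 4 := rfl
  set D := σ.stat
  set g := σ.reg 27 with hgdef
  set w := σ.reg 28 with hwdef
  set L := σ.reg 23 with hLdef
  have hV' := hV
  obtain ⟨hgw, hwg, hw⟩ := hV'
  have hmono := hD.mono hs hgw.le (by omega)
  have hg : g < D.N := by omega
  have hF := Frame.refl 20 σ
  refine ex_ite (fun h1 => ?_) (fun h1 => ?_)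
  · simp only [holds_le, eval_reg, h29] at h1
    refine ex_seq (ex_assign (hb.arr _ _ _) (ex_assign (hb.arr _ _ _) ?_))
    refine ⟨by omega, (hF.setReg (by omega)).setReg (by omega), by simp [hLdef], Or.inr
      ⟨by simp [h24], le_of_cstep hD hs hV (by simp) ?_, ?_⟩⟩
    · intro y hy
      simp only [Static.cstep] at hy
      split_ifs at hy <;> cases hy <;> simp only [Static.pos] <;> omega
    · simp only [Static.pos, Static.toState, reg_setReg, eval_rd, eval_reg, eval_const, arr_setReg,
        esid, ← hgdef, ← hwdef]
      simp only [Nat.reduceEqDiff, if_true, if_false]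
      rw [Static.run_skip (d := L) (by omega) le_rfl
          (fun j hj hj' => ⟨hD.not_fits g j hg (by omega) (by omega),
            hD.not_fits w j hw (by omega) (by omega)⟩), Static.run_self le_rfl]
  · simp only [holds_le, eval_reg, h29, not_le] at h1
    refine ex_assign_seq (by simp; omega) (ex_ite (fun h2 => ?_) (fun h2 => ?_))
    · simp only [holds_eq, eval_reg, eval_rd, reg_setReg, arr_setReg, eval_const, h29, enx,
        Nat.reduceEqDiff, if_false, ← hwdef] at h2
      refine ex_assign_seq (by simp; omega) (ex_assign (by simp; exact hb.1 _) ?_)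
      refine ⟨by omega, ((hF.setReg (by omega)).setReg (by omega)).setReg (by omega),
        by simp [hLdef], Or.inl ⟨by simp, ?_, by simp; omega⟩⟩
      refine .single ?_
      simp only [Static.cstep]
      rw [if_pos (by omega), if_pos h2]
      simp [hgdef]
    · simp only [holds_eq, eval_reg, eval_rd, reg_setReg, arr_setReg, eval_const, h29, enx,
        Nat.reduceEqDiff, if_false, ← hwdef] at h2
      refine ex_ite (fun h3 => ?_) (fun h3 => ?_)
      · simp only [holds_le, eval_reg, eval_rd, reg_setReg, arr_setReg, eval_const, enx,
          Nat.reduceEqDiff, if_false, ← hwdef, ← hLdef] at h3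
        refine ex_seq (ex_assign (hb.arr _ _ _) (ex_assign (hb.arr _ _ _) ?_))
        refine ⟨by omega, ((hF.setReg (by omega)).setReg (by omega)).setReg (by omega),
          by simp [hLdef], Or.inr ⟨by simp [h24], le_of_cstep hD hs hV (by simp) ?_, ?_⟩⟩
        · intro y hy
          simp only [Static.cstep] at hy
          split_ifs at hy
          all_goals first | omega | (cases hy; simp only [Static.pos]; omega)
        · simp only [Static.pos, Static.toState, reg_setReg, eval_rd, eval_reg, eval_const,
            arr_setReg, Nat.reduceEqDiff, if_true, if_false, ← hwdef, esid, h29, eval_add]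
          have hgN : D.nx g < D.N := by omega
          rw [Static.run_skip (d := D.nx g) (by omega) (by omega)
              (fun j hj hj' => ⟨hD.not_fits g j hg (by omega) (by omega),
                hD.not_fits w j hw (by omega) (by omega)⟩),
            Static.run_append (d := D.nx g + 1) (by omega) (by omega),
            Static.run_last' (hD.not_fits w _ hw (by omega) (by omega)) (hD.fits g hg hgN),
            Static.run_skip (d := L) (by omega) (by omega)
              (fun j hj hj' => ⟨hD.not_fits w j hw (by omega) (by omega),
                hD.not_fits_of_le hs hwg.le hgN (by omega) (by omega)⟩), Static.run_self le_rfl]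
      · simp only [holds_le, eval_reg, eval_rd, reg_setReg, arr_setReg, eval_const, enx,
          Nat.reduceEqDiff, if_false, ← hwdef, ← hLdef, not_le] at h3
        refine ex_assign_seq (by simp; omega) (ex_assign_seq (by simp; omega)
          (ex_assign (by simp; exact hb.1 _) ?_))
        refine ⟨by omega, (((hF.setReg (by omega)).setReg (by omega)).setReg (by omega)).setReg
          (by omega), by simp [hLdef], Or.inl ⟨by simp, ?_, by simp; omega⟩⟩
        refine .single ?_
        simp only [Static.cstep]
        rw [if_pos (by omega), if_neg h2, if_pos (hm h3 h2)]
        simp [hwdef, add_assoc]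

end

end DIS

/-! ### Advancing from a configuration `A` to the next node or to a limit. -/

namespace DIS

namespace Static

variable {κ : Type*} [LinearOrder κ] {D : Static κ}

theorem Reach.of_shift {x z : Cfg} {k : ℕ} (h : D.Reach (x.shift k) z) :
    ∃ y, z = y.shift k ∧ D.Reach x y := by
  induction h with
  | refl => exact ⟨x, rfl, .refl⟩
  | tail _ h ih =>
    obtain ⟨y, rfl, hy⟩ := ih
    rw [cstep_shift, Option.map_eq_some_iff] at h
    obtain ⟨w, hw, rfl⟩ := h
    exact ⟨w, rfl, hy.tail hw⟩

theorem IsJump.eq_of_reach {J ct : ℕ → ℕ} (hJ : D.IsJump J ct) {u u' m n : ℕ} (hu : u < D.N)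
    (hu' : D.nx u < D.N)
    (h : D.Reach (.A (D.sid u) (D.nx u) m) (.Nd u' n)) : J u = u' := by
  have e : Cfg.A (D.sid u) (D.nx u) m = (Cfg.A (D.sid u) (D.nx u) 0).shift m := by
    simp [Cfg.shift]
  rw [e] at h
  obtain ⟨y, hy, hr⟩ := h.of_shift
  cases y with
  | Nd u'' n' =>
    simp only [Cfg.shift] at hy
    injection hy with h1 h2
    subst h1
    exact hJ.jump_unique hu hu' hr
  | A => cases hy
  | P => cases hy

open Classical in
theorem cstep_chain_of_fits {β v n g : ℕ} (hN : D.nx v < D.N) (h1 : v < g) (h2 : g < D.nx v)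
    (h3 : D.Fits β g) (hmin : ∀ j, v < j → j < g → ¬ D.Fits β j) :
    D.cstep (.A β v n) = if D.Fits (D.sid g) (D.nx v) then some (.Nd v (n + 2))
      else some (.P g (D.nx v) (n + 2)) := by
  have hex : ∃ g, v < g ∧ g < D.nx v ∧ D.Fits β g := ⟨g, h1, h2, h3⟩
  have hf : Nat.find hex = g := by
    rw [Nat.find_eq_iff]
    exact ⟨⟨h1, h2, h3⟩, fun j hj h => hmin j h.1 hj h.2.2⟩
  simp only [cstep]
  rw [if_pos hN, dif_pos hex, hf]

end Static

section

variable {α : Type u} [LinearOrder α]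

/-- The position of the next job on one machine. -/
def nxE (v : Expr) : Expr := rd 3 (.const 0) v

/-- The handle of the job at a position of the static sequence. -/
def sidE (v : Expr) : Expr := rd 9 (.const 0) v

/-- Register `30` holds the first position after `v` at which a job fits after `β`, or the limit if
there is none; `β` and `v` are in the registers `20` and `21`. Register `24` is the flag of
`Outcome`. -/
def branch : Program :=
  .ite (.le (.reg 23) (.reg 30))
    (.assign 25 (.reg 20) ;; .assign 26 (sidE (.reg 21)))
    (.assign 27 (.reg 30) ;; .assign 22 (.add (.reg 22) (.const 1)) ;;
      .assign 28 (nxE (.reg 21)) ;;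
      .ite (.le (.reg 23) (.reg 28))
        (.assign 25 (sidE (.reg 21)) ;; .assign 26 (sidE (.reg 27)))
        (.assign 22 (.add (.reg 22) (.const 1)) ;;
          .ite (fits (sidE (.reg 27)) (sidE (.reg 28)))
            (.assign 24 (.const 1) ;; .assign 25 (.reg 21))
            (.assign 29 (nxE (.reg 27)) ;; merge ;; finish)))

-- The chain phase is over here: by `hor`, either a job fits after `β` before `nx v`, or `nx v` is
-- not below the limit. In the first case the transition of `A` leads to a node or to a
-- configuration `P`, which `merge` and `finish` follow.
open Classical in
theorem ex_branch {B H : ℕ} {σ : State α} (hb : Bounded B σ) (hC : Chains σ H)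
    (hL : σ.reg 23 ≤ σ.reg 4) (h24 : σ.reg 24 = 0) (hvg : σ.reg 21 < σ.reg 30)
    (hgL : σ.reg 30 ≤ σ.reg 23) (hc : σ.reg 22 + (2 * σ.reg 4 + 8) ≤ B)
    (hmin : ∀ j, σ.reg 21 < j → j < σ.reg 30 → ¬ σ.stat.Fits (σ.reg 20) j)
    (hfit : σ.reg 30 < σ.reg 23 → σ.stat.Fits (σ.reg 20) (σ.reg 30))
    (hor : σ.stat.Between (σ.reg 21) (σ.fk (σ.reg 20)) ∨ σ.reg 23 ≤ σ.stat.nx (σ.reg 21)) :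
    Ex B branch σ (fun τ s => s ≤ 8 * σ.reg 6 + 24 ∧ Frame 20 σ τ ∧ τ.reg 23 = σ.reg 23 ∧
      Outcome σ.stat (σ.reg 23) (.A (σ.reg 20) (σ.reg 21) (σ.reg 22)) τ) := by
  have hD := hC.next
  have hs := hC.sorted
  have enx : ∀ v, σ.arr 3 0 v = σ.stat.nx v := fun _ => rfl
  have esid : ∀ v, σ.arr 9 0 v = σ.stat.sid v := fun _ => rfl
  have efit : ∀ b v, σ.fk b ≤ σ.sk (σ.stat.sid v) ↔ σ.stat.Fits b v := fun _ _ => Iff.rfl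
  have hN : σ.stat.N = σ.reg 4 := rfl
  have estat : ∀ τ : State α, Frame 20 σ τ → τ.stat = σ.stat := fun τ h => h.stat (by omega)
  set D := σ.stat
  set v := σ.reg 21 with hvdef
  set β := σ.reg 20 with hβdef
  set g := σ.reg 30 with hgdef
  set L := σ.reg 23 with hLdef
  have hv : v < D.N := by omega
  have hF := Frame.refl 20 σ
  have hV : D.Valid (.A β v (σ.reg 22)) := hv
  have hvn := hD.lt v hv
  have hbeyond : L ≤ D.nx v → ∀ y, D.cstep (.A β v (σ.reg 22)) = some y → L ≤ D.pos y := by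
    intro hle y hy
    simp only [Static.cstep] at hy
    split_ifs at hy <;> cases hy <;> simp only [Static.pos] <;> omega
  refine ex_ite (fun h1 => ?_) (fun h1 => ?_)
  · simp only [holds_le, eval_reg] at h1
    have hle : L ≤ D.nx v := by
      rcases hor with ⟨g', a1, a2, a3, a4⟩ | h
      · by_contra hcon
        exact hmin g' a1 (by omega) a4
      · exact h
    refine ex_seq (ex_assign (hb.1 _) (ex_assign (hb.arr _ _ _) ?_))
    refine ⟨by omega, (hF.setReg (by omega)).setReg (by omega), by simp [hLdef], Or.inr
      ⟨by simp [h24], le_of_cstep hD hs hV (by simp) (hbeyond hle), ?_⟩⟩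
    simp only [Static.pos, Static.toState, reg_setReg, sidE, eval_rd, eval_reg, eval_const,
      arr_setReg, esid, Nat.reduceEqDiff, if_true, if_false]
    rw [Static.run_skip (d := L) (by omega) le_rfl
          (fun j hj hj' => ⟨hmin j (by omega) (by omega),
            hD.not_fits v j hv (by omega) (by omega)⟩), Static.run_self le_rfl]
  · simp only [holds_le, eval_reg, not_le] at h1
    have hf := hfit h1
    -- If some job between `v` and `nx v` fits after `β`, the first fitting one is not later;
    -- otherwise `nx v` is not below the limit, while `g` is.
    have hgv : g < D.nx v := by
      rcases hor with ⟨g', a1, a2, a3, a4⟩ | h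
      · by_contra hcon
        exact hmin g' a1 (by omega) a4
      · omega
    refine ex_assign_seq (hb.1 _) (ex_assign_seq (by simp; omega)
      (ex_assign_seq (hb.arr _ _ _) (ex_ite (fun h2 => ?_) (fun h2 => ?_))))
    · simp only [holds_le, nxE, eval_reg, eval_rd, reg_setReg, arr_setReg, eval_const, enx,
          Nat.reduceEqDiff, if_false, if_true, ← hvdef, ← hLdef] at h2
      refine ex_seq (ex_assign (hb.arr _ _ _) (ex_assign (hb.arr _ _ _) ?_))
      refine ⟨by omega, ((((hF.setReg (by omega)).setReg (by omega)).setReg (by omega)).setReg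
        (by omega)).setReg (by omega), by simp [hLdef], Or.inr ⟨by simp [h24],
          le_of_cstep hD hs hV (by simp) (hbeyond h2), ?_⟩⟩
      simp only [Static.pos, Static.toState, reg_setReg, sidE, eval_rd, eval_reg, eval_const,
        arr_setReg, esid, eval_add, Nat.reduceEqDiff, if_true, if_false]
      rw [Static.run_skip (d := g) (by omega) (by omega)
          (fun j hj hj' => ⟨hmin j (by omega) hj', hD.not_fits v j hv (by omega) (by omega)⟩),
        Static.run_append (d := g + 1) (by omega) (by omega),
        Static.run_last' (hD.not_fits v g hv hvg hgv) hf,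
        Static.run_skip (d := L) (by omega) (by omega)
          (fun j hj hj' => ⟨hD.not_fits v j hv (by omega) (by omega),
            hD.not_fits_of_le hs hvg.le (by omega) (by omega) (by omega)⟩),
        Static.run_self le_rfl]
    · simp only [holds_le, nxE, eval_reg, eval_rd, reg_setReg, arr_setReg, eval_const, enx,
          Nat.reduceEqDiff, if_false, if_true, ← hvdef, ← hLdef, not_le] at h2
      have hst := Static.cstep_chain_of_fits (n := σ.reg 22) (show D.nx v < D.N by omega) hvg hgv
        hf hmin
      refine ex_assign_seq (by simp; omega) (ex_ite (fun h3 => ?_) (fun h3 => ?_))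
      · simp only [holds_fits, nxE, sidE, eval_reg, eval_rd, reg_setReg, arr_setReg, eval_const,
          sk_setReg, fk_setReg, enx, esid, efit, Nat.reduceEqDiff, if_false, if_true,
          ← hvdef] at h3
        rw [if_pos h3] at hst
        refine ex_assign_seq (by simp; omega) (ex_assign (by simp; exact hb.1 _) ?_)
        refine ⟨by omega, (((((hF.setReg (by omega)).setReg (by omega)).setReg (by omega)).setReg
          (by omega)).setReg (by omega)).setReg (by omega), by simp [hLdef],
            Or.inl ⟨by simp, .single ?_, by simp [← hvdef]; omega⟩⟩
        rw [hst]
        simp [← hvdef, add_assoc]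
      · simp only [holds_fits, nxE, sidE, eval_reg, eval_rd, reg_setReg, arr_setReg, eval_const,
          sk_setReg, fk_setReg, enx, esid, efit, Nat.reduceEqDiff, if_false, if_true,
          ← hvdef] at h3
        rw [if_neg h3] at hst
        obtain ⟨hVP, -, -, -⟩ := Static.cstep_spec hD hs hV hst
        refine ex_assign_seq (hb.arr _ _ _) (ex_seq ?_)
        generalize hρ : State.setReg _ 29 _ = ρ
        have hFρ : Frame 20 σ ρ := by
          rw [← hρ]
          exact ((((hF.setReg (by omega)).setReg (by omega)).setReg (by omega)).setReg
            (by omega)).setReg (by omega)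
        have e4 := hFρ.2.2 4 (by omega)
        have e6 := hFρ.2.2 6 (by omega)
        have e22 : ρ.reg 22 = σ.reg 22 + 2 := by rw [← hρ]; simp [add_assoc]
        have e23 : ρ.reg 23 = L := by rw [← hρ]; simp [hLdef]
        have e24 : ρ.reg 24 = 0 := by rw [← hρ]; simp [h24]
        have e27 : ρ.reg 27 = g := by rw [← hρ]; simp [hgdef]
        have e28 : ρ.reg 28 = D.nx v := by rw [← hρ]; simp [nxE, enx, hvdef]
        have e29 : ρ.reg 29 = D.nx g := by rw [← hρ]; simp [nxE, enx, hgdef]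
        have hbρ : Bounded B ρ := by
          refine ⟨fun x => ?_, by rw [hFρ.1]; exact hb.2⟩
          rw [← hρ]
          have := hb.1 x
          have := hb.1 30
          have := hb.arr 3 0 v
          have := hb.arr 3 0 g
          simp only [reg_setReg, eval_reg, eval_add, eval_const, nxE, eval_rd, arr_setReg,
            ← hvdef, Nat.reduceEqDiff, if_true, if_false]
          split_ifs <;> omega
        have hCρ := hC.of_frame hFρ (by omega)
        have eD := estat _ hFρ
        refine (ex_merge hbρ hCρ (by omega) (by rw [e27, e28]; omega)
          (by rw [e27, e28, eD]; exact hVP.2.1) (by omega) (by rw [e29, e27, eD])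
          (by omega)).imp_bounded hbρ ?_
        rintro τ s hbτ ⟨hsτ, hFτ, k23, k24, hr, k28, k29, k22, hm⟩
        have hFτ' := hFρ.trans hFτ le_rfl
        have f4 := hFτ'.2.2 4 (by omega)
        have f6 := hFτ'.2.2 6 (by omega)
        have eDτ := estat _ hFτ'
        rw [eD, e27, e28, e22] at hr
        obtain ⟨hV', -, -⟩ := hr.spec hD hs hVP
        rw [eD] at k29 hm
        refine (ex_finish hbτ (hC.of_frame hFτ' (by omega)) (by omega) (by rw [eDτ]; exact hV')
          (by omega) (by rw [k29, eDτ]) (by omega) (by omega) ?_).imp ?_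
        · rw [eDτ, k23]; exact hm
        · rintro τ' s' ⟨hs', hF', l23, ho⟩
          refine ⟨by omega, hFτ'.trans hF' le_rfl, by omega, ?_⟩
          rw [eDτ, k23, e23] at ho
          exact ho.of_reach hD hs hV (.head hst hr) (by simp only [Static.pos]; omega)

/-- Follows the configurations from `A β v n`, with `β`, `v`, `n` in the registers `20`, `21`,
`22`, up to the next node or to the position in register `23`. -/
def advance : Program :=
  .assign 24 (.const 0) ;; .assign 30 (.reg 21) ;; .assign 31 (.reg 20) ;; .assign 32 (.reg 22) ;;
  .assign 33 (.sub (.reg 23) (.const 1)) ;; search 1 id ;;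
  .assign 21 (.reg 30) ;; .assign 22 (.reg 32) ;; .assign 30 (.add (.reg 21) (.const 1)) ;;
  .assign 32 (.const 0) ;; .assign 33 (.reg 23) ;; search 0 id ;; branch

/-- The chain search gets the limit `L - 1`, so that its end stays below `L`. The search for the
intermediate job starts one position after that end and may return `L` itself, meaning that no job
was found. -/
theorem ex_advance {B H : ℕ} {σ : State α} (hb : Bounded B σ) (hC : Chains σ H)
    (hL : σ.reg 23 ≤ σ.reg 4) (hv : σ.reg 21 < σ.reg 23)
    (hc : σ.reg 22 + (3 * σ.reg 4 + 8) ≤ B) :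
    Ex B advance σ (fun τ s => s ≤ 32 * σ.reg 6 + 60 ∧ Frame 20 σ τ ∧ τ.reg 23 = σ.reg 23 ∧
      Outcome σ.stat (σ.reg 23) (.A (σ.reg 20) (σ.reg 21) (σ.reg 22)) τ) := by
  have hbr := hb.1
  have hF := Frame.refl 20 σ
  refine ex_assign_seq (by simp) (ex_assign_seq (hbr _) (ex_assign_seq (hbr _)
    (ex_assign_seq (hbr _) (ex_assign_seq ?_ (ex_seq ?_)))))
  · have := hbr 23
    simp; omega
  generalize hρ : State.setReg _ 33 _ = ρ
  have hFρ : Frame 20 σ ρ := by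
    rw [← hρ]
    exact ((((hF.setReg (by omega)).setReg (by omega)).setReg (by omega)).setReg
      (by omega)).setReg (by omega)
  have e4 := hFρ.2.2 4 (by omega)
  have e6 := hFρ.2.2 6 (by omega)
  have e20 : ρ.reg 20 = σ.reg 20 := by rw [← hρ]; simp
  have e23 : ρ.reg 23 = σ.reg 23 := by rw [← hρ]; simp
  have e24 : ρ.reg 24 = 0 := by rw [← hρ]; simp
  have e30 : ρ.reg 30 = σ.reg 21 := by rw [← hρ]; simp
  have e31 : ρ.reg 31 = σ.reg 20 := by rw [← hρ]; simp
  have e32 : ρ.reg 32 = σ.reg 22 := by rw [← hρ]; simp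
  have e33 : ρ.reg 33 = σ.reg 23 - 1 := by rw [← hρ]; simp
  have hbρ : Bounded B ρ := by
    refine ⟨fun x => ?_, by rw [hFρ.1]; exact hb.2⟩
    rw [← hρ]
    have := hbr x; have := hbr 21; have := hbr 20; have := hbr 22; have := hbr 23
    simp only [reg_setReg, eval_reg, eval_sub, eval_const, Nat.reduceEqDiff, if_false]
    split_ifs <;> omega
  have eD := hFρ.stat (by omega)
  refine (ex_search_chain hbρ (hC.of_frame hFρ (by omega)) (by omega) (by omega)
    (by omega)).imp_bounded hbρ ?_
  rintro τ s hbτ ⟨hs, hFτ, k31, k30, k30', hr, k32, hor⟩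
  have hFτ' := hFρ.trans hFτ (by omega)
  rw [eD, e30, e31, e32] at hr
  rw [e31, eD, e33, hFρ.fk] at hor
  have f20 := hFτ.2.2 20 (by omega)
  have f23 := hFτ.2.2 23 (by omega)
  have f24 := hFτ.2.2 24 (by omega)
  have f4 := hFτ.2.2 4 (by omega)
  have f6 := hFτ.2.2 6 (by omega)
  refine ex_assign_seq (hbτ.1 _) (ex_assign_seq (by simp; exact hbτ.1 _) (ex_assign_seq
    (by have := hC.pow; simp; omega) (ex_assign_seq (by simp) (ex_assign_seq (by simp; exact hbτ.1 _)
      (ex_seq ?_)))))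
  generalize hπ : State.setReg _ 33 _ = π
  have hFπ : Frame 20 τ π := by
    rw [← hπ]
    exact (((((Frame.refl 20 τ).setReg (by omega)).setReg (by omega)).setReg (by omega)).setReg
      (by omega)).setReg (by omega)
  have hFπ' := hFτ'.trans hFπ (by omega)
  have g4 := hFπ'.2.2 4 (by omega)
  have g6 := hFπ'.2.2 6 (by omega)
  have g20 : π.reg 20 = σ.reg 20 := by rw [← hπ]; simp [f20, e20]
  have g21 : π.reg 21 = τ.reg 30 := by rw [← hπ]; simp
  have g22 : π.reg 22 = τ.reg 32 := by rw [← hπ]; simp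
  have g23 : π.reg 23 = σ.reg 23 := by rw [← hπ]; simp [f23, e23]
  have g24 : π.reg 24 = 0 := by rw [← hπ]; simp [f24, e24]
  have g30 : π.reg 30 = τ.reg 30 + 1 := by rw [← hπ]; simp
  have g31 : π.reg 31 = σ.reg 20 := by rw [← hπ]; simp [k31, e31]
  have g32 : π.reg 32 = 0 := by rw [← hπ]; simp
  have g33 : π.reg 33 = σ.reg 23 := by rw [← hπ]; simp [f23, e23]
  have hbπ : Bounded B π := by
    refine ⟨fun x => ?_, by rw [hFπ.1]; exact hbτ.2⟩
    rw [← hπ]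
    have := hbτ.1 x; have := hbτ.1 30; have := hbτ.1 32; have := hbτ.1 23
    simp only [reg_setReg, eval_reg, eval_add, eval_const, Nat.reduceEqDiff, if_true, if_false]
    split_ifs <;> omega
  have eDπ := hFπ'.stat (by omega)
  have hCπ := hC.of_frame hFπ' (by omega)
  refine (ex_search_succ hbπ hCπ.pow hCπ.sk_zero hCπ.bot_lt hCπ.succ (by omega) (by omega)
    (by omega)).imp_bounded hbπ ?_
  rintro ω t hbω ⟨ht, hFω, m1, m2, m3, m4, -⟩
  have hFω' := hFπ'.trans hFω (by omega)
  have eDω := hFω'.stat (by omega)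
  have r4 := hFω'.2.2 4 (by omega)
  have r6 := hFω'.2.2 6 (by omega)
  have r20 := hFω.2.2 20 (by omega)
  have r21 := hFω.2.2 21 (by omega)
  have r22 := hFω.2.2 22 (by omega)
  have r23 := hFω.2.2 23 (by omega)
  have r24 := hFω.2.2 24 (by omega)
  rw [eDπ, g31] at m3 m4
  refine (ex_branch hbω (hC.of_frame hFω' (by omega)) (by omega) (by omega) (by omega) (by omega)
    (by omega) ?_ ?_ ?_).imp ?_
  · intro j hj hj'
    rw [eDω, r20, g20]
    exact m3 j (by omega) hj'
  · intro h
    rw [eDω, r20, g20]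
    exact m4 (by omega)
  · rw [eDω, r21, g21, r20, g20, hFω'.fk]
    exact hor.imp_right (fun h => by omega)
  · rintro τ' s' ⟨hs', hF', l23, ho⟩
    refine ⟨by omega, hFω'.trans hF' le_rfl, by omega, ?_⟩
    rw [eDω, r20, g20, r21, g21, r22, g22, r23, g23] at ho
    exact ho.of_reach hC.next hC.sorted (show σ.reg 21 < σ.reg 4 by omega) hr
      (by simp only [Static.pos]; omega)

end

end DIS

/-! ### The greedy algorithm on a whole stretch of static positions. -/

namespace DIS

section

variable {α : Type u}

/-- Everything but the registers `7`, `8`, `9` and those from `20` on agrees. -/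
def Frame789 (σ τ : State α) : Prop :=
  τ.mem = σ.mem ∧ τ.key = σ.key ∧ ∀ x < 20, x ≠ 7 → x ≠ 8 → x ≠ 9 → τ.reg x = σ.reg x

theorem Frame.frame789 {σ τ : State α} (h : Frame 20 σ τ) : Frame789 σ τ :=
  ⟨h.1, h.2.1, fun x hx _ _ _ => h.2.2 x hx⟩

variable [LinearOrder α]

/-- The static sequence is sorted, and all its lifting tables are correct. -/
structure Tables (σ : State α) (H : ℕ) : Prop extends Chains σ H where
  jump : σ.stat.IsJump (σ.arr 6 0) (σ.arr 8 0)
  lift : Table σ 2 (σ.reg 4) (σ.reg 6) H (σ.arr 6 0) (σ.arr 8 0) (fun _ _ => False)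

theorem Table.of_eq {σ τ : State α} {G N K H : ℕ} {f ct : ℕ → ℕ} {Lb : ℕ → WithBot α → Prop}
    (h : Table σ G N K H f ct Lb) (ha : ∀ i k v, i < 9 → τ.arr i k v = σ.arr i k v)
    (hs : ∀ h, h ≤ H → τ.sk h = σ.sk h) (hG : G < 3) : Table τ G N K H f ct Lb := by
  obtain ⟨h1, h2, h3, h4⟩ := h
  refine ⟨?_, ?_, ?_, ?_⟩
  · intro k v hk hv; rw [ha _ _ _ (by omega)]; exact h1 k v hk hv
  · intro k v x hk hv
    rw [ha _ _ _ (by omega), ← h2 k v x hk hv]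
    unfold State.Hit
    rw [hs _ (h4 k v hk hv)]
  · intro k v hk hv; rw [ha _ _ _ (by omega)]; exact h3 k v hk hv
  · intro k v hk hv; rw [ha _ _ _ (by omega)]; exact h4 k v hk hv

theorem Tables.of_frame {σ τ : State α} {H n : ℕ} (h : Tables σ H) (hF : Frame n σ τ)
    (hn : 6 < n) : Tables τ H := by
  refine ⟨h.toChains.of_frame hF hn, ?_, ?_⟩
  · rw [hF.stat (by omega), hF.arr]; exact h.jump
  · rw [hF.2.2 4 (by omega), hF.2.2 6 (by omega), hF.arr]
    exact h.lift.of_eq (fun i k v _ => by rw [hF.arr]) (fun h _ => by rw [hF.sk]) (by omega)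

/-- It suffices to know that `nx` is below `N` at the end of the path: this happens only at
positions of jobs, and the potential does not decrease along jumps, so all earlier nodes are genuine
too. -/
theorem IsJump.iterate {D : Static (WithBot α)} {J ct : ℕ → ℕ} (hJ : D.IsJump J ct)
    (hD : D.IsNext) (hs : D.Sorted) {u n : ℕ} (hu : u < D.N) (i : ℕ)
    (h : D.nx (J^[i] u) < D.N) :
    J^[i] u < D.N ∧ D.nx u ≤ D.nx (J^[i] u) ∧
    D.run (D.nx u + 1) (D.nx (J^[i] u) + 1) (D.sid u, D.sid (D.nx u), n) =
      (D.sid (J^[i] u), D.sid (D.nx (J^[i] u)),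
        n + ∑ j ∈ Finset.range i, ct (J^[j] u)) := by
  have hG := isGraph_jump hD hs hJ
  induction i with
  | zero => exact ⟨hu, le_rfl, Static.run_self le_rfl _⟩
  | succ i ih =>
    have h1 := hG.iterate_le (v := u) (by omega) (i + 1)
    have h2 := hD.lt_of_nx_lt h h1
    have h3 := hG.iterate_le (v := u) (by omega) i
    have h4 := hG.ct_le _ h3
    rw [Function.iterate_succ_apply'] at h h2 ⊢
    obtain ⟨a1, a2, a3⟩ := ih (by omega)
    obtain ⟨b1, b2⟩ := hJ.run_eq hD hs (n := n + ∑ j ∈ Finset.range i, ct (J^[j] u)) a1 h2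
    refine ⟨h2, by omega, ?_⟩
    rw [Static.run_append (d := D.nx (J^[i] u) + 1) (by omega) (by omega), a3, b2,
      Finset.sum_range_succ, add_assoc]

/-- The labels of this graph are never hit, so the search ends at the last node whose potential `nx`
is within the limit. -/
theorem ex_search_jump {B H : ℕ} {σ : State α} (hb : Bounded B σ) (hT : Tables σ H)
    (hv : σ.reg 30 < σ.reg 4) (hnv : σ.stat.nx (σ.reg 30) ≤ σ.reg 33)
    (hL : σ.reg 33 < σ.reg 4) (hc : σ.reg 32 + (σ.reg 4 + 1) ≤ B) :
    Ex B (search 2 nxE) σ (fun τ s => s ≤ 12 * σ.reg 6 + 4 ∧ Frame 30 σ τ ∧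
      τ.reg 30 < σ.reg 4 ∧ σ.stat.nx (σ.reg 30) ≤ σ.stat.nx (τ.reg 30) ∧
      σ.stat.nx (τ.reg 30) ≤ σ.reg 33 ∧
      σ.reg 33 < σ.stat.nx (σ.arr 6 0 (τ.reg 30)) ∧ τ.reg 32 ≤ σ.reg 32 + (σ.reg 4 + 1) ∧
      σ.stat.run (σ.stat.nx (σ.reg 30) + 1) (σ.stat.nx (τ.reg 30) + 1)
        (σ.stat.sid (σ.reg 30), σ.stat.sid (σ.stat.nx (σ.reg 30)), σ.reg 32) =
        (σ.stat.sid (τ.reg 30), σ.stat.sid (σ.stat.nx (τ.reg 30)), τ.reg 32)) := by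
  have hG := isGraph_jump hT.next hT.sorted hT.jump
  refine (ex_search hb hT.lift hG (Xe := nxE) ?_
    hT.sk_zero hT.bot_lt (by omega) hnv hL.le hc (by have := hT.pow; omega)).imp ?_
  · intro τ e hm _
    simp only [nxE, eval_rd, eval_const, arr_congr hm]
    rfl
  rintro τ s ⟨hs, hF, -, -, i, h30, -, hX, hor, h32, -⟩
  have hor' := hor.resolve_left id
  rw [Function.iterate_succ_apply'] at hor'
  obtain ⟨g1, g2, g3⟩ := IsJump.iterate hT.jump hT.next hT.sorted (n := σ.reg 32)
    (show σ.reg 30 < σ.stat.N from hv) i (lt_of_le_of_lt hX hL)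
  have hle := hG.sum_add_le (v := σ.reg 30) (show _ ≤ σ.reg 4 + 1 by omega) i
  rw [h30]
  refine ⟨hs, hF, g1, g2, hX, hor', ?_, ?_⟩
  · rw [h32]
    have := hG.X_le _ (hG.iterate_le (v := σ.reg 30) (show _ ≤ σ.reg 4 + 1 by omega) i)
    have hN : σ.stat.N = σ.reg 4 := rfl
    omega
  · rw [g3, h32]

/-- After a node has been found, makes all jumps to nodes below the limit in register `11`, and
follows the configurations up to this limit. -/
def jumps : Program :=
  .assign 30 (.reg 25) ;; .assign 31 (.const 0) ;; .assign 32 (.reg 22) ;;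
    .assign 33 (.sub (.reg 11) (.const 1)) ;; search 2 nxE ;;
    .assign 20 (sidE (.reg 30)) ;; .assign 21 (nxE (.reg 30)) ;;
    .assign 22 (.reg 32) ;; advance

/-- After the jumps, the remaining way to the limit contains no further node, so one call of
`advance` must end with an explicit state at the limit. -/
theorem ex_jumps {B H : ℕ} {σ : State α} (hb : Bounded B σ) (hT : Tables σ H)
    (hL : σ.reg 11 ≤ σ.reg 4) (hu : σ.reg 25 < σ.reg 4)
    (hu' : σ.stat.nx (σ.reg 25) < σ.reg 11) (h23 : σ.reg 23 = σ.reg 11)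
    (hc : σ.reg 22 + (4 * σ.reg 4 + 10) ≤ B) :
    Ex B jumps σ (fun τ s => s ≤ 44 * σ.reg 6 + 71 ∧ Frame 20 σ τ ∧
      σ.stat.run (σ.stat.nx (σ.reg 25) + 1) (σ.reg 11)
        (σ.stat.sid (σ.reg 25), σ.stat.sid (σ.stat.nx (σ.reg 25)), σ.reg 22) =
        (τ.reg 25, τ.reg 26, τ.reg 22)) := by
  have hbr := hb.1
  have hF := Frame.refl 20 σ
  refine ex_assign_seq (hbr _) (ex_assign_seq (by simp) (ex_assign_seq (hbr _)
    (ex_assign_seq ?_ (ex_seq ?_))))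
  · have := hbr 11
    simp; omega
  generalize hρ : State.setReg _ 33 _ = ρ
  have hFρ : Frame 20 σ ρ := by
    rw [← hρ]
    exact (((hF.setReg (by omega)).setReg (by omega)).setReg (by omega)).setReg (by omega)
  have e4 := hFρ.2.2 4 (by omega)
  have e6 := hFρ.2.2 6 (by omega)
  have e11 := hFρ.2.2 11 (by omega)
  have e23 : ρ.reg 23 = σ.reg 11 := by rw [← hρ]; simp [h23]
  have e30 : ρ.reg 30 = σ.reg 25 := by rw [← hρ]; simp
  have e32 : ρ.reg 32 = σ.reg 22 := by rw [← hρ]; simp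
  have e33 : ρ.reg 33 = σ.reg 11 - 1 := by rw [← hρ]; simp
  have hbρ : Bounded B ρ := by
    refine ⟨fun x => ?_, by rw [hFρ.1]; exact hb.2⟩
    rw [← hρ]
    have := hbr x; have := hbr 25; have := hbr 22; have := hbr 11
    simp only [reg_setReg, eval_reg, eval_sub, eval_const, Nat.reduceEqDiff, if_false]
    split_ifs <;> omega
  have eD := hFρ.stat (by omega)
  refine (ex_search_jump hbρ (hT.of_frame hFρ (by omega)) (by omega) (by rw [eD, e30]; omega)
    (by omega) (by omega)).imp_bounded hbρ ?_
  rintro τ s hbτ ⟨hs, hFτ, k30, k1, k2, k3, k4, k5⟩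
  have hFτ' := hFρ.trans hFτ (by omega)
  rw [eD, e30] at k1
  rw [eD, e33] at k2
  rw [eD, e33, hFρ.arr] at k3
  rw [eD, e30, e32] at k5
  have f4 := hFτ'.2.2 4 (by omega)
  have f6 := hFτ'.2.2 6 (by omega)
  have f23 := hFτ.2.2 23 (by omega)
  refine ex_assign_seq (hbτ.arr _ _ _) (ex_assign_seq (hbτ.arr _ _ _)
    (ex_assign_seq (by simp; exact hbτ.1 _) ?_))
  generalize hπ : State.setReg _ 22 _ = π
  have hFπ : Frame 20 τ π := by
    rw [← hπ]
    exact ((((Frame.refl 20 τ).setReg (by omega)).setReg (by omega)).setReg (by omega))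
  have hFπ' := hFτ'.trans hFπ (by omega)
  have g4 := hFπ'.2.2 4 (by omega)
  have g6 := hFπ'.2.2 6 (by omega)
  have g20 : π.reg 20 = σ.stat.sid (τ.reg 30) := by
    rw [← hπ]; simp [sidE, hFτ'.arr]; rfl
  have g21 : π.reg 21 = σ.stat.nx (τ.reg 30) := by
    rw [← hπ]; simp [nxE, hFτ'.arr]; rfl
  have g22 : π.reg 22 = τ.reg 32 := by rw [← hπ]; simp
  have g23 : π.reg 23 = σ.reg 11 := by rw [← hπ]; simp [f23, e23]
  have hbπ : Bounded B π := by
    refine ⟨fun x => ?_, by rw [hFπ.1]; exact hbτ.2⟩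
    rw [← hπ]
    have := hbτ.1 x; have := hbτ.1 32
    have := hbτ.arr 9 0 (τ.reg 30); have := hbτ.arr 3 0 (τ.reg 30)
    simp only [reg_setReg, arr_setReg, eval_reg, eval_rd, sidE, nxE, eval_const,
      Nat.reduceEqDiff, if_false]
    split_ifs <;> omega
  have eDπ := hFπ'.stat (by omega)
  have hTπ := hT.of_frame hFπ' (by omega)
  refine (ex_advance hbπ hTπ.toChains (by omega) (by omega) (by omega)).imp ?_
  rintro ω t ⟨ht, hFω, l23, ho⟩
  rw [eDπ, g20, g21, g22, g23] at ho
  refine ⟨by omega, hFπ'.trans hFω le_rfl, ?_⟩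
  rcases ho with ⟨-, hr, hlt⟩ | ⟨-, -, ho⟩
  -- A node found before the limit would have to be the target of the jump from the last node, but
  -- that target has its potential beyond the limit.
  · have := hT.jump.eq_of_reach (show τ.reg 30 < σ.reg 4 by omega)
      (show σ.stat.nx (τ.reg 30) < σ.reg 4 by omega) hr
    rw [this] at k3
    omega
  · simp only [Static.pos, Static.toState] at ho
    rw [Static.run_append (d := σ.stat.nx (τ.reg 30) + 1) (by omega) (by omega), k5, ho]

/-- Processes the static jobs at the positions from `reg 10` up to `reg 11`. -/
def gap : Program :=
  .ite (lt (.reg 10) (.reg 11))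
    (.assign 30 (.reg 10) ;; .assign 31 (.reg 7) ;; .assign 32 (.const 0) ;;
      .assign 33 (.reg 11) ;; search 0 id ;;
      .ite (lt (.reg 30) (.reg 11))
        (.assign 22 (.add (.reg 9) (.const 1)) ;; .assign 23 (.reg 11) ;;
          .assign 21 (.reg 30) ;;
          .ite (fits (.reg 8) (sidE (.reg 21))) (.assign 20 (.reg 7)) (.assign 20 (.reg 8)) ;;
          advance ;;
          .ite (eq (.reg 24) (.const 1))
            jumps .skip ;;
          .assign 7 (.reg 25) ;; .assign 8 (.reg 26) ;; .assign 9 (.reg 22))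
        .skip)
    .skip

-- The initial state is arbitrary, for instance with pending jobs as last jobs. After the first
-- static job that fits has been placed, the state has the form `A β v`; then one advance to a node,
-- the jumps, and one more advance reach the end of the stretch. The number of steps is linear in
-- the number of levels, whatever the length of the stretch.
open Classical in
theorem ex_gap {B H : ℕ} {σ : State α} (hb : Bounded B σ) (hT : Tables σ H)
    (hL : σ.reg 11 ≤ σ.reg 4) (hab : σ.fk (σ.reg 7) ≤ σ.fk (σ.reg 8))
    (hc : σ.reg 9 + (5 * σ.reg 4 + 12) ≤ B) :
    Ex B gap σ (fun τ s => s ≤ 88 * σ.reg 6 + 160 ∧ Frame789 σ τ ∧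
      σ.stat.run (σ.reg 10) (σ.reg 11) (σ.reg 7, σ.reg 8, σ.reg 9) =
        (τ.reg 7, τ.reg 8, τ.reg 9)) := by
  have hbr := hb.1
  have hF := Frame.refl 20 σ
  refine ex_ite (fun h1 => ?_) (fun h1 => ?_)
  swap
  · simp only [holds_lt, eval_reg, not_lt] at h1
    exact ex_skip ⟨by omega, hF.frame789, Static.run_self h1 _⟩
  simp only [holds_lt, eval_reg] at h1
  refine ex_assign_seq (hbr _) (ex_assign_seq (hbr _) (ex_assign_seq (by simp)
    (ex_assign_seq (by simp; exact hbr _) (ex_seq ?_))))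
  generalize hρ : State.setReg _ 33 _ = ρ
  have hFρ : Frame 20 σ ρ := by
    rw [← hρ]
    exact (((hF.setReg (by omega)).setReg (by omega)).setReg (by omega)).setReg (by omega)
  have e4 := hFρ.2.2 4 (by omega)
  have e6 := hFρ.2.2 6 (by omega)
  have e11 := hFρ.2.2 11 (by omega)
  have e30 : ρ.reg 30 = σ.reg 10 := by rw [← hρ]; simp
  have e31 : ρ.reg 31 = σ.reg 7 := by rw [← hρ]; simp
  have e32 : ρ.reg 32 = 0 := by rw [← hρ]; simp
  have e33 : ρ.reg 33 = σ.reg 11 := by rw [← hρ]; simp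
  have hbρ : Bounded B ρ := by
    refine ⟨fun x => ?_, by rw [hFρ.1]; exact hb.2⟩
    rw [← hρ]
    have := hbr x; have := hbr 7; have := hbr 10; have := hbr 11
    simp only [reg_setReg, eval_reg, eval_const, Nat.reduceEqDiff, if_false]
    split_ifs <;> omega
  have eD := hFρ.stat (by omega)
  have hTρ := hT.of_frame hFρ (by omega)
  refine (ex_search_succ hbρ hTρ.pow hTρ.sk_zero hTρ.bot_lt hTρ.succ (by omega) (by omega)
    (by omega)).imp_bounded hbρ ?_
  rintro τ s hbτ ⟨hs, hFτ, k1, k2, k3, k4, -⟩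
  have hFτ' := hFρ.trans hFτ (by omega)
  rw [eD, e31, e30] at k3
  rw [eD, e31, e33] at k4
  -- The machine in register `7` is free first, so a job that does not fit there fits on neither
  -- machine.
  have hskip : ∀ j, σ.reg 10 ≤ j → j < τ.reg 30 →
      ¬ σ.stat.Fits (σ.reg 7) j ∧ ¬ σ.stat.Fits (σ.reg 8) j :=
    fun j hj hj' => ⟨k3 j hj hj', fun h => k3 j hj hj' (hab.trans h)⟩
  have f6 := hFτ'.2.2 6 (by omega)
  have f7 := hFτ'.2.2 7 (by omega)
  have f8 := hFτ'.2.2 8 (by omega)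
  have f9 := hFτ'.2.2 9 (by omega)
  have f11 := hFτ'.2.2 11 (by omega)
  refine ex_ite (fun h2 => ?_) (fun h2 => ?_)
  swap
  · simp only [holds_lt, eval_reg, not_lt] at h2
    refine ex_skip ⟨by omega, hFτ'.frame789, ?_⟩
    rw [Static.run_skip (d := σ.reg 11) (by omega) le_rfl
      (fun j hj hj' => hskip j hj (by omega)), Static.run_self le_rfl, f7, f8, f9]
  simp only [holds_lt, eval_reg] at h2
  have hfit := k4 (by omega)
  refine ex_assign_seq (by simp; omega) (ex_assign_seq (by simp; exact hbτ.1 _)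
    (ex_assign_seq (by simp; exact hbτ.1 _) (ex_seq ?_)))
  -- The job at `τ.reg 30` becomes the last to finish on either choice of machine; `β` is the last
  -- job of the other machine.
  have hstep : ∃ β, σ.stat.run (τ.reg 30) (τ.reg 30 + 1) (σ.reg 7, σ.reg 8, σ.reg 9) =
      (β, σ.stat.sid (τ.reg 30), σ.reg 9 + 1) ∧
      β = if σ.stat.Fits (σ.reg 8) (τ.reg 30) then σ.reg 7 else σ.reg 8 := by
    split_ifs with h3
    · exact ⟨_, Static.run_last h3, rfl⟩
    · exact ⟨_, Static.run_last' h3 hfit, rfl⟩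
  obtain ⟨β, hβ, hβ'⟩ := hstep
  refine Ex.imp_bounded (Q := fun π t => t ≤ 2 ∧ Frame 20 σ π ∧ π.reg 20 = β ∧
    π.reg 21 = τ.reg 30 ∧ π.reg 22 = σ.reg 9 + 1 ∧ π.reg 23 = σ.reg 11) ?_ ?_ ?_
  · have e21 : τ.arr 9 0 (τ.reg 30) = σ.stat.sid (τ.reg 30) := by rw [hFτ'.arr]; rfl
    have e20 : (fits (.reg 8) (sidE (.reg 21))).Holds
        (((τ.setReg 22 (Expr.eval τ (.add (.reg 9) (.const 1)))).setReg 23 (Expr.eval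
        (τ.setReg 22 (Expr.eval τ (.add (.reg 9) (.const 1)))) (.reg 11))).setReg 21
        (Expr.eval ((τ.setReg 22 (Expr.eval τ (.add (.reg 9) (.const 1)))).setReg 23 (Expr.eval
        (τ.setReg 22 (Expr.eval τ (.add (.reg 9) (.const 1)))) (.reg 11))) (.reg 30))) ↔
        σ.stat.Fits (σ.reg 8) (τ.reg 30) := by
      simp [sidE, e21, f8, hFτ'.sk, hFτ'.fk]; rfl
    refine ex_ite (fun h3 => ?_) (fun h3 => ?_)
    · rw [e20] at h3
      rw [if_pos h3] at hβ'
      refine ex_assign (by simp; exact hbτ.1 _) ⟨by omega, (((hFτ'.setReg (by omega)).setReg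
        (by omega)).setReg (by omega)).setReg (by omega), ?_⟩
      simp [hβ', f7, f9, f11]
    · rw [e20] at h3
      rw [if_neg h3] at hβ'
      refine ex_assign (by simp; exact hbτ.1 _) ⟨by omega, (((hFτ'.setReg (by omega)).setReg
        (by omega)).setReg (by omega)).setReg (by omega), ?_⟩
      simp [hβ', f8, f9, f11]
  · refine ⟨fun x => ?_, hbτ.2⟩
    have := hbτ.1 x; have := hbτ.1 11; have := hbτ.1 30
    simp only [reg_setReg, eval_reg, eval_add, eval_const, Nat.reduceEqDiff, if_false]
    split_ifs <;> omega
  rintro π t hbπ ⟨ht, hFπ, g20, g21, g22, g23⟩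
  have eDπ := hFπ.stat (by omega)
  have hTπ := hT.of_frame hFπ (by omega)
  have g4 := hFπ.2.2 4 (by omega)
  have g6 := hFπ.2.2 6 (by omega)
  refine ex_seq ((ex_advance hbπ hTπ.toChains (by omega) (by omega) (by omega)).imp_bounded hbπ ?_)
  rintro ω r hbω ⟨hr, hFω, l23, ho⟩
  have hFω' := hFπ.trans hFω le_rfl
  have eDω := hFω'.stat (by omega)
  have m4 := hFω'.2.2 4 (by omega)
  have m6 := hFω'.2.2 6 (by omega)
  have m11 := hFω'.2.2 11 (by omega)
  rw [eDπ, g20, g21, g22, g23] at ho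
  have hfst : σ.stat.run (σ.reg 10) (τ.reg 30 + 1) (σ.reg 7, σ.reg 8, σ.reg 9) =
      (β, σ.stat.sid (τ.reg 30), σ.reg 9 + 1) := by
    rw [Static.run_skip (d := τ.reg 30) (by omega) (by omega) hskip, hβ]
  have key : Ex B (.ite (eq (.reg 24) (.const 1)) jumps .skip) ω (fun χ t =>
      t ≤ 44 * σ.reg 6 + 72 ∧ Frame 20 σ χ ∧
      σ.stat.run (σ.reg 10) (σ.reg 11) (σ.reg 7, σ.reg 8, σ.reg 9) =
        (χ.reg 25, χ.reg 26, χ.reg 22)) := by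
    refine ex_ite (fun h3 => ?_) (fun h3 => ?_)
    · simp only [holds_eq, eval_reg, eval_const] at h3
      rcases ho with ⟨-, hr, hlt⟩ | ⟨h0, -⟩
      swap
      · omega
      obtain ⟨v1, v2, v3⟩ := hr.spec hT.next hT.sorted
        (show σ.stat.Valid (.A β (τ.reg 30) (σ.reg 9 + 1)) from (show τ.reg 30 < σ.reg 4 by omega))
      simp only [Static.pos, Static.toState] at v2 v3
      have hle := σ.stat.run_le (τ.reg 30 + 1) (σ.stat.nx (ω.reg 25) + 1)
        (β, σ.stat.sid (τ.reg 30), σ.reg 9 + 1)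
      rw [v3] at hle
      simp only at hle
      refine (ex_jumps hbω (hT.of_frame hFω' (by omega)) (by omega) ?_ ?_ (by omega)
        (by omega)).imp ?_
      · rw [m4]; exact v1.1
      · rw [eDω]; omega
      · rintro χ w ⟨hw, hFχ, hχ⟩
        refine ⟨by omega, hFω'.trans hFχ le_rfl, ?_⟩
        rw [eDω, m11] at hχ
        rw [Static.run_append (d := τ.reg 30 + 1) (by omega) (by omega), hfst,
          Static.run_append (d := σ.stat.nx (ω.reg 25) + 1) (by omega) (by omega), v3, hχ]
    · simp only [holds_eq, eval_reg, eval_const] at h3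
      rcases ho with ⟨h0, -⟩ | ⟨-, -, ho⟩
      · omega
      simp only [Static.pos, Static.toState] at ho
      refine ex_skip ⟨by omega, hFω', ?_⟩
      rw [Static.run_append (d := τ.reg 30 + 1) (by omega) (by omega), hfst, ho]
  refine ex_seq (key.imp_bounded hbω ?_)
  rintro χ w hbχ ⟨hw, hFχ, hχ⟩
  refine ex_assign_seq (hbχ.1 _) (ex_assign_seq (by simp; exact hbχ.1 _)
    (ex_assign (by simp; exact hbχ.1 _) ?_))
  refine ⟨by omega, ⟨hFχ.1, hFχ.2.1, fun x hx h7 h8 h9 => ?_⟩, ?_⟩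
  · simp [h7, h8, h9, hFχ.2.2 x hx]
  · rw [hχ]; simp

end

end DIS

/-! ### Frames, counting loops, and the doubling of the tables. -/

namespace DIS

section

variable {α : Type u}

/-- The keys, the registers below `n`, and the arrays in `S` agree. -/
def FrameArr (n : ℕ) (S : ℕ → Prop) (σ τ : State α) : Prop :=
  τ.key = σ.key ∧ (∀ x < n, τ.reg x = σ.reg x) ∧
    ∀ i < 16, S i → ∀ k v, τ.arr i k v = σ.arr i k v

theorem FrameArr.refl (n : ℕ) (S : ℕ → Prop) (σ : State α) : FrameArr n S σ σ :=
  ⟨rfl, fun _ _ => rfl, fun _ _ _ _ _ => rfl⟩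

theorem FrameArr.trans {n m : ℕ} {S T : ℕ → Prop} {σ τ ρ : State α} (h : FrameArr n S σ τ)
    (h' : FrameArr m T τ ρ) (hn : n ≤ m) (hST : ∀ i, S i → T i) : FrameArr n S σ ρ :=
  ⟨h'.1.trans h.1, fun x hx => (h'.2.1 x (by omega)).trans (h.2.1 x hx),
    fun i hi hS k v => (h'.2.2 i hi (hST i hS) k v).trans (h.2.2 i hi hS k v)⟩

theorem FrameArr.setReg {n : ℕ} {S : ℕ → Prop} {σ τ : State α} (h : FrameArr n S σ τ) {x v : ℕ}
    (hx : n ≤ x) : FrameArr n S σ (τ.setReg x v) :=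
  ⟨h.1, fun y hy => by rw [reg_setReg, if_neg (by omega)]; exact h.2.1 y hy, h.2.2⟩

theorem FrameArr.setArr {n : ℕ} {S : ℕ → Prop} {σ τ : State α} (h : FrameArr n S σ τ)
    {i k v x : ℕ} (hi : i < 16) (hS : ¬ S i) : FrameArr n S σ (τ.setArr i k v x) :=
  ⟨h.1, h.2.1, fun j hj hSj k' v' => by
    rw [arr_setArr _ _ _ _ _ _ hi hj, if_neg (fun e : j = i ∧ k' = k ∧ v' = v => hS (e.1 ▸ hSj))]; exact h.2.2 j hj hSj k' v'⟩

theorem Frame.frameArr {n : ℕ} {S : ℕ → Prop} {σ τ : State α} (h : Frame n σ τ) :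
    FrameArr n S σ τ := ⟨h.2.1, h.2.2, fun i _ _ k v => by rw [h.arr]⟩

theorem FrameArr.sk {n : ℕ} {S : ℕ → Prop} {σ τ : State α} (h : FrameArr n S σ τ) :
    τ.sk = σ.sk := sk_congr h.1
theorem FrameArr.fk {n : ℕ} {S : ℕ → Prop} {σ τ : State α} (h : FrameArr n S σ τ) :
    τ.fk = σ.fk := fk_congr h.1

variable [LinearOrder α]

/-- A counting loop. -/
theorem ex_for {B x k n : ℕ} {e : Expr} {p : Program} (J : ℕ → State α → Prop) (hn : n ≤ B)
    (he : ∀ v τ, J v τ → e.eval τ = n ∧ τ.reg x = v)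
    (hbody : ∀ v τ, v < n → Bounded B τ → J v τ →
      Ex B p τ (fun ρ s => s ≤ k ∧ ρ.reg x = v ∧ J (v + 1) (ρ.setReg x (v + 1)))) :
    ∀ {v σ}, v ≤ n → Bounded B σ → J v σ →
      Ex B (.loop (lt (.reg x) e) (p ;; .assign x (.add (.reg x) (.const 1)))) σ
        (fun τ s => s ≤ (k + 2) * (n - v) + 1 ∧ J n τ) := by
  intro v σ hv
  induction hm : n - v generalizing v σ with
  | zero =>
    intro hb hJ
    obtain ⟨h1, h2⟩ := he v σ hJ
    have : v = n := by omega
    exact ⟨σ, 1, .loop_done (by simp [h1, h2]; omega), by omega, this ▸ hJ⟩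
  | succ m ih =>
    intro hb hJ
    obtain ⟨h1, h2⟩ := he v σ hJ
    obtain ⟨τ, s, e1, hs, hx, hJ'⟩ := hbody v σ (by omega) hb hJ
    have e2 : Steps B (.assign x (.add (.reg x) (.const 1))) τ (τ.setReg x (v + 1)) 1 := by
      have := Steps.assign (B := B) τ x (.add (.reg x) (.const 1)) (by simp [hx]; omega)
      simpa [State.setReg, hx] using this
    obtain ⟨ρ, t, e3, ht, hd⟩ := ih (v := v + 1) (σ := τ.setReg x (v + 1)) (by omega) (by omega)
      ((e1.seq e2).bounded hb) hJ'
    refine ⟨ρ, _, .loop_step (by simp [h1, h2]; omega) (e1.seq e2) e3, ?_, hd⟩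
    rw [Nat.mul_add]; omega

/-! ### Construction of the tables -/

/-- The number of levels of the tables. -/
def calcLevels : Program :=
  .assign 6 (.const 0) ;; .assign 14 (.const 1) ;;
  .loop (lt (.reg 14) (.add (.reg 4) (.const 2)))
    (.assign 14 (.add (.reg 14) (.reg 14)) ;; .assign 6 (.add (.reg 6) (.const 1)))

/-- With `2 ^ K ≥ N + 2`, a walk of `2 ^ K` steps reaches the sink from every node, which is what
starts the binary searches. The upper bound on `2 ^ K` keeps the number of levels logarithmic. -/
theorem ex_calcLevels {B : ℕ} {σ : State α} (hB : 2 * (σ.reg 4 + 2) ≤ B) :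
    Ex B calcLevels σ (fun τ s => s ≤ 3 * (σ.reg 4 + 2) + 3 ∧ τ.mem = σ.mem ∧ τ.key = σ.key ∧
      (∀ x < 13, x ≠ 6 → τ.reg x = σ.reg x) ∧ σ.reg 4 + 2 ≤ 2 ^ τ.reg 6 ∧
      2 ^ τ.reg 6 < 2 * (σ.reg 4 + 2) ∧ 1 ≤ τ.reg 6) := by
  refine ex_assign_seq (by simp) (ex_assign_seq (by simp; omega) ?_)
  let I : ℕ → State α → Prop := fun m τ => τ.mem = σ.mem ∧ τ.key = σ.key ∧
    (∀ x < 13, x ≠ 6 → τ.reg x = σ.reg x) ∧ τ.reg 14 = 2 ^ τ.reg 6 ∧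
    2 ^ τ.reg 6 < 2 * (σ.reg 4 + 2) ∧ σ.reg 4 + 2 - τ.reg 14 ≤ m
  refine (ex_while (k := 2) I ?_ (m := σ.reg 4 + 2) ?_).imp ?_
  · rintro m τ ⟨h1, h2, h3, h4, h5, h6⟩ hc
    simp only [holds_lt, eval_reg, eval_add, eval_const] at hc
    have h34 := h3 4 (by omega) (by omega)
    have hlt := Nat.lt_two_pow_self (n := τ.reg 6)
    refine ex_assign_seq (by simp; omega) (ex_assign (by simp; omega) ?_)
    refine ⟨by omega, m - 1, by omega, h1, h2, ?_, ?_, ?_, ?_⟩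
    · intro x hx hx6
      rw [reg_setReg, if_neg hx6, reg_setReg, if_neg (by omega), h3 x hx hx6]
    · simp [h4, pow_succ]; ring
    · simp [pow_succ]; omega
    · simp; omega
  · refine ⟨rfl, rfl, ?_, by simp, by simp; omega, by simp⟩
    intro x hx hx6
    rw [reg_setReg, if_neg (by omega), reg_setReg, if_neg hx6]
  · rintro τ s ⟨hs, hc, m, h1, h2, h3, h4, h5, h6⟩
    simp only [holds_lt, eval_reg, eval_add, eval_const, h3 4 (by omega) (by omega), not_lt] at hc
    refine ⟨by omega, h1, h2, h3, by omega, h5, ?_⟩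
    by_contra h0
    have : τ.reg 6 = 0 := by omega
    rw [h4, this] at hc
    omega

theorem table_one {σ : State α} {G N H : ℕ} {f ct : ℕ → ℕ} {Lb : ℕ → WithBot α → Prop}
    (h1 : ∀ v, v ≤ N + 1 → σ.arr (3 * G) 0 v = f v)
    (h2 : ∀ v x, v ≤ N + 1 → (σ.Hit (σ.arr (3 * G + 1) 0 v) x ↔ Lb v x))
    (h3 : ∀ v, v ≤ N + 1 → σ.arr (3 * G + 2) 0 v = ct v)
    (h4 : ∀ v, v ≤ N + 1 → σ.arr (3 * G + 1) 0 v ≤ H) : Table σ G N 1 H f ct Lb := by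
  refine ⟨?_, ?_, ?_, ?_⟩
  · intro k v hk hv
    obtain rfl : k = 0 := by omega
    simpa using h1 v hv
  · intro k v x hk hv
    obtain rfl : k = 0 := by omega
    simpa using h2 v x hv
  · intro k v hk hv
    obtain rfl : k = 0 := by omega
    simpa using h3 v hv
  · intro k v hk hv
    obtain rfl : k = 0 := by omega
    exact h4 v hv

/-- One entry of a level of the tables of the graph `G`. -/
def buildEntry (G : ℕ) : Program :=
  .ite (.keyLE (skA (rd (3 * G + 1) (.reg 14) (.reg 15)))
      (skA (rd (3 * G + 1) (.reg 14) (rd (3 * G) (.reg 14) (.reg 15)))))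
    (wr (3 * G + 1) (.add (.reg 14) (.const 1)) (.reg 15)
      (rd (3 * G + 1) (.reg 14) (rd (3 * G) (.reg 14) (.reg 15))))
    (wr (3 * G + 1) (.add (.reg 14) (.const 1)) (.reg 15)
      (rd (3 * G + 1) (.reg 14) (.reg 15))) ;;
  wr (3 * G + 2) (.add (.reg 14) (.const 1)) (.reg 15)
    (.add (rd (3 * G + 2) (.reg 14) (.reg 15))
      (rd (3 * G + 2) (.reg 14) (rd (3 * G) (.reg 14) (.reg 15)))) ;;
  wr (3 * G) (.add (.reg 14) (.const 1)) (.reg 15)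
    (rd (3 * G) (.reg 14) (rd (3 * G) (.reg 14) (.reg 15)))

/-- Computes the tables of the graph `G` from their level `0`. -/
def build (G : ℕ) : Program :=
  .assign 14 (.const 0) ;;
  .loop (lt (.reg 14) (.sub (.reg 6) (.const 1)))
    ((.assign 15 (.const 0) ;;
      .loop (lt (.reg 15) (.add (.reg 4) (.const 2)))
        (buildEntry G ;; .assign 15 (.add (.reg 15) (.const 1)))) ;;
      .assign 14 (.add (.reg 14) (.const 1)))

/-- The entries `(k, v)` of the tables of the graph `G` are correct. -/
structure Entry (σ : State α) (G H : ℕ) (f ct : ℕ → ℕ) (Lb : ℕ → WithBot α → Prop) (k v : ℕ) :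
    Prop where
  up : σ.arr (3 * G) k v = f^[2 ^ k] v
  hit : ∀ x, σ.Hit (σ.arr (3 * G + 1) k v) x ↔ ∃ i < 2 ^ k, Lb (f^[i] v) x
  ct : σ.arr (3 * G + 2) k v = ∑ i ∈ Finset.range (2 ^ k), ct (f^[i] v)
  lab_le : σ.arr (3 * G + 1) k v ≤ H

theorem table_iff {σ : State α} {G N K H : ℕ} {f ct : ℕ → ℕ} {Lb : ℕ → WithBot α → Prop} :
    Table σ G N K H f ct Lb ↔ ∀ k < K, ∀ v ≤ N + 1, Entry σ G H f ct Lb k v :=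
  ⟨fun h k hk v hv => ⟨h.up k v hk hv, fun x => h.hit k v x hk hv, h.ct k v hk hv,
    h.lab_le k v hk hv⟩, fun h => ⟨fun k v hk hv => (h k hk v hv).up,
    fun k v x hk hv => (h k hk v hv).hit x, fun k v hk hv => (h k hk v hv).ct,
    fun k v hk hv => (h k hk v hv).lab_le⟩⟩

theorem Entry.congr {σ τ : State α} {G H k v : ℕ} {f ct : ℕ → ℕ} {Lb : ℕ → WithBot α → Prop}
    (h : Entry σ G H f ct Lb k v) (h0 : τ.arr (3 * G) k v = σ.arr (3 * G) k v)
    (h1 : τ.arr (3 * G + 1) k v = σ.arr (3 * G + 1) k v)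
    (h2 : τ.arr (3 * G + 2) k v = σ.arr (3 * G + 2) k v) (hs : τ.sk = σ.sk) :
    Entry τ G H f ct Lb k v := by
  obtain ⟨a, b, c, d⟩ := h
  refine ⟨by rw [h0, a], ?_, by rw [h2, c], by rw [h1]; exact d⟩
  rw [h1]; unfold State.Hit at *; rw [hs]; exact b

/-- A walk of `2 ^ (k + 1)` steps is one of `2 ^ k` steps to `w` followed by another one from `w`:
ends compose, lengths add, and the later starting label is kept. All reads are from level `k` and
all writes go to level `k + 1`, so the writes do not disturb each other. -/
theorem ex_buildEntry {B G N H : ℕ} {f ct X : ℕ → ℕ} {Lb : ℕ → WithBot α → Prop} {σ : State α}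
    (hb : Bounded B σ) (hG3 : G < 3) (hG : IsGraph N f ct X) (hN : N + 1 ≤ B)
    (h0 : σ.sk 0 = ⊥) (hH : ∀ h, 1 ≤ h → h ≤ H → ⊥ < σ.sk h)
    (hv : σ.reg 15 ≤ N + 1)
    (hE : ∀ v ≤ N + 1, Entry σ G H f ct Lb (σ.reg 14) v) :
    Ex B (buildEntry G) σ (fun τ s => s ≤ 5 ∧ τ.key = σ.key ∧ τ.reg = σ.reg ∧
      (∀ i < 16, ∀ k v, ¬ ((i = 3 * G ∨ i = 3 * G + 1 ∨ i = 3 * G + 2) ∧ k = σ.reg 14 + 1 ∧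
        v = σ.reg 15) → τ.arr i k v = σ.arr i k v) ∧
      Entry τ G H f ct Lb (σ.reg 14 + 1) (σ.reg 15)) := by
  set k := σ.reg 14 with hk
  set v := σ.reg 15 with hvdef
  have hf := hG.iterate_le hv (2 ^ k)
  have E1 := hE v hv
  have E2 := hE _ hf
  set w := f^[2 ^ k] v with hw
  set l := if σ.sk (σ.arr (3 * G + 1) k v) ≤ σ.sk (σ.arr (3 * G + 1) k w) then
    σ.arr (3 * G + 1) k w else σ.arr (3 * G + 1) k v with hl
  have hl' : l ≤ H := by
    rw [hl]; split_ifs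
    · exact E2.lab_le
    · exact E1.lab_le
  have hsum : σ.arr (3 * G + 2) k v + σ.arr (3 * G + 2) k w =
      ∑ i ∈ Finset.range (2 ^ (k + 1)), ct (f^[i] v) := by
    rw [pow_succ, mul_two, sum_iterate_add, E1.ct, E2.ct]
  -- Sums of lengths are dominated by the increase of the potential, hence never exceed `N + 1`.
  have hsumB : σ.arr (3 * G + 2) k v + σ.arr (3 * G + 2) k w ≤ B := by
    rw [hsum]
    have := hG.sum_add_le hv (2 ^ (k + 1))
    have := hG.X_le _ (hG.iterate_le hv (2 ^ (k + 1)))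
    omega
  have hup : f^[2 ^ (k + 1)] v = f^[2 ^ k] w := by
    rw [pow_succ, mul_two, Function.iterate_add_apply]
  refine ex_seq (Ex.imp (Q := fun τ s => s ≤ 2 ∧ τ = σ.setArr (3 * G + 1) (k + 1) v l) ?_ ?_)
  · refine ex_ite (fun h => ?_) (fun h => ?_)
    · simp only [holds_sk_le, eval_rd, eval_reg, ← hk, ← hvdef, E1.up] at h
      refine ex_wr (hb.arr _ _ _) ⟨by omega, ?_⟩
      simp only [eval_rd, eval_reg, eval_add, eval_const, ← hk, ← hvdef, E1.up]
      rw [← hw] at h ⊢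
      rw [hl, if_pos h]
    · simp only [holds_sk_le, eval_rd, eval_reg, ← hk, ← hvdef, E1.up] at h
      refine ex_wr (hb.arr _ _ _) ⟨by omega, ?_⟩
      simp only [eval_rd, eval_reg, eval_add, eval_const, ← hk, ← hvdef]
      rw [← hw] at h
      rw [hl, if_neg h]
  · rintro τ s ⟨hs, rfl⟩
    have e1 : ∀ i j, i < 3 → (σ.setArr (3 * G + 1) (k + 1) v l).arr (3 * G + i) k j =
        σ.arr (3 * G + i) k j := fun i j hi => by
      rw [arr_setArr _ _ _ _ _ _ (by omega) (by omega), if_neg (by omega)]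
    have e10 : ∀ j, (σ.setArr (3 * G + 1) (k + 1) v l).arr (3 * G) k j = σ.arr (3 * G) k j :=
      fun j => e1 0 j (by omega)
    have e12 := fun j => e1 2 j (by omega)
    have ev : (Expr.add (rd (3 * G + 2) (.reg 14) (.reg 15))
        (rd (3 * G + 2) (.reg 14) (rd (3 * G) (.reg 14) (.reg 15)))).eval
        (σ.setArr (3 * G + 1) (k + 1) v l) =
          σ.arr (3 * G + 2) k v + σ.arr (3 * G + 2) k w := by
      simp only [eval_add, eval_rd, eval_reg, reg_setArr, ← hk, ← hvdef, e10, e12, E1.up, hw]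
    refine ex_wr_seq (by rw [ev]; exact hsumB) ?_
    rw [ev]
    simp only [eval_add, eval_reg, eval_const, reg_setArr, ← hk, ← hvdef]
    generalize hτ : State.setArr (State.setArr _ _ _ _ _) _ _ _ _ = τ
    have t1 : ∀ i j c, i < 16 → τ.arr i j c = if i = 3 * G + 2 ∧ j = k + 1 ∧ c = v then
        σ.arr (3 * G + 2) k v + σ.arr (3 * G + 2) k w else
        if i = 3 * G + 1 ∧ j = k + 1 ∧ c = v then l else σ.arr i j c := by
      intro i j c hi
      rw [← hτ, arr_setArr _ _ _ _ _ _ (by omega) hi, arr_setArr _ _ _ _ _ _ (by omega) hi]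
    have hreg : τ.reg = σ.reg := by rw [← hτ]; rfl
    have hkey : τ.key = σ.key := by rw [← hτ]; rfl
    have ev2 : (rd (3 * G) (.reg 14) (rd (3 * G) (.reg 14) (.reg 15))).eval τ =
        f^[2 ^ (k + 1)] v := by
      simp only [eval_rd, eval_reg, hreg, ← hk, ← hvdef]
      rw [t1 _ _ _ (by omega), t1 _ _ _ (by omega), if_neg (by omega), if_neg (by omega),
        if_neg (by omega), if_neg (by omega), E1.up, ← hw, E2.up, hup]
    refine ex_wr ?_ ?_
    · rw [ev2]; exact (hG.iterate_le hv _).trans hN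
    · rw [ev2]
      simp only [eval_add, eval_reg, eval_const, hreg, ← hk, ← hvdef]
      have t2 : ∀ i j c, i < 16 → (τ.setArr (3 * G) (k + 1) v (f^[2 ^ (k + 1)] v)).arr i j c =
          if i = 3 * G ∧ j = k + 1 ∧ c = v then f^[2 ^ (k + 1)] v else τ.arr i j c :=
        fun i j c hi => arr_setArr _ _ _ _ _ _ (by omega) hi
      refine ⟨by omega, hkey, hreg, ?_, ?_⟩
      · intro i hi k' v' hne
        rw [t2 _ _ _ hi, t1 _ _ _ hi, if_neg (by tauto), if_neg (by tauto), if_neg (by tauto)]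
      · refine ⟨?_, ?_, ?_, ?_⟩
        · rw [t2 _ _ _ (by omega), if_pos ⟨rfl, rfl, rfl⟩]
        · rw [t2 _ _ _ (by omega), if_neg (by omega), t1 _ _ _ (by omega), if_neg (by omega),
            if_pos ⟨rfl, rfl, rfl⟩]
          intro x
          have : (τ.setArr (3 * G) (k + 1) v (f^[2 ^ (k + 1)] v)).Hit l x ↔ σ.Hit l x := by
            unfold State.Hit; rw [sk_setArr, sk_congr hkey]
          rw [this, hl, hit_max σ h0 (fun h1 => hH _ h1 E1.lab_le), E1.hit, E2.hit, pow_succ,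
            mul_two, exists_lt_add]
          simp only [hw, Nat.add_comm (2 ^ k), Function.iterate_add_apply]
        · rw [t2 _ _ _ (by omega), if_neg (by omega), t1 _ _ _ (by omega),
            if_pos ⟨rfl, rfl, rfl⟩, hsum]
        · rw [t2 _ _ _ (by omega), if_neg (by omega), t1 _ _ _ (by omega), if_neg (by omega),
            if_pos ⟨rfl, rfl, rfl⟩]
          exact hl'

/-- The tables that do not belong to the graph `G`, and their levels `0`. -/
def FrameTable (G : ℕ) (σ τ : State α) : Prop :=
  FrameArr 13 (fun i => ¬ (i = 3 * G ∨ i = 3 * G + 1 ∨ i = 3 * G + 2)) σ τ ∧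
    ∀ i < 16, ∀ v, τ.arr i 0 v = σ.arr i 0 v

theorem ex_build {B G H : ℕ} {f ct X : ℕ → ℕ} {Lb : ℕ → WithBot α → Prop} {σ : State α}
    (hb : Bounded B σ) (hG3 : G < 3) (hG : IsGraph (σ.reg 4) f ct X) (hN : σ.reg 4 + 2 ≤ B)
    (h0 : σ.sk 0 = ⊥) (hH : ∀ h, 1 ≤ h → h ≤ H → ⊥ < σ.sk h) (hK : 1 ≤ σ.reg 6)
    (hT : Table σ G (σ.reg 4) 1 H f ct Lb) :
    Ex B (build G) σ (fun τ s => s ≤ 20 * (σ.reg 6 * (σ.reg 4 + 2)) ∧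
      FrameTable G σ τ ∧ Table τ G (σ.reg 4) (σ.reg 6) H f ct Lb) := by
  set N := σ.reg 4 with hNdef
  set K := σ.reg 6 with hKdef
  have hKB : K ≤ B := hb.1 6
  let J : ℕ → State α → Prop := fun k τ => FrameTable G σ τ ∧ τ.reg 14 = k ∧
    Table τ G N (k + 1) H f ct Lb
  refine ex_assign_seq (by simp) ((ex_for (n := K - 1) (k := 7 * (N + 2) + 2) J (by omega) ?_ ?_
    (v := 0) (by omega) ?_ ?_).imp ?_)
  · rintro v τ ⟨hF, h14, -⟩
    exact ⟨by simp [hF.1.2.1 6 (by omega), ← hKdef], h14⟩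
  · rintro k τ hk hbτ ⟨hF, h14, hTk⟩
    let I : ℕ → State α → Prop := fun v ρ => FrameTable G σ ρ ∧ ρ.reg 14 = k ∧ ρ.reg 15 = v ∧
      Table ρ G N (k + 1) H f ct Lb ∧ ∀ v' < v, Entry ρ G H f ct Lb (k + 1) v'
    refine ex_assign_seq (by simp) ((ex_for (n := N + 2) (k := 5) I (by omega) ?_ ?_
      (v := 0) (by omega) (hbτ.update_reg (by simp)) ?_).imp ?_)
    · rintro v ρ ⟨hFρ, -, h15, -⟩
      exact ⟨by simp [hFρ.1.2.1 4 (by omega), ← hNdef], h15⟩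
    · rintro v ρ hv hbρ ⟨hFρ, g14, g15, hTρ, hE⟩
      have hsk := hFρ.1.sk
      rw [table_iff] at hTρ
      refine (ex_buildEntry hbρ hG3 hG (by omega) (by rw [hsk]; exact h0)
        (by rw [hsk]; exact hH) (by omega) (fun v' hv' => hTρ _ (by omega) v' hv')).imp ?_
      rintro ω s ⟨hs, k1, k2, k3, k4⟩
      rw [g14, g15] at k3 k4
      refine ⟨hs, by rw [k2, g15], ?_, by simp [k2, g14], by simp, ?_, ?_⟩
      · refine ⟨⟨k1.trans hFρ.1.1, fun x hx => ?_, fun i hi hS k' v' => ?_⟩, fun i hi v' => ?_⟩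
        · rw [reg_setReg, if_neg (by omega), k2, hFρ.1.2.1 x hx]
        · rw [arr_setReg, k3 i hi _ _ (fun h => hS h.1), hFρ.1.2.2 i hi hS]
        · rw [arr_setReg, k3 i hi _ _ (by omega), hFρ.2 i hi]
      · rw [table_iff]
        intro k' hk' v' hv'
        refine (hTρ k' hk' v' hv').congr ?_ ?_ ?_ (sk_congr k1) <;>
        · rw [arr_setReg]; exact k3 _ (by omega) _ _ (by omega)
      · intro v' hv'
        by_cases hvv : v' = v
        · subst hvv
          exact k4.congr rfl rfl rfl rfl
        · refine (hE v' (by omega)).congr ?_ ?_ ?_ (sk_congr k1) <;>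
          · rw [arr_setReg]; exact k3 _ (by omega) _ _ (by omega)
    · refine ⟨⟨hF.1.setReg (by omega), hF.2⟩, by simp [h14], by simp, ?_, by simp⟩
      rw [table_iff] at hTk ⊢
      exact fun k' hk' v' hv' => (hTk k' hk' v' hv').congr rfl rfl rfl rfl
    · rintro ρ s ⟨hs, hFρ, g14, g15, hTρ, hE⟩
      refine ⟨by omega, g14, ⟨hFρ.1.setReg (by omega), hFρ.2⟩, by simp, ?_⟩
      rw [table_iff] at hTρ ⊢
      intro k' hk' v' hv'
      by_cases hkk : k' = k + 1
      · subst hkk; exact (hE v' (by omega)).congr rfl rfl rfl rfl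
      · exact (hTρ k' (by omega) v' hv').congr rfl rfl rfl rfl
  · exact hb.update_reg (by simp)
  · refine ⟨⟨(FrameArr.refl _ _ σ).setReg (by omega), fun _ _ _ => rfl⟩, by simp, ?_⟩
    rw [table_iff] at hT ⊢
    exact fun k' hk' v' hv' => (hT k' hk' v' hv').congr rfl rfl rfl rfl
  · rintro τ s ⟨hs, hF, h14, hTτ⟩
    rw [Nat.sub_add_cancel hK] at hTτ
    refine ⟨?_, hF, hTτ⟩
    obtain ⟨K', hK'⟩ : ∃ K', K = K' + 1 := ⟨K - 1, by omega⟩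
    rw [hK'] at hs ⊢
    simp only [Nat.add_sub_cancel, Nat.sub_zero] at hs
    nlinarith

end

end DIS

/-! ### Level zero of the three tables: successors, chains, jumps. -/

namespace DIS

section

variable {α : Type u}

theorem FrameArr.mono {n m : ℕ} {S T : ℕ → Prop} {σ τ : State α} (h : FrameArr n S σ τ)
    (hm : m ≤ n) (hST : ∀ i, T i → S i) : FrameArr m T σ τ :=
  ⟨h.1, fun x hx => h.2.1 x (by omega), fun i hi hT => h.2.2 i hi (hST i hT)⟩

theorem FrameArr.arr_row {n i : ℕ} {S : ℕ → Prop} {σ τ : State α} (h : FrameArr n S σ τ)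
    (hi : i < 16) (hS : S i) (k : ℕ) : τ.arr i k = σ.arr i k := funext (h.2.2 i hi hS k)

theorem stat_congr {σ τ : State α} (hk : τ.key = σ.key) (h4 : τ.reg 4 = σ.reg 4)
    (h3 : τ.arr 3 0 = σ.arr 3 0) (h9 : τ.arr 9 0 = σ.arr 9 0) : τ.stat = σ.stat := by
  simp only [State.stat, sk_congr hk, fk_congr hk, h4, h3, h9]

variable [LinearOrder α]

theorem Table.congr {σ τ : State α} {G N K H : ℕ} {f ct : ℕ → ℕ} {Lb : ℕ → WithBot α → Prop}
    (h : Table σ G N K H f ct Lb)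
    (ha : ∀ i, i = 3 * G ∨ i = 3 * G + 1 ∨ i = 3 * G + 2 → ∀ k v, τ.arr i k v = σ.arr i k v)
    (hk : τ.key = σ.key) : Table τ G N K H f ct Lb := by
  rw [table_iff] at h ⊢
  exact fun k hk' v hv => (h k hk' v hv).congr (ha _ (by omega) _ _) (ha _ (by omega) _ _)
    (ha _ (by omega) _ _) (sk_congr hk)

/-- The successors of the positions, with the jobs as labels. -/
def fillSucc : Program :=
  .assign 15 (.const 0) ;;
  .loop (lt (.reg 15) (.add (.reg 4) (.const 2)))
    ((wr 0 (.const 0) (.reg 15)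
        (.sub (.add (.reg 15) (.const 1)) (.sub (.reg 15) (.reg 4))) ;;
      wr 2 (.const 0) (.reg 15) (.sub (.const 1) (.sub (.reg 15) (.reg 4))) ;;
      .ite (lt (.reg 15) (.reg 4)) (wr 1 (.const 0) (.reg 15) (sidE (.reg 15)))
        (wr 1 (.const 0) (.reg 15) (.const 0))) ;;
      .assign 15 (.add (.reg 15) (.const 1)))

/-- Truncated subtraction treats the sink without a case distinction: for `v ≤ N + 1`, the
expression `v + 1 - (v - N)` is `min (v + 1) (N + 1)`, and `1 - (v - N)` vanishes only at `v = N +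
1`. -/
theorem ex_fillSucc {B H : ℕ} {σ : State α} (hb : Bounded B σ) (hN : σ.reg 4 + 2 ≤ B)
    (h1 : ∀ v, v < σ.reg 4 → 1 ≤ σ.arr 9 0 v) (h2 : ∀ v, v < σ.reg 4 → σ.arr 9 0 v ≤ H) :
    Ex B fillSucc σ (fun τ s => s ≤ 6 * (σ.reg 4 + 2) + 2 ∧
      FrameArr 13 (fun i => 3 ≤ i) σ τ ∧
      Table τ 0 (σ.reg 4) 1 H (succTo (σ.reg 4)) (unitTo (σ.reg 4))
        (fun v x => v < σ.reg 4 ∧ x ≤ σ.sk (σ.arr 9 0 v))) := by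
  set N := σ.reg 4 with hNdef
  let J : ℕ → State α → Prop := fun v τ => FrameArr 13 (fun i => 3 ≤ i) σ τ ∧ τ.reg 15 = v ∧
    ∀ v' < v, τ.arr 0 0 v' = succTo N v' ∧ τ.arr 2 0 v' = unitTo N v' ∧
      τ.arr 1 0 v' = if v' < N then σ.arr 9 0 v' else 0
  refine ex_assign_seq (by simp) ((ex_for (n := N + 2) (k := 4) J (by omega) ?_ ?_
    (v := 0) (by omega) (hb.update_reg (by simp)) ?_).imp ?_)
  · rintro v τ ⟨hF, h15, -⟩
    exact ⟨by simp [hF.2.1 4 (by omega), ← hNdef], h15⟩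
  · rintro v τ hv hbτ ⟨hF, h15, hE⟩
    have h4 := hF.2.1 4 (by omega)
    rw [← hNdef] at h4
    have upd : ∀ l, (l = if v < N then σ.arr 9 0 v else 0) →
        J (v + 1) ((((τ.setArr 0 0 v (v + 1 - (v - N))).setArr 2 0 v (1 - (v - N))).setArr 1 0 v
          l).setReg 15 (v + 1)) := by
      intro l hl
      refine ⟨(((hF.setArr (by omega) (by omega)).setArr (by omega) (by omega)).setArr (by omega)
        (by omega)).setReg (by omega), by simp, fun v' hv' => ?_⟩
      simp only [arr_setReg, arr_setArr _ _ _ _ _ _ (show (1 : ℕ) < 16 by omega) (show (0 : ℕ) < 16 by omega),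
        arr_setArr _ _ _ _ _ _ (show (1 : ℕ) < 16 by omega) (show (1 : ℕ) < 16 by omega),
        arr_setArr _ _ _ _ _ _ (show (1 : ℕ) < 16 by omega) (show (2 : ℕ) < 16 by omega),
        arr_setArr _ _ _ _ _ _ (show (2 : ℕ) < 16 by omega) (show (0 : ℕ) < 16 by omega),
        arr_setArr _ _ _ _ _ _ (show (2 : ℕ) < 16 by omega) (show (1 : ℕ) < 16 by omega),
        arr_setArr _ _ _ _ _ _ (show (2 : ℕ) < 16 by omega) (show (2 : ℕ) < 16 by omega),
        arr_setArr _ _ _ _ _ _ (show (0 : ℕ) < 16 by omega) (show (0 : ℕ) < 16 by omega),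
        arr_setArr _ _ _ _ _ _ (show (0 : ℕ) < 16 by omega) (show (1 : ℕ) < 16 by omega),
        arr_setArr _ _ _ _ _ _ (show (0 : ℕ) < 16 by omega) (show (2 : ℕ) < 16 by omega)]
      by_cases hvv : v' = v
      · subst hvv
        simp only [hl, succTo, unitTo]
        norm_num
        constructor
        · omega
        · split_ifs <;> omega
      · simp [hvv]
        exact hE v' (by omega)
    refine ex_wr_seq (by simp [h15, h4]; omega) (ex_wr_seq (by simp; omega)
      (ex_ite (fun h => ?_) (fun h => ?_)))
    · simp only [holds_lt, eval_reg, reg_setArr, h15, h4] at h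
      refine ex_wr ?_ ?_
      · simp only [sidE, eval_rd]
        rw [arr_setArr _ _ _ _ _ _ (by omega) (by omega), if_neg (by omega),
          arr_setArr _ _ _ _ _ _ (by omega) (by omega), if_neg (by omega)]
        exact hbτ.arr _ _ _
      refine ⟨by omega, by simp [h15], ?_⟩
      simp only [eval_sub, eval_add, eval_reg, eval_const, reg_setArr, h15, h4, sidE, eval_rd,
        arr_setArr _ _ _ _ _ _ (show (2 : ℕ) < 16 by omega) (show (9 : ℕ) < 16 by omega),
        arr_setArr _ _ _ _ _ _ (show (0 : ℕ) < 16 by omega) (show (9 : ℕ) < 16 by omega)]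
      refine upd _ ?_
      rw [if_pos h, if_neg (by omega), if_neg (by omega)]
      exact hF.2.2 9 (by omega) (by omega) _ _
    · simp only [holds_lt, eval_reg, reg_setArr, h15, h4] at h
      refine ex_wr (by simp) ?_
      refine ⟨by omega, by simp [h15], ?_⟩
      simp only [eval_sub, eval_add, eval_reg, eval_const, reg_setArr, h15, h4]
      exact upd _ (by rw [if_neg h])
  · exact ⟨(FrameArr.refl _ _ σ).setReg (by omega), by simp, by simp⟩
  · rintro τ s ⟨hs, hF, h15, hE⟩
    refine ⟨by omega, hF, table_one ?_ ?_ ?_ ?_⟩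
    · exact fun v hv => (hE v (by omega)).1
    · intro v x hv
      rw [(hE v (by omega)).2.2]
      unfold State.Hit
      rw [hF.sk]
      split_ifs with h
      · simp [h, h1 v h]
      · simp [h]
    · exact fun v hv => (hE v (by omega)).2.1
    · intro v hv
      rw [(hE v (by omega)).2.2]
      split_ifs with h
      · exact h2 v h
      · omega

/-- The next jobs on one machine, labelled with a job between that starts as late as possible. -/
def fillChain : Program :=
  .assign 15 (.const 0) ;;
  .loop (lt (.reg 15) (.add (.reg 4) (.const 2)))
    ((wr 5 (.const 0) (.reg 15) (.sub (.const 1) (.sub (.reg 15) (.reg 4))) ;;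
      .ite (lt (.reg 15) (.reg 4))
        (.assign 30 (.add (.reg 15) (.const 1)) ;; .assign 31 (sidE (.reg 15)) ;;
          .assign 32 (.const 0) ;; .assign 33 (.reg 4) ;; search 0 id ;;
          wr 3 (.const 0) (.reg 15) (.reg 30) ;; wr 4 (.const 0) (.reg 15) (.reg 34))
        (wr 3 (.const 0) (.reg 15) (.add (.reg 4) (.const 1)) ;;
          wr 4 (.const 0) (.reg 15) (.const 0))) ;;
      .assign 15 (.add (.reg 15) (.const 1)))

/-- The values `w` and `l` are the successor of the position `v` and its label. -/
structure NextAt (σ : State α) (H v w l : ℕ) : Prop where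
  lt : v < σ.reg 4 → v < w
  le : v < σ.reg 4 → w ≤ σ.reg 4
  eq_top : σ.reg 4 ≤ v → w = σ.reg 4 + 1
  not_fits : v < σ.reg 4 → ∀ j, v < j → j < w → ¬ σ.fk (σ.arr 9 0 v) ≤ σ.sk (σ.arr 9 0 j)
  fits : v < σ.reg 4 → w < σ.reg 4 → σ.fk (σ.arr 9 0 v) ≤ σ.sk (σ.arr 9 0 w)
  hit : ∀ x, σ.Hit l x ↔ ∃ j, v < j ∧ j < w ∧ j < σ.reg 4 ∧ x ≤ σ.sk (σ.arr 9 0 j)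
  lab_le : l ≤ H

/-- One search in the successor graph from `v + 1` serves two purposes: its end is the first job
that fits after `v`, or `N`, and the label of the traversed path is the latest starting job strictly
in between, or `0`. -/
theorem ex_fillChain {B H : ℕ} {σ : State α} (hb : Bounded B σ) (hN : σ.reg 4 + 2 ≤ B)
    (pow : σ.reg 4 + 2 ≤ 2 ^ σ.reg 6) (sk_zero : σ.sk 0 = ⊥)
    (bot_lt : ∀ h, 1 ≤ h → h ≤ H → ⊥ < σ.sk h)
    (succ : Table σ 0 (σ.reg 4) (σ.reg 6) H (succTo (σ.reg 4)) (unitTo (σ.reg 4))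
      (fun v x => v < σ.reg 4 ∧ x ≤ σ.sk (σ.arr 9 0 v))) :
    Ex B fillChain σ (fun τ s => s ≤ (12 * σ.reg 6 + 14) * (σ.reg 4 + 2) + 2 ∧
      FrameArr 13 (fun i => i < 3 ∨ 6 ≤ i) σ τ ∧ τ.stat.IsNext ∧
      Table τ 1 (σ.reg 4) 1 H τ.stat.nx (unitTo (σ.reg 4)) τ.stat.Between) := by
  set N := σ.reg 4 with hNdef
  let J : ℕ → State α → Prop := fun v τ => FrameArr 13 (fun i => i < 3 ∨ 6 ≤ i) σ τ ∧
    τ.reg 15 = v ∧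
    ∀ v' < v, τ.arr 5 0 v' = unitTo N v' ∧ NextAt σ H v' (τ.arr 3 0 v') (τ.arr 4 0 v')
  refine ex_assign_seq (by simp) ((ex_for (n := N + 2) (k := 12 * σ.reg 6 + 12) J (by omega) ?_ ?_
    (v := 0) (by omega) (hb.update_reg (by simp)) ?_).imp ?_)
  · rintro v τ ⟨hF, h15, -⟩
    exact ⟨by simp [hF.2.1 4 (by omega), ← hNdef], h15⟩
  · rintro v τ hv hbτ ⟨hF, h15, hE⟩
    have h4 := hF.2.1 4 (by omega)
    rw [← hNdef] at h4
    have upd : ∀ (ρ : State α) w l, FrameArr 13 (fun i => i < 3 ∨ 6 ≤ i) σ ρ →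
        (∀ k v', ρ.arr 3 k v' = τ.arr 3 k v') → (∀ k v', ρ.arr 4 k v' = τ.arr 4 k v') →
        (∀ v', ρ.arr 5 0 v' = if v' = v then 1 - (v - N) else τ.arr 5 0 v') →
        NextAt σ H v w l →
        J (v + 1) (((ρ.setArr 3 0 v w).setArr 4 0 v l).setReg 15 (v + 1)) := by
      intro ρ w l hFρ e3 e4 e5 hn
      refine ⟨((hFρ.setArr (by omega) (by omega)).setArr (by omega) (by omega)).setReg (by omega),
        by simp, fun v' hv' => ?_⟩
      simp only [arr_setReg,
        arr_setArr _ _ _ _ _ _ (show (3 : ℕ) < 16 by omega) (show (3 : ℕ) < 16 by omega),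
        arr_setArr _ _ _ _ _ _ (show (3 : ℕ) < 16 by omega) (show (4 : ℕ) < 16 by omega),
        arr_setArr _ _ _ _ _ _ (show (3 : ℕ) < 16 by omega) (show (5 : ℕ) < 16 by omega),
        arr_setArr _ _ _ _ _ _ (show (4 : ℕ) < 16 by omega) (show (3 : ℕ) < 16 by omega),
        arr_setArr _ _ _ _ _ _ (show (4 : ℕ) < 16 by omega) (show (4 : ℕ) < 16 by omega),
        arr_setArr _ _ _ _ _ _ (show (4 : ℕ) < 16 by omega) (show (5 : ℕ) < 16 by omega),
        e3, e4, e5]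
      by_cases hvv : v' = v
      · subst hvv
        simp only [unitTo]
        norm_num
        refine ⟨?_, hn⟩
        split_ifs <;> omega
      · simp [hvv]
        exact hE v' (by omega)
    refine ex_wr_seq (by simp; omega) ?_
    simp only [eval_sub, eval_reg, eval_const, h15, h4]
    generalize hρ : State.setArr _ _ _ _ _ = ρ
    have hFρ : FrameArr 13 (fun i => i < 3 ∨ 6 ≤ i) σ ρ := by
      rw [← hρ]; exact hF.setArr (by omega) (by omega)
    have g15 : ρ.reg 15 = v := by rw [← hρ]; exact h15
    have g4 : ρ.reg 4 = N := by rw [← hρ]; exact h4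
    have g6 : ρ.reg 6 = σ.reg 6 := hFρ.2.1 6 (by omega)
    have a3 : ∀ k v', ρ.arr 3 k v' = τ.arr 3 k v' := fun k v' => by
      rw [← hρ, arr_setArr _ _ _ _ _ _ (by omega) (by omega), if_neg (by omega)]
    have a4 : ∀ k v', ρ.arr 4 k v' = τ.arr 4 k v' := fun k v' => by
      rw [← hρ, arr_setArr _ _ _ _ _ _ (by omega) (by omega), if_neg (by omega)]
    have a5 : ∀ v', ρ.arr 5 0 v' = if v' = v then 1 - (v - N) else τ.arr 5 0 v' := fun v' => by
      rw [← hρ, arr_setArr _ _ _ _ _ _ (by omega) (by omega)]; simp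
    have a9 : ρ.arr 9 0 = σ.arr 9 0 := hFρ.arr_row (by omega) (by omega) 0
    have hbρ : Bounded B ρ := by
      rw [← hρ]; exact hbτ.update_mem (by omega)
    refine ex_ite (fun h => ?_) (fun h => ?_)
    · simp only [holds_lt, eval_reg, g15, g4] at h
      refine ex_assign_seq (by simp [g15]; omega) (ex_assign_seq (by exact hbρ.arr _ _ _)
        (ex_assign_seq (by simp) (ex_assign_seq (by simp [g4]; omega) ?_)))
      simp only [eval_add, eval_reg, eval_const, sidE, eval_rd, reg_setReg, arr_setReg, g15, g4,
        Nat.reduceEqDiff, if_false]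
      generalize hπ : State.setReg _ 33 _ = π
      have hFπ : Frame 30 ρ π := by
        rw [← hπ]
        exact ((((Frame.refl 30 ρ).setReg (by omega)).setReg (by omega)).setReg (by omega)).setReg
          (by omega)
      have p4 : π.reg 4 = N := (hFπ.2.2 4 (by omega)).trans g4
      have p6 : π.reg 6 = σ.reg 6 := (hFπ.2.2 6 (by omega)).trans g6
      have p15 : π.reg 15 = v := (hFπ.2.2 15 (by omega)).trans g15
      have p30 : π.reg 30 = v + 1 := by rw [← hπ]; simp
      have p31 : π.reg 31 = σ.arr 9 0 v := by rw [← hπ]; simp [a9]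
      have p32 : π.reg 32 = 0 := by rw [← hπ]; simp
      have p33 : π.reg 33 = N := by rw [← hπ]; simp
      have pkey : π.key = σ.key := hFπ.2.1.trans hFρ.1
      have parr : π.arr = ρ.arr := hFπ.arr
      have hbπ : Bounded B π := by
        rw [← hπ]
        exact (((hbρ.update_reg (by omega)).update_reg (hbρ.arr _ _ _)).update_reg
          (by omega)).update_reg (by omega)
      have hT : Table π 0 N (σ.reg 6) H (succTo N) (unitTo N)
          (fun v x => v < N ∧ x ≤ σ.sk (σ.arr 9 0 v)) :=
        succ.congr (fun i hi k v => by
          rw [parr]; exact hFρ.2.2 i (by omega) (by omega) k v) pkey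
      refine ex_seq ((ex_search_succ (H := H) hbπ (by rw [p4, p6]; exact pow)
        (by rw [sk_congr pkey]; exact sk_zero) (by rw [sk_congr pkey]; exact bot_lt)
        (by rw [p4, p6, sk_congr pkey, parr, a9]; exact hT)
        (by omega) (by omega) (by omega)).imp_bounded hbπ ?_)
      rintro ω s hbω ⟨hs, hFω, q1, q2, q3, q4, q5, q6⟩
      have w15 : ω.reg 15 = v := (hFω.2.2 15 (by omega)).trans p15
      have warr : ω.arr = ρ.arr := hFω.arr.trans parr
      have hFω' : FrameArr 13 (fun i => i < 3 ∨ 6 ≤ i) σ ω :=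
        ((hFρ.trans (hFπ.frameArr (S := fun _ => True)) (by omega) (fun _ _ => trivial)).trans
          (hFω.frameArr (S := fun _ => True)) (by omega) (by simp)).mono (by omega) (by simp)
      have pfit : ∀ j, π.stat.Fits (σ.arr 9 0 v) j ↔
          σ.fk (σ.arr 9 0 v) ≤ σ.sk (σ.arr 9 0 j) := by
        intro j
        simp only [Static.Fits, State.stat, sk_congr pkey, fk_congr pkey, parr, a9]
      rw [p31] at q3 q4
      rw [p30] at q1 q3 q5
      rw [p33] at q2 q4
      rw [sk_congr pkey, parr, a9] at q5
      refine ex_wr_seq (hbω.1 _) (ex_wr (hbω.1 _) ?_)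
      simp only [eval_reg, eval_const, w15, reg_setArr]
      rw [p6] at hs
      refine ⟨by omega, trivial, upd ω _ _ hFω' (fun k v' => by rw [warr, a3])
        (fun k v' => by rw [warr, a4]) (fun v' => by rw [warr, a5]) ?_⟩
      refine ⟨fun _ => by omega, fun _ => by omega, fun h' => by omega, fun _ j hj hj' hf => ?_,
        fun _ hw => ?_, fun x => ?_, q6⟩
      · exact q3 j (by omega) hj' ((pfit j).2 hf)
      · exact (pfit _).1 (q4 hw)
      · have := q5 x
        unfold State.Hit at this ⊢
        rw [sk_congr pkey] at this
        rw [this]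
        exact ⟨fun ⟨j, h1, h2, h3⟩ => ⟨j, by omega, h2, by omega, h3⟩,
          fun ⟨j, h1, h2, _, h3⟩ => ⟨j, by omega, h2, h3⟩⟩
    · simp only [holds_lt, eval_reg, g15, g4] at h
      refine ex_wr_seq (by simp [g4]; omega) (ex_wr (by simp) ?_)
      simp only [eval_reg, eval_const, eval_add, reg_setArr, g15, g4]
      refine ⟨by omega, trivial, upd ρ _ _ hFρ a3 a4 a5 ?_⟩
      exact ⟨fun h' => absurd h' h, fun h' => absurd h' h, fun _ => rfl, fun h' => absurd h' h,
        fun h' => absurd h' h, fun x => ⟨fun h' => absurd h' (hit_zero σ x),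
          fun ⟨j, h1, h2, h3, _⟩ => by omega⟩, by omega⟩
  · exact ⟨(FrameArr.refl _ _ σ).setReg (by omega), by simp, by simp⟩
  · rintro τ s ⟨hs, hF, h15, hE⟩
    have h4 : τ.stat.N = N := hF.2.1 4 (by omega)
    have enx : ∀ v, τ.stat.nx v = τ.arr 3 0 v := fun _ => rfl
    have e9 : τ.stat.sid = σ.arr 9 0 := hF.arr_row (by omega) (by omega) 0
    have es : τ.stat.s = σ.sk := hF.sk
    have ef : τ.stat.f = σ.fk := hF.fk
    refine ⟨by rw [Nat.sub_zero] at hs; linarith, hF, ?_, table_one ?_ ?_ ?_ ?_⟩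
    · refine ⟨?_, ?_, ?_, ?_, ?_⟩ <;> simp only [Static.Fits, h4, enx, e9, es, ef]
      · exact fun v hv => (hE v (by omega)).2.lt hv
      · exact fun v hv => (hE v (by omega)).2.le hv
      · exact fun v hv hv' => (hE v (by omega)).2.eq_top hv
      · exact fun v j hv => (hE v (by omega)).2.not_fits hv j
      · exact fun v hv => (hE v (by omega)).2.fits hv
    · exact fun v hv => rfl
    · intro v x hv
      unfold Static.Between
      simp only [h4, enx, e9, es]
      rw [← (hE v (by omega)).2.hit]
      unfold State.Hit
      rw [hF.sk]
    · exact fun v hv => (hE v (by omega)).1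
    · exact fun v hv => (hE v (by omega)).2.lab_le

/-- The jumps between the nodes. -/
def fillJump : Program :=
  .assign 15 (.const 0) ;;
  .loop (lt (.reg 15) (.add (.reg 4) (.const 2)))
    ((wr 7 (.const 0) (.reg 15) (.const 0) ;;
      .assign 25 (.add (.reg 4) (.sub (.const 1) (.sub (.reg 4) (.reg 15)))) ;;
      .assign 22 (.const 0) ;;
      .ite (lt (nxE (.reg 15)) (.reg 4))
        (.assign 20 (sidE (.reg 15)) ;; .assign 21 (nxE (.reg 15)) ;; .assign 23 (.reg 4) ;;
          advance ;;
          .ite (eq (.reg 24) (.const 0)) (.assign 25 (.reg 4) ;; .assign 22 (.const 0)) .skip)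
        .skip ;;
      wr 6 (.const 0) (.reg 15) (.reg 25) ;; wr 8 (.const 0) (.reg 15) (.reg 22)) ;;
      .assign 15 (.add (.reg 15) (.const 1)))

/-- The values `w` and `n` are the target and the length of the jump from `u`. -/
structure JumpAt (D : Static (WithBot α)) (u w n : ℕ) : Prop where
  le : u < D.N → w ≤ D.N
  eq_top : D.N ≤ u → w = D.N + 1
  ct_eq : D.N ≤ w → n = 0
  nx_lt : w < D.N → D.nx w < D.N ∧ D.nx u < D.N
  reach : w < D.N → D.Reach (.A (D.sid u) (D.nx u) 0) (.Nd w n)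
  not_reach : D.nx u < D.N → w = D.N → ∀ u' n, ¬ D.Reach (.A (D.sid u) (D.nx u) 0) (.Nd u' n)

/-- The jump from `u` is found by `advance` with limit `N`, which uses only the first two graphs.
The default target `N + (1 - (N - u))` is `N` for a position of a job, meaning that no node follows,
and `N + 1` for the two auxiliary nodes. -/
theorem ex_fillJump {B H : ℕ} {σ : State α} (hb : Bounded B σ) (hN : 3 * σ.reg 4 + 8 ≤ B)
    (hC : Chains σ H) :
    Ex B fillJump σ (fun τ s => s ≤ (32 * σ.reg 6 + 80) * (σ.reg 4 + 2) + 2 ∧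
      FrameArr 13 (fun i => i < 6 ∨ 9 ≤ i) σ τ ∧ σ.stat.IsJump (τ.arr 6 0) (τ.arr 8 0) ∧
      Table τ 2 (σ.reg 4) 1 H (τ.arr 6 0) (τ.arr 8 0) (fun _ _ => False)) := by
  set N := σ.reg 4 with hNdef
  have hDN : σ.stat.N = N := rfl
  have hD := hC.next
  have hsort := hC.sorted
  let J : ℕ → State α → Prop := fun v τ => FrameArr 13 (fun i => i < 6 ∨ 9 ≤ i) σ τ ∧
    τ.reg 15 = v ∧
    ∀ v' < v, τ.arr 7 0 v' = 0 ∧ JumpAt σ.stat v' (τ.arr 6 0 v') (τ.arr 8 0 v')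
  refine ex_assign_seq (by simp) ((ex_for (n := N + 2) (k := 32 * σ.reg 6 + 78) J (by omega) ?_ ?_
    (v := 0) (by omega) (hb.update_reg (by simp)) ?_).imp ?_)
  · rintro v τ ⟨hF, h15, -⟩
    exact ⟨by simp [hF.2.1 4 (by omega), ← hNdef], h15⟩
  · rintro v τ hv hbτ ⟨hF, h15, hE⟩
    have h4 := hF.2.1 4 (by omega)
    rw [← hNdef] at h4
    refine ex_wr_seq (by simp) (ex_assign_seq (by simp [h4]; omega) (ex_assign_seq (by simp) ?_))
    simp only [eval_add, eval_sub, eval_reg, eval_const, reg_setArr, h15, h4]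
    generalize hρ : State.setReg _ 22 _ = ρ
    have hFρ : FrameArr 13 (fun i => i < 6 ∨ 9 ≤ i) σ ρ := by
      rw [← hρ]; exact ((hF.setArr (by omega) (by omega)).setReg (by omega)).setReg (by omega)
    have g15 : ρ.reg 15 = v := by rw [← hρ]; simp [h15]
    have g4 : ρ.reg 4 = N := by rw [← hρ]; simp [h4]
    have g6 : ρ.reg 6 = σ.reg 6 := hFρ.2.1 6 (by omega)
    have g22 : ρ.reg 22 = 0 := by rw [← hρ]; simp
    have g25 : ρ.reg 25 = N + (1 - (N - v)) := by rw [← hρ]; simp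
    have a6 : ∀ k v', ρ.arr 6 k v' = τ.arr 6 k v' := fun k v' => by
      rw [← hρ, arr_setReg, arr_setReg, arr_setArr _ _ _ _ _ _ (by omega) (by omega),
        if_neg (by omega)]
    have a7 : ∀ v', ρ.arr 7 0 v' = if v' = v then 0 else τ.arr 7 0 v' := fun v' => by
      rw [← hρ, arr_setReg, arr_setReg, arr_setArr _ _ _ _ _ _ (by omega) (by omega)]; simp
    have a8 : ∀ k v', ρ.arr 8 k v' = τ.arr 8 k v' := fun k v' => by
      rw [← hρ, arr_setReg, arr_setReg, arr_setArr _ _ _ _ _ _ (by omega) (by omega),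
        if_neg (by omega)]
    have hbρ : Bounded B ρ := by
      rw [← hρ]
      exact ((hbτ.update_mem (by omega)).update_reg (by omega)).update_reg (by omega)
    have eD : ρ.stat = σ.stat := stat_congr hFρ.1 (hFρ.2.1 4 (by omega))
      (hFρ.arr_row (by omega) (by omega) 0) (hFρ.arr_row (by omega) (by omega) 0)
    have e3 : ρ.arr 3 0 v = σ.stat.nx v := by rw [← eD]; rfl
    have e9 : ρ.arr 9 0 v = σ.stat.sid v := by rw [← eD]; rfl
    have hCρ : Chains ρ H := by
      have tc : ∀ {G : ℕ}, G < 2 → ∀ {N K : ℕ} {f ct : ℕ → ℕ} {Lb : ℕ → WithBot α → Prop},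
          Table σ G N K H f ct Lb → Table ρ G N K H f ct Lb := fun hG _ _ _ _ _ h =>
        h.congr (fun i hi k v => hFρ.2.2 i (by omega) (by omega) k v) hFρ.1
      obtain ⟨c1, c2, c3, c4, c5, c6, c7, c8, c9⟩ := hC
      have r9 : ρ.arr 9 0 = σ.arr 9 0 := hFρ.arr_row (by omega) (by omega) 0
      constructor <;> (try rw [eD]) <;> (try rw [hFρ.sk]) <;> (try rw [g4]) <;> (try rw [g6]) <;>
        (try rw [r9]) <;> (try assumption)
      · exact tc (by omega) c8
      · exact tc (by omega) c9
    refine ex_seq ?_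
    have key : Ex B (.ite (lt (nxE (.reg 15)) (.reg 4))
        (.assign 20 (sidE (.reg 15)) ;; .assign 21 (nxE (.reg 15)) ;; .assign 23 (.reg 4) ;;
          advance ;;
          .ite (eq (.reg 24) (.const 0)) (.assign 25 (.reg 4) ;; .assign 22 (.const 0)) .skip)
        .skip) ρ (fun ω s => s ≤ 32 * σ.reg 6 + 70 ∧ Frame 20 ρ ω ∧
          JumpAt σ.stat v (ω.reg 25) (ω.reg 22)) := by
      refine ex_ite (fun h => ?_) (fun h => ?_)
      · simp only [holds_lt, nxE, eval_rd, eval_reg, eval_const, g15, g4, e3] at h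
        have hvN : v < N := hD.lt_of_nx_lt h (by omega)
        have hvn := hD.lt v hvN
        refine ex_assign_seq (by exact hbρ.arr _ _ _) (ex_assign_seq (by exact hbρ.arr _ _ _)
          (ex_assign_seq (by exact hbρ.1 _) ?_))
        simp only [sidE, nxE, eval_rd, eval_reg, eval_const, reg_setReg, arr_setReg, g15, g4,
          Nat.reduceEqDiff, if_false, e3, e9]
        generalize hπ : State.setReg _ 23 _ = π
        have hFπ : Frame 20 ρ π := by
          rw [← hπ]
          exact (((Frame.refl 20 ρ).setReg (by omega)).setReg (by omega)).setReg (by omega)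
        have p4 : π.reg 4 = N := (hFπ.2.2 4 (by omega)).trans g4
        have p6 : π.reg 6 = σ.reg 6 := (hFπ.2.2 6 (by omega)).trans g6
        have p20 : π.reg 20 = σ.stat.sid v := by rw [← hπ]; simp
        have p21 : π.reg 21 = σ.stat.nx v := by rw [← hπ]; simp
        have p22 : π.reg 22 = 0 := by rw [← hπ]; simp [g22]
        have p23 : π.reg 23 = N := by rw [← hπ]; simp
        have hbπ : Bounded B π := by
          rw [← hπ]
          exact ((hbρ.update_reg (by rw [← e9]; exact hbρ.arr _ _ _)).update_reg
            (by omega)).update_reg (by omega)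
        refine ex_seq ((ex_advance hbπ (hCρ.of_frame hFπ (by omega)) (by omega) (by omega)
          (by omega)).imp ?_)
        rintro ω s ⟨hs, hFω, -, ho⟩
        rw [hFπ.stat (by omega), eD, p20, p21, p22, p23] at ho
        have hFω' := hFπ.trans hFω le_rfl
        have w4 : ω.reg 4 = N := (hFω'.2.2 4 (by omega)).trans g4
        rw [p6] at hs
        have hV : σ.stat.Valid (.A (σ.stat.sid v) (σ.stat.nx v) 0) := h
        refine ex_ite (fun h0 => ?_) (fun h0 => ?_)
        · simp only [holds_eq, eval_reg, eval_const] at h0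
          have ho' := (ho.resolve_left (by omega)).2.1
          refine ex_assign_seq (by simp [w4]; omega) (ex_assign (by simp) ?_)
          refine ⟨by omega, (hFω'.setReg (by omega)).setReg (by omega), ?_⟩
          simp only [eval_reg, eval_const, reg_setReg, w4]
          norm_num
          refine ⟨fun _ => le_rfl, fun h' => by omega, fun _ => rfl, fun h' => by omega,
            fun h' => by omega, fun _ _ u n hr => ?_⟩
          -- A node that was not found before the limit `N` would satisfy `N ≤ nx u`, which
          -- contradicts its validity.
          have h1 := ho' u n hr
          have h2 := (hr.spec hD hsort hV).1
          simp only [Static.Valid] at h2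
          omega
        · simp only [holds_eq, eval_reg, eval_const] at h0
          have ho' := (ho.resolve_right (by omega)).2.1
          have h2 := (ho'.spec hD hsort hV).1
          simp only [Static.Valid] at h2
          refine ex_skip ⟨by omega, hFω', fun _ => by omega, fun h' => by omega,
            fun h' => by omega, fun _ => ⟨h2.2, h⟩, fun _ => ho', fun _ h' => by omega⟩
      · simp only [holds_lt, nxE, eval_rd, eval_reg, eval_const, g15, g4, e3] at h
        refine ex_skip ⟨by omega, Frame.refl _ _, ?_⟩
        rw [g25, g22]
        exact ⟨fun h' => by omega, fun h' => by omega, fun _ => rfl, fun h' => by omega,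
          fun h' => by omega, fun h' => by omega⟩
    refine key.imp_bounded hbρ ?_
    rintro ω s hbω ⟨hs, hFω, hj⟩
    have w15 : ω.reg 15 = v := (hFω.2.2 15 (by omega)).trans g15
    have warr : ω.arr = ρ.arr := hFω.arr
    have hFω' : FrameArr 13 (fun i => i < 6 ∨ 9 ≤ i) σ ω :=
      hFρ.trans (hFω.frameArr (S := fun i => i < 6 ∨ 9 ≤ i)) (by omega) (by simp)
    refine ex_wr_seq (hbω.1 _) (ex_wr (hbω.1 _) ?_)
    simp only [eval_reg, eval_const, w15, reg_setArr]
    refine ⟨by omega, trivial, ((hFω'.setArr (by omega) (by omega)).setArr (by omega)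
      (by omega)).setReg (by omega), by simp, fun v' hv' => ?_⟩
    simp only [arr_setReg,
      arr_setArr _ _ _ _ _ _ (show (6 : ℕ) < 16 by omega) (show (6 : ℕ) < 16 by omega),
      arr_setArr _ _ _ _ _ _ (show (6 : ℕ) < 16 by omega) (show (7 : ℕ) < 16 by omega),
      arr_setArr _ _ _ _ _ _ (show (6 : ℕ) < 16 by omega) (show (8 : ℕ) < 16 by omega),
      arr_setArr _ _ _ _ _ _ (show (8 : ℕ) < 16 by omega) (show (6 : ℕ) < 16 by omega),
      arr_setArr _ _ _ _ _ _ (show (8 : ℕ) < 16 by omega) (show (7 : ℕ) < 16 by omega),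
      arr_setArr _ _ _ _ _ _ (show (8 : ℕ) < 16 by omega) (show (8 : ℕ) < 16 by omega),
      warr, a6, a7, a8]
    by_cases hvv : v' = v
    · subst hvv
      simpa using hj
    · simp [hvv]
      exact hE v' (by omega)
  · exact ⟨(FrameArr.refl _ _ σ).setReg (by omega), by simp, by simp⟩
  · rintro τ s ⟨hs, hF, h15, hE⟩
    refine ⟨by rw [Nat.sub_zero] at hs; linarith, hF, ⟨?_, ?_, ?_, ?_, ?_, ?_⟩, table_one ?_ ?_ ?_ ?_⟩
    · exact fun u hu => (hE u (by omega)).2.le hu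
    · exact fun u hu hu' => (hE u (by omega)).2.eq_top hu
    · exact fun u hu h => (hE u (by omega)).2.ct_eq h
    · exact fun u hu h => (hE u (by omega)).2.nx_lt h
    · exact fun u hu h => (hE u (by omega)).2.reach h
    · exact fun u hu h h' => (hE u (by omega)).2.not_reach h h'
    · exact fun v hv => rfl
    · intro v x hv
      rw [(hE v (by omega)).1]
      exact ⟨hit_zero τ x, False.elim⟩
    · exact fun v hv => rfl
    · intro v hv
      rw [(hE v (by omega)).1]
      omega

/-- Builds all tables for the static sequence of jobs. -/
def buildTables : Program :=
  calcLevels ;; fillSucc ;; build 0 ;; fillChain ;; build 1 ;; fillJump ;; build 2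

/-- The order of the stages is forced: the chains are found by searches in the finished successor
tables, and the jumps by `advance`, which needs both of these tables. -/
theorem ex_buildTables {B H : ℕ} {σ : State α} (hb : Bounded B σ) (hN : 3 * σ.reg 4 + 8 ≤ B)
    (h1 : ∀ v, v < σ.reg 4 → 1 ≤ σ.arr 9 0 v) (h2 : ∀ v, v < σ.reg 4 → σ.arr 9 0 v ≤ H)
    (hs : σ.stat.Sorted) (sk_zero : σ.sk 0 = ⊥) (bot_lt : ∀ h, 1 ≤ h → h ≤ H → ⊥ < σ.sk h) :
    Ex B buildTables σ (fun τ s => s ≤ 250 * (τ.reg 6 * (σ.reg 4 + 2)) ∧ τ.key = σ.key ∧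
      (∀ x < 13, x ≠ 6 → τ.reg x = σ.reg x) ∧
      (∀ i < 16, 9 ≤ i → ∀ k v, τ.arr i k v = σ.arr i k v) ∧
      2 ^ τ.reg 6 < 2 * (σ.reg 4 + 2) ∧ Tables τ H) := by
  set N := σ.reg 4 with hNdef
  refine ex_seq ((ex_calcLevels (by omega)).imp_bounded hb ?_)
  rintro τ₀ s₀ hb₀ ⟨hs₀, m0, k0, r0, pow, pow', hK⟩
  have n0 : τ₀.reg 4 = N := r0 4 (by omega) (by omega)
  have a0 := arr_congr m0
  refine ex_seq ((ex_fillSucc (H := H) hb₀ (by omega) (by rw [n0, a0]; exact h1)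
    (by rw [n0, a0]; exact h2)).imp_bounded hb₀ ?_)
  rintro τ₁ s₁ hb₁ ⟨hs₁, F₁, T₁⟩
  set K := τ₀.reg 6 with hKdef
  have n1 : τ₁.reg 4 = N := (F₁.2.1 4 (by omega)).trans n0
  have K1 : τ₁.reg 6 = K := F₁.2.1 6 (by omega)
  have sk1 : τ₁.sk = σ.sk := F₁.sk.trans (sk_congr k0)
  rw [n0, sk_congr k0, a0] at T₁
  refine ex_seq ((ex_build hb₁ (by omega) (f := succTo N) (ct := unitTo N) (X := id)
    (by rw [n1]; exact isGraph_succTo N) (by omega)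
    (by rw [sk1]; exact sk_zero) (by rw [sk1]; exact bot_lt) (by omega)
    (by rw [n1]; exact T₁)).imp_bounded hb₁ ?_)
  rintro τ₂ s₂ hb₂ ⟨hs₂, F₂, T₂⟩
  have n2 : τ₂.reg 4 = N := (F₂.1.2.1 4 (by omega)).trans n1
  have K2 : τ₂.reg 6 = K := (F₂.1.2.1 6 (by omega)).trans K1
  have sk2 : τ₂.sk = σ.sk := F₂.1.sk.trans sk1
  have a2 : ∀ i < 16, 9 ≤ i → ∀ k v, τ₂.arr i k v = σ.arr i k v := fun i hi h9 k v => by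
    rw [F₂.1.2.2 i hi (by omega), F₁.2.2 i hi (by omega), a0]
  have a29 : τ₂.arr 9 0 = σ.arr 9 0 := funext (a2 9 (by omega) (by omega) 0)
  rw [n1, K1] at T₂
  refine ex_seq ((ex_fillChain (H := H) hb₂ (by omega) (by rw [n2, K2]; omega)
    (by rw [sk2]; exact sk_zero) (by rw [sk2]; exact bot_lt)
    (by rw [n2, K2, sk2, a29]; exact T₂)).imp_bounded hb₂ ?_)
  rintro τ₃ s₃ hb₃ ⟨hs₃, F₃, I₃, T₃⟩
  have n3 : τ₃.reg 4 = N := (F₃.2.1 4 (by omega)).trans n2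
  have K3 : τ₃.reg 6 = K := (F₃.2.1 6 (by omega)).trans K2
  have sk3 : τ₃.sk = σ.sk := F₃.sk.trans sk2
  have hG₃ : IsGraph (τ₃.reg 4) τ₃.stat.nx (unitTo (τ₃.reg 4)) id := isGraph_nx I₃
  refine ex_seq ((ex_build hb₃ (by omega) (f := τ₃.stat.nx) (ct := unitTo N) (X := id)
    (by rw [← n3]; exact hG₃) (by omega) (by rw [sk3]; exact sk_zero) (by rw [sk3]; exact bot_lt)
    (by omega) (by rw [n3]; rw [n2] at T₃; exact T₃)).imp_bounded hb₃ ?_)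
  rintro τ₄ s₄ hb₄ ⟨hs₄, F₄, T₄⟩
  have n4 : τ₄.reg 4 = N := (F₄.1.2.1 4 (by omega)).trans n3
  have K4 : τ₄.reg 6 = K := (F₄.1.2.1 6 (by omega)).trans K3
  have sk4 : τ₄.sk = σ.sk := F₄.1.sk.trans sk3
  have fk4 : τ₄.fk = σ.fk := F₄.1.fk.trans (F₃.fk.trans (F₂.1.fk.trans (F₁.fk.trans (fk_congr k0))))
  have a4 : ∀ i < 16, 9 ≤ i → ∀ k v, τ₄.arr i k v = σ.arr i k v := fun i hi h9 k v => by
    rw [F₄.1.2.2 i hi (by omega), F₃.2.2 i hi (by omega), a2 i hi h9]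
  have a49 : τ₄.arr 9 0 = σ.arr 9 0 := funext (a4 9 (by omega) (by omega) 0)
  have e4 : τ₄.stat = τ₃.stat := stat_congr F₄.1.1 (n4.trans n3.symm)
    (funext (F₄.2 3 (by omega))) (funext (F₄.2 9 (by omega)))
  have hsort : τ₄.stat.Sorted := by
    have : ∀ i j, i ≤ j → j < τ₄.reg 4 → τ₄.fk (τ₄.arr 9 0 i) ≤ τ₄.fk (τ₄.arr 9 0 j) := by
      rw [n4, fk4, a49]; exact hs
    exact this
  have hC : Chains τ₄ H := by
    constructor
    · rw [n4, K4]; omega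
    · rw [sk4]; exact sk_zero
    · rw [sk4]; exact bot_lt
    · rw [n4, a49]; exact h1
    · rw [n4, a49]; exact h2
    · exact hsort
    · rw [e4]; exact I₃
    · rw [n4, K4, sk4, a49]
      exact (T₂.congr (fun i hi => F₃.2.2 i (by omega) (by omega)) F₃.1).congr
        (fun i hi => F₄.1.2.2 i (by omega) (by omega)) F₄.1.1
    · rw [n4, K4, e4]; rw [n3, K3] at T₄; exact T₄
  refine ex_seq ((ex_fillJump hb₄ (by omega) hC).imp_bounded hb₄ ?_)
  rintro τ₅ s₅ hb₅ ⟨hs₅, F₅, I₅, T₅⟩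
  have n5 : τ₅.reg 4 = N := (F₅.2.1 4 (by omega)).trans n4
  have K5 : τ₅.reg 6 = K := (F₅.2.1 6 (by omega)).trans K4
  have sk5 : τ₅.sk = σ.sk := F₅.sk.trans sk4
  have hG₅ : IsGraph N (τ₅.arr 6 0) (τ₅.arr 8 0) τ₄.stat.nx := by
    have := isGraph_jump hC.next hC.sorted I₅
    rw [← n4]; exact this
  refine (ex_build hb₅ (by omega) (f := τ₅.arr 6 0) (ct := τ₅.arr 8 0) (X := τ₄.stat.nx)
    (by rw [n5]; exact hG₅) (by omega) (by rw [sk5]; exact sk_zero) (by rw [sk5]; exact bot_lt)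
    (by omega) (by rw [n5]; rw [n4] at T₅; exact T₅)).imp ?_
  rintro τ₆ s₆ ⟨hs₆, F₆, T₆⟩
  have n6 : τ₆.reg 4 = N := (F₆.1.2.1 4 (by omega)).trans n5
  have K6 : τ₆.reg 6 = K := (F₆.1.2.1 6 (by omega)).trans K5
  have sk6 : τ₆.sk = σ.sk := F₆.1.sk.trans sk5
  have key6 : τ₆.key = τ₄.key := F₆.1.1.trans F₅.1
  have a6 : ∀ i < 16, i < 6 ∨ 9 ≤ i → ∀ k v, τ₆.arr i k v = τ₄.arr i k v := fun i hi h9 k v => by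
    rw [F₆.1.2.2 i hi (by omega), F₅.2.2 i hi h9]
  have e6 : τ₆.stat = τ₄.stat := stat_congr key6 (n6.trans n4.symm)
    (funext (a6 3 (by omega) (by omega) 0)) (funext (a6 9 (by omega) (by omega) 0))
  have j6 : τ₆.arr 6 0 = τ₅.arr 6 0 := funext (F₆.2 6 (by omega))
  have j8 : τ₆.arr 8 0 = τ₅.arr 8 0 := funext (F₆.2 8 (by omega))
  refine ⟨?_, ?_, ?_, ?_, ?_, ⟨?_, ?_, ?_⟩⟩
  · rw [K6]
    rw [n1, K1] at hs₂
    rw [n2, K2] at hs₃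
    rw [n3, K3] at hs₄
    rw [n4, K4] at hs₅
    rw [n5, K5] at hs₆
    rw [n0] at hs₁
    have : N + 2 ≤ K * (N + 2) := Nat.le_mul_of_pos_left _ (by omega)
    rw [Nat.add_mul, Nat.mul_assoc] at hs₃ hs₅
    omega
  · exact key6.trans (F₄.1.1.trans (F₃.1.trans (F₂.1.1.trans (F₁.1.trans k0))))
  · intro x hx hx6
    rw [F₆.1.2.1 x hx, F₅.2.1 x hx, F₄.1.2.1 x hx, F₃.2.1 x hx, F₂.1.2.1 x hx, F₁.2.1 x hx,
      r0 x hx hx6]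
  · exact fun i hi h9 k v => by rw [a6 i hi (Or.inr h9), a4 i hi h9]
  · rw [K6]; omega
  · obtain ⟨c1, c2, c3, c4, c5, c6, c7, c8, c9⟩ := hC
    have r9 : τ₆.arr 9 0 = τ₄.arr 9 0 := funext (a6 9 (by omega) (by omega) 0)
    have tc : ∀ {G : ℕ}, G < 2 → ∀ {N K : ℕ} {f ct : ℕ → ℕ} {Lb : ℕ → WithBot α → Prop},
        Table τ₄ G N K H f ct Lb → Table τ₆ G N K H f ct Lb := fun hG _ _ _ _ _ h =>
      h.congr (fun i hi k v => a6 i (by omega) (by omega) k v) key6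
    have n64 : τ₆.reg 4 = τ₄.reg 4 := n6.trans n4.symm
    have K64 : τ₆.reg 6 = τ₄.reg 6 := K6.trans K4.symm
    have sk64 : τ₆.sk = τ₄.sk := sk_congr key6
    constructor <;> (try rw [e6]) <;> (try rw [sk64]) <;> (try rw [n64]) <;> (try rw [K64]) <;>
        (try rw [r9]) <;> (try assumption)
    · exact tc (by omega) c8
    · exact tc (by omega) c9
  · rw [e6, j6, j8]; exact I₅
  · rw [j6, j8, n6, K6]; rw [n5, K5] at T₆; exact T₆

end

end DIS

namespace DIS

/-! ### Updates that are pending -/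

/-- A static sequence of jobs, and a list of `P` pending updates: jobs `h` that are to be inserted
in front of the position `lim h`, with `kind h = 0`, or to be removed from the position `lim h`,
with `kind h = 1`. -/
structure Layout (κ : Type*) where
  D : Static κ
  pend : ℕ → ℕ
  lim : ℕ → ℕ
  kind : ℕ → ℕ
  P : ℕ

namespace Layout

variable {κ : Type*} {L : Layout κ}

variable (L) in
/-- The pending updates from the number `e` on. -/
def rest (e : ℕ) : List ℕ := (List.range' e (L.P - e)).map L.pend

theorem rest_nil {e : ℕ} (h : L.P ≤ e) : L.rest e = [] := by
  simp [rest, Nat.sub_eq_zero_of_le h]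

theorem rest_cons {e : ℕ} (h : e < L.P) : L.rest e = L.pend e :: L.rest (e + 1) := by
  unfold rest
  rw [show L.P - e = (L.P - (e + 1)) + 1 by omega, List.range'_succ, List.map_cons]

theorem mem_rest {h : ℕ} : h ∈ L.rest 0 ↔ ∃ e < L.P, L.pend e = h := by
  simp [rest, List.mem_range'_1]

variable (L) in
/-- The sequence of jobs, from the position `c` of the static sequence on, after the updates
`es`. -/
def cur : ℕ → List ℕ → List ℕ
  | c, [] => L.D.seg c L.D.N
  | c, h :: es => L.D.seg c (L.lim h) ++
      if L.kind h = 0 then h :: cur (L.lim h) es else cur (L.lim h + 1) es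

theorem cur_cons_of_lt {c h : ℕ} {es : List ℕ} (hc : c < L.lim h) :
    L.cur c (h :: es) = L.D.sid c :: L.cur (c + 1) (h :: es) := by
  simp only [cur]
  rw [Static.seg_cons hc, List.cons_append]

theorem cur_cons_of_le {c h : ℕ} {es : List ℕ} (hc : L.lim h ≤ c) : L.cur c (h :: es) =
    if L.kind h = 0 then h :: L.cur (L.lim h) es else L.cur (L.lim h + 1) es := by
  simp only [cur]
  rw [Static.seg_self hc, List.nil_append]

theorem cur_nil_of_lt {c : ℕ} (hc : c < L.D.N) : L.cur c [] = L.D.sid c :: L.cur (c + 1) [] :=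
  Static.seg_cons hc

/-- The updates after adding one. -/
theorem exists_add {h q : ℕ} {pend' : ℕ → ℕ} (hq : q ≤ L.P)
    (hlt : ∀ e < q, pend' e = L.pend e) (heq : pend' q = h)
    (hgt : ∀ e, q ≤ e → e < L.P → pend' (e + 1) = L.pend e) (x : ℕ) :
    (∃ e < L.P + 1, pend' e = x) ↔ x = h ∨ ∃ e < L.P, L.pend e = x := by
  constructor
  · rintro ⟨e, he, rfl⟩
    rcases lt_trichotomy e q with h | h | h
    · exact Or.inr ⟨e, by omega, (hlt e h).symm⟩
    · exact Or.inl (h ▸ heq)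
    · refine Or.inr ⟨e - 1, by omega, ?_⟩
      have := hgt (e - 1) (by omega) (by omega)
      rw [Nat.sub_add_cancel (by omega)] at this
      exact this.symm
  · rintro (rfl | ⟨e, he, rfl⟩)
    · exact ⟨q, by omega, heq⟩
    · rcases Nat.lt_or_ge e q with h | h
      · exact ⟨e, by omega, hlt e h⟩
      · exact ⟨e + 1, by omega, hgt e h he⟩

variable (L) in
/-- The jobs that are present. -/
def Present (h : ℕ) : Prop :=
  (∃ j < L.D.N, L.D.sid j = h ∧ ∀ e < L.P, L.pend e ≠ h) ∨ (∃ e < L.P, L.pend e = h ∧ L.kind h = 0)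

/-- Present jobs after the insertion of a new job. -/
theorem present_add {h q : ℕ} {pend' : ℕ → ℕ} (hq : q ≤ L.P)
    (hlt : ∀ e < q, pend' e = L.pend e) (heq : pend' q = h)
    (hgt : ∀ e, q ≤ e → e < L.P → pend' (e + 1) = L.pend e) (hk : L.kind h = 0)
    (hs : ∀ j < L.D.N, L.D.sid j ≠ h) (x : ℕ) :
    ({ L with pend := pend', P := L.P + 1 } : Layout κ).Present x ↔ x = h ∨ L.Present x := by
  have key := exists_add hq hlt heq hgt x
  unfold Present
  simp only
  constructor
  · rintro (⟨j, h1, rfl, h2⟩ | ⟨e, h1, h2, h3⟩)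
    · refine Or.inr (Or.inl ⟨j, h1, rfl, fun e he h3 => ?_⟩)
      obtain ⟨e', h4, h5⟩ := key.2 (Or.inr ⟨e, he, h3⟩)
      exact h2 e' h4 h5
    · rcases key.1 ⟨e, h1, h2⟩ with rfl | ⟨e', h4, h5⟩
      · exact Or.inl rfl
      · exact Or.inr (Or.inr ⟨e', h4, h5, h3⟩)
  · rintro (rfl | ⟨j, h1, rfl, h2⟩ | ⟨e, h1, h2, h3⟩)
    · obtain ⟨e, h4, h5⟩ := key.2 (Or.inl rfl)
      exact Or.inr ⟨e, h4, h5, hk⟩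
    · refine Or.inl ⟨j, h1, rfl, fun e he h3 => ?_⟩
      rcases key.1 ⟨e, he, h3⟩ with h4 | ⟨e', h4, h5⟩
      · exact hs j h1 h4
      · exact h2 e' h4 h5
    · obtain ⟨e', h4, h5⟩ := key.2 (Or.inr ⟨e, h1, h2⟩)
      exact Or.inr ⟨e', h4, h5, h3⟩

/-- Present jobs after the deletion of a job of the static sequence. -/
theorem present_add_delete {h q : ℕ} {pend' : ℕ → ℕ} (hq : q ≤ L.P)
    (hlt : ∀ e < q, pend' e = L.pend e) (heq : pend' q = h)
    (hgt : ∀ e, q ≤ e → e < L.P → pend' (e + 1) = L.pend e) (hk : L.kind h = 1) (x : ℕ) :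
    ({ L with pend := pend', P := L.P + 1 } : Layout κ).Present x ↔ x ≠ h ∧ L.Present x := by
  have key := exists_add hq hlt heq hgt x
  unfold Present
  simp only
  constructor
  · rintro (⟨j, h1, rfl, h2⟩ | ⟨e, h1, h2, h3⟩)
    · refine ⟨fun h3 => ?_, Or.inl ⟨j, h1, rfl, fun e he h3 => ?_⟩⟩
      · obtain ⟨e', h4, h5⟩ := key.2 (Or.inl h3)
        exact h2 e' h4 h5
      · obtain ⟨e', h4, h5⟩ := key.2 (Or.inr ⟨e, he, h3⟩)
        exact h2 e' h4 h5
    · have hx : x ≠ h := fun h4 => by rw [h4] at h3; omega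
      obtain ⟨e', h4, h5⟩ := (key.1 ⟨e, h1, h2⟩).resolve_left hx
      exact ⟨hx, Or.inr ⟨e', h4, h5, h3⟩⟩
  · rintro ⟨hx, ⟨j, h1, rfl, h2⟩ | ⟨e, h1, h2, h3⟩⟩
    · refine Or.inl ⟨j, h1, rfl, fun e he h3 => ?_⟩
      obtain ⟨e', h4, h5⟩ := (key.1 ⟨e, he, h3⟩).resolve_left hx
      exact h2 e' h4 h5
    · obtain ⟨e', h4, h5⟩ := key.2 (Or.inr ⟨e, h1, h2⟩)
      exact Or.inr ⟨e', h4, h5, h3⟩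

variable [LinearOrder κ]

variable (L) in
/-- The position of a pending update is correct. -/
def Ent (h : ℕ) : Prop :=
  (L.kind h = 1 ∧ L.lim h < L.D.N ∧ L.D.sid (L.lim h) = h) ∨
  (L.kind h = 0 ∧ L.lim h ≤ L.D.N ∧ (∀ j < L.lim h, L.D.f (L.D.sid j) ≤ L.D.f h) ∧
    ∀ j, L.lim h ≤ j → j < L.D.N → L.D.f h < L.D.f (L.D.sid j))

variable (L) in
/-- The order of the pending updates. -/
def Le (h h' : ℕ) : Prop := L.lim h < L.lim h' ∨ L.lim h = L.lim h' ∧ L.D.f h ≤ L.D.f h'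

variable (L) in
/-- The layout is consistent, and its handles are at most `H`. -/
structure Good (H : ℕ) : Prop where
  sid_pos : ∀ j, j < L.D.N → 1 ≤ L.D.sid j
  sid_le : ∀ j, j < L.D.N → L.D.sid j ≤ H
  lim_sid : ∀ j, j < L.D.N → L.lim (L.D.sid j) = j
  kind_sid : ∀ j, j < L.D.N → L.kind (L.D.sid j) = 1
  sorted : L.D.Sorted
  pend_pos : ∀ e, e < L.P → 1 ≤ L.pend e
  pend_le : ∀ e, e < L.P → L.pend e ≤ H
  ent : ∀ e, e < L.P → L.Ent (L.pend e)
  order : ∀ e e', e < e' → e' < L.P → L.pend e ≠ L.pend e' ∧ L.Le (L.pend e) (L.pend e')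

variable (L) in
/-- The updates `es` are correct and in order, and they concern positions from `c` on. -/
structure Ok (c : ℕ) (es : List ℕ) : Prop where
  order : es.Pairwise (fun h h' => h ≠ h' ∧ L.Le h h')
  ent : ∀ h ∈ es, L.Ent h
  le : ∀ h ∈ es, c ≤ L.lim h

theorem Good.ok {H : ℕ} (hL : L.Good H) : L.Ok 0 (L.rest 0) := by
  refine ⟨?_, ?_, fun _ _ => Nat.zero_le _⟩
  · rw [rest, List.pairwise_map]
    refine (List.pairwise_lt_range' (s := 0) (n := L.P - 0)).imp_of_mem ?_
    intro a b _ hb hab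
    rw [List.mem_range'_1] at hb
    exact hL.order a b hab (by omega)
  · intro h hh
    obtain ⟨e, he, rfl⟩ := mem_rest.1 hh
    exact hL.ent e he

theorem Ent.lim_le {h : ℕ} (he : L.Ent h) : L.lim h ≤ L.D.N := by
  rcases he with ⟨-, h1, -⟩ | ⟨-, h1, -⟩ <;> omega

/-- After a deletion the remaining updates lie beyond the deleted position: a second deletion there
would be the same job, and a job inserted in front of that position finishes earlier than the
deleted one, so it would come before it in the list. -/
theorem Ok.tail {c h : ℕ} {es : List ℕ} (ho : L.Ok c (h :: es)) :
    L.Ok (if L.kind h = 0 then L.lim h else L.lim h + 1) es := by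
  obtain ⟨h1, h2, h3⟩ := ho
  rw [List.pairwise_cons] at h1
  refine ⟨h1.2, fun x hx => h2 x (List.mem_cons_of_mem _ hx), fun x hx => ?_⟩
  obtain ⟨hne, hle⟩ := h1.1 x hx
  have hx2 := h2 x (List.mem_cons_of_mem _ hx)
  rcases hle with hlt | ⟨heq, hf⟩
  · split_ifs <;> omega
  · split_ifs with hk
    · exact heq.le
    · exfalso
      obtain ⟨-, g1, g2⟩ := (h2 h (by simp)).resolve_right (fun h' => hk h'.1)
      rcases hx2 with ⟨-, -, g3⟩ | ⟨-, -, -, g3⟩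
      · exact hne (by rw [← g2, ← g3, heq])
      · refine absurd (g3 (L.lim h) heq.ge g1) (not_lt.2 ?_)
        rwa [g2]

theorem Ok.succ {c h : ℕ} {es : List ℕ} (ho : L.Ok c (h :: es)) (hc : c < L.lim h) :
    L.Ok (c + 1) (h :: es) := by
  refine ⟨ho.order, ho.ent, fun x hx => ?_⟩
  rcases List.mem_cons.1 hx with rfl | hx
  · exact hc
  · rcases ((List.pairwise_cons.1 ho.order).1 x hx).2 with h1 | h1 <;> omega

/-- For a static job `lim` is its own position. Hence a job in a segment in front of the next update
is not itself pending, and a pending deletion removes exactly the position at which it is processed.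
-/
theorem mem_cur {H : ℕ} (hL : L.Good H) {x : ℕ} {es : List ℕ} : ∀ {c : ℕ}, L.Ok c es →
    (x ∈ L.cur c es ↔ (∃ j, c ≤ j ∧ j < L.D.N ∧ L.D.sid j = x ∧ x ∉ es) ∨
      (x ∈ es ∧ L.kind x = 0)) := by
  induction es with
  | nil => intro c _; simp [cur, Static.mem_seg]
  | cons h es ih =>
    intro c ho
    have ih' := ih ho.tail
    have hent := ho.ent h (by simp)
    have hc := ho.le h (by simp)
    have hlim : ∀ y ∈ es, L.lim h ≤ L.lim y := fun y hy => by
      rcases ((List.pairwise_cons.1 ho.order).1 y hy).2 with h1 | h1 <;> omega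
    have hsmall : ∀ j, j < L.lim h → L.D.sid j ∉ h :: es := by
      intro j hj hm
      have hjN : j < L.D.N := lt_of_lt_of_le hj hent.lim_le
      have h1 := hL.lim_sid j hjN
      rcases List.mem_cons.1 hm with h2 | h2
      · rw [h2] at h1; omega
      · have := hlim _ h2; omega
    have hseg : x ∈ L.D.seg c (L.lim h) ↔
        ∃ j, c ≤ j ∧ j < L.lim h ∧ j < L.D.N ∧ L.D.sid j = x ∧ x ∉ h :: es := by
      rw [Static.mem_seg]
      refine ⟨fun ⟨j, h1, h2, h3⟩ => ⟨j, h1, h2, lt_of_lt_of_le h2 hent.lim_le, h3,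
        h3 ▸ hsmall j h2⟩, fun ⟨j, h1, h2, h3, h4, h5⟩ => ⟨j, h1, h2, h4⟩⟩
    simp only [cur]
    rw [List.mem_append, hseg]
    rcases hent with ⟨hk, hN, hs⟩ | ⟨hk, hN, hs⟩
    · rw [if_neg (by omega)] at ih' ⊢
      rw [ih']
      constructor
      · rintro (⟨j, h1, h2, h3, h4, h5⟩ | ⟨j, h1, h2, h3, h4⟩ | ⟨h1, h2⟩)
        · exact Or.inl ⟨j, h1, h3, h4, h5⟩
        · refine Or.inl ⟨j, by omega, h2, h3, fun hm => ?_⟩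
          rcases List.mem_cons.1 hm with h5 | h5
          · have := hL.lim_sid j h2
            rw [h3, h5] at this; omega
          · exact h4 h5
        · exact Or.inr ⟨List.mem_cons_of_mem _ h1, h2⟩
      · rintro (⟨j, h1, h2, h3, h4⟩ | ⟨h1, h2⟩)
        · rcases lt_trichotomy j (L.lim h) with h5 | h5 | h5
          · exact Or.inl ⟨j, h1, h5, h2, h3, h4⟩
          · exact absurd (by rw [← h3, h5, hs]; simp) h4
          · exact Or.inr (Or.inl ⟨j, h5, h2, h3, fun h6 => h4 (List.mem_cons_of_mem _ h6)⟩)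
        · rcases List.mem_cons.1 h1 with rfl | h1
          · omega
          · exact Or.inr (Or.inr ⟨h1, h2⟩)
    · rw [if_pos hk] at ih' ⊢
      rw [List.mem_cons (l := L.cur (L.lim h) es), ih']
      constructor
      · rintro (⟨j, h1, h2, h3, h4, h5⟩ | rfl | ⟨j, h1, h2, h3, h4⟩ | ⟨h1, h2⟩)
        · exact Or.inl ⟨j, h1, h3, h4, h5⟩
        · exact Or.inr ⟨by simp, hk⟩
        · refine Or.inl ⟨j, by omega, h2, h3, fun hm => ?_⟩
          rcases List.mem_cons.1 hm with h5 | h5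
          · have := hL.kind_sid j h2
            rw [h3, h5] at this; omega
          · exact h4 h5
        · exact Or.inr ⟨List.mem_cons_of_mem _ h1, h2⟩
      · rintro (⟨j, h1, h2, h3, h4⟩ | ⟨h1, h2⟩)
        · rcases Nat.lt_or_ge j (L.lim h) with h5 | h5
          · exact Or.inl ⟨j, h1, h5, h2, h3, h4⟩
          · exact Or.inr (Or.inr (Or.inl ⟨j, h5, h2, h3,
              fun h6 => h4 (List.mem_cons_of_mem _ h6)⟩))
        · rcases List.mem_cons.1 h1 with rfl | h1
          · exact Or.inr (Or.inl rfl)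
          · exact Or.inr (Or.inr (Or.inr ⟨h1, h2⟩))

theorem pairwise_seg {H : ℕ} (hL : L.Good H) {c M : ℕ} (hM : M ≤ L.D.N) :
    (L.D.seg c M).Pairwise (fun x y => L.D.f x ≤ L.D.f y ∧ x ≠ y) := by
  rw [Static.seg, List.pairwise_map]
  refine (List.pairwise_lt_range' (s := c) (n := M - c)).imp_of_mem ?_
  intro a b _ hb hab
  rw [List.mem_range'_1] at hb
  have hb' : b < L.D.N := by omega
  refine ⟨hL.sorted a b hab.le hb', fun h => ?_⟩
  have h1 := hL.lim_sid a (by omega)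
  have h2 := hL.lim_sid b hb'
  rw [h] at h1
  omega

/-- A job inserted in front of `lim h` finishes no earlier than the static jobs before that position
and earlier than those from there on. Insertions at the same place are listed by finish, and handles
do not repeat since kinds separate static jobs from inserted ones. -/
theorem pairwise_cur {H : ℕ} (hL : L.Good H) {es : List ℕ} : ∀ {c : ℕ}, L.Ok c es →
    (L.cur c es).Pairwise (fun x y => L.D.f x ≤ L.D.f y ∧ x ≠ y) := by
  induction es with
  | nil => intro c _; exact pairwise_seg hL le_rfl
  | cons h es ih =>
    intro c ho
    have ih' := ih ho.tail
    have hmem := fun x => mem_cur hL (x := x) ho.tail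
    have hent := ho.ent h (by simp)
    have hlim : ∀ y ∈ es, L.lim h ≤ L.lim y := fun y hy => by
      rcases ((List.pairwise_cons.1 ho.order).1 y hy).2 with h1 | h1 <;> omega
    have hrest : ∀ j, j < L.lim h → ∀ y, y ∈ L.cur
        (if L.kind h = 0 then L.lim h else L.lim h + 1) es →
        L.D.f (L.D.sid j) ≤ L.D.f y ∧ L.D.sid j ≠ y := by
      intro j hj y hy
      have hjN : j < L.D.N := lt_of_lt_of_le hj hent.lim_le
      rcases (hmem y).1 hy with ⟨j', h1, h2, h3, -⟩ | ⟨h1, h2⟩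
      · have hjj : j < j' := by split_ifs at h1 <;> omega
        rw [← h3]
        refine ⟨hL.sorted j j' hjj.le h2, fun h4 => ?_⟩
        have g1 := hL.lim_sid j hjN
        have g2 := hL.lim_sid j' h2
        rw [h4] at g1; omega
      · have g := (ho.ent y (List.mem_cons_of_mem _ h1)).resolve_left (fun g => by omega)
        refine ⟨g.2.2.1 j (lt_of_lt_of_le hj (hlim y h1)), fun h4 => ?_⟩
        have := hL.kind_sid j hjN
        rw [h4] at this; omega
    simp only [cur]
    rw [List.pairwise_append]
    refine ⟨pairwise_seg hL hent.lim_le, ?_, ?_⟩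
    · split_ifs with hk
      · rw [if_pos hk] at ih' hmem
        rw [List.pairwise_cons]
        refine ⟨fun y hy => ?_, ih'⟩
        have g := hent.resolve_left (fun g => by omega)
        rcases (hmem y).1 hy with ⟨j, h1, h2, h3, -⟩ | ⟨h1, h2⟩
        · rw [← h3]
          refine ⟨(g.2.2.2 j h1 h2).le, fun h4 => ?_⟩
          have := hL.kind_sid j h2
          rw [← h4] at this; omega
        · obtain ⟨hne, hle⟩ := (List.pairwise_cons.1 ho.order).1 y h1
          refine ⟨?_, hne⟩
          rcases hle with h3 | h3
          · have g' := (ho.ent y (List.mem_cons_of_mem _ h1)).resolve_left (fun g => by omega)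
            exact (g.2.2.2 _ le_rfl (lt_of_lt_of_le h3 g'.2.1)).le.trans (g'.2.2.1 _ h3)
          · exact h3.2
      · rw [if_neg hk] at ih'
        exact ih'
    · intro x hx y hy
      obtain ⟨j, -, h1, rfl⟩ := Static.mem_seg.1 hx
      split_ifs at hy with hk
      · rcases List.mem_cons.1 hy with rfl | hy
        · have g := hent.resolve_left (fun g => by omega)
          refine ⟨g.2.2.1 j h1, fun h4 => ?_⟩
          have := hL.kind_sid j (lt_of_lt_of_le h1 g.2.1)
          rw [h4] at this; omega
        · exact hrest j h1 y (by rw [if_pos hk]; exact hy)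
      · exact hrest j h1 y (by rw [if_neg hk]; exact hy)

theorem mem_cur_zero {H : ℕ} (hL : L.Good H) {x : ℕ} : x ∈ L.cur 0 (L.rest 0) ↔ L.Present x := by
  rw [mem_cur hL hL.ok]
  simp only [mem_rest, Present]
  refine or_congr ⟨?_, ?_⟩ ⟨?_, ?_⟩
  · rintro ⟨j, -, h1, h2, h3⟩; exact ⟨j, h1, h2, fun e he h => h3 ⟨e, he, h⟩⟩
  · rintro ⟨j, h1, h2, h3⟩; exact ⟨j, Nat.zero_le _, h1, h2, fun ⟨e, he, h⟩ => h3 e he h⟩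
  · rintro ⟨⟨e, h1, h2⟩, h3⟩; exact ⟨e, h1, h2, h3⟩
  · rintro ⟨e, h1, h2, h3⟩; exact ⟨⟨e, h1, h2⟩, h3⟩

theorem Good.present_pos {H h : ℕ} (hL : L.Good H) (hp : L.Present h) : 1 ≤ h ∧ h ≤ H := by
  rcases hp with ⟨j, h1, rfl, -⟩ | ⟨e, h1, rfl, -⟩
  · exact ⟨hL.sid_pos j h1, hL.sid_le j h1⟩
  · exact ⟨hL.pend_pos e h1, hL.pend_le e h1⟩

/-- The listed handles are distinct numbers from `1` to `H`. -/
theorem length_cur_le {H : ℕ} (hL : L.Good H) : (L.cur 0 (L.rest 0)).length ≤ H := by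
  have h1 : (L.cur 0 (L.rest 0)).Nodup := (pairwise_cur hL hL.ok).imp (fun h => h.2)
  have h2 : L.cur 0 (L.rest 0) ⊆ List.range' 1 H := by
    intro x hx
    have := hL.present_pos ((mem_cur_zero hL).1 hx)
    rw [List.mem_range'_1]; omega
  have := (h1.subperm h2).length_le
  simpa using this

/-- Only the data of the handles up to `H` matters. -/
theorem Good.congr {L' : Layout κ} {H H' : ℕ} (hL : L.Good H) (hH : H ≤ H')
    (hN : L'.D.N = L.D.N) (hsid : L'.D.sid = L.D.sid) (hP : L'.P = L.P)
    (hpend : ∀ e < L.P, L'.pend e = L.pend e)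
    (hf : ∀ h, 1 ≤ h → h ≤ H → L'.D.f h = L.D.f h)
    (hlim : ∀ h, 1 ≤ h → h ≤ H → L'.lim h = L.lim h)
    (hkind : ∀ h, 1 ≤ h → h ≤ H → L'.kind h = L.kind h) : L'.Good H' := by
  obtain ⟨h1, h2, h3, h4, h5, h6, h7, h8, h9⟩ := hL
  have hfs : ∀ j < L.D.N, L'.D.f (L.D.sid j) = L.D.f (L.D.sid j) :=
    fun j hj => hf _ (h1 j hj) (h2 j hj)
  constructor
  · rw [hN, hsid]; exact h1
  · rw [hN, hsid]; exact fun j hj => (h2 j hj).trans hH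
  · rw [hN, hsid]; exact fun j hj => (hlim _ (h1 j hj) (h2 j hj)).trans (h3 j hj)
  · rw [hN, hsid]; exact fun j hj => (hkind _ (h1 j hj) (h2 j hj)).trans (h4 j hj)
  · intro i j hij hj
    rw [hN] at hj
    rw [hsid, hfs i (by omega), hfs j hj]
    exact h5 i j hij hj
  · rw [hP]; exact fun e he => (hpend e he).symm ▸ h6 e he
  · rw [hP]; exact fun e he => (hpend e he).symm ▸ (h7 e he).trans hH
  · rw [hP]
    intro e he
    have g := h8 e he
    rw [hpend e he]
    unfold Ent at g ⊢
    rw [hkind _ (h6 e he) (h7 e he), hlim _ (h6 e he) (h7 e he), hN, hsid,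
      hf _ (h6 e he) (h7 e he)]
    refine g.imp id (fun ⟨g1, g2, g3, g4⟩ => ⟨g1, g2, fun j hj => ?_, fun j hj hj' => ?_⟩)
    · rw [hfs j (by omega)]; exact g3 j hj
    · rw [hfs j hj']; exact g4 j hj hj'
  · rw [hP]
    intro e e' hee he'
    have he : e < L.P := by omega
    rw [hpend e he, hpend e' he']
    unfold Le
    rw [hlim _ (h6 e he) (h7 e he), hlim _ (h6 e' he') (h7 e' he'), hf _ (h6 e he) (h7 e he),
      hf _ (h6 e' he') (h7 e' he')]
    exact h9 e e' hee he'

theorem Good.present_congr {L' : Layout κ} {H : ℕ} (hL : L.Good H)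
    (hN : L'.D.N = L.D.N) (hsid : L'.D.sid = L.D.sid) (hP : L'.P = L.P)
    (hpend : ∀ e < L.P, L'.pend e = L.pend e)
    (hkind : ∀ h, 1 ≤ h → h ≤ H → L'.kind h = L.kind h) (h : ℕ) :
    L'.Present h ↔ L.Present h := by
  unfold Present
  rw [hN, hsid, hP]
  refine or_congr (exists_congr fun j => and_congr_right fun _ => and_congr_right fun _ =>
    forall_congr' fun e => forall_congr' fun he => by rw [hpend e he])
    (exists_congr fun e => and_congr_right fun he => ?_)
  rw [hpend e he]
  refine and_congr_right fun he' => ?_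
  rw [← he', hkind _ (hL.pend_pos e he) (hL.pend_le e he)]

theorem Le.trans {h h' h'' : ℕ} (h1 : L.Le h h') (h2 : L.Le h' h'') : L.Le h h'' := by
  rcases h1 with h1 | ⟨h1, g1⟩ <;> rcases h2 with h2 | ⟨h2, g2⟩
  · exact Or.inl (h1.trans h2)
  · exact Or.inl (h2 ▸ h1)
  · exact Or.inl (h1 ▸ h2)
  · exact Or.inr ⟨h1.trans h2, g1.trans g2⟩

/-- Adding a pending update. -/
theorem Good.add {H h q : ℕ} {pend' : ℕ → ℕ} (hL : L.Good H) (h1 : 1 ≤ h) (hH : h ≤ H)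
    (hent : L.Ent h) (hq : q ≤ L.P) (hne : ∀ e < L.P, L.pend e ≠ h)
    (hlt : ∀ e < q, pend' e = L.pend e) (heq : pend' q = h)
    (hgt : ∀ e, q ≤ e → e < L.P → pend' (e + 1) = L.pend e)
    (hle : ∀ e < q, L.Le (L.pend e) h) (hge : ∀ e, q ≤ e → e < L.P → L.Le h (L.pend e)) :
    ({ L with pend := pend', P := L.P + 1 } : Layout κ).Good H := by
  have cases : ∀ e < L.P + 1, (e < q ∧ pend' e = L.pend e) ∨ (e = q ∧ pend' e = h) ∨
      (q < e ∧ e - 1 < L.P ∧ pend' e = L.pend (e - 1)) := by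
    intro e he
    rcases lt_trichotomy e q with h | h | h
    · exact Or.inl ⟨h, hlt e h⟩
    · exact Or.inr (Or.inl ⟨h, h ▸ heq⟩)
    · refine Or.inr (Or.inr ⟨h, by omega, ?_⟩)
      have := hgt (e - 1) (by omega) (by omega)
      rwa [Nat.sub_add_cancel (by omega)] at this
  obtain ⟨g1, g2, g3, g4, g5, g6, g7, g8, g9⟩ := hL
  refine ⟨g1, g2, g3, g4, g5, ?_, ?_, ?_, ?_⟩
  · intro e he
    rcases cases e he with ⟨k1, k2⟩ | ⟨k1, k2⟩ | ⟨k1, k2, k3⟩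
    · show 1 ≤ pend' e
      rw [k2]; exact g6 e (by omega)
    · show 1 ≤ pend' e
      omega
    · show 1 ≤ pend' e
      rw [k3]; exact g6 _ k2
  · intro e he
    show pend' e ≤ H
    rcases cases e he with ⟨k1, k2⟩ | ⟨k1, k2⟩ | ⟨k1, k2, k3⟩
    · rw [k2]; exact g7 e (by omega)
    · omega
    · rw [k3]; exact g7 _ k2
  · intro e he
    show L.Ent (pend' e)
    rcases cases e he with ⟨k1, k2⟩ | ⟨k1, k2⟩ | ⟨k1, k2, k3⟩
    · rw [k2]; exact g8 e (by omega)
    · rw [k2]; exact hent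
    · rw [k3]; exact g8 _ k2
  · intro e e' hee he'
    show pend' e ≠ pend' e' ∧ L.Le (pend' e) (pend' e')
    have he' : e' < L.P + 1 := he'
    rcases cases e (by omega) with ⟨k1, k2⟩ | ⟨k1, k2⟩ | ⟨k1, k2, k3⟩ <;>
      rcases cases e' he' with ⟨m1, m2⟩ | ⟨m1, m2⟩ | ⟨m1, m2, m3⟩
    · rw [k2, m2]; exact g9 e e' hee (by omega)
    · rw [k2, m2]; exact ⟨hne e (by omega), hle e k1⟩
    · rw [k2, m3]; exact g9 e (e' - 1) (by omega) m2
    · omega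
    · omega
    · rw [k2, m3]; exact ⟨(hne _ m2).symm, hge _ (by omega) m2⟩
    · omega
    · omega
    · rw [k3, m3]; exact g9 (e - 1) (e' - 1) (by omega) m2

/-- Removing a pending update. -/
theorem Good.remove {H q : ℕ} {pend' : ℕ → ℕ} (hL : L.Good H) (hq : q < L.P)
    (hlt : ∀ e < q, pend' e = L.pend e) (hgt : ∀ e, q ≤ e → e + 1 < L.P → pend' e = L.pend (e + 1)) :
    ({ L with pend := pend', P := L.P - 1 } : Layout κ).Good H := by
  have cases : ∀ e < L.P - 1, (e < q ∧ pend' e = L.pend e) ∨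
      (q ≤ e ∧ e + 1 < L.P ∧ pend' e = L.pend (e + 1)) := by
    intro e he
    rcases Nat.lt_or_ge e q with h | h
    · exact Or.inl ⟨h, hlt e h⟩
    · exact Or.inr ⟨h, by omega, hgt e h (by omega)⟩
  obtain ⟨g1, g2, g3, g4, g5, g6, g7, g8, g9⟩ := hL
  refine ⟨g1, g2, g3, g4, g5, ?_, ?_, ?_, ?_⟩
  · intro e he
    show 1 ≤ pend' e
    rcases cases e he with ⟨k1, k2⟩ | ⟨k1, k2, k3⟩
    · rw [k2]; exact g6 e (by omega)
    · rw [k3]; exact g6 _ k2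
  · intro e he
    show pend' e ≤ H
    rcases cases e he with ⟨k1, k2⟩ | ⟨k1, k2, k3⟩
    · rw [k2]; exact g7 e (by omega)
    · rw [k3]; exact g7 _ k2
  · intro e he
    show L.Ent (pend' e)
    rcases cases e he with ⟨k1, k2⟩ | ⟨k1, k2, k3⟩
    · rw [k2]; exact g8 e (by omega)
    · rw [k3]; exact g8 _ k2
  · intro e e' hee he'
    show pend' e ≠ pend' e' ∧ L.Le (pend' e) (pend' e')
    have he' : e' < L.P - 1 := he'
    rcases cases e (by omega) with ⟨k1, k2⟩ | ⟨k1, k2, k3⟩ <;>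
      rcases cases e' he' with ⟨m1, m2⟩ | ⟨m1, m2, m3⟩
    · rw [k2, m2]; exact g9 e e' hee (by omega)
    · rw [k2, m3]; exact g9 e _ (by omega) m2
    · omega
    · rw [k3, m3]; exact g9 _ _ (by omega) m2

theorem Good.exists_remove {H q : ℕ} {pend' : ℕ → ℕ} (hL : L.Good H) (hq : q < L.P)
    (hlt : ∀ e < q, pend' e = L.pend e) (hgt : ∀ e, q ≤ e → e + 1 < L.P → pend' e = L.pend (e + 1))
    (x : ℕ) : (∃ e < L.P - 1, pend' e = x) ↔ x ≠ L.pend q ∧ ∃ e < L.P, L.pend e = x := by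
  constructor
  · rintro ⟨e, he, rfl⟩
    rcases Nat.lt_or_ge e q with h | h
    · rw [hlt e h]
      exact ⟨(hL.order e q h hq).1, e, by omega, rfl⟩
    · rw [hgt e h (by omega)]
      exact ⟨(hL.order q (e + 1) (by omega) (by omega)).1.symm, e + 1, by omega, rfl⟩
  · rintro ⟨hx, e, he, rfl⟩
    rcases lt_trichotomy e q with h | h | h
    · exact ⟨e, by omega, hlt e h⟩
    · exact absurd (by rw [h]) hx
    · refine ⟨e - 1, by omega, ?_⟩
      rw [hgt _ (by omega) (by omega), Nat.sub_add_cancel (by omega)]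

/-- Present jobs after the deletion of a job that was to be inserted. -/
theorem Good.present_remove {H q : ℕ} {pend' : ℕ → ℕ} (hL : L.Good H) (hq : q < L.P)
    (hlt : ∀ e < q, pend' e = L.pend e) (hgt : ∀ e, q ≤ e → e + 1 < L.P → pend' e = L.pend (e + 1))
    (hk : L.kind (L.pend q) = 0) (x : ℕ) :
    ({ L with pend := pend', P := L.P - 1 } : Layout κ).Present x ↔
      x ≠ L.pend q ∧ L.Present x := by
  have key := hL.exists_remove hq hlt hgt x
  unfold Present
  simp only
  constructor
  · rintro (⟨j, h1, rfl, h2⟩ | ⟨e, h1, h2, h3⟩)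
    · have hx : L.D.sid j ≠ L.pend q := fun h3 => by
        have := hL.kind_sid j h1
        rw [h3] at this; omega
      refine ⟨hx, Or.inl ⟨j, h1, rfl, fun e he h3 => ?_⟩⟩
      obtain ⟨e', h4, h5⟩ := key.2 ⟨hx, e, he, h3⟩
      exact h2 e' h4 h5
    · obtain ⟨hx, e', h4, h5⟩ := key.1 ⟨e, h1, h2⟩
      exact ⟨hx, Or.inr ⟨e', h4, h5, h3⟩⟩
  · rintro ⟨hx, ⟨j, h1, rfl, h2⟩ | ⟨e, h1, h2, h3⟩⟩
    · refine Or.inl ⟨j, h1, rfl, fun e he h3 => ?_⟩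
      obtain ⟨-, e', h4, h5⟩ := key.1 ⟨e, he, h3⟩
      exact h2 e' h4 h5
    · obtain ⟨e', h4, h5⟩ := key.2 ⟨hx, e, h1, h2⟩
      exact Or.inr ⟨e', h4, h5, h3⟩

/-- A list of jobs as a layout without pending updates. -/
theorem Good.of_list {H : ℕ} {l : List ℕ} (hl : l.Pairwise (fun x y => L.D.f x ≤ L.D.f y ∧ x ≠ y))
    (hH : ∀ x ∈ l, 1 ≤ x ∧ x ≤ H) (hN : L.D.N = l.length) (hP : L.P = 0)
    (hsid : ∀ j (hj : j < l.length), L.D.sid j = l[j])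
    (hlim : ∀ j (hj : j < l.length), L.lim l[j] = j)
    (hkind : ∀ x ∈ l, L.kind x = 1) : L.Good H ∧ ∀ x, L.Present x ↔ x ∈ l := by
  constructor
  · constructor
    · intro j hj; rw [hN] at hj; rw [hsid j hj]; exact (hH _ (List.getElem_mem hj)).1
    · intro j hj; rw [hN] at hj; rw [hsid j hj]; exact (hH _ (List.getElem_mem hj)).2
    · intro j hj; rw [hN] at hj; rw [hsid j hj]; exact hlim j hj
    · intro j hj; rw [hN] at hj; rw [hsid j hj]; exact hkind _ (List.getElem_mem hj)
    · intro i j hij hj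
      rw [hN] at hj
      rw [hsid j hj, hsid i (by omega)]
      rcases hij.lt_or_eq with h | rfl
      · exact (List.pairwise_iff_getElem.1 hl i j (by omega) hj h).1
      · exact le_rfl
    all_goals rw [hP]; intros; omega
  · intro x
    unfold Present
    rw [hP, hN]
    simp only [Nat.not_lt_zero, false_and, exists_false, or_false, IsEmpty.forall_iff,
      implies_true, and_true]
    rw [List.mem_iff_getElem]
    exact ⟨fun ⟨j, h1, h2⟩ => ⟨j, h1, by rw [← hsid j h1, h2]⟩,
      fun ⟨j, h1, h2⟩ => ⟨j, h1, by rw [hsid j h1, h2]⟩⟩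

end Layout

end DIS

/-! ### Rebuilding: the pending updates are merged into the static sequence. -/

namespace DIS

section

variable {α : Type u}

/-- The layout that is stored in a state. -/
def State.lay (σ : State α) : Layout (WithBot α) :=
  ⟨σ.stat, σ.arr 11 0, σ.arr 12 0, σ.arr 13 0, σ.reg 5⟩

variable [LinearOrder α]

/-- The number of the job in the register `e` of the list of pending updates. -/
def pendE (e : Expr) : Expr := rd 11 (.const 0) e
def limE (h : Expr) : Expr := rd 12 (.const 0) h
def kindE (h : Expr) : Expr := rd 13 (.const 0) h

/-- Lists all jobs that are present in the array `10`. -/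
def mergeUpdates : Program :=
  .assign 13 (.const 0) ;; .assign 16 (.const 0) ;; .assign 17 (.const 0) ;;
  .loop (.not (.and (.le (.reg 4) (.reg 13)) (.le (.reg 5) (.reg 16))))
    (.ite (.and (lt (.reg 16) (.reg 5)) (.le (limE (pendE (.reg 16))) (.reg 13)))
      (.ite (eq (kindE (pendE (.reg 16))) (.const 0))
          (wr 10 (.const 0) (.reg 17) (pendE (.reg 16)) ;;
            .assign 17 (.add (.reg 17) (.const 1)))
          (.assign 13 (.add (.reg 13) (.const 1))) ;;
        .assign 16 (.add (.reg 16) (.const 1)))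
      (wr 10 (.const 0) (.reg 17) (sidE (.reg 13)) ;;
        .assign 17 (.add (.reg 17) (.const 1)) ;; .assign 13 (.add (.reg 13) (.const 1))))

theorem ex_mergeUpdates {B H : ℕ} {σ : State α} (hb : Bounded B σ) (hL : σ.lay.Good H)
    (hH : H ≤ B) :
    Ex B mergeUpdates σ (fun τ s => s ≤ 6 * (σ.reg 4 + σ.reg 5) + 4 ∧
      FrameArr 13 (fun i => i ≠ 10) σ τ ∧
      τ.reg 17 = (σ.lay.cur 0 (σ.lay.rest 0)).length ∧
      ∀ j (hj : j < (σ.lay.cur 0 (σ.lay.rest 0)).length),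
        τ.arr 10 0 j = (σ.lay.cur 0 (σ.lay.rest 0))[j]) := by
  have hlen := Layout.length_cur_le hL
  have hok := hL.ok
  set L := σ.lay with hLdef
  set l := L.cur 0 (L.rest 0) with hl
  have hLN : L.D.N = σ.reg 4 := rfl
  have hLP : L.P = σ.reg 5 := rfl
  set N := σ.reg 4 with hN
  set P := σ.reg 5 with hP
  have hNB : N ≤ B := hb.1 4
  have hPB : P ≤ B := hb.1 5
  -- `pre` is the part of the final list that has been written, and `cur` from the present position
  -- and update on is the rest. Each round consumes a position or an update, a deletion both; this
  -- gives the variant `μ`.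
  let I : ℕ → State α → Prop := fun μ τ => FrameArr 13 (fun i => i ≠ 10) σ τ ∧
    ∃ c e m pre, τ.reg 13 = c ∧ τ.reg 16 = e ∧ τ.reg 17 = m ∧ c ≤ N ∧ e ≤ P ∧
      L.Ok c (L.rest e) ∧ l = pre ++ L.cur c (L.rest e) ∧ pre.length = m ∧
      (∀ j (hj : j < pre.length), τ.arr 10 0 j = pre[j]) ∧ μ = (N - c) + (P - e)
  refine ex_assign_seq (by simp) (ex_assign_seq (by simp) (ex_assign_seq (by simp) ?_))
  refine (ex_while (k := 5) I ?_ (m := N + P) ?_).imp ?_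
  · rintro μ τ ⟨hF, c, e, m, pre, h13, h16, h17, hc, he, ho, hpre, hm, harr, hμ⟩ hcond
    have h4 : τ.reg 4 = N := hF.2.1 4 (by omega)
    have h5 : τ.reg 5 = P := hF.2.1 5 (by omega)
    have a9 : ∀ v, τ.arr 9 0 v = L.D.sid v := fun v => hF.2.2 9 (by omega) (by omega) 0 v
    have a11 : ∀ v, τ.arr 11 0 v = L.pend v := fun v => hF.2.2 11 (by omega) (by omega) 0 v
    have a12 : ∀ v, τ.arr 12 0 v = L.lim v := fun v => hF.2.2 12 (by omega) (by omega) 0 v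
    have a13 : ∀ v, τ.arr 13 0 v = L.kind v := fun v => hF.2.2 13 (by omega) (by omega) 0 v
    simp only [holds_not, holds_and, holds_le, eval_reg, h4, h5, h13, h16] at hcond
    -- What has been written is a prefix of the final list, whose length and handles are at most
    -- `H`; this keeps all stored numbers bounded.
    have emit : ∀ x es' c' , l = (pre ++ [x]) ++ L.cur c' es' →
        m + 1 ≤ B ∧ x ≤ B := by
      intro x es' c' hx
      have h1 : l.length = m + 1 + (L.cur c' es').length := by
        rw [hx]; simp [hm]; omega
      have h2 : x ∈ l := by rw [hx]; simp
      have h3 := hL.present_pos ((Layout.mem_cur_zero hL).1 h2)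
      omega
    have hext : ∀ x, ∀ j (hj : j < (pre ++ [x]).length), (τ.setArr 10 0 m x).arr 10 0 j =
        (pre ++ [x])[j] := by
      intro x j hj
      rw [arr_setArr _ _ _ _ _ _ (by omega) (by omega)]
      simp only [List.length_append, List.length_singleton] at hj
      by_cases hjm : j = m
      · rw [if_pos ⟨rfl, rfl, hjm⟩]
        subst hjm
        subst hm
        simp
      · rw [if_neg (by omega), harr j (by omega), List.getElem_append_left]
    refine ex_ite (fun h1 => ?_) (fun h1 => ?_)
    · simp only [holds_and, holds_lt, holds_le, eval_reg, eval_const, limE, pendE, eval_rd, h5, h13,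
        h16, a11, a12] at h1
      have hr := Layout.rest_cons (L := L) (e := e) h1.1
      rw [hr] at ho hpre
      have hlim : L.lim (L.pend e) = c := le_antisymm h1.2 (ho.le _ (by simp))
      rw [Layout.cur_cons_of_le h1.2] at hpre
      have htail := ho.tail
      have hent := ho.ent _ (List.mem_cons_self ..)
      rw [hlim] at hpre htail
      refine ex_seq ?_
      refine ex_ite (fun h2 => ?_) (fun h2 => ?_)
      · simp only [holds_eq, kindE, pendE, eval_rd, eval_reg, eval_const, h16, a11, a13] at h2
        rw [if_pos h2] at hpre htail
        have hpre' : l = (pre ++ [L.pend e]) ++ L.cur c (L.rest (e + 1)) := by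
          rw [hpre, List.append_assoc]; rfl
        obtain ⟨b1, b2⟩ := emit _ _ _ hpre'
        refine ex_wr_seq (by simp [pendE, h16, a11]; exact b2) (ex_assign (by simp [h17]; exact b1)
          (ex_assign (by simp [h16]; omega) ?_))
        refine ⟨by omega, (N - c) + (P - (e + 1)), by omega, ?_⟩
        simp only [eval_reg, eval_const, eval_add, reg_setArr, reg_setReg, pendE, eval_rd, h16, h17,
          a11, Nat.reduceEqDiff, if_false]
        refine ⟨((hF.setArr (by omega) (by omega)).setReg (by omega)).setReg (by omega), c, e + 1,
          m + 1, pre ++ [L.pend e], by simp [h13], by simp, by simp, hc, h1.1, htail, hpre',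
          by simp [hm], hext _, rfl⟩
      · simp only [holds_eq, kindE, pendE, eval_rd, eval_reg, eval_const, h16, a11, a13] at h2
        rw [if_neg h2] at hpre htail
        have hcN : c < N := by
          have := (hent.resolve_right (fun g => h2 g.1)).2.1
          omega
        refine ex_assign (by simp [h13]; omega) (ex_assign (by simp [h16]; omega) ?_)
        refine ⟨by omega, (N - (c + 1)) + (P - (e + 1)), by omega, ?_⟩
        simp only [eval_reg, eval_const, eval_add, reg_setReg, h16, h13, Nat.reduceEqDiff,
          if_false]
        exact ⟨(hF.setReg (by omega)).setReg (by omega), c + 1, e + 1, m, pre, by simp, by simp,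
          by simp [h17], hcN, h1.1, htail, hpre, hm, harr, rfl⟩
    · simp only [holds_and, holds_lt, holds_le, eval_reg, eval_const, limE, pendE, eval_rd, h5, h13,
        h16, a11, a12] at h1
      have hstep : c < N ∧ L.Ok (c + 1) (L.rest e) ∧
          l = (pre ++ [L.D.sid c]) ++ L.cur (c + 1) (L.rest e) := by
        rcases Nat.lt_or_ge e P with heP | heP
        · have hr := Layout.rest_cons (L := L) (e := e) heP
          have hlt : c < L.lim (L.pend e) := by
            by_contra hcon
            exact h1 ⟨heP, by omega⟩
          have hlN := (ho.ent (L.pend e) (by rw [hr]; simp)).lim_le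
          rw [hr] at ho hpre ⊢
          refine ⟨by omega, ho.succ hlt, ?_⟩
          rw [hpre, Layout.cur_cons_of_lt hlt, List.append_assoc]; rfl
        · have hr := Layout.rest_nil (L := L) (e := e) heP
          have hlt : c < N := by
            by_contra hcon
            exact hcond ⟨by omega, by omega⟩
          rw [hr] at hpre ⊢
          refine ⟨hlt, ⟨List.Pairwise.nil, by simp, by simp⟩, ?_⟩
          rw [hpre, Layout.cur_nil_of_lt hlt, List.append_assoc]; rfl
      obtain ⟨hcN, ho', hpre'⟩ := hstep
      obtain ⟨b1, b2⟩ := emit _ _ _ hpre'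
      refine ex_wr_seq (by simp [sidE, h13, a9]; exact b2)
        (ex_assign_seq (by simp [h17]; exact b1) (ex_assign (by simp [h13]; omega) ?_))
      refine ⟨by omega, (N - (c + 1)) + (P - e), by omega, ?_⟩
      simp only [eval_reg, eval_const, eval_add, reg_setArr, reg_setReg, sidE, eval_rd, h13, h17,
          a9, Nat.reduceEqDiff, if_false]
      exact ⟨((hF.setArr (by omega) (by omega)).setReg (by omega)).setReg (by omega), c + 1, e,
        m + 1, pre ++ [L.D.sid c], by simp, by simp [h16], by simp, hcN, he, ho', hpre',
        by simp [hm], hext _, rfl⟩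
  · refine ⟨(((FrameArr.refl _ _ σ).setReg (by omega)).setReg (by omega)).setReg (by omega), 0, 0, 0,
      [], by simp, by simp, by simp, Nat.zero_le _, Nat.zero_le _, hok, by rw [hl]; rfl, rfl,
      by simp, by omega⟩
  · rintro τ s ⟨hs, hcond, μ, hF, c, e, m, pre, h13, h16, h17, hc, he, ho, hpre, hm, harr, hμ⟩
    have h4 : τ.reg 4 = N := hF.2.1 4 (by omega)
    have h5 : τ.reg 5 = P := hF.2.1 5 (by omega)
    simp only [holds_not, holds_and, holds_le, eval_reg, h4, h5, h13, h16, not_not] at hcond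
    have hlp : l = pre := by
      rw [hpre, Layout.rest_nil (L := L) (e := e) hcond.2]
      simp only [Layout.cur]
      rw [Static.seg_self (show L.D.N ≤ c from hcond.1), List.append_nil]
    refine ⟨by omega, hF, by rw [h17, hlp, hm], ?_⟩
    rw [hlp]
    exact harr

/-- Makes the list in the array `10` the static sequence. -/
def copyTmp : Program :=
  .assign 13 (.const 0) ;;
  .loop (lt (.reg 13) (.reg 17))
    ((wr 9 (.const 0) (.reg 13) (rd 10 (.const 0) (.reg 13)) ;;
      wr 12 (.const 0) (rd 10 (.const 0) (.reg 13)) (.reg 13) ;;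
      wr 13 (.const 0) (rd 10 (.const 0) (.reg 13)) (.const 1)) ;;
      .assign 13 (.add (.reg 13) (.const 1)))

/-- The entries for `lim` and `kind` are indexed by handles. By `hinj` the handles are distinct, so
later rounds do not overwrite what earlier rounds stored. -/
theorem ex_copyTmp {B : ℕ} {σ : State α} (hb : Bounded B σ) (hB : 1 ≤ B)
    (hinj : ∀ i j, i < j → j < σ.reg 17 → σ.arr 10 0 i ≠ σ.arr 10 0 j) :
    Ex B copyTmp σ (fun τ s => s ≤ 5 * σ.reg 17 + 2 ∧
      FrameArr 13 (fun i => i ≠ 9 ∧ i ≠ 12 ∧ i ≠ 13) σ τ ∧ τ.reg 17 = σ.reg 17 ∧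
      ∀ j < σ.reg 17, τ.arr 9 0 j = σ.arr 10 0 j ∧ τ.arr 12 0 (σ.arr 10 0 j) = j ∧
        τ.arr 13 0 (σ.arr 10 0 j) = 1) := by
  set m := σ.reg 17 with hm
  have hmB : m ≤ B := hb.1 17
  let J : ℕ → State α → Prop := fun v τ =>
    FrameArr 13 (fun i => i ≠ 9 ∧ i ≠ 12 ∧ i ≠ 13) σ τ ∧ τ.reg 17 = m ∧ τ.reg 13 = v ∧
    ∀ j < v, τ.arr 9 0 j = σ.arr 10 0 j ∧ τ.arr 12 0 (σ.arr 10 0 j) = j ∧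
        τ.arr 13 0 (σ.arr 10 0 j) = 1
  refine ex_assign_seq (by simp) ((ex_for (n := m) (k := 3) J hmB ?_ ?_
    (v := 0) (by omega) (hb.update_reg (by simp)) ?_).imp ?_)
  · rintro v τ ⟨-, h17, h13, -⟩
    exact ⟨h17, h13⟩
  · rintro v τ hv hbτ ⟨hF, h17, h13, hE⟩
    have a10 : ∀ j, τ.arr 10 0 j = σ.arr 10 0 j := fun j => hF.2.2 10 (by omega) (by omega) 0 j
    refine ex_wr_seq (by exact hbτ.arr _ _ _) ?_
    simp only [eval_reg, eval_const, eval_rd, h13, a10]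
    refine ex_wr_seq (by simp [h13]; omega) ?_
    have b10 : ∀ j, (τ.setArr 9 0 v (σ.arr 10 0 v)).arr 10 0 j = σ.arr 10 0 j := fun j => by
      rw [arr_setArr _ _ _ _ _ _ (by omega) (by omega), if_neg (by omega), a10]
    simp only [eval_reg, eval_const, eval_rd, reg_setArr, h13, b10]
    refine ex_wr (by simpa using hB) ?_
    have c10 : ∀ j, ((τ.setArr 9 0 v (σ.arr 10 0 v)).setArr 12 0 (σ.arr 10 0 v) v).arr 10 0 j =
        σ.arr 10 0 j := fun j => by
      rw [arr_setArr _ _ _ _ _ _ (by omega) (by omega), if_neg (by omega), b10]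
    simp only [eval_reg, eval_const, eval_rd, reg_setArr, h13, c10]
    refine ⟨by omega, trivial, (((hF.setArr (by omega) (by omega)).setArr (by omega)
      (by omega)).setArr (by omega) (by omega)).setReg (by omega), by simp [h17], by simp, ?_⟩
    intro j hj
    simp only [arr_setReg,
      arr_setArr _ _ _ _ _ _ (show (9 : ℕ) < 16 by omega) (show (9 : ℕ) < 16 by omega),
      arr_setArr _ _ _ _ _ _ (show (9 : ℕ) < 16 by omega) (show (12 : ℕ) < 16 by omega),
      arr_setArr _ _ _ _ _ _ (show (9 : ℕ) < 16 by omega) (show (13 : ℕ) < 16 by omega),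
      arr_setArr _ _ _ _ _ _ (show (12 : ℕ) < 16 by omega) (show (9 : ℕ) < 16 by omega),
      arr_setArr _ _ _ _ _ _ (show (12 : ℕ) < 16 by omega) (show (12 : ℕ) < 16 by omega),
      arr_setArr _ _ _ _ _ _ (show (12 : ℕ) < 16 by omega) (show (13 : ℕ) < 16 by omega),
      arr_setArr _ _ _ _ _ _ (show (13 : ℕ) < 16 by omega) (show (9 : ℕ) < 16 by omega),
      arr_setArr _ _ _ _ _ _ (show (13 : ℕ) < 16 by omega) (show (12 : ℕ) < 16 by omega),
      arr_setArr _ _ _ _ _ _ (show (13 : ℕ) < 16 by omega) (show (13 : ℕ) < 16 by omega)]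
    by_cases hjv : j = v
    · subst hjv; simp
    · have := hinj j v (by omega) hv
      simp [hjv, this]
      exact hE j (by omega)
  · exact ⟨(FrameArr.refl _ _ σ).setReg (by omega), by simp [hm], by simp, by simp⟩
  · rintro τ s ⟨hs, hF, h17, h13, hE⟩
    exact ⟨by omega, hF, h17, hE⟩

/-- Performs the pending updates. -/
def rebuild : Program :=
  mergeUpdates ;; copyTmp ;; .assign 4 (.reg 17) ;; .assign 5 (.const 0) ;; buildTables

theorem ex_rebuild {B H : ℕ} {σ : State α} (hb : Bounded B σ) (hL : σ.lay.Good H)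
    (hH : 3 * H + 8 ≤ B) (sk_zero : σ.sk 0 = ⊥) (bot_lt : ∀ h, 1 ≤ h → h ≤ H → ⊥ < σ.sk h) :
    Ex B rebuild σ (fun τ s => s ≤ 300 * (τ.reg 6 * (H + σ.reg 4 + σ.reg 5 + 2)) ∧
      τ.key = σ.key ∧ (∀ x < 13, x ≠ 4 → x ≠ 5 → x ≠ 6 → τ.reg x = σ.reg x) ∧
      τ.reg 4 ≤ H ∧ τ.reg 5 = 0 ∧ 2 ^ τ.reg 6 < 2 * (τ.reg 4 + 2) ∧ Tables τ H ∧
      τ.lay.Good H ∧ ∀ x, τ.lay.Present x ↔ σ.lay.Present x) := by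
  have hlen := Layout.length_cur_le hL
  have hpw := Layout.pairwise_cur hL hL.ok
  have hmem : ∀ x, x ∈ σ.lay.cur 0 (σ.lay.rest 0) ↔ σ.lay.Present x :=
    fun x => Layout.mem_cur_zero hL
  refine ex_seq ((ex_mergeUpdates hb hL (by omega)).imp_bounded hb ?_)
  rintro τ₁ s₁ hb₁ ⟨hs₁, F₁, r₁, t₁⟩
  set l := σ.lay.cur 0 (σ.lay.rest 0) with hl
  refine ex_seq ((ex_copyTmp hb₁ (by omega) ?_).imp_bounded hb₁ ?_)
  · intro i j hij hj
    rw [r₁] at hj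
    rw [t₁ i (by omega), t₁ j hj]
    exact (List.pairwise_iff_getElem.1 hpw i j (by omega) hj hij).2
  rintro τ₂ s₂ hb₂ ⟨hs₂, F₂, r₂, t₂⟩
  rw [r₁] at t₂ r₂
  refine ex_assign_seq (hb₂.1 _) (ex_assign_seq (by simp) ?_)
  simp only [eval_reg, eval_const, r₂]
  generalize hπ : State.setReg _ 5 _ = π
  have hbπ : Bounded B π := by
    rw [← hπ]; exact (hb₂.update_reg (by omega)).update_reg (by omega)
  have p4 : π.reg 4 = l.length := by rw [← hπ]; simp
  have p5 : π.reg 5 = 0 := by rw [← hπ]; simp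
  have pkey : π.key = σ.key := by rw [← hπ]; exact F₂.1.trans F₁.1
  have psk : π.sk = σ.sk := sk_congr pkey
  have pfk : π.fk = σ.fk := fk_congr pkey
  have preg : ∀ x < 13, x ≠ 4 → x ≠ 5 → π.reg x = σ.reg x := by
    intro x hx h4 h5
    rw [← hπ]
    simp [h4, h5, F₂.2.1 x hx, F₁.2.1 x hx]
  have p9 : ∀ j (hj : j < l.length), π.arr 9 0 j = l[j] := fun j hj => by
    rw [← hπ]; exact (t₂ j hj).1.trans (t₁ j hj)
  have p12 : ∀ j (hj : j < l.length), π.arr 12 0 l[j] = j := fun j hj => by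
    have := (t₂ j hj).2.1
    rw [t₁ j hj] at this
    rw [← hπ]; exact this
  have p13 : ∀ x ∈ l, π.arr 13 0 x = 1 := fun x hx => by
    obtain ⟨j, hj, rfl⟩ := List.mem_iff_getElem.1 hx
    have := (t₂ j hj).2.2
    rw [t₁ j hj] at this
    rw [← hπ]; exact this
  have hlH : ∀ x ∈ l, 1 ≤ x ∧ x ≤ H := fun x hx => hL.present_pos ((hmem x).1 hx)
  obtain ⟨hgood, hpres⟩ := Layout.Good.of_list (L := π.lay) (H := H) (l := l)
    (by
      have : π.lay.D.f = σ.lay.D.f := pfk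
      rw [this]; exact hpw) hlH p4 p5 p9 p12 p13
  have hsid_pos : ∀ v, v < π.reg 4 → 1 ≤ π.arr 9 0 v := hgood.sid_pos
  have hsid_le : ∀ v, v < π.reg 4 → π.arr 9 0 v ≤ H := hgood.sid_le
  refine (ex_buildTables (H := H) hbπ (by omega) hsid_pos hsid_le hgood.sorted
    (by rw [psk]; exact sk_zero) (by rw [psk]; exact bot_lt)).imp ?_
  rintro ω s ⟨hs, wkey, wreg, warr, wpow, hT⟩
  have w4 : ω.reg 4 = π.reg 4 := wreg 4 (by omega) (by omega)
  have w5 : ω.reg 5 = π.reg 5 := wreg 5 (by omega) (by omega)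
  have hK := hT.pow
  have e9 : ω.lay.D.sid = π.lay.D.sid := funext (warr 9 (by omega) (by omega) 0)
  have e11 : ω.lay.pend = π.lay.pend := funext (warr 11 (by omega) (by omega) 0)
  have e12 : ω.lay.lim = π.lay.lim := funext (warr 12 (by omega) (by omega) 0)
  have e13 : ω.lay.kind = π.lay.kind := funext (warr 13 (by omega) (by omega) 0)
  have ef : ω.lay.D.f = π.lay.D.f := fk_congr wkey
  refine ⟨?_, wkey.trans pkey, fun x hx h4 h5 h6 => (wreg x hx h6).trans (preg x hx h4 h5),
    by omega, by omega, by omega, hT, ?_, fun x => ?_⟩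
  · have hK1 : 1 ≤ ω.reg 6 := by
      by_contra h0
      rw [show ω.reg 6 = 0 by omega] at hK
      omega
    rw [p4] at hs
    rw [r₁] at hs₂
    have h1 : ω.reg 6 * (l.length + 2) ≤ ω.reg 6 * (H + 2) := Nat.mul_le_mul_left _ (by omega)
    have h2 : H + σ.reg 4 + σ.reg 5 + 2 ≤ ω.reg 6 * (H + σ.reg 4 + σ.reg 5 + 2) :=
      Nat.le_mul_of_pos_left _ hK1
    have h3 : ω.reg 6 * (H + 2) ≤ ω.reg 6 * (H + σ.reg 4 + σ.reg 5 + 2) :=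
      Nat.mul_le_mul_left _ (by omega)
    omega
  · exact hgood.congr le_rfl w4 e9 w5 (fun e _ => by rw [e11]) (fun h _ _ => by rw [ef])
      (fun h _ _ => by rw [e12]) (fun h _ _ => by rw [e13])
  · rw [← hmem, ← hpres]
    exact hgood.present_congr w4 e9 w5 (fun e _ => by rw [e11]) (fun h _ _ => by rw [e13]) x

end

end DIS

/-! ### New handles do not affect the tables. -/

namespace DIS

namespace Static

variable {κ : Type*} [LinearOrder κ] {D D' : Static κ}

open Classical in
theorem cstep_congr (hsid : D'.sid = D.sid) (hnx : D'.nx = D.nx) (hN : D'.N = D.N)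
    (hfit : ∀ i < D.N, ∀ j < D.N, D'.Fits (D.sid i) j ↔ D.Fits (D.sid i) j) {β v n : ℕ}
    (hβ : ∀ j < D.N, D'.Fits β j ↔ D.Fits β j) : D'.cstep (.A β v n) = D.cstep (.A β v n) := by
  simp only [cstep, hsid, hnx, hN]
  by_cases h : D.nx v < D.N
  · have hp : (fun g => v < g ∧ g < D.nx v ∧ D'.Fits β g) =
        fun g => v < g ∧ g < D.nx v ∧ D.Fits β g := by
      funext g
      exact propext (and_congr_right fun _ => and_congr_right fun h2 => hβ g (h2.trans h))
    rw [if_pos h, if_pos h]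
    by_cases hex : ∃ g, v < g ∧ g < D.nx v ∧ D.Fits β g
    · have hex' : ∃ g, v < g ∧ g < D.nx v ∧ D'.Fits β g := by
        have := hex; rw [← hp] at this; exact this
      have hf : Nat.find hex' = Nat.find hex := by
        congr 1
      rw [dif_pos hex, dif_pos hex', hf]
      have := hfit (Nat.find hex) ((Nat.find_spec hex).2.1.trans h) _ h
      simp only [this]
    · rw [dif_neg hex, dif_neg (by have := hex; rw [← hp] at this; exact this)]
  · rw [if_neg h, if_neg h]

/-- Reachability from a job of the sequence depends only on the jobs of the sequence. -/
theorem reach_congr (hsid : D'.sid = D.sid) (hnx : D'.nx = D.nx) (hN : D'.N = D.N)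
    (hfit : ∀ i < D.N, ∀ j < D.N, D'.Fits (D.sid i) j ↔ D.Fits (D.sid i) j) {u w n : ℕ}
    (hu : u < D.N) (y : Cfg) :
    D'.Reach (.A (D.sid u) w n) y ↔ D.Reach (.A (D.sid u) w n) y := by
  -- Only the handle `β` of a configuration `A` can refer to a job outside the sequence. It is `sid
  -- u` at the start and never changes, so the comparisons of static jobs decide every transition.
  have hstep : ∀ x : Cfg, (∀ β v m, x = .A β v m → β = D.sid u) → D'.cstep x = D.cstep x := by
    intro x hx
    cases x with
    | A β v m => rw [hx β v m rfl]; exact cstep_congr hsid hnx hN hfit (hfit u hu)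
    | P g w m => simp only [cstep, hnx, hN]
    | Nd => rfl
  have hinv : ∀ x z : Cfg, (∀ β v m, x = .A β v m → β = D.sid u) → D.cstep x = some z →
      ∀ β v m, z = .A β v m → β = D.sid u := by
    rintro x z hx h β v m rfl
    cases x with
    | A β' v' m' =>
      simp only [cstep] at h
      split_ifs at h <;> cases h
      exact hx _ _ _ rfl
    | P g w m' =>
      simp only [cstep] at h
      split_ifs at h <;> cases h
    | Nd => cases h
  have h0 : ∀ β v m, Cfg.A (D.sid u) w n = .A β v m → β = D.sid u := by
    intro β v m h; cases h; rfl
  constructor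
  · intro h
    suffices D.Reach (.A (D.sid u) w n) y ∧ ∀ β v m, y = .A β v m → β = D.sid u from this.1
    induction h with
    | refl => exact ⟨.refl, h0⟩
    | @tail y z _ h ih =>
      rw [hstep y ih.2] at h
      exact ⟨ih.1.tail h, hinv y z ih.2 h⟩
  · intro h
    suffices D'.Reach (.A (D.sid u) w n) y ∧ ∀ β v m, y = .A β v m → β = D.sid u from this.1
    induction h with
    | refl => exact ⟨.refl, h0⟩
    | @tail y z _ h ih =>
      refine ⟨ih.1.tail ?_, hinv y z ih.2 h⟩
      rw [hstep y ih.2]; exact h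

end Static

section

variable {α : Type u}

/-- Only the list of pending updates and some auxiliary registers differ. -/
def FrameUpdate (σ τ : State α) : Prop :=
  τ.key = σ.key ∧ (∀ x < 13, x ≠ 5 → τ.reg x = σ.reg x) ∧
    ∀ i < 16, i ≠ 11 → ∀ k v, τ.arr i k v = σ.arr i k v

theorem FrameUpdate.lay {σ τ : State α} (h : FrameUpdate σ τ) :
    τ.lay = { σ.lay with pend := τ.arr 11 0, P := τ.reg 5 } := by
  simp only [State.lay, State.stat, sk_congr h.1, fk_congr h.1, h.2.1 4 (by omega) (by omega),
    show τ.arr 9 0 = σ.arr 9 0 from funext (h.2.2 9 (by omega) (by omega) 0),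
    show τ.arr 3 0 = σ.arr 3 0 from funext (h.2.2 3 (by omega) (by omega) 0),
    show τ.arr 12 0 = σ.arr 12 0 from funext (h.2.2 12 (by omega) (by omega) 0),
    show τ.arr 13 0 = σ.arr 13 0 from funext (h.2.2 13 (by omega) (by omega) 0)]

variable [LinearOrder α]

/-- The tables remain correct when new handles are used. -/
theorem Tables.extend {σ τ : State α} {H H' : ℕ} (h : Tables σ H) (hH : H ≤ H')
    (ha : ∀ i < 10, ∀ k v, τ.arr i k v = σ.arr i k v) (h4 : τ.reg 4 = σ.reg 4)
    (h6 : τ.reg 6 = σ.reg 6) (hsk : ∀ h ≤ H, τ.sk h = σ.sk h) (hfk : ∀ h ≤ H, τ.fk h = σ.fk h)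
    (hbot : ∀ h, 1 ≤ h → h ≤ H' → ⊥ < τ.sk h) : Tables τ H' := by
  have a9 : τ.arr 9 0 = σ.arr 9 0 := funext (ha 9 (by omega) 0)
  have a3 : τ.arr 3 0 = σ.arr 3 0 := funext (ha 3 (by omega) 0)
  have a6 : τ.arr 6 0 = σ.arr 6 0 := funext (ha 6 (by omega) 0)
  have a8 : τ.arr 8 0 = σ.arr 8 0 := funext (ha 8 (by omega) 0)
  have esid : τ.stat.sid = σ.stat.sid := a9
  have enx : τ.stat.nx = σ.stat.nx := a3
  have eN : τ.stat.N = σ.stat.N := h4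
  have hle : ∀ j < σ.stat.N, σ.stat.sid j ≤ H := h.sid_le
  have hs : ∀ j < σ.stat.N, τ.stat.s (σ.stat.sid j) = σ.stat.s (σ.stat.sid j) :=
    fun j hj => hsk _ (hle j hj)
  have hf : ∀ j < σ.stat.N, τ.stat.f (σ.stat.sid j) = σ.stat.f (σ.stat.sid j) :=
    fun j hj => hfk _ (hle j hj)
  have hfit : ∀ i < σ.stat.N, ∀ j < σ.stat.N,
      (τ.stat.Fits (σ.stat.sid i) j ↔ σ.stat.Fits (σ.stat.sid i) j) := by
    intro i hi j hj
    unfold Static.Fits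
    rw [esid, hf i hi, hs j hj]
  have tc : ∀ {G : ℕ}, G < 3 → ∀ {N K : ℕ} {f ct : ℕ → ℕ} {Lb Lb' : ℕ → WithBot α → Prop},
      (∀ v x, Lb v x ↔ Lb' v x) → Table σ G N K H f ct Lb → Table τ G N K H' f ct Lb' := by
    intro G hG N K f ct Lb Lb' hLb h
    have : Lb' = Lb := by funext v x; exact propext (hLb v x).symm
    rw [this]
    obtain ⟨t1, t2, t3, t4⟩ := Table.of_eq h (fun i k v hi => ha i (by omega) k v) hsk hG
    exact ⟨t1, t2, t3, fun k v hk hv => (t4 k v hk hv).trans hH⟩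
  obtain ⟨⟨c1, c2, c3, c4, c5, c6, c7, c8, c9⟩, hj, hl⟩ := h
  refine ⟨⟨?_, ?_, hbot, ?_, ?_, ?_, ?_, ?_, ?_⟩, ?_, ?_⟩
  · rw [h4, h6]; exact c1
  · rw [hsk 0 (by omega)]; exact c2
  · rw [h4, a9]; exact c4
  · rw [h4, a9]; exact fun v hv => (c5 v hv).trans hH
  · intro i j hij hj
    rw [eN] at hj
    rw [esid, hf i (by omega), hf j hj]
    exact c6 i j hij hj
  · obtain ⟨n1, n2, n3, n4, n5⟩ := c7
    refine ⟨?_, ?_, ?_, ?_, ?_⟩ <;> simp only [eN, enx, esid]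
    · exact n1
    · exact n2
    · exact n3
    · intro v j hv hj hj' hF
      have := n2 v hv
      exact n4 v j hv hj hj' ((hfit v hv j (by omega)).1 hF)
    · exact fun v hv hv' => (hfit v hv _ hv').2 (n5 v hv hv')
  · rw [h4, h6]
    refine tc (by omega) (fun v x => and_congr_right fun hv => ?_) c8
    rw [a9, hsk _ (c5 v hv)]
  · rw [h4, h6, enx]
    refine tc (by omega) (fun v x => ?_) c9
    unfold Static.Between
    rw [enx, eN, esid]
    refine exists_congr fun g => and_congr_right fun _ => and_congr_right fun _ =>
      and_congr_right fun hg => ?_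
    rw [hs g hg]
  · rw [a6, a8]
    obtain ⟨j1, j2, j3, j4, j5, j6⟩ := hj
    have hr : ∀ {u}, u < σ.stat.N → ∀ w n y, τ.stat.Reach (.A (σ.stat.sid u) w n) y ↔
        σ.stat.Reach (.A (σ.stat.sid u) w n) y := fun hu w n y =>
      Static.reach_congr esid enx eN hfit hu y
    refine ⟨?_, ?_, ?_, ?_, ?_, ?_⟩ <;> simp only [eN, enx, esid]
    · exact j1
    · exact j2
    · exact j3
    · exact j4
    · exact fun u hu hu' => (hr hu _ _ _).2 (j5 u hu hu')
    · exact fun u hu hu' hu'' u' n hR => j6 u hu hu' hu'' u' n ((hr hu _ _ _).1 hR)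
  · rw [h4, h6, a6, a8]
    exact tc (by omega) (fun _ _ => Iff.rfl) hl

/-! ### The operations -/

/-- Adds the update of the job in register `18` to the list of pending updates. -/
def addUpdate : Program :=
  .assign 13 (.reg 5) ;;
  .loop (.and (.le (.const 1) (.reg 13))
      (.and (.not (lt (limE (pendE (.sub (.reg 13) (.const 1)))) (limE (.reg 18))))
        (.not (.and (eq (limE (pendE (.sub (.reg 13) (.const 1)))) (limE (.reg 18)))
          (.keyLE (fkA (pendE (.sub (.reg 13) (.const 1)))) (fkA (.reg 18)))))))
    (wr 11 (.const 0) (.reg 13) (pendE (.sub (.reg 13) (.const 1))) ;;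
      .assign 13 (.sub (.reg 13) (.const 1))) ;;
  wr 11 (.const 0) (.reg 13) (.reg 18) ;; .assign 5 (.add (.reg 5) (.const 1))

/-- One round of insertion sort: the entries that are not below the new one move up by one place.
The comparison is total, so an entry that is not `Le` the new one is above it. -/
theorem ex_addUpdate {B H : ℕ} {σ : State α} (hb : Bounded B σ) (hL : σ.lay.Good H)
    (h1 : 1 ≤ σ.reg 18) (hH : σ.reg 18 ≤ H) (hent : σ.lay.Ent (σ.reg 18))
    (hne : ∀ e < σ.lay.P, σ.lay.pend e ≠ σ.reg 18) (hP : σ.reg 5 + 1 ≤ B) :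
    Ex B addUpdate σ (fun τ s => s ≤ 3 * σ.reg 5 + 4 ∧ FrameUpdate σ τ ∧
      τ.reg 5 = σ.reg 5 + 1 ∧ τ.lay.Good H ∧
      (σ.lay.kind (σ.reg 18) = 1 → ∀ x, τ.lay.Present x ↔ x ≠ σ.reg 18 ∧ σ.lay.Present x) ∧
      (σ.lay.kind (σ.reg 18) = 0 → (∀ j < σ.lay.D.N, σ.lay.D.sid j ≠ σ.reg 18) →
        ∀ x, τ.lay.Present x ↔ x = σ.reg 18 ∨ σ.lay.Present x)) := by
  set L := σ.lay with hLdef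
  set h := σ.reg 18 with hh
  set P := σ.reg 5 with hPdef
  have hLP : L.P = P := rfl
  let I : ℕ → State α → Prop := fun e τ => FrameArr 13 (fun i => i ≠ 11) σ τ ∧ τ.reg 18 = h ∧
    τ.reg 13 = e ∧ e ≤ P ∧ (∀ x < e, τ.arr 11 0 x = L.pend x) ∧
    (∀ x, e ≤ x → x < P → τ.arr 11 0 (x + 1) = L.pend x) ∧ ∀ x, e ≤ x → x < P → L.Le h (L.pend x)
  have htest : ∀ e τ, I e τ → ((Test.and (.le (.const 1) (.reg 13))
      (.and (.not (lt (limE (pendE (.sub (.reg 13) (.const 1)))) (limE (.reg 18))))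
        (.not (.and (eq (limE (pendE (.sub (.reg 13) (.const 1)))) (limE (.reg 18)))
          (.keyLE (fkA (pendE (.sub (.reg 13) (.const 1)))) (fkA (.reg 18))))))).Holds τ ↔
        1 ≤ e ∧ ¬ L.Le (L.pend (e - 1)) h) := by
    rintro e τ ⟨hF, h18, h13, he, hlt, -⟩
    have a12 : ∀ v, τ.arr 12 0 v = L.lim v := fun v => hF.2.2 12 (by omega) (by omega) 0 v
    simp only [holds_and, holds_le, holds_not, holds_lt, holds_eq, holds_fk_le, limE, pendE,
      eval_rd, eval_sub, eval_reg, eval_const, h13, h18, a12, hF.fk]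
    refine and_congr_right fun he1 => ?_
    rw [hlt (e - 1) (by omega), ← not_or]
    rfl
  refine ex_assign_seq (hb.1 _) (ex_seq ((ex_while (k := 2) I ?_ (m := P) ?_).imp_bounded
    (hb.update_reg (hb.1 _)) ?_))
  · intro e τ hI hc
    obtain ⟨he1, hnle⟩ := (htest e τ hI).1 hc
    obtain ⟨hF, h18, h13, he, hlt, hgt, hge⟩ := hI
    have hpB : L.pend (e - 1) ≤ B := hb.arr 11 0 _
    have hle : L.Le h (L.pend (e - 1)) := by
      unfold Layout.Le at hnle ⊢
      rw [not_or, not_and] at hnle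
      rcases lt_trichotomy (L.lim h) (L.lim (L.pend (e - 1))) with g | g | g
      · exact Or.inl g
      · exact Or.inr ⟨g, (not_le.1 (hnle.2 g.symm)).le⟩
      · exact absurd g hnle.1
    refine ex_wr_seq (by simp [pendE, h13, hlt (e - 1) (by omega)]; exact hpB)
      (ex_assign (by simp [h13]; omega) ?_)
    refine ⟨by omega, e - 1, by omega, ?_⟩
    simp only [eval_reg, eval_const, eval_sub, pendE, eval_rd, reg_setArr, h13,
      hlt (e - 1) (by omega)]
    refine ⟨(hF.setArr (by omega) (by simp)).setReg (by omega), by simp [h18], by simp, by omega,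
      fun x hx => ?_, fun x hx hx' => ?_, fun x hx hx' => ?_⟩
    · rw [arr_setReg, arr_setArr _ _ _ _ _ _ (by omega) (by omega), if_neg (by omega)]
      exact hlt x (by omega)
    · rw [arr_setReg, arr_setArr _ _ _ _ _ _ (by omega) (by omega)]
      by_cases hxe : x + 1 = e
      · rw [if_pos ⟨rfl, rfl, hxe⟩, ← hxe, Nat.add_sub_cancel]
      · rw [if_neg (by omega)]
        exact hgt x (by omega) hx'
    · by_cases hxe : x + 1 = e
      · rw [show x = e - 1 by omega]; exact hle
      · exact hge x (by omega) hx'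
  · exact ⟨(FrameArr.refl _ _ σ).setReg (by omega), by simp [hh], by simp [hPdef], le_rfl,
      fun _ _ => rfl, fun x hx hx' => by omega, fun x hx hx' => by omega⟩
  · rintro τ s hbτ ⟨hs, hc, e, hI⟩
    rw [htest e τ hI] at hc
    obtain ⟨hF, h18, h13, he, hlt, hgt, hge⟩ := hI
    have h5 : τ.reg 5 = P := hF.2.1 5 (by omega)
    refine ex_wr_seq (hbτ.1 _) (ex_assign (by simp [h5]; exact hP) ?_)
    simp only [eval_reg, eval_const, eval_add, reg_setArr, h13, h18, h5]
    generalize hπ : State.setReg _ 5 _ = π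
    have hFU : FrameUpdate σ π := by
      rw [← hπ]
      have := (hF.setArr (i := 11) (k := 0) (v := e) (x := h) (by omega) (by simp))
      refine ⟨this.1, fun x hx hx5 => ?_, this.2.2⟩
      rw [reg_setReg, if_neg hx5]
      exact this.2.1 x hx
    have p5 : π.reg 5 = P + 1 := by rw [← hπ]; simp
    have hlay := hFU.lay
    rw [p5] at hlay
    have harr : ∀ x, π.arr 11 0 x = if x = e then h else τ.arr 11 0 x := fun x => by
      rw [← hπ, arr_setReg, arr_setArr _ _ _ _ _ _ (by omega) (by omega)]
      simp
    have q1 : ∀ x < e, π.arr 11 0 x = L.pend x := fun x hx => by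
      rw [harr, if_neg (by omega)]; exact hlt x hx
    have q2 : π.arr 11 0 e = h := by rw [harr, if_pos rfl]
    have q3 : ∀ x, e ≤ x → x < L.P → π.arr 11 0 (x + 1) = L.pend x := fun x hx hx' => by
      rw [harr, if_neg (by omega)]; exact hgt x hx hx'
    have q4 : ∀ x < e, L.Le (L.pend x) h := by
      intro x hx
      have h0 : L.Le (L.pend (e - 1)) h := by
        by_contra hcon
        exact hc ⟨by omega, hcon⟩
      rcases Nat.lt_or_ge x (e - 1) with g | g
      · exact (hL.order x (e - 1) g (by omega)).2.trans h0
      · rwa [show x = e - 1 by omega]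
    refine ⟨by omega, hFU, p5, ?_, fun hk x => ?_, fun hk hs x => ?_⟩
    · rw [hlay]
      exact hL.add h1 hH hent he hne q1 q2 q3 q4 hge
    · rw [hlay]
      exact Layout.present_add_delete he q1 q2 q3 hk x
    · rw [hlay]
      exact Layout.present_add he q1 q2 q3 hk hs x

/-- Removes the update of the job in register `18` from the list of pending updates. -/
def removeUpdate : Program :=
  .assign 16 (.const 0) ;; .assign 13 (.const 0) ;;
  .loop (lt (.reg 13) (.reg 5))
    ((.ite (eq (pendE (.reg 13)) (.reg 18)) (.assign 16 (.const 1)) .skip ;;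
      .ite (eq (.reg 16) (.const 1))
        (wr 11 (.const 0) (.reg 13) (pendE (.add (.reg 13) (.const 1)))) .skip) ;;
      .assign 13 (.add (.reg 13) (.const 1))) ;;
  .assign 5 (.sub (.reg 5) (.const 1))

/-- Register `16` records that the job has been met; from then on every entry is replaced by the
next one. The last replacement reads one entry beyond the list, which is harmless because the list
becomes shorter. -/
theorem ex_removeUpdate {B H q : ℕ} {σ : State α} (hb : Bounded B σ) (hL : σ.lay.Good H)
    (hB : 1 ≤ B) (hq : q < σ.reg 5) (hpq : σ.lay.pend q = σ.reg 18)
    (hk : σ.lay.kind (σ.reg 18) = 0) :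
    Ex B removeUpdate σ (fun τ s => s ≤ 6 * σ.reg 5 + 4 ∧ FrameUpdate σ τ ∧
      τ.reg 5 = σ.reg 5 - 1 ∧ τ.lay.Good H ∧
      ∀ x, τ.lay.Present x ↔ x ≠ σ.reg 18 ∧ σ.lay.Present x) := by
  set L := σ.lay with hLdef
  set h := σ.reg 18 with hh
  set P := σ.reg 5 with hPdef
  have hLP : L.P = P := rfl
  have hPB : P ≤ B := hb.1 5
  have hiff : ∀ e < P, L.pend e = h ↔ e = q := by
    intro e he
    constructor
    · intro g
      rcases lt_trichotomy e q with g' | g' | g'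
      · exact absurd (g.trans hpq.symm) (hL.order e q g' hq).1
      · exact g'
      · exact absurd (hpq.trans g.symm) (hL.order q e g' he).1
    · rintro rfl; exact hpq
  let J : ℕ → State α → Prop := fun v τ => FrameArr 13 (fun i => i ≠ 11) σ τ ∧ τ.reg 18 = h ∧
    τ.reg 13 = v ∧ τ.reg 16 = (if q < v then 1 else 0) ∧
    ∀ x, τ.arr 11 0 x = if q ≤ x ∧ x < v then L.pend (x + 1) else L.pend x
  refine ex_assign_seq (by simp) (ex_assign_seq (by simp) (ex_seq ((ex_for (n := P) (k := 4) J hPB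
    ?_ ?_ (v := 0) (by omega) ((hb.update_reg (by simp)).update_reg (by simp)) ?_).imp_bounded
    ((hb.update_reg (by simp)).update_reg (by simp)) ?_)))
  · rintro v τ ⟨hF, -, h13, -⟩
    exact ⟨hF.2.1 5 (by omega), h13⟩
  · rintro v τ hv hbτ ⟨hF, h18, h13, h16, harr⟩
    have hpv : τ.arr 11 0 v = L.pend v := by rw [harr, if_neg (by omega)]
    have hpv' : τ.arr 11 0 (v + 1) = L.pend (v + 1) := by rw [harr, if_neg (by omega)]
    have key : Ex B (.ite (eq (pendE (.reg 13)) (.reg 18)) (.assign 16 (.const 1)) .skip) τ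
        (fun ρ s => s ≤ 2 ∧ ρ = τ.setReg 16 (if q < v + 1 then 1 else 0)) := by
      refine ex_ite (fun g => ?_) (fun g => ?_)
      · simp only [holds_eq, pendE, eval_rd, eval_reg, eval_const, h13, h18, hpv] at g
        rw [hiff v hv] at g
        exact ex_assign (by simpa using hB) ⟨by omega, by simp [g]⟩
      · simp only [holds_eq, pendE, eval_rd, eval_reg, eval_const, h13, h18, hpv] at g
        rw [hiff v hv] at g
        refine ex_skip ⟨by omega, ?_⟩
        have : (if q < v + 1 then 1 else 0) = τ.reg 16 := by
          rw [h16]; congr 1; exact propext (by omega)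
        rw [this]
        simp [State.setReg]
    refine ex_seq (key.imp ?_)
    rintro ρ s ⟨hs, rfl⟩
    refine ex_ite (fun g => ?_) (fun g => ?_)
    · simp only [holds_eq, eval_reg, eval_const, reg_setReg, if_true] at g
      have g' : q ≤ v := by split_ifs at g; omega
      refine ex_wr (by exact hbτ.arr _ _ _) ?_
      simp only [eval_reg, eval_const, eval_add, pendE, eval_rd, arr_setReg, reg_setReg, h13,
        Nat.reduceEqDiff, if_false, hpv']
      refine ⟨by omega, by simp [h13], ((hF.setReg (by omega)).setArr (by omega) (by simp)).setReg
        (by omega), by simp [h18], by simp, by simp, fun x => ?_⟩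
      rw [arr_setReg, arr_setArr _ _ _ _ _ _ (by omega) (by omega), arr_setReg, harr]
      by_cases hxv : x = v
      · subst hxv
        rw [if_pos ⟨rfl, rfl, rfl⟩, if_pos ⟨g', by omega⟩]
      · rw [if_neg (by omega)]
        exact if_congr (by omega) rfl rfl
    · simp only [holds_eq, eval_reg, eval_const, reg_setReg, if_true] at g
      have g' : v < q := by split_ifs at g <;> omega
      refine ex_skip ⟨by omega, by simp [h13], (hF.setReg (by omega)).setReg (by omega),
        by simp [h18], by simp, by simp, fun x => ?_⟩
      rw [arr_setReg, arr_setReg, harr]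
      exact if_congr (by omega) rfl rfl
  · exact ⟨((FrameArr.refl _ _ σ).setReg (by omega)).setReg (by omega), by simp [hh], by simp,
      by simp, fun x => by rw [if_neg (by omega)]; rfl⟩
  · rintro τ s hbτ ⟨hs, hF, h18, h13, h16, harr⟩
    have h5 : τ.reg 5 = P := hF.2.1 5 (by omega)
    refine ex_assign (by simp [h5]; omega) ?_
    simp only [eval_reg, eval_const, eval_sub, h5]
    generalize hπ : State.setReg _ 5 _ = π
    have hFU : FrameUpdate σ π := by
      rw [← hπ]
      refine ⟨hF.1, fun x hx hx5 => ?_, hF.2.2⟩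
      rw [reg_setReg, if_neg hx5]
      exact hF.2.1 x hx
    have p5 : π.reg 5 = P - 1 := by rw [← hπ]; simp
    have hlay := hFU.lay
    rw [p5] at hlay
    have harr' : ∀ x, π.arr 11 0 x = if q ≤ x ∧ x < P then L.pend (x + 1) else L.pend x := fun x => by
      rw [← hπ]; exact harr x
    have q1 : ∀ x < q, π.arr 11 0 x = L.pend x := fun x hx => by
      rw [harr', if_neg (by omega)]
    have q3 : ∀ x, q ≤ x → x + 1 < L.P → π.arr 11 0 x = L.pend (x + 1) := fun x hx hx' => by
      rw [harr', if_pos (by omega)]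
    refine ⟨by omega, hFU, p5, ?_, fun x => ?_⟩
    · rw [hlay]
      exact hL.remove hq q1 q3
    · rw [hlay]
      have := hL.present_remove hq q1 q3 (by rw [hpq]; exact hk) x
      rw [hpq] at this
      exact this

end

end DIS

/-! ### Insertion and deletion of a job. -/

namespace DIS

section

variable {α : Type u} [LinearOrder α]

/-- The position of the first job of the static sequence that finishes after the job in register
`3` is put into register `13`. -/
def locate : Program :=
  .assign 13 (.const 0) ;; .assign 35 (.reg 6) ;;
  .loop (.le (.const 1) (.reg 35))
    (.assign 35 (.sub (.reg 35) (.const 1)) ;;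
      .ite (.and (.le (rd 0 (.reg 35) (.reg 13)) (.reg 4))
          (.keyLE (fkA (sidE (.sub (rd 0 (.reg 35) (.reg 13)) (.const 1)))) (fkA (.reg 3))))
        (.assign 13 (rd 0 (.reg 35) (.reg 13))) .skip)

/-- Binary search for the largest `i` such that the first `i` static jobs finish no later than the
new one; as the sequence is sorted, it is enough to test the last of them. Jobs with equal finish
therefore precede the new one, as `Layout.Ent` requires. -/
theorem ex_locate {B H : ℕ} {σ : State α} (hb : Bounded B σ) (hT : Tables σ H) :
    Ex B locate σ (fun τ s => s ≤ 4 * σ.reg 6 + 4 ∧ Frame 13 σ τ ∧ τ.reg 13 ≤ σ.reg 4 ∧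
      (∀ j < τ.reg 13, σ.fk (σ.arr 9 0 j) ≤ σ.fk (σ.reg 3)) ∧
      ∀ j, τ.reg 13 ≤ j → j < σ.reg 4 → σ.fk (σ.reg 3) < σ.fk (σ.arr 9 0 j)) := by
  set N := σ.reg 4 with hN
  set K := σ.reg 6 with hK
  have hKB : K ≤ B := hb.1 6
  have hsort : ∀ i j, i ≤ j → j < N → σ.fk (σ.arr 9 0 i) ≤ σ.fk (σ.arr 9 0 j) := hT.sorted
  have hG := isGraph_succTo N
  let C : ℕ → Prop := fun i => i ≤ N ∧ ∀ j < i, σ.fk (σ.arr 9 0 j) ≤ σ.fk (σ.reg 3)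
  let R : ℕ → State α → Prop := fun i τ => Frame 13 σ τ ∧ τ.reg 13 = i
  have hR : ∀ i τ x, R i τ → R i (τ.setReg 35 x) :=
    fun i τ x ⟨h1, h2⟩ => ⟨h1.setReg (by omega), by simpa⟩
  refine ex_assign_seq (by simp) (ex_assign_seq (by simp; exact hKB) ?_)
  refine Ex.imp (ex_descend (K := K) (k := 2) (C := C) R hR ?_ (j := K) (i := 0) ?_ ?_ ?_ ?_ le_rfl
    hKB) ?_
  · rintro i j τ ⟨hF, h13⟩ ⟨hi, hCi⟩ h35 hj
    have hup : τ.arr 0 j i = (succTo N)^[2 ^ j] i := by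
      rw [hF.arr]; exact hT.succ.up j i hj (by omega)
    -- The successor table replaces the computation of powers of two: its entry is `i + 2 ^ j`, or a
    -- number above `N` if this would leave the sequence.
    have hval : (i + 2 ^ j ≤ N ∧ τ.arr 0 j i = i + 2 ^ j) ∨ (N < i + 2 ^ j ∧ N < τ.arr 0 j i) := by
      rw [hup]
      rcases Nat.lt_or_ge N (i + 2 ^ j) with h | h
      · have := hG.le_iterate (v := i) (by omega) (2 ^ j)
        exact Or.inr ⟨h, by omega⟩
      · exact Or.inl ⟨h, iterate_succTo (by omega)⟩
    have h4 : τ.reg 4 = N := hF.2.2 4 (by omega)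
    have h3 : τ.reg 3 = σ.reg 3 := hF.2.2 3 (by omega)
    have hpos := Nat.one_le_two_pow (n := j)
    refine ex_ite (fun h => ?_) (fun h => ?_)
    · simp only [holds_and, holds_le, holds_fk_le, sidE, eval_rd, eval_reg, eval_sub, eval_const,
        h35, h13, h4, h3, hF.fk] at h
      rcases hval with ⟨g1, g2⟩ | ⟨g1, g2⟩
      · rw [g2, hF.arr] at h
        refine ex_assign (by simp only [eval_rd, hF.arr]; exact hb.arr _ _ _) ?_
        simp only [eval_rd, eval_reg, h35, h13, g2]
        refine ⟨by omega, by simp [h35], Or.inl ⟨⟨g1, fun j' hj' => ?_⟩, hF.setReg (by omega),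
          by simp⟩⟩
        exact (hsort j' _ (by omega) (by omega)).trans h.2
      · omega
    · simp only [holds_and, holds_le, holds_fk_le, sidE, eval_rd, eval_reg, eval_sub, eval_const,
        h35, h13, h4, h3, hF.fk] at h
      refine ex_skip ⟨by omega, h35, Or.inr ⟨fun hC => ?_, hF, h13⟩⟩
      rcases hval with ⟨g1, g2⟩ | ⟨g1, g2⟩
      · rw [g2, hF.arr] at h
        exact h ⟨g1, hC.2 _ (by omega)⟩
      · have := hC.1; omega
  · exact ⟨((Frame.refl 13 σ).setReg (by omega)).setReg (by omega), by simp⟩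
  · exact ⟨Nat.zero_le _, fun j hj => absurd hj (Nat.not_lt_zero _)⟩
  · rintro ⟨h, -⟩
    have : N + 2 ≤ 2 ^ K := hT.pow
    omega
  · simp [hK]
  · rintro τ s ⟨hs, i, ⟨hi, hCi⟩, hCi', hF, h13⟩
    rw [h13]
    refine ⟨by omega, hF, hi, hCi, fun j hj hjN => ?_⟩
    by_contra hcon
    rw [not_lt] at hcon
    refine hCi' ⟨by omega, fun j' hj' => ?_⟩
    exact (hsort j' j (by omega) hjN).trans hcon

/-- The part of the invariant of the data structure that concerns the stored jobs. -/
structure Inv (σ : State α) (H : ℕ) : Prop where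
  reg_eq : σ.reg 3 = H
  good : σ.lay.Good H
  le : σ.reg 4 ≤ H
  sk_zero : σ.sk 0 = ⊥
  fk_zero : σ.fk 0 = ⊥
  bot_lt : ∀ h, 1 ≤ h → h ≤ H → ⊥ < σ.sk h
  sk_lt : ∀ h, 1 ≤ h → h ≤ H → σ.sk h < σ.fk h

theorem FrameUpdate.inv {σ τ : State α} {H : ℕ} (h : FrameUpdate σ τ) (hI : Inv σ H)
    (hg : τ.lay.Good H) : Inv τ H := by
  refine ⟨(h.2.1 3 (by omega) (by omega)).trans hI.reg_eq, hg,
    (h.2.1 4 (by omega) (by omega)).trans_le hI.le, ?_, ?_, ?_, ?_⟩ <;>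
    simp only [sk_congr h.1, fk_congr h.1]
  · exact hI.sk_zero
  · exact hI.fk_zero
  · exact hI.bot_lt
  · exact hI.sk_lt

theorem FrameUpdate.tables {σ τ : State α} {H : ℕ} (h : FrameUpdate σ τ) (hT : Tables σ H) :
    Tables τ H :=
  hT.extend le_rfl (fun i hi k v => h.2.2 i (by omega) (by omega) k v)
    (h.2.1 4 (by omega) (by omega)) (h.2.1 6 (by omega) (by omega))
    (fun x _ => by rw [sk_congr h.1]) (fun x _ => by rw [fk_congr h.1])
    (by rw [sk_congr h.1]; exact hT.bot_lt)

/-- The insertion of a job. -/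
def insertJob : Program :=
  .assign 3 (.add (.reg 3) (.const 1)) ;; .copyKey (skA (.reg 3)) (.const 0) ;;
  .copyKey (fkA (.reg 3)) (.const 1) ;; locate ;; wr 12 (.const 0) (.reg 3) (.reg 13) ;;
  wr 13 (.const 0) (.reg 3) (.const 0) ;; .assign 18 (.reg 3) ;; addUpdate ;; .assign 0 (.reg 3)

/-- The new job gets the handle `H + 1`, which occurs neither in the tables nor in the pending list.
Writing its keys, its `lim` and its `kind` thus leaves everything else valid, by `Tables.extend` and
`Good.congr`. -/
theorem ex_insertJob {B H : ℕ} {σ : State α} (hb : Bounded B σ) (hI : Inv σ H) (hT : Tables σ H)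
    (hH : H + 1 ≤ B) (hP : σ.reg 5 + 1 ≤ B) (h0 : ⊥ < σ.key 0) (h1 : σ.key 0 < σ.key 1) :
    Ex B insertJob σ (fun τ s => s ≤ 4 * σ.reg 6 + 3 * σ.reg 5 + 20 ∧ Inv τ (H + 1) ∧
      Tables τ (H + 1) ∧ (∀ x, τ.lay.Present x ↔ x = H + 1 ∨ σ.lay.Present x) ∧
      (∀ h ≤ H, τ.sk h = σ.sk h ∧ τ.fk h = σ.fk h) ∧ τ.sk (H + 1) = σ.key 0 ∧
      τ.fk (H + 1) = σ.key 1 ∧ τ.reg 0 = H + 1 ∧ τ.reg 5 = σ.reg 5 + 1 ∧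
      ∀ x, x = 1 ∨ x = 2 ∨ x = 4 ∨ x = 6 → τ.reg x = σ.reg x) := by
  have hg := hI.good
  have h3 := hI.reg_eq
  refine ex_assign_seq (by simp [h3]; exact hH) (ex_seq (ex_copyKey (ex_seq (ex_copyKey ?_))))
  simp only [skA, fkA, eval_add, eval_mul, eval_reg, eval_const, reg_setKey, reg_setReg, if_true,
    h3]
  generalize hρ : State.setKey _ _ _ = ρ
  have rkey : ∀ a, ρ.key a = if a = 2 * (H + 1) + 3 then σ.key 1 else
      if a = 2 * (H + 1) + 2 then σ.key 0 else σ.key a := fun a => by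
    rw [← hρ]; simp
  have rsk : ∀ h ≤ H, ρ.sk h = σ.sk h := fun h hh => by
    unfold State.sk; rw [rkey, if_neg (by omega), if_neg (by omega)]
  have rfk : ∀ h ≤ H, ρ.fk h = σ.fk h := fun h hh => by
    unfold State.fk; rw [rkey, if_neg (by omega), if_neg (by omega)]
  have rskH : ρ.sk (H + 1) = σ.key 0 := by
    unfold State.sk; rw [rkey, if_neg (by omega), if_pos rfl]
  have rfkH : ρ.fk (H + 1) = σ.key 1 := by
    unfold State.fk; rw [rkey, if_pos rfl]
  have rreg : ∀ x, ρ.reg x = if x = 3 then H + 1 else σ.reg x := fun x => by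
    rw [← hρ]; simp
  have rarr : ρ.arr = σ.arr := by rw [← hρ]; rfl
  have hbρ : Bounded B ρ := by
    rw [← hρ]
    refine ⟨fun x => ?_, hb.2⟩
    have := hb.1 x
    simp only [reg_setKey, reg_setReg]
    split_ifs
    · exact hH
    · exact this
  have rbot : ∀ h, 1 ≤ h → h ≤ H + 1 → ⊥ < ρ.sk h := by
    intro h hh hh'
    rcases Nat.lt_or_ge H h with g | g
    · rw [show h = H + 1 by omega, rskH]; exact h0
    · rw [rsk h g]; exact hI.bot_lt h hh g
  have rlt : ∀ h, 1 ≤ h → h ≤ H + 1 → ρ.sk h < ρ.fk h := by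
    intro h hh hh'
    rcases Nat.lt_or_ge H h with g | g
    · rw [show h = H + 1 by omega, rskH, rfkH]; exact h1
    · rw [rsk h g, rfk h g]; exact hI.sk_lt h hh g
  have hTρ : Tables ρ (H + 1) := hT.extend (by omega) (fun i _ k v => by rw [rarr])
    (by rw [rreg]; rfl) (by rw [rreg]; rfl) rsk rfk rbot
  have r3 : ρ.reg 3 = H + 1 := by rw [rreg]; rfl
  have r4 : ρ.reg 4 = σ.reg 4 := by rw [rreg]; rfl
  refine ex_seq ((ex_locate hbρ hTρ).imp_bounded hbρ ?_)
  rintro τ s hbτ ⟨hs, hF, k1, k2, k3⟩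
  rw [r3, r4, rarr] at k3
  rw [r3, rarr] at k2
  rw [r4] at k1
  have t3 : τ.reg 3 = H + 1 := (hF.2.2 3 (by omega)).trans r3
  refine ex_wr_seq (hbτ.1 _) (ex_wr_seq (by simp) (ex_assign_seq (by simp [t3]; exact hH) ?_))
  simp only [eval_reg, eval_const, reg_setArr, t3]
  generalize hπ : State.setReg _ 18 _ = π
  have parr : ∀ i < 16, ∀ k v, π.arr i k v = if i = 13 ∧ k = 0 ∧ v = H + 1 then 0 else
      if i = 12 ∧ k = 0 ∧ v = H + 1 then τ.reg 13 else σ.arr i k v := fun i hi k v => by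
    rw [← hπ, arr_setReg, arr_setArr _ _ _ _ _ _ (by omega) hi, arr_setArr _ _ _ _ _ _ (by omega) hi,
      hF.arr, rarr]
  have pkey : π.key = ρ.key := by rw [← hπ]; exact hF.2.1
  have preg : ∀ x < 13, π.reg x = ρ.reg x := fun x hx => by
    rw [← hπ, reg_setReg, if_neg (by omega)]; exact hF.2.2 x hx
  have p18 : π.reg 18 = H + 1 := by rw [← hπ]; simp
  have hbπ : Bounded B π := by
    rw [← hπ]
    exact ((hbτ.update_mem (hbτ.1 _)).update_mem (by omega)).update_reg hH
  have psk : π.sk = ρ.sk := sk_congr pkey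
  have pfk : π.fk = ρ.fk := fk_congr pkey
  have p4 : π.reg 4 = σ.reg 4 := (preg 4 (by omega)).trans r4
  have p5 : π.reg 5 = σ.reg 5 := (preg 5 (by omega)).trans (by rw [rreg]; rfl)
  have p6 : π.reg 6 = σ.reg 6 := (preg 6 (by omega)).trans (by rw [rreg]; rfl)
  have ρ6 : ρ.reg 6 = σ.reg 6 := by rw [rreg]; rfl
  have e9 : π.arr 9 0 = σ.arr 9 0 := funext fun v => by
    rw [parr _ (by omega), if_neg (by omega), if_neg (by omega)]
  have e11 : π.arr 11 0 = σ.arr 11 0 := funext fun v => by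
    rw [parr _ (by omega), if_neg (by omega), if_neg (by omega)]
  have e12 : ∀ h ≤ H, π.arr 12 0 h = σ.arr 12 0 h := fun v hv => by
    rw [parr _ (by omega), if_neg (by omega), if_neg (by omega)]
  have e13 : ∀ h ≤ H, π.arr 13 0 h = σ.arr 13 0 h := fun v hv => by
    rw [parr _ (by omega), if_neg (by omega), if_neg (by omega)]
  have limH : π.lay.lim (H + 1) = τ.reg 13 := by
    refine (parr 12 (by omega) _ _).trans ?_
    rw [if_neg (by omega), if_pos (by simp)]
  have kindH : π.lay.kind (H + 1) = 0 := by
    refine (parr 13 (by omega) _ _).trans ?_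
    rw [if_pos (by simp)]
  have hgπ : π.lay.Good (H + 1) := hg.congr (by omega) p4 e9 p5 (fun e _ => congrFun e11 e)
    (fun h _ hh => (congrFun pfk h).trans (rfk h hh)) (fun h _ hh => e12 h hh)
    (fun h _ hh => e13 h hh)
  have hpres : ∀ x, π.lay.Present x ↔ σ.lay.Present x :=
    hg.present_congr p4 e9 p5 (fun e _ => congrFun e11 e) (fun h _ hh => e13 h hh)
  have hTπ : Tables π (H + 1) := hTρ.extend le_rfl
    (fun i hi k v => by rw [parr i (by omega), if_neg (by omega), if_neg (by omega), rarr])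
    (p4.trans r4.symm) (p6.trans ρ6.symm) (fun x _ => by rw [psk]) (fun x _ => by rw [pfk])
    (by rw [psk]; exact rbot)
  have hent : π.lay.Ent (H + 1) := by
    have esid : π.lay.D.sid = σ.arr 9 0 := e9
    have ef : π.lay.D.f = ρ.fk := pfk
    have eN : π.lay.D.N = σ.reg 4 := p4
    refine Or.inr ⟨kindH, ?_, ?_, ?_⟩ <;> rw [limH]
    · rw [eN]; exact k1
    · rw [esid, ef]; exact k2
    · rw [esid, ef, eN]; exact k3
  have hnp : ∀ e < π.lay.P, π.lay.pend e ≠ H + 1 := by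
    intro e he
    have he' : e < σ.lay.P := by
      have : π.lay.P = σ.lay.P := p5
      omega
    have h := hg.pend_le e he'
    have : π.lay.pend e = σ.lay.pend e := congrFun e11 e
    omega
  have hns : ∀ j < π.lay.D.N, π.lay.D.sid j ≠ H + 1 := by
    intro j hj
    have hj' : j < σ.lay.D.N := by
      have : π.lay.D.N = σ.lay.D.N := p4
      omega
    have h := hg.sid_le j hj'
    have : π.lay.D.sid j = σ.lay.D.sid j := congrFun e9 j
    omega
  refine ex_seq ((ex_addUpdate hbπ hgπ (by omega) (by omega) (by rw [p18]; exact hent)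
    (by rw [p18]; exact hnp) (by rw [p5]; exact hP)).imp_bounded hbπ ?_)
  rintro ω t hbω ⟨ht, hFω, w5, hgω, -, hpω⟩
  rw [p18] at hpω
  have hIπ : Inv π (H + 1) := by
    refine ⟨(preg 3 (by omega)).trans r3, hgπ, ?_, ?_, ?_, ?_, ?_⟩
    · have := hI.le; omega
    · rw [psk, rsk 0 (by omega)]; exact hI.sk_zero
    · rw [pfk, rfk 0 (by omega)]; exact hI.fk_zero
    · rw [psk]; exact rbot
    · rw [psk, pfk]; exact rlt
  have hIω := hFω.inv hIπ hgω
  have hTω := hFω.tables hTπ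
  have w3 := hIω.reg_eq
  have wsk : ω.sk = ρ.sk := (sk_congr hFω.1).trans psk
  have wfk : ω.fk = ρ.fk := (fk_congr hFω.1).trans pfk
  refine ex_assign (hbω.1 _) ?_
  simp only [eval_reg, w3]
  generalize hχ : State.setReg _ 0 _ = χ
  have hχf : χ.key = ω.key ∧ (∀ x, x ≠ 0 → χ.reg x = ω.reg x) ∧ χ.arr = ω.arr ∧ χ.reg 0 = H + 1 := by
    rw [← hχ]
    exact ⟨rfl, fun x hx => by simp [hx], rfl, by simp⟩
  obtain ⟨x1, x2, x3, x4⟩ := hχf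
  have xsk : χ.sk = ω.sk := sk_congr x1
  have xfk : χ.fk = ω.fk := fk_congr x1
  have xlay : χ.lay = ω.lay := by
    simp only [State.lay, State.stat, xsk, xfk, x3, x2 4 (by omega), x2 5 (by omega)]
  refine ⟨?_, ⟨?_, ?_, ?_, ?_, ?_, ?_, ?_⟩, ?_, fun x => ?_, fun h hh => ?_, ?_, ?_, x4, ?_, ?_⟩
  · rw [ρ6] at hs; rw [p5] at ht; omega
  · rw [x2 3 (by omega)]; exact w3
  · rw [xlay]; exact hgω
  · rw [x2 4 (by omega)]; exact hIω.le
  · rw [xsk]; exact hIω.sk_zero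
  · rw [xfk]; exact hIω.fk_zero
  · rw [xsk]; exact hIω.bot_lt
  · rw [xsk, xfk]; exact hIω.sk_lt
  · exact hTω.extend le_rfl (fun i _ k v => by rw [x3]) (x2 4 (by omega)) (x2 6 (by omega))
      (fun x _ => by rw [xsk]) (fun x _ => by rw [xfk]) (by rw [xsk]; exact hIω.bot_lt)
  · rw [xlay, hpω kindH hns, hpres]
  · rw [xsk, xfk, wsk, wfk, rsk h hh, rfk h hh]; exact ⟨rfl, rfl⟩
  · rw [xsk, wsk, rskH]
  · rw [xfk, wfk, rfkH]
  · rw [x2 5 (by omega), w5, p5]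
  · intro x hx
    rw [x2 x (by omega), hFω.2.1 x (by omega) (by omega), preg x (by omega), rreg,
      if_neg (by omega)]

/-- The deletion of a job. -/
def deleteJob : Program :=
  .assign 18 (.reg 0) ;; .ite (eq (kindE (.reg 18)) (.const 0)) removeUpdate addUpdate

/-- The kind separates the cases. Kind `0` means that the job is only pending, so its entry is
dropped. A static job has kind `1` and its position as `lim` since the last rebuilding, so its
handle is already a correct pending deletion. -/
theorem ex_deleteJob {B H : ℕ} {σ : State α} (hb : Bounded B σ) (hI : Inv σ H) (hT : Tables σ H)
    (hP : σ.reg 5 + 1 ≤ B) (hp : σ.lay.Present (σ.reg 0)) :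
    Ex B deleteJob σ (fun τ s => s ≤ 6 * σ.reg 5 + 10 ∧ Inv τ H ∧ Tables τ H ∧
      (∀ x, τ.lay.Present x ↔ x ≠ σ.reg 0 ∧ σ.lay.Present x) ∧ τ.key = σ.key ∧
      τ.reg 5 ≤ σ.reg 5 + 1 ∧ ∀ x, x = 1 ∨ x = 2 ∨ x = 4 ∨ x = 6 → τ.reg x = σ.reg x) := by
  have hg := hI.good
  refine ex_assign_seq (hb.1 _) ?_
  simp only [eval_reg]
  generalize hπ : State.setReg _ 18 _ = π
  have p18 : π.reg 18 = σ.reg 0 := by rw [← hπ]; simp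
  have hFπ : FrameUpdate σ π := by
    rw [← hπ]
    exact ⟨rfl, fun x hx _ => by rw [reg_setReg, if_neg (by omega)], fun _ _ _ _ _ => rfl⟩
  have hbπ : Bounded B π := by rw [← hπ]; exact hb.update_reg (hb.1 _)
  have hlay : π.lay = σ.lay := by rw [← hπ]; rfl
  have p5 : π.reg 5 = σ.reg 5 := by rw [← hπ]; rfl
  have hgπ : π.lay.Good H := by rw [hlay]; exact hg
  have hIπ := hFπ.inv hI hgπ
  have hTπ := hFπ.tables hT
  have hk : ∀ v, π.arr 13 0 v = π.lay.kind v := fun _ => rfl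
  have hcomm : ∀ (τ : State α) (s : ℕ), s ≤ 6 * σ.reg 5 + 4 → FrameUpdate π τ →
      τ.reg 5 ≤ σ.reg 5 + 1 → τ.lay.Good H →
      (∀ x, τ.lay.Present x ↔ x ≠ σ.reg 0 ∧ σ.lay.Present x) →
      (1 + (1 + s)) ≤ 6 * σ.reg 5 + 10 ∧ Inv τ H ∧ Tables τ H ∧
      (∀ x, τ.lay.Present x ↔ x ≠ σ.reg 0 ∧ σ.lay.Present x) ∧ τ.key = σ.key ∧
      τ.reg 5 ≤ σ.reg 5 + 1 ∧ ∀ x, x = 1 ∨ x = 2 ∨ x = 4 ∨ x = 6 → τ.reg x = σ.reg x := by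
    intro τ s h1 h2 h3 h4 h5
    refine ⟨by omega, h2.inv hIπ h4, h2.tables hTπ, h5, h2.1.trans hFπ.1, h3, fun x hx => ?_⟩
    rw [h2.2.1 x (by omega) (by omega), hFπ.2.1 x (by omega) (by omega)]
  refine ex_ite (fun h => ?_) (fun h => ?_)
  · simp only [holds_eq, kindE, eval_rd, eval_reg, eval_const, p18, hk] at h
    obtain ⟨e, he, hpe⟩ : ∃ e < σ.lay.P, σ.lay.pend e = σ.reg 0 := by
      rcases hp with ⟨j, g1, g2, -⟩ | ⟨e, g1, g2, -⟩
      · have := hg.kind_sid j g1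
        rw [g2, ← hlay, h] at this
        omega
      · exact ⟨e, g1, g2⟩
    refine (ex_removeUpdate (q := e) hbπ hgπ (by omega) (by rw [p5]; exact he)
      (by rw [hlay, p18]; exact hpe) (by rw [p18]; exact h)).imp ?_
    rintro τ s ⟨hs, hF, h5, h6, h7⟩
    rw [p18, hlay] at h7
    exact hcomm τ s (by omega) hF (by omega) h6 h7
  · simp only [holds_eq, kindE, eval_rd, eval_reg, eval_const, p18, hk] at h
    rw [hlay] at h
    obtain ⟨j, hj, hjs, hjp⟩ : ∃ j < σ.lay.D.N, σ.lay.D.sid j = σ.reg 0 ∧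
        ∀ e < σ.lay.P, σ.lay.pend e ≠ σ.reg 0 := by
      rcases hp with g | ⟨e, -, -, g⟩
      · exact g
      · exact absurd g h
    have hk1 := hg.kind_sid j hj
    have hl1 := hg.lim_sid j hj
    rw [hjs] at hk1 hl1
    obtain ⟨hpos, hle⟩ := hg.present_pos hp
    refine (ex_addUpdate hbπ hgπ (by omega) (by omega) ?_ (by rw [p18, hlay]; exact hjp)
      (by omega)).imp ?_
    · rw [p18, hlay]
      exact Or.inl ⟨hk1, by rw [hl1]; exact hj, by rw [hl1]; exact hjs⟩
    · rintro τ s ⟨hs, hF, h5, h6, h7, -⟩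
      rw [p18, hlay] at h7
      exact hcomm τ s (by omega) hF (by omega) h6 (h7 hk1)

end

end DIS

/-! ### Answering a query. -/

namespace DIS

/-- The machine listed first remains the one that is free first; `ex_gap` relies on this when it
skips jobs. -/
theorem foldl_gstep_sorted {ι κ : Type*} [LinearOrder κ] (s f : ι → κ) (l : List ι) :
    ∀ a b n, l.Pairwise (fun x y => f x ≤ f y) → (∀ x ∈ l, f b ≤ f x) → f a ≤ f b →
      f (l.foldl (gstep s f) (a, b, n)).1 ≤ f (l.foldl (gstep s f) (a, b, n)).2.1 := by
  induction l with
  | nil => intro a b n _ _ h; exact h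
  | cons x l ih =>
    intro a b n hl hb hab
    rw [List.pairwise_cons] at hl
    have hbx : f b ≤ f x := hb x (by simp)
    simp only [List.foldl_cons, gstep]
    split_ifs
    · exact ih _ _ _ hl.2 hl.1 (hab.trans hbx)
    · exact ih _ _ _ hl.2 hl.1 hbx
    · exact ih _ _ _ hl.2 (fun y hy => hb y (by simp [hy])) hab

section

variable {α : Type u} [LinearOrder α]

/-- The greedy algorithm for one job. -/
def greedyStep : Program :=
  .ite (fits (.reg 8) (.reg 13))
    (.assign 8 (.reg 13) ;; .assign 9 (.add (.reg 9) (.const 1)))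
    (.ite (fits (.reg 7) (.reg 13))
      (.assign 7 (.reg 8) ;; .assign 8 (.reg 13) ;; .assign 9 (.add (.reg 9) (.const 1)))
      .skip)

theorem ex_greedyStep {B : ℕ} {σ : State α} (hb : Bounded B σ) (h9 : σ.reg 9 + 1 ≤ B) :
    Ex B greedyStep σ (fun τ s => s ≤ 5 ∧ Frame 7 σ τ ∧ τ.reg 10 = σ.reg 10 ∧
      τ.reg 12 = σ.reg 12 ∧
      gstep σ.sk σ.fk (σ.reg 7, σ.reg 8, σ.reg 9) (σ.reg 13) = (τ.reg 7, τ.reg 8, τ.reg 9)) := by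
  have hF := Frame.refl 7 σ
  refine ex_ite (fun h => ?_) (fun h => ex_ite (fun h' => ?_) (fun h' => ?_))
  · simp only [holds_fits, eval_reg] at h
    refine ex_assign_seq (hb.1 _) (ex_assign (by simpa using h9) ?_)
    refine ⟨by omega, (hF.setReg (by omega)).setReg (by omega), by simp, by simp, ?_⟩
    simp [gstep, h]
  · simp only [holds_fits, eval_reg] at h h'
    refine ex_assign_seq (hb.1 _) (ex_assign_seq (hb.1 _) (ex_assign (by simpa using h9) ?_))
    refine ⟨by omega, ((hF.setReg (by omega)).setReg (by omega)).setReg (by omega), by simp,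
      by simp, ?_⟩
    simp [gstep, h, h']
  · simp only [holds_fits, eval_reg] at h h'
    refine ex_skip ⟨by omega, hF, rfl, rfl, ?_⟩
    simp [gstep, h, h']

/-- The answer to a query. -/
def answer : Program :=
  .assign 7 (.const 0) ;; .assign 8 (.const 0) ;; .assign 9 (.const 0) ;; .assign 10 (.const 0) ;;
  .assign 12 (.const 0) ;;
  .loop (lt (.reg 12) (.reg 5))
    ((.assign 11 (limE (pendE (.reg 12))) ;; gap ;; .assign 10 (.reg 11) ;;
      .assign 13 (pendE (.reg 12)) ;;
      .ite (eq (kindE (.reg 13)) (.const 0)) greedyStep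
        (.assign 10 (.add (.reg 10) (.const 1)))) ;;
      .assign 12 (.add (.reg 12) (.const 1))) ;;
  .assign 11 (.reg 4) ;; gap ;; .assign 0 (.reg 9)

/-- Registers `7`, `8`, `9` hold the greedy state after a prefix of the current list, and `cur`
describes the rest. Every pending update costs one stretch and at most one greedy step, so there are
`P + 1` stretches in all. -/
theorem ex_answer {B H : ℕ} {σ : State α} (hb : Bounded B σ) (hI : Inv σ H) (hT : Tables σ H)
    (hB : 6 * H + 20 ≤ B) :
    Ex B answer σ (fun τ s => s ≤ 300 * (σ.reg 6 * (σ.reg 5 + 1)) ∧ τ.mem = σ.mem ∧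
      τ.key = σ.key ∧ (∀ x < 7, x ≠ 0 → τ.reg x = σ.reg x) ∧
      τ.reg 0 = opt σ.sk σ.fk ⊥ ⊥ (σ.lay.cur 0 (σ.lay.rest 0))) := by
  have hg := hI.good
  have hok := hg.ok
  have hlen := Layout.length_cur_le hg
  have hpw := Layout.pairwise_cur hg hg.ok
  have hNH := hI.le
  set L := σ.lay with hLdef
  set l := L.cur 0 (L.rest 0) with hl
  set N := σ.reg 4 with hN
  set P := σ.reg 5 with hP
  set K := σ.reg 6 with hK
  have hPB : P ≤ B := hb.1 5
  have hLN : L.D.N = N := rfl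
  have hLP : L.P = P := rfl
  have hK1 : 1 ≤ K := by
    by_contra h0
    have := hT.pow
    rw [← hK, show K = 0 by omega] at this
    omega
  -- Handle `0` is the last job of an empty machine; its finish is `⊥`, so it is in order before
  -- every job and blocks none.
  have hmin : ∀ x, σ.fk 0 ≤ σ.fk x := fun x => by rw [hI.fk_zero]; exact bot_le
  have hpre : ∀ pre suf, l = pre ++ suf → ∀ a b n,
      pre.foldl (gstep σ.sk σ.fk) (0, 0, 0) = (a, b, n) → σ.fk a ≤ σ.fk b ∧ n ≤ H := by
    intro pre suf hps a b n hf
    have h1 : pre.Pairwise (fun x y => σ.fk x ≤ σ.fk y) := by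
      have : l.Pairwise (fun x y => σ.fk x ≤ σ.fk y) := hpw.imp (fun h => h.1)
      rw [hps, List.pairwise_append] at this
      exact this.1
    have h2 := foldl_gstep_sorted σ.sk σ.fk pre 0 0 0 h1 (fun x _ => hmin x) le_rfl
    have h3 := foldl_gstep_le σ.sk σ.fk pre (0, 0, 0)
    rw [hf] at h2 h3
    have h4 : pre.length ≤ l.length := by rw [hps]; simp
    exact ⟨h2, by simp only at h3; omega⟩
  have hgap : ∀ (τ : State α) (pre : List ℕ), Bounded B τ → Frame 7 σ τ →
      τ.reg 11 ≤ N → (∃ suf, l = pre ++ suf) →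
      pre.foldl (gstep σ.sk σ.fk) (0, 0, 0) = (τ.reg 7, τ.reg 8, τ.reg 9) →
      Ex B gap τ (fun ρ s => s ≤ 88 * K + 160 ∧ Frame 7 σ ρ ∧
        (∀ x < 20, x ≠ 7 → x ≠ 8 → x ≠ 9 → ρ.reg x = τ.reg x) ∧
        (pre ++ L.D.seg (τ.reg 10) (τ.reg 11)).foldl (gstep σ.sk σ.fk) (0, 0, 0) =
          (ρ.reg 7, ρ.reg 8, ρ.reg 9)) := by
    rintro τ pre hbτ hF h11 ⟨suf, hsuf⟩ hf
    obtain ⟨g1, g2⟩ := hpre pre suf hsuf _ _ _ hf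
    have h4 : τ.reg 4 = N := hF.2.2 4 (by omega)
    have h6 : τ.reg 6 = K := hF.2.2 6 (by omega)
    refine (ex_gap hbτ (hT.of_frame hF (by omega)) (by omega) (by rw [hF.fk]; exact g1)
      (by omega)).imp ?_
    rintro ρ s ⟨hs, hFρ, hrun⟩
    rw [h6] at hs
    rw [hF.stat (by omega)] at hrun
    refine ⟨hs, ⟨hFρ.1.trans hF.1, hFρ.2.1.trans hF.2.1, fun x hx => ?_⟩, hFρ.2.2, ?_⟩
    · rw [hFρ.2.2 x (by omega) (by omega) (by omega) (by omega), hF.2.2 x hx]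
    · rw [List.foldl_append, hf]; exact hrun
  let J : ℕ → State α → Prop := fun v τ => Frame 7 σ τ ∧ τ.reg 12 = v ∧ τ.reg 10 ≤ N ∧
    L.Ok (τ.reg 10) (L.rest v) ∧ ∃ pre, l = pre ++ L.cur (τ.reg 10) (L.rest v) ∧
    pre.foldl (gstep σ.sk σ.fk) (0, 0, 0) = (τ.reg 7, τ.reg 8, τ.reg 9)
  refine ex_assign_seq (by simp) (ex_assign_seq (by simp) (ex_assign_seq (by simp)
    (ex_assign_seq (by simp) (ex_assign_seq (by simp) (ex_seq ?_)))))
  simp only [eval_const]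
  generalize hπ : State.setReg _ 12 _ = π
  have hFπ : Frame 7 σ π := by
    rw [← hπ]
    exact (((((Frame.refl 7 σ).setReg (by omega)).setReg (by omega)).setReg (by omega)).setReg
      (by omega)).setReg (by omega)
  have hbπ : Bounded B π := by
    rw [← hπ]
    exact ((((hb.update_reg (by simp)).update_reg (by simp)).update_reg (by simp)).update_reg
      (by simp)).update_reg (by simp)
  refine (ex_for (n := P) (k := 88 * K + 170) J hPB ?_ ?_ (v := 0) (by omega) hbπ ?_).imp_bounded
    hbπ ?_
  · rintro v τ ⟨hF, h12, -⟩
    exact ⟨hF.2.2 5 (by omega), h12⟩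
  · rintro v τ hv hbτ ⟨hF, h12, h10, ho, pre, hsuf, hf⟩
    have hr := Layout.rest_cons (L := L) (e := v) hv
    rw [hr] at ho hsuf
    have hent := ho.ent (L.pend v) (by simp)
    have hc := ho.le (L.pend v) (by simp)
    have htail := ho.tail
    have a11 : ∀ x, τ.arr 11 0 x = L.pend x := fun x => by rw [hF.arr]; rfl
    have a12 : ∀ x, τ.arr 12 0 x = L.lim x := fun x => by rw [hF.arr]; rfl
    have hlimN : L.lim (L.pend v) ≤ N := hent.lim_le
    refine ex_assign_seq (hbτ.arr _ _ _) ?_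
    simp only [limE, pendE, eval_rd, eval_reg, eval_const, h12, a11, a12]
    refine ex_seq ((hgap (τ.setReg 11 (L.lim (L.pend v))) pre
      (hbτ.update_reg (by rw [← a12]; exact hbτ.arr _ _ _)) (hF.setReg (by omega))
      (by simpa using hlimN) ⟨_, hsuf⟩ (by simpa using hf)).imp_bounded
      (hbτ.update_reg (by rw [← a12]; exact hbτ.arr _ _ _)) ?_)
    rintro ρ s hbρ ⟨hs, hFρ, hreg, hfρ⟩
    simp only [reg_setReg, Nat.reduceEqDiff, if_false, if_true] at hfρ
    have r11 : ρ.reg 11 = L.lim (L.pend v) := by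
      rw [hreg 11 (by omega) (by omega) (by omega) (by omega)]; simp
    have r12 : ρ.reg 12 = v := by
      rw [hreg 12 (by omega) (by omega) (by omega) (by omega)]; simp [h12]
    have b11 : ∀ x, ρ.arr 11 0 x = L.pend x := fun x => by rw [hFρ.arr]; rfl
    refine ex_assign_seq (hbρ.1 _) (ex_assign_seq (hbρ.arr _ _ _) ?_)
    simp only [eval_rd, eval_reg, eval_const, reg_setReg, arr_setReg, r11, r12, b11,
      Nat.reduceEqDiff, if_false]
    generalize hω : State.setReg _ 13 _ = ω
    have hFω : Frame 7 σ ω := by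
      rw [← hω]; exact (hFρ.setReg (by omega)).setReg (by omega)
    have hbω : Bounded B ω := by
      rw [← hω]
      refine (hbρ.update_reg ?_).update_reg ?_
      · rw [← r11]; exact hbρ.1 _
      · rw [← b11]; exact hbρ.arr _ _ _
    have w7 : ω.reg 7 = ρ.reg 7 := by rw [← hω]; simp
    have w8 : ω.reg 8 = ρ.reg 8 := by rw [← hω]; simp
    have w9 : ω.reg 9 = ρ.reg 9 := by rw [← hω]; simp
    have w10 : ω.reg 10 = L.lim (L.pend v) := by rw [← hω]; simp
    have w12 : ω.reg 12 = v := by rw [← hω]; simp [r12]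
    have w13 : ω.reg 13 = L.pend v := by rw [← hω]; simp
    have k13 : ω.arr 13 0 (L.pend v) = L.kind (L.pend v) := by rw [hFω.arr]; rfl
    rw [← w7, ← w8, ← w9] at hfρ
    have hsuf' : l = (pre ++ L.D.seg (τ.reg 10) (L.lim (L.pend v))) ++
        if L.kind (L.pend v) = 0 then L.pend v :: L.cur (L.lim (L.pend v)) (L.rest (v + 1))
        else L.cur (L.lim (L.pend v) + 1) (L.rest (v + 1)) := by
      rw [hsuf, List.append_assoc]; rfl
    obtain ⟨-, hcnt⟩ := hpre _ _ hsuf' _ _ _ hfρ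
    refine ex_ite (fun h => ?_) (fun h => ?_)
    · simp only [holds_eq, kindE, eval_rd, eval_reg, eval_const, w13, k13] at h
      rw [if_pos h] at hsuf' htail
      refine (ex_greedyStep hbω (by omega)).imp ?_
      rintro χ t ⟨ht, hFχ, x10, x12, hgs⟩
      rw [hFω.sk, hFω.fk, w13] at hgs
      refine ⟨by omega, by rw [x12, w12], (hFω.trans hFχ le_rfl).setReg (by omega), by simp, ?_, ?_,
        (pre ++ L.D.seg (τ.reg 10) (L.lim (L.pend v))) ++ [L.pend v], ?_, ?_⟩
      · simp [x10, w10]; exact hlimN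
      · simp [x10, w10]; exact htail
      · rw [hsuf']; simp [x10, w10]
      · rw [List.foldl_append, hfρ]
        simp only [List.foldl_cons, List.foldl_nil, hgs]
        simp
    · simp only [holds_eq, kindE, eval_rd, eval_reg, eval_const, w13, k13] at h
      rw [if_neg h] at hsuf' htail
      have hlt : L.lim (L.pend v) < N := (hent.resolve_right (fun g => h g.1)).2.1
      refine ex_assign (by simp [w10]; omega) ?_
      refine ⟨by omega, by simp [w12], (hFω.setReg (by omega)).setReg (by omega), by simp, ?_, ?_,
        (pre ++ L.D.seg (τ.reg 10) (L.lim (L.pend v))), ?_, ?_⟩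
      · simp [w10]; exact hlt
      · simp [w10]; exact htail
      · simp [w10]; rw [← List.append_assoc]; exact hsuf'
      · rw [hfρ]; simp
  · have q : ∀ x, x = 7 ∨ x = 8 ∨ x = 9 ∨ x = 10 ∨ x = 12 → π.reg x = 0 := by
      rintro x (rfl | rfl | rfl | rfl | rfl) <;> rw [← hπ] <;> simp
    refine ⟨hFπ, q 12 (by omega), by rw [q 10 (by omega)]; omega, by rw [q 10 (by omega)]; exact hok,
      [], by rw [q 10 (by omega)]; rfl, by rw [q 7 (by omega), q 8 (by omega), q 9 (by omega)]; rfl⟩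
  · rintro τ s hbτ ⟨hs, hF, h12, h10, ho, pre, hsuf, hf⟩
    rw [Layout.rest_nil (L := L) (e := P) le_rfl] at hsuf
    have h4 : τ.reg 4 = N := hF.2.2 4 (by omega)
    refine ex_assign_seq (hbτ.1 _) ?_
    simp only [eval_reg, h4]
    refine ex_seq ((hgap (τ.setReg 11 N) pre (hbτ.update_reg (by omega)) (hF.setReg (by omega))
      (by simp) ⟨_, hsuf⟩ (by simpa using hf)).imp_bounded (hbτ.update_reg (by omega)) ?_)
    rintro ρ t hbρ ⟨ht, hFρ, hreg, hfρ⟩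
    simp only [reg_setReg, Nat.reduceEqDiff, if_false, if_true] at hfρ
    have hl' : pre ++ L.D.seg (τ.reg 10) N = l := hsuf.symm
    rw [hl'] at hfρ
    refine ex_assign (hbρ.1 _) ?_
    refine ⟨?_, hFρ.1, hFρ.2.1, fun x hx hx0 => ?_, ?_⟩
    · have h1 : P + 1 ≤ K * (P + 1) := Nat.le_mul_of_pos_left _ hK1
      have h2 : (88 * K + 170 + 2) * (P - 0) = 88 * (K * P) + 172 * P := by
        rw [Nat.sub_zero]; ring
      rw [h2] at hs
      rw [Nat.mul_add, Nat.mul_one] at h1 ⊢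
      omega
    · rw [reg_setReg, if_neg hx0]; exact hFρ.2.2 x hx
    · have h1 := foldl_gstep_eq_opt σ.sk σ.fk l 0 0 0 (hpw.imp (fun h => h.1))
        (fun x _ => hmin x) le_rfl
      rw [hfρ, hI.fk_zero] at h1
      simp only [Nat.zero_add] at h1
      simpa using h1

end

end DIS

/-! ### Amortization: rebuilding at the squares. -/

namespace DIS

section

variable {α : Type u} [LinearOrder α]

/-- Counts the operations, and rebuilds the tables whenever this count reaches a square. -/
def prelude : Program :=
  .ite (eq (.reg 1) (.mul (.reg 2) (.reg 2)))
    (rebuild ;; .assign 2 (.add (.reg 2) (.const 1))) .skip ;;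
  .assign 1 (.add (.reg 1) (.const 1))

/-- The invariant after `m` operations. -/
structure Ready (σ : State α) (m H : ℕ) : Prop extends Inv σ H where
  time : σ.reg 1 = m
  le_sq : m ≤ σ.reg 2 * σ.reg 2
  sq_le : (σ.reg 2 - 1) * (σ.reg 2 - 1) + σ.reg 5 ≤ m
  tables : 0 < σ.reg 2 → Tables σ H
  pow_lt : 0 < σ.reg 2 → 2 ^ σ.reg 6 < 2 * (H + 2)
  handles : H ≤ m

omit [LinearOrder α] in
theorem State.lay_congr {σ τ : State α} (hmem : τ.mem = σ.mem) (hsk : τ.sk = σ.sk)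
    (hfk : τ.fk = σ.fk) (h4 : τ.reg 4 = σ.reg 4) (h5 : τ.reg 5 = σ.reg 5) : τ.lay = σ.lay := by
  simp only [State.lay, State.stat, hsk, hfk, arr_congr hmem, h4, h5]

theorem Inv.congr {σ τ : State α} {H : ℕ} (h : Inv σ H) (hmem : τ.mem = σ.mem)
    (hsk : τ.sk = σ.sk) (hfk : τ.fk = σ.fk) (hreg : ∀ x < 7, x ≠ 0 → τ.reg x = σ.reg x) :
    Inv τ H := by
  refine ⟨(hreg 3 (by omega) (by omega)).trans h.reg_eq, ?_,
    (hreg 4 (by omega) (by omega)).trans_le h.le, ?_, ?_, ?_, ?_⟩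
  · rw [State.lay_congr hmem hsk hfk (hreg 4 (by omega) (by omega)) (hreg 5 (by omega) (by omega))]
    exact h.good
  · rw [hsk]; exact h.sk_zero
  · rw [hfk]; exact h.fk_zero
  · rw [hsk]; exact h.bot_lt
  · rw [hsk, hfk]; exact h.sk_lt

theorem Inv.tables_congr {σ τ : State α} {H : ℕ} (h : Inv σ H) (hT : Tables σ H)
    (hmem : τ.mem = σ.mem) (hsk : τ.sk = σ.sk) (hfk : τ.fk = σ.fk)
    (hreg : ∀ x < 7, x ≠ 0 → τ.reg x = σ.reg x) : Tables τ H :=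
  hT.extend le_rfl (fun i _ k v => by rw [arr_congr hmem]) (hreg 4 (by omega) (by omega))
    (hreg 6 (by omega) (by omega)) (fun x _ => by rw [hsk]) (fun x _ => by rw [hfk])
    (by rw [hsk]; exact h.bot_lt)

theorem Ready.congr {σ τ : State α} {m H : ℕ} (h : Ready σ m H) (hmem : τ.mem = σ.mem)
    (hsk : τ.sk = σ.sk) (hfk : τ.fk = σ.fk) (hreg : ∀ x < 7, x ≠ 0 → τ.reg x = σ.reg x) :
    Ready τ m H := by
  have h1 := hreg 1 (by omega) (by omega)
  have h2 := hreg 2 (by omega) (by omega)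
  have h5 := hreg 5 (by omega) (by omega)
  have h6 := hreg 6 (by omega) (by omega)
  refine ⟨h.toInv.congr hmem hsk hfk hreg, h1.trans h.time, ?_, ?_, fun hr => ?_, fun hr => ?_,
    h.handles⟩
  · rw [h2]; exact h.le_sq
  · rw [h2, h5]; exact h.sq_le
  · rw [h2] at hr
    exact h.toInv.tables_congr (h.tables hr) hmem hsk hfk hreg
  · rw [h2] at hr; rw [h6]; exact h.pow_lt hr

theorem ready_init : Ready (State.init α) 0 0 := by
  have hg : (State.init α).lay.Good 0 := by
    constructor
    · exact fun j hj => absurd hj (Nat.not_lt_zero _)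
    · exact fun j hj => absurd hj (Nat.not_lt_zero _)
    · exact fun j hj => absurd hj (Nat.not_lt_zero _)
    · exact fun j hj => absurd hj (Nat.not_lt_zero _)
    · exact fun i j _ hj => absurd hj (Nat.not_lt_zero _)
    · exact fun j hj => absurd hj (Nat.not_lt_zero _)
    · exact fun j hj => absurd hj (Nat.not_lt_zero _)
    · exact fun j hj => absurd hj (Nat.not_lt_zero _)
    · exact fun i j _ hj => absurd hj (Nat.not_lt_zero _)
  exact ⟨⟨rfl, hg, le_rfl, rfl, rfl, fun h h1 h2 => by omega, fun h h1 h2 => by omega⟩, rfl,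
    le_rfl, le_rfl, fun h => absurd h (lt_irrefl 0), fun h => absurd h (lt_irrefl 0), le_rfl⟩

/-- A bound for the number of levels of the tables. -/
def levels (n : ℕ) : ℕ := Nat.log 2 (2 * (n + 2))

/-- A bound for the number of steps of an operation without rebuilding. -/
def opBound (n : ℕ) : ℕ := 400 * (levels n * (2 * n.sqrt + 3))

/-- A bound for the number of steps of a rebuilding. -/
def rebuildBound (n : ℕ) : ℕ := 300 * (levels n * (3 * n + 2))

/-- The invariant after the prelude of the operation number `m`, where `r` is the number of
rebuildings before it and `s` is the number of steps. -/
structure Started (σ : State α) (n m H r s : ℕ) : Prop extends Inv σ H where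
  time : σ.reg 1 = m + 1
  le_sq : m + 1 ≤ σ.reg 2 * σ.reg 2
  sq_le : (σ.reg 2 - 1) * (σ.reg 2 - 1) + σ.reg 5 ≤ m
  tables : Tables σ H
  pow_lt : 2 ^ σ.reg 6 < 2 * (H + 2)
  handles : H ≤ m
  steps : s + r * rebuildBound n ≤ 10 + σ.reg 2 * rebuildBound n

theorem Ready.le_levels {K H n : ℕ} (h : 2 ^ K < 2 * (H + 2)) (hn : H ≤ n) : K ≤ levels n :=
  Nat.le_log_of_pow_le (by omega) (by omega)

/-- Let `r` be the content of register `2`. If `m = r * r`, the tables are rebuilt, the pending list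
becomes empty and `r` grows by one, which restores `(r - 1) * (r - 1) + P ≤ m < r * r`. The cost of
the rebuilding is charged to the increase of `r`, with `r * rebuildBound n` as potential. -/
theorem ex_prelude {n m H : ℕ} {σ : State α} (hb : Bounded (6 * n + 20) σ) (h : Ready σ m H)
    (hm : m + 1 ≤ n) :
    Ex (6 * n + 20) prelude σ (fun τ s => Started τ n m H (σ.reg 2) s ∧ τ.reg 0 = σ.reg 0 ∧
      τ.key = σ.key ∧ ∀ x, τ.lay.Present x ↔ σ.lay.Present x) := by
  have hHm := h.handles
  have hsq := h.le_sq
  have hlt := h.sq_le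
  have hle := h.le
  refine ex_seq (ex_ite (fun hc => ?_) (fun hc => ?_))
  · simp only [holds_eq, eval_reg, eval_mul, h.time] at hc
    have hr1 : σ.reg 2 ≤ n + 1 := by nlinarith
    refine ex_seq ((ex_rebuild hb h.good (by omega) h.sk_zero h.bot_lt).imp ?_)
    rintro τ s ⟨hs, hkey, hreg, h4, h5, h6, hT, hg, hp⟩
    have t1 : τ.reg 1 = m := (hreg 1 (by omega) (by omega) (by omega) (by omega)).trans h.time
    have t2 : τ.reg 2 = σ.reg 2 := hreg 2 (by omega) (by omega) (by omega) (by omega)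
    refine ex_assign (by simp [t2]; omega) (ex_assign (by simp [t1]; omega) ?_)
    simp only [eval_add, eval_reg, eval_const, t1, t2, reg_setReg, Nat.reduceEqDiff, if_false]
    generalize hπ : State.setReg _ 1 _ = π
    have pkey : π.key = σ.key := by rw [← hπ]; exact hkey
    have psk : π.sk = σ.sk := sk_congr pkey
    have pfk : π.fk = σ.fk := fk_congr pkey
    have preg : ∀ x, x ≠ 1 → x ≠ 2 → π.reg x = τ.reg x := fun x h1 h2 => by
      rw [← hπ]; simp [h1, h2]
    have p1 : π.reg 1 = m + 1 := by rw [← hπ]; simp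
    have p2 : π.reg 2 = σ.reg 2 + 1 := by rw [← hπ]; simp
    have play : π.lay = τ.lay := by rw [← hπ]; rfl
    have pT : Tables π H := hT.extend le_rfl (fun i _ k v => by rw [← hπ]; rfl)
      (preg 4 (by omega) (by omega)) (preg 6 (by omega) (by omega)) (fun x _ => by rw [← hπ]; rfl)
      (fun x _ => by rw [← hπ]; rfl) (by rw [psk]; exact h.bot_lt)
    have hK := Ready.le_levels (h6.trans_le (show 2 * (τ.reg 4 + 2) ≤ 2 * (H + 2) by omega))
      (show H ≤ n by omega)
    refine ⟨⟨⟨?_, ?_, ?_, ?_, ?_, ?_, ?_⟩, p1, ?_, ?_, pT, ?_, hHm, ?_⟩, ?_, pkey, ?_⟩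
    · rw [preg 3 (by omega) (by omega), hreg 3 (by omega) (by omega) (by omega) (by omega)]
      exact h.reg_eq
    · rw [play]; exact hg
    · rw [preg 4 (by omega) (by omega)]; exact h4
    · rw [psk]; exact h.sk_zero
    · rw [pfk]; exact h.fk_zero
    · rw [psk]; exact h.bot_lt
    · rw [psk, pfk]; exact h.sk_lt
    · rw [p2]; nlinarith
    · rw [p2, preg 5 (by omega) (by omega), h5, Nat.add_sub_cancel]; omega
    · rw [preg 6 (by omega) (by omega)]; omega
    · have h1 : τ.reg 6 * (H + σ.reg 4 + σ.reg 5 + 2) ≤ levels n * (3 * n + 2) :=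
        Nat.mul_le_mul hK (by omega)
      rw [p2, Nat.add_mul, Nat.one_mul]
      unfold rebuildBound
      omega
    · exact hreg 0 (by omega) (by omega) (by omega) (by omega)
    · rw [play]; exact hp
  · simp only [holds_eq, eval_reg, eval_mul, h.time] at hc
    -- `r = 0` forces `m = 0 = r * r`, which is the other case: the first operation always builds
    -- the tables.
    have hr : 0 < σ.reg 2 := by
      by_contra h0
      rw [show σ.reg 2 = 0 by omega] at hc hsq
      omega
    refine ex_skip (ex_assign (by simp [h.time]; omega) ?_)
    simp only [eval_add, eval_reg, eval_const, h.time]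
    have hT := h.tables hr
    refine ⟨⟨⟨?_, h.good, ?_, h.sk_zero, h.fk_zero, h.bot_lt, h.sk_lt⟩, ?_, ?_, ?_, ?_, ?_, hHm, ?_⟩,
      ?_, rfl, fun _ => Iff.rfl⟩
    · simpa using h.reg_eq
    · simpa using h.le
    · simp
    · simp; omega
    · simpa using hlt
    · exact hT.extend le_rfl (fun i _ k v => rfl) rfl rfl (fun x _ => rfl) (fun x _ => rfl) h.bot_lt
    · simpa using h.pow_lt hr
    · simp
    · simp

theorem Started.ready {σ τ : State α} {n m H H' r s t : ℕ} (h : Started σ n m H r s)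
    (hI : Inv τ H') (hT : Tables τ H') (hle : H ≤ H') (hle' : H' ≤ H + 1) (hn : m + 1 ≤ n)
    (h5 : τ.reg 5 ≤ σ.reg 5 + 1) (hreg : ∀ x, x = 1 ∨ x = 2 ∨ x = 4 ∨ x = 6 → τ.reg x = σ.reg x)
    (ht : t ≤ 300 * (σ.reg 6 * (σ.reg 5 + 1))) :
    Ready τ (m + 1) H' ∧
      (s + t) + r * rebuildBound n ≤ opBound n + τ.reg 2 * rebuildBound n := by
  have h1 := h.handles
  have h2 := h.sq_le
  have h3 := h.le_sq
  have r2 := hreg 2 (by omega)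
  have r6 := hreg 6 (by omega)
  refine ⟨⟨hI, (hreg 1 (by omega)).trans h.time, ?_, ?_, fun _ => hT, fun _ => ?_, by omega⟩, ?_⟩
  · rw [r2]; exact h3
  · rw [r2]; omega
  · rw [r6]; exact h.pow_lt.trans_le (by omega)
  · have hK := Ready.le_levels h.pow_lt (show H ≤ n by omega)
    have hK1 : 1 ≤ σ.reg 6 := by
      by_contra h0
      have := h.tables.pow
      rw [show σ.reg 6 = 0 by omega] at this
      omega
    have hr : σ.reg 2 - 1 ≤ n.sqrt := Nat.le_sqrt.2 (by omega)
    -- With `q = r - 1 ≤ √n`, the inequalities `q * q + P ≤ m` and `m + 1 ≤ (q + 1) * (q + 1)` leave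
    -- at most `2 * q` pending updates.
    have hP : σ.reg 5 ≤ 2 * n.sqrt + 2 := by
      obtain ⟨q, hq⟩ : ∃ q, σ.reg 2 = q + 1 := ⟨σ.reg 2 - 1, by
        have : σ.reg 2 ≠ 0 := by rintro h0; rw [h0] at h3; omega
        omega⟩
      rw [hq] at h2 h3 hr
      simp only [Nat.add_sub_cancel] at h2 hr
      have : (q + 1) * (q + 1) = q * q + 2 * q + 1 := by ring
      omega
    have h4 : σ.reg 6 * (σ.reg 5 + 1) ≤ levels n * (2 * n.sqrt + 3) :=
      Nat.mul_le_mul hK (by omega)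
    have h5 : 1 ≤ σ.reg 6 * (σ.reg 5 + 1) := Nat.mul_pos hK1 (by omega)
    have := h.steps
    rw [r2]
    unfold opBound
    omega

theorem Started.pending_le {σ : State α} {n m H r s : ℕ} (h : Started σ n m H r s) :
    σ.reg 6 ≤ σ.reg 6 * (σ.reg 5 + 1) ∧ σ.reg 5 + 1 ≤ σ.reg 6 * (σ.reg 5 + 1) := by
  have hK1 : 1 ≤ σ.reg 6 := by
    by_contra h0
    have := h.tables.pow
    rw [show σ.reg 6 = 0 by omega] at this
    omega
  exact ⟨Nat.le_mul_of_pos_right _ (by omega), Nat.le_mul_of_pos_left _ hK1⟩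

theorem ex_insert {n m H : ℕ} {σ : State α} (hb : Bounded (6 * n + 20) σ) (h : Ready σ m H)
    (hm : m + 1 ≤ n) (h0 : ⊥ < σ.key 0) (h1 : σ.key 0 < σ.key 1) :
    Ex (6 * n + 20) (prelude ;; insertJob) σ (fun τ s => Ready τ (m + 1) (H + 1) ∧
      s + σ.reg 2 * rebuildBound n ≤ opBound n + τ.reg 2 * rebuildBound n ∧
      (∀ x, τ.lay.Present x ↔ x = H + 1 ∨ σ.lay.Present x) ∧
      (∀ h ≤ H, τ.sk h = σ.sk h ∧ τ.fk h = σ.fk h) ∧ τ.sk (H + 1) = σ.key 0 ∧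
      τ.fk (H + 1) = σ.key 1 ∧ τ.reg 0 = H + 1) := by
  refine ex_seq ((ex_prelude hb h hm).imp_bounded hb ?_)
  rintro π s hbπ ⟨hS, -, pkey, pp⟩
  have hH := hS.handles
  have hP := hS.sq_le
  obtain ⟨g1, g2⟩ := hS.pending_le
  refine (ex_insertJob hbπ hS.toInv hS.tables (by omega) (by omega) (by rwa [pkey])
    (by rwa [pkey])).imp ?_
  rintro τ t ⟨ht, hI, hT, hpr, hk, hk0, hk1, t0, t5, treg⟩
  obtain ⟨a1, a2⟩ := hS.ready hI hT (by omega) le_rfl hm t5.le treg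
    (show t ≤ 300 * (π.reg 6 * (π.reg 5 + 1)) by omega)
  rw [sk_congr pkey, fk_congr pkey] at hk
  exact ⟨a1, a2, fun x => by rw [hpr, pp], hk, by rw [hk0, pkey], by rw [hk1, pkey], t0⟩

theorem ex_delete {n m H : ℕ} {σ : State α} (hb : Bounded (6 * n + 20) σ) (h : Ready σ m H)
    (hm : m + 1 ≤ n) (hp : σ.lay.Present (σ.reg 0)) :
    Ex (6 * n + 20) (prelude ;; deleteJob) σ (fun τ s => Ready τ (m + 1) H ∧
      s + σ.reg 2 * rebuildBound n ≤ opBound n + τ.reg 2 * rebuildBound n ∧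
      (∀ x, τ.lay.Present x ↔ x ≠ σ.reg 0 ∧ σ.lay.Present x) ∧ τ.key = σ.key) := by
  refine ex_seq ((ex_prelude hb h hm).imp_bounded hb ?_)
  rintro π s hbπ ⟨hS, p0, pkey, pp⟩
  have hP := hS.sq_le
  obtain ⟨g1, g2⟩ := hS.pending_le
  refine (ex_deleteJob hbπ hS.toInv hS.tables (by omega) (by rw [p0, pp]; exact hp)).imp ?_
  rintro τ t ⟨ht, hI, hT, hpr, hk, t5, treg⟩
  obtain ⟨a1, a2⟩ := hS.ready hI hT le_rfl (by omega) hm t5 treg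
    (show t ≤ 300 * (π.reg 6 * (π.reg 5 + 1)) by omega)
  exact ⟨a1, a2, fun x => by rw [hpr, pp, p0], hk.trans pkey⟩

theorem ex_query {n m H : ℕ} {σ : State α} (hb : Bounded (6 * n + 20) σ) (h : Ready σ m H)
    (hm : m + 1 ≤ n) :
    Ex (6 * n + 20) (prelude ;; answer) σ (fun τ s => Ready τ (m + 1) H ∧
      s + σ.reg 2 * rebuildBound n ≤ opBound n + τ.reg 2 * rebuildBound n ∧
      (∀ x, τ.lay.Present x ↔ σ.lay.Present x) ∧ τ.key = σ.key ∧
      τ.reg 0 = opt τ.sk τ.fk ⊥ ⊥ (τ.lay.cur 0 (τ.lay.rest 0))) := by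
  refine ex_seq ((ex_prelude hb h hm).imp_bounded hb ?_)
  rintro π s hbπ ⟨hS, -, pkey, pp⟩
  have hH := hS.handles
  refine (ex_answer hbπ hS.toInv hS.tables (by omega)).imp ?_
  rintro τ t ⟨ht, tmem, tkey, treg, t0⟩
  have tsk := sk_congr tkey
  have tfk := fk_congr tkey
  have tlay := State.lay_congr tmem tsk tfk (treg 4 (by omega) (by omega))
    (treg 5 (by omega) (by omega))
  obtain ⟨a1, a2⟩ := hS.ready (hS.toInv.congr tmem tsk tfk treg)
    (hS.toInv.tables_congr hS.tables tmem tsk tfk treg) le_rfl (by omega) hm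
    (by rw [treg 5 (by omega) (by omega)]; omega) (fun x hx => treg x (by omega) (by omega)) ht
  exact ⟨a1, a2, fun x => by rw [tlay, pp], tkey.trans pkey, by rw [tlay, tsk, tfk]; exact t0⟩

end

end DIS

/-! ### From handles to the maintained collection of intervals. -/

namespace DIS

section

variable {α : Type u} [LinearOrder α]

theorem contents_append {ops : List (Op α)} {op : Op α} {k : ℕ} (hk : k ≤ ops.length) :
    contents (ops ++ [op]) k = contents ops k := by
  ext p
  simp only [contents, Set.mem_ofPred_eq]
  refine and_congr_right fun hp => ?_
  rw [List.getElem?_append_left (by omega)]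
  refine and_congr_right fun _ => forall_congr' fun j => forall_congr' fun hj => ?_
  rw [List.getElem?_append_left (by omega)]

theorem ValidOps.of_append {ops : List (Op α)} {op : Op α} (h : ValidOps (ops ++ [op])) :
    ValidOps ops := by
  intro k i hk
  have hlt : k < ops.length := (List.getElem?_eq_some_iff.1 hk).1
  rw [← contents_append (op := op) hlt.le]
  exact h k i (by rwa [List.getElem?_append_left hlt])

theorem mem_contents_append {ops : List (Op α)} {op : Op α} (h : ValidOps (ops ++ [op]))
    (p : ℕ × Job α) : p ∈ contents (ops ++ [op]) (ops.length + 1) ↔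
      (p ∈ contents ops ops.length ∧ op ≠ .delete p.1) ∨
        (p.1 = ops.length ∧ op = .insert p.2) := by
  have hlast : (ops ++ [op])[ops.length]? = some op := by simp
  rw [← contents_append (op := op) le_rfl]
  constructor
  · rintro ⟨h1, h2, h3⟩
    rcases Nat.lt_or_ge p.1 ops.length with h4 | h4
    · refine Or.inl ⟨⟨h4, h2, fun j hj => h3 j (by omega)⟩, ?_⟩
      have := h3 ops.length (by omega)
      rw [hlast] at this
      exact fun h => this (by rw [h])
    · have h5 : p.1 = ops.length := by omega
      rw [h5, hlast] at h2
      exact Or.inr ⟨h5, Option.some_injective _ h2⟩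
  · rintro (⟨⟨h1, h2, h3⟩, h4⟩ | ⟨h1, h2⟩)
    · refine ⟨by omega, h2, fun j hj => ?_⟩
      rcases Nat.lt_or_ge j ops.length with h5 | h5
      · exact h3 j h5
      · rw [show j = ops.length by omega, hlast]
        exact fun h => h4 (Option.some_injective _ h)
    -- No operation so far can delete the new interval, since a valid deletion refers to an earlier
    -- insertion.
    · refine ⟨by omega, by rw [h1, hlast, h2], fun j hj hd => ?_⟩
      obtain ⟨I, hI⟩ := h j p.1 hd
      have h5 : p.1 < j := hI.1
      omega

/-- The present handles of the state `σ` are those of the jobs in `S`, where `outs` lists the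
outputs so far. -/
structure Link (S : Set (ℕ × Job α)) (outs : List ℕ) (σ : State α) : Prop where
  present : ∀ p ∈ S, σ.lay.Present (outs.getD p.1 0)
  start : ∀ p ∈ S, σ.sk (outs.getD p.1 0) = jobStart p
  finish : ∀ p ∈ S, σ.fk (outs.getD p.1 0) = jobFinish p
  surj : ∀ h, σ.lay.Present h → ∃ p ∈ S, outs.getD p.1 0 = h
  inj : ∀ p ∈ S, ∀ q ∈ S, outs.getD p.1 0 = outs.getD q.1 0 → p = q

/-- `surj` assigns to every listed handle an interval of `S`, and by `present` and `inj` this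
enumerates `S` without repetition. Starts and finishes agree, so `opt` has the same value on handles
and on labelled intervals. -/
theorem Link.isOptimum {S : Set (ℕ × Job α)} {outs : List ℕ} {σ : State α} {H : ℕ}
    (h : Link S outs σ) (hg : σ.lay.Good H) :
    IsOptimum 2 S (opt σ.sk σ.fk ⊥ ⊥ (σ.lay.cur 0 (σ.lay.rest 0))) := by
  set l := σ.lay.cur 0 (σ.lay.rest 0) with hl
  have hpw : l.Pairwise (fun x y => σ.fk x ≤ σ.fk y ∧ x ≠ y) := Layout.pairwise_cur hg hg.ok
  have hmem : ∀ x, x ∈ l ↔ σ.lay.Present x := fun x => Layout.mem_cur_zero hg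
  choose g hgS hgo using fun x : {x // x ∈ l} => h.surj x.1 ((hmem x.1).1 x.2)
  have hnd : l.Nodup := hpw.imp (fun h => h.2)
  have hset : {p | p ∈ l.attach.map g} = S := by
    ext p
    simp only [Set.mem_ofPred_eq, List.mem_map, List.mem_attach, true_and]
    constructor
    · rintro ⟨x, rfl⟩; exact hgS x
    · intro hp
      exact ⟨⟨_, (hmem _).2 (h.present p hp)⟩, h.inj _ (hgS _) _ hp (hgo _)⟩
  have hs : ∀ x : {x // x ∈ l}, jobStart (g x) = σ.sk x.1 := fun x => by
    rw [← h.start _ (hgS x), hgo]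
  have hf : ∀ x : {x // x ∈ l}, jobFinish (g x) = σ.fk x.1 := fun x => by
    rw [← h.finish _ (hgS x), hgo]
  have hopt : opt σ.sk σ.fk ⊥ ⊥ l = opt jobStart jobFinish ⊥ ⊥ (l.attach.map g) := by
    conv_lhs => rw [← List.attach_map_subtype_val l]
    rw [opt_map, opt_map]
    exact opt_congr _ (fun x _ => ⟨(hs x).symm, (hf x).symm⟩) _ _
  rw [hopt, ← hset]
  refine isOptimum_opt _ ?_ ?_
  · refine (List.nodup_attach.2 hnd).map fun x y hxy => Subtype.ext ?_
    rw [← hgo x, ← hgo y, hxy]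
  · rw [List.pairwise_map]
    have : (l.attach.map Subtype.val).Pairwise (fun x y => σ.fk x ≤ σ.fk y) := by
      rw [List.attach_map_subtype_val]; exact hpw.imp (fun h => h.1)
    rw [List.pairwise_map] at this
    exact this.imp (fun {x y} h => by rwa [hf, hf])

theorem getD_append_left {outs : List ℕ} {o i : ℕ} (h : i < outs.length) :
    (outs ++ [o]).getD i 0 = outs.getD i 0 := by
  simp [List.getD, List.getElem?_append_left h]

/-- This serves deletions and queries: no interval appears, and the additional output stands at a
position that is no label of an interval of `S`. -/
theorem Link.mono {S S' : Set (ℕ × Job α)} {outs : List ℕ} {σ τ : State α} {o : ℕ}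
    (h : Link S outs σ) (hS : ∀ p ∈ S, p.1 < outs.length) (hsub : S' ⊆ S)
    (hp : ∀ p ∈ S', τ.lay.Present (outs.getD p.1 0))
    (hp' : ∀ x, τ.lay.Present x → σ.lay.Present x ∧ ∀ p ∈ S, outs.getD p.1 0 = x → p ∈ S')
    (hsk : τ.sk = σ.sk) (hfk : τ.fk = σ.fk) : Link S' (outs ++ [o]) τ := by
  have hout : ∀ p ∈ S', (outs ++ [o]).getD p.1 0 = outs.getD p.1 0 :=
    fun p hp => getD_append_left (hS p (hsub hp))
  constructor
  · intro p h1; rw [hout p h1]; exact hp p h1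
  · intro p h1; rw [hout p h1, hsk]; exact h.start p (hsub h1)
  · intro p h1; rw [hout p h1, hfk]; exact h.finish p (hsub h1)
  · intro x hx
    obtain ⟨h1, h2⟩ := hp' x hx
    obtain ⟨p, h3, h4⟩ := h.surj x h1
    exact ⟨p, h2 p h3 h4, by rw [hout p (h2 p h3 h4), h4]⟩
  · intro p h1 q h2 h3
    rw [hout p h1, hout q h2] at h3
    exact h.inj p (hsub h1) q (hsub h2) h3

/-- The new handle `H + 1` exceeds the handles of all jobs present, which is what keeps the
correspondence injective. -/
theorem Link.insert {S S' : Set (ℕ × Job α)} {outs : List ℕ} {σ τ : State α} {H : ℕ} {I : Job α}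
    (h : Link S outs σ) (hS : ∀ p ∈ S, p.1 < outs.length) (hg : σ.lay.Good H)
    (hS' : ∀ p, p ∈ S' ↔ p ∈ S ∨ p = (outs.length, I))
    (hp : ∀ x, τ.lay.Present x ↔ x = H + 1 ∨ σ.lay.Present x)
    (hk : ∀ h ≤ H, τ.sk h = σ.sk h ∧ τ.fk h = σ.fk h) (hs : τ.sk (H + 1) = I.start)
    (hf : τ.fk (H + 1) = I.finish) : Link S' (outs ++ [H + 1]) τ := by
  have hold : ∀ p ∈ S, (outs ++ [H + 1]).getD p.1 0 = outs.getD p.1 0 :=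
    fun p hp => getD_append_left (hS p hp)
  have hnew : (outs ++ [H + 1]).getD outs.length 0 = H + 1 := by simp
  have hle : ∀ p ∈ S, outs.getD p.1 0 ≤ H := fun p hp => (hg.present_pos (h.present p hp)).2
  constructor
  · intro p h1
    rcases (hS' p).1 h1 with h1 | rfl
    · rw [hold p h1, hp]; exact Or.inr (h.present p h1)
    · rw [hnew, hp]; exact Or.inl rfl
  · intro p h1
    rcases (hS' p).1 h1 with h1 | rfl
    · rw [hold p h1, (hk _ (hle p h1)).1]; exact h.start p h1
    · rw [hnew]; exact hs
  · intro p h1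
    rcases (hS' p).1 h1 with h1 | rfl
    · rw [hold p h1, (hk _ (hle p h1)).2]; exact h.finish p h1
    · rw [hnew]; exact hf
  · intro x hx
    rcases (hp x).1 hx with rfl | hx
    · exact ⟨_, (hS' _).2 (Or.inr rfl), hnew⟩
    · obtain ⟨p, h1, h2⟩ := h.surj x hx
      exact ⟨p, (hS' _).2 (Or.inl h1), by rw [hold p h1, h2]⟩
  · intro p h1 q h2 h3
    rcases (hS' p).1 h1 with h1 | rfl <;> rcases (hS' q).1 h2 with h2 | rfl
    · rw [hold p h1, hold q h2] at h3
      exact h.inj p h1 q h2 h3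
    · rw [hold p h1, hnew] at h3
      have := hle p h1
      omega
    · rw [hold q h2, hnew] at h3
      have := hle q h2
      omega
    · rfl

/-- The data structure. -/
def dataStructure : DataStructure := ⟨prelude ;; insertJob, prelude ;; deleteJob, prelude ;; answer⟩

/-- A bound for the cost of an elementary step of the data structure, up to a logarithm. -/
def stepWeight : ℕ :=
  dataStructure.insert.weight + dataStructure.delete.weight + dataStructure.query.weight

theorem CorrectAnswers.append {ops : List (Op α)} {op : Op α} {outs : List ℕ} {o : ℕ}
    (h : CorrectAnswers 2 ops outs) (hlen : outs.length = ops.length)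
    (ho : op = .query → IsOptimum 2 (contents ops ops.length) o) :
    CorrectAnswers 2 (ops ++ [op]) (outs ++ [o]) := by
  intro k hk
  have hlt : k < (ops ++ [op]).length := (List.getElem?_eq_some_iff.1 hk).1
  rw [List.length_append, List.length_singleton] at hlt
  rw [contents_append (by omega)]
  rcases Nat.lt_or_ge k ops.length with h1 | h1
  · rw [List.getElem?_append_left h1] at hk
    rw [List.getElem?_append_left (by omega)]
    exact h k hk
  · have h2 : k = ops.length := by omega
    subst h2
    rw [List.getElem?_concat_length] at hk
    refine ⟨o, ?_, ho (Option.some_injective _ hk)⟩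
    rw [← hlen, List.getElem?_concat_length]

/-- `feed` touches only the key cells `0` and `1`, which belong to no handle, and register `0`, on
which no invariant depends; so the invariants survive the input. -/
theorem exists_step {n H : ℕ} {ops : List (Op α)} {op : Op α} {σ : State α} {outs : List ℕ}
    (hv : ValidOps (ops ++ [op])) (hn : (ops ++ [op]).length ≤ n) (hlen : outs.length = ops.length)
    (hb : Bounded (6 * n + 20) σ) (h : Ready σ ops.length H)
    (hL : Link (contents ops ops.length) outs σ) :
    Bounded (6 * n + 20) (feed outs σ op) ∧
      Ex (6 * n + 20) (dataStructure.code op) (feed outs σ op) (fun τ s =>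
        (∃ H', Ready τ (ops.length + 1) H') ∧
        s + σ.reg 2 * rebuildBound n ≤ opBound n + τ.reg 2 * rebuildBound n ∧
        Link (contents (ops ++ [op]) (ops.length + 1)) (outs ++ [τ.reg 0]) τ ∧
        (op = .query → IsOptimum 2 (contents ops ops.length) (τ.reg 0))) := by
  have hm : ops.length + 1 ≤ n := by simpa using hn
  have hS : ∀ p ∈ contents ops ops.length, p.1 < outs.length := fun p hp => by
    rw [hlen]; exact hp.1
  have hmem := mem_contents_append hv
  cases op with
  | insert I =>
    have hsk : (feed outs σ (.insert I)).sk = σ.sk := by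
      funext x; simp [feed, State.sk]
    have hfk : (feed outs σ (.insert I)).fk = σ.fk := by
      funext x; simp [feed, State.fk]
    have hk0 : (feed outs σ (.insert I)).key 0 = I.start := by simp [feed]
    have hk1 : (feed outs σ (.insert I)).key 1 = I.finish := by simp [feed]
    have hb' : Bounded (6 * n + 20) (feed outs σ (.insert I)) := hb
    have h' : Ready (feed outs σ (.insert I)) ops.length H := h.congr rfl hsk hfk (fun _ _ _ => rfl)
    have hlay := State.lay_congr (σ := σ) (τ := feed outs σ (.insert I)) rfl hsk hfk rfl rfl
    refine ⟨hb', (ex_insert hb' h' hm (by rw [hk0]; exact WithBot.bot_lt_coe _)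
      (by rw [hk0, hk1]; exact WithBot.coe_lt_coe.2 I.start_lt_finish)).imp ?_⟩
    rintro τ s ⟨h1, h2, h3, h4, h5, h6, h7⟩
    rw [hlay] at h3
    rw [hsk, hfk] at h4
    refine ⟨⟨_, h1⟩, h2, ?_, fun hq => by cases hq⟩
    rw [h7]
    refine hL.insert (I := I) hS h.good (fun p => ?_) h3 h4 (h5.trans hk0) (h6.trans hk1)
    rw [hmem]
    refine or_congr ⟨fun h => h.1, fun h => ⟨h, by simp⟩⟩ ?_
    rw [hlen, Prod.ext_iff]
    simp only [Op.insert.injEq]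
    exact and_congr_right fun _ => eq_comm
  | delete i =>
    have hi : ∃ I, (i, I) ∈ contents ops ops.length := by
      obtain ⟨I, hI⟩ := hv ops.length i (by simp)
      exact ⟨I, by rwa [contents_append le_rfl] at hI⟩
    obtain ⟨I, hI⟩ := hi
    have hp := hL.present _ hI
    have hr0 : (feed outs σ (.delete i)).reg 0 = outs.getD i 0 := by simp [feed]
    have hb' : Bounded (6 * n + 20) (feed outs σ (.delete i)) := by
      refine hb.update_reg ?_
      have h1 := (h.good.present_pos hp).2
      have h2 := h.handles
      simp only at h1
      omega
    have hreg : ∀ x < 7, x ≠ 0 → (feed outs σ (.delete i)).reg x = σ.reg x := fun x _ hx => by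
      simp [feed, hx]
    have h' : Ready (feed outs σ (.delete i)) ops.length H := h.congr rfl rfl rfl hreg
    have hlay := State.lay_congr (σ := σ) (τ := feed outs σ (.delete i)) rfl rfl rfl
      (hreg 4 (by omega) (by omega)) (hreg 5 (by omega) (by omega))
    refine ⟨hb', (ex_delete hb' h' hm (by rw [hr0, hlay]; exact hp)).imp ?_⟩
    rintro τ s ⟨h1, h2, h3, h4⟩
    rw [hlay, hr0] at h3
    rw [hreg 2 (by omega) (by omega)] at h2
    have hmem' : ∀ p ∈ contents ops ops.length, p.1 ≠ i →
        p ∈ contents (ops ++ [.delete i]) (ops.length + 1) := fun p hp hpi =>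
      (hmem p).2 (Or.inl ⟨hp, fun h => hpi (by cases h; rfl)⟩)
    have hmem'' : ∀ p ∈ contents (ops ++ [.delete i]) (ops.length + 1),
        p ∈ contents ops ops.length ∧ p.1 ≠ i := fun p hp => by
      rcases (hmem p).1 hp with ⟨g1, g2⟩ | ⟨-, g2⟩
      · exact ⟨g1, fun h => g2 (by rw [h])⟩
      · cases g2
    refine ⟨⟨_, h1⟩, h2, ?_, fun hq => by cases hq⟩
    refine hL.mono hS (fun p hp => (hmem'' p hp).1) (fun p hp => ?_) (fun x hx => ?_)
      (sk_congr h4) (fk_congr h4)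
    -- Different intervals in the collection have different handles, so only the deleted interval
    -- loses its job.
    · obtain ⟨g1, g2⟩ := hmem'' p hp
      exact (h3 _).2 ⟨fun he => g2 (by rw [hL.inj p g1 _ hI he]), hL.present p g1⟩
    · obtain ⟨g1, g2⟩ := (h3 x).1 hx
      exact ⟨g2, fun p hp hx => hmem' p hp fun hpi => g1 (by rw [← hx, hpi])⟩
  | query =>
    refine ⟨hb, (ex_query (σ := σ) hb h hm).imp ?_⟩
    rintro τ s ⟨h1, h2, h3, h4, h5⟩
    have hL' : Link (contents (ops ++ [.query]) (ops.length + 1)) (outs ++ [τ.reg 0]) τ := by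
      have hS' : ∀ p, p ∈ contents (ops ++ [.query]) (ops.length + 1) ↔
          p ∈ contents ops ops.length := fun p => by rw [hmem]; simp
      exact hL.mono hS (fun p hp => (hS' p).1 hp)
        (fun p hp => (h3 _).2 (hL.present p ((hS' p).1 hp)))
        (fun x hx => ⟨(h3 x).1 hx, fun p hp _ => (hS' p).2 hp⟩) (sk_congr h4) (fk_congr h4)
    refine ⟨⟨_, h1⟩, h2, hL', fun _ => ?_⟩
    rw [h5]
    have := hL'.isOptimum h1.good
    rwa [show contents (ops ++ [.query]) (ops.length + 1) = contents ops ops.length by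
      ext p; rw [hmem]; simp] at this

/-- Summing the amortized bounds makes the potential telescope: each operation contributes `opBound
n`, and the rebuildings together contribute the final value of register `2` times `rebuildBound n`.
-/
theorem exists_run (n : ℕ) (ops : List (Op α)) : ValidOps ops → ops.length ≤ n →
    ∃ (σ : State α) (outs : List ℕ) (t H : ℕ), Run dataStructure ops σ outs t ∧
      CorrectAnswers 2 ops outs ∧ outs.length = ops.length ∧ Bounded (6 * n + 20) σ ∧
      Ready σ ops.length H ∧ Link (contents ops ops.length) outs σ ∧
      t ≤ (ops.length * opBound n + σ.reg 2 * rebuildBound n) *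
        (stepWeight * (6 * n + 20).size) := by
  induction ops using List.reverseRecOn with
  | nil =>
    intro _ _
    refine ⟨State.init α, [], 0, 0, .nil, fun k hk => by simp at hk, rfl,
      ⟨fun _ => Nat.zero_le _, fun _ => Nat.zero_le _⟩, ready_init, ?_, Nat.zero_le _⟩
    have hE : ∀ p, p ∉ contents ([] : List (Op α)) 0 := fun p hp =>
      absurd hp.1 (Nat.not_lt_zero _)
    refine ⟨fun p hp => absurd hp (hE p), fun p hp => absurd hp (hE p),
      fun p hp => absurd hp (hE p), ?_, fun p hp => absurd hp (hE p)⟩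
    rintro h (⟨j, hj, -⟩ | ⟨j, hj, -⟩) <;> exact absurd hj (Nat.not_lt_zero _)
  | append_singleton ops op ih =>
    intro hv hn
    have hn' : ops.length ≤ n := by rw [List.length_append] at hn; omega
    obtain ⟨σ, outs, t, H, hrun, hca, hlen, hb, hR, hL, ht⟩ := ih hv.of_append hn'
    obtain ⟨hb', τ, s, hst, ⟨H', hR'⟩, hs, hL', ho⟩ := exists_step hv hn hlen hb hR hL
    have hZ : 1 ≤ (6 * n + 20).size := Nat.size_pos.2 (by omega)
    obtain ⟨u, hex, hu⟩ := hst.exec hZ le_rfl hb'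
    refine ⟨τ, outs ++ [τ.reg 0], t + u, H', hrun.snoc hex, hca.append hlen ho, by simp [hlen],
      hst.bounded hb', ?_, ?_, ?_⟩
    · rwa [List.length_append, List.length_singleton]
    · rwa [List.length_append, List.length_singleton]
    · have hW : (dataStructure.code op).weight ≤ stepWeight := by
        unfold stepWeight
        cases op <;> simp only [DataStructure.code] <;> omega
      have h1 : u ≤ s * (stepWeight * (6 * n + 20).size) :=
        hu.trans (Nat.mul_le_mul_left _ (Nat.mul_le_mul_right _ hW))
      rw [List.length_append, List.length_singleton]
      calc t + u ≤ ((ops.length * opBound n + σ.reg 2 * rebuildBound n) + s) *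
            (stepWeight * (6 * n + 20).size) := by rw [Nat.add_mul]; omega
        _ ≤ _ := Nat.mul_le_mul_right _ (by rw [Nat.add_mul]; omega)

end

end DIS

/-! ### Numerical bounds. -/

namespace DIS

/-- The factor `2` passes from binary to natural logarithms, as `log 2 > 1 / 2`. -/
theorem nat_le_log {k n c : ℕ} (h : 2 ^ k ≤ (n + 2) ^ c) :
    (k : ℝ) ≤ 2 * c * Real.log ((n : ℝ) + 2) := by
  have h1 : ((2 : ℝ)) ^ k ≤ ((n : ℝ) + 2) ^ c := by exact_mod_cast h
  have h2 := Real.log_le_log (by positivity) h1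
  rw [Real.log_pow, Real.log_pow] at h2
  have h3 := Real.log_two_gt_d9
  have h4 : (k : ℝ) * (1 / 2) ≤ k * Real.log 2 :=
    mul_le_mul_of_nonneg_left (by linarith) (by positivity)
  linarith

theorem levels_le (n : ℕ) : (levels n : ℝ) ≤ 4 * Real.log ((n : ℝ) + 2) := by
  have h1 : 2 ^ levels n ≤ 2 * (n + 2) := Nat.pow_log_le_self 2 (by omega)
  have := nat_le_log (k := levels n) (n := n) (c := 2) (by nlinarith)
  push_cast at this
  linarith

theorem size_le (n : ℕ) (hn : 1 ≤ n) :
    ((6 * n + 20).size : ℝ) ≤ 10 * Real.log ((n : ℝ) + 2) := by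
  obtain ⟨z, hz⟩ : ∃ z, (6 * n + 20).size = z + 1 :=
    ⟨(6 * n + 20).size - 1, by have := Nat.size_pos.2 (show 0 < 6 * n + 20 by omega); omega⟩
  have h1 : 2 ^ z ≤ 6 * n + 20 := Nat.lt_size.1 (by omega)
  have h2 : (6 * n + 20) ≤ (n + 2) ^ 4 := by
    -- Here `1 ≤ n` enters, through `27 = 3 ^ 3 ≤ (n + 2) ^ 3`.
    calc 6 * n + 20 ≤ (n + 2) * 27 := by omega
      _ ≤ (n + 2) * (n + 2) ^ 3 := Nat.mul_le_mul_left _ (Nat.pow_le_pow_left (show 3 ≤ n + 2 by omega) 3)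
      _ = _ := by ring
  have h3 := nat_le_log (h1.trans h2)
  have h4 : Real.log 2 ≤ Real.log ((n : ℝ) + 2) :=
    Real.log_le_log (by norm_num) (by linarith [(Nat.cast_nonneg n : (0 : ℝ) ≤ n)])
  have h5 := Real.log_two_gt_d9
  rw [hz]
  push_cast at h3 ⊢
  linarith

/-- As `1 ≤ √n`, both `2 √n + 3 ≤ 5 √n` and `r ≤ 2 √n` hold, and `3 n + 2 ≤ 5 n`; the constant is
`400 * 5 + 2 * 300 * 5`. -/
theorem total_le {n r : ℕ} (hn : 1 ≤ n) (hr : r ≤ n.sqrt + 1) :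
    n * opBound n + r * rebuildBound n ≤ 5000 * (n * n.sqrt * levels n) := by
  have h1 : 1 ≤ n.sqrt := Nat.le_sqrt.2 (by omega)
  have h2 : opBound n ≤ 400 * (levels n * (5 * n.sqrt)) :=
    Nat.mul_le_mul_left _ (Nat.mul_le_mul_left _ (by omega))
  have h3 : rebuildBound n ≤ 300 * (levels n * (5 * n)) :=
    Nat.mul_le_mul_left _ (Nat.mul_le_mul_left _ (by omega))
  calc n * opBound n + r * rebuildBound n
      ≤ n * (400 * (levels n * (5 * n.sqrt))) + (2 * n.sqrt) * (300 * (levels n * (5 * n))) :=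
        Nat.add_le_add (Nat.mul_le_mul_left _ h2) (Nat.mul_le_mul (by omega) h3)
    _ = _ := by ring

end DIS

theorem mainTheorem3 :
    ∃ (D : DIS.DataStructure) (C : ℝ) (k : ℕ),
      ∀ (α : Type u) [LinearOrder α] (ops : List (DIS.Op α)), DIS.ValidOps ops →
        ∃ (σ : DIS.State α) (outs : List ℕ) (t : ℕ),
          DIS.Run D ops σ outs t ∧
          DIS.CorrectAnswers 2 ops outs ∧
          (t : ℝ) ≤ (ops.length : ℝ) *
            (C * Real.sqrt (ops.length : ℝ) * Real.log ((ops.length : ℝ) + 2) ^ k) := by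
  -- The constant is `5000 * 4 * 10` times the weight of the programs. One logarithm comes from the
  -- levels of the tables, the other one from the bit length of the stored numbers.
  refine ⟨DIS.dataStructure, 200000 * DIS.stepWeight, 2, fun α _ ops hv => ?_⟩
  rcases eq_or_ne ops [] with rfl | hne
  · exact ⟨_, _, _, .nil, fun k hk => by simp at hk, by simp⟩
  have hn : 1 ≤ ops.length := List.length_pos_of_ne_nil hne
  obtain ⟨σ, outs, t, H, hrun, hca, -, -, hR, -, ht⟩ := DIS.exists_run ops.length ops hv le_rfl
  refine ⟨σ, outs, t, hrun, hca, ?_⟩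
  have hsq := hR.sq_le
  generalize ops.length = n at hn hsq ht ⊢
  have hr : σ.reg 2 ≤ n.sqrt + 1 := by
    have : σ.reg 2 - 1 ≤ n.sqrt := Nat.le_sqrt.2 (by omega)
    omega
  have h1 := ht.trans (Nat.mul_le_mul_right _ (DIS.total_le hn hr))
  have h2 : (t : ℝ) ≤ (5000 * ((n : ℝ) * (n.sqrt : ℝ) * (DIS.levels n : ℝ))) *
      ((DIS.stepWeight : ℝ) * ((6 * n + 20).size : ℝ)) := by exact_mod_cast h1
  have h3 := DIS.levels_le n
  have h4 := DIS.size_le n hn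
  have h5 : (n.sqrt : ℝ) ≤ Real.sqrt n := Real.nat_sqrt_le_real_sqrt
  have h6 : 0 ≤ Real.log ((n : ℝ) + 2) :=
    Real.log_nonneg (by linarith [(Nat.cast_nonneg n : (0 : ℝ) ≤ n)])
  calc (t : ℝ) ≤ _ := h2
    _ ≤ (5000 * ((n : ℝ) * Real.sqrt n * (4 * Real.log ((n : ℝ) + 2)))) *
      ((DIS.stepWeight : ℝ) * (10 * Real.log ((n : ℝ) + 2))) := by gcongr
    _ = _ := by ring
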